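/- Let $\mathcal A=\bigwedge V=\mathcal A_0\oplus\mathcal A_1$ be the exterior algebra of an infinite-dimensional real vector space $V$, let $m=2p$ be even, $n\ge 0$, and let $\mathbb R^{m|n}=(\mathcal A_0)^m\times(\mathcal A_1)^n$, with points $z=(x,\xi)$ and body $\mathbb R^m$; the even coordinates are written $(x,w)$ with $x,w$ having $p$ components each. A superfunction $f=\sum_I f_I\theta^I$ ($I\subset\{1,\dots,n\}$, $f_I\in C^\infty(\mathbb R^m,\mathbb C)$) is evaluated on $\mathbb R^{m|n}$ by $f(x,\xi)=\sum_I\tilde f_I(x)\xi^I$, where $\tilde f_I$ is the Taylor extension of $f_I$ in the nilpotent part of $x$; $\mathcal B(\mathbb R^{m|n})$ is the space of those $f$ for which all derivatives of all $f_I$ are bounded. A superdiffeomorphism of $\mathbb R^{m|n}$ is a bijection $\phi$ such that the components of $\phi$ and of $\phi^{-1}$ are smooth superfunctions with coefficients in $\mathcal A$, i.e. finite sums $\sum_j a_jf_j$ with $a_j\in\mathcal A$ and $f_j$ a smooth superfunction. Let $\theta\in\mathbb R\setminus\{0\}$, $\alpha\in\mathbb R\setminus\{-1,0\}$, and let $\star$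 be the product $$(f_1\star f_2)(x,\xi,w)=\kappa\int dx_1d\xi_1dw_1dx_2d\xi_2dw_2\, f_1(x_1,\xi_1,w_1)f_2(x_2,\xi_2,w_2)\,e^{\frac{2i}{\theta}((x_2-x)\cdot w_1+(x-x_1)\cdot w_2+(x_1-x_2)\cdot w)}e^{-i\frac{(1+\alpha)^2}{\alpha\theta}(\xi\xi_1+\xi_1\xi_2+\xi_2\xi)},$$ $$\kappa=\frac{(i\theta)^n(-1)^{\frac{n(n+1)}2}\alpha^n}{(\pi\theta)^m(1+\alpha)^{2n}},$$ a Berezin integral in the odd variables and an oscillating integral in the even ones. It is defined for superfunctions in $\mathcal B(\mathbb R^{m|n})$ and, more generally, for superfunctions of polynomial growth, that is, such that for each coefficient $f_I$ there is an $N$ with $|\partial^\beta f_I(x)|\le C_\beta(1+|x|)^N$ for all $\beta$; it is extended $\mathcal A$-bilinearly (with the sign rule) to superfunctions with coefficients in $\mathcal A$. Let $\mathrm{Aut}(\star)$ be the set of superdiffeomorphisms $\phi$ of $\mathbb R^{m|n}$ such that, for all $f_1,f_2\in\mathcal B(\mathbb R^{m|n})$, the pullbacks $\phi^*f_1,\phi^*f_2$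 are superfunctions of polynomial growth with coefficients in $\mathcal A$, and $\phi^*(f_1\star f_2)=(\phi^*f_1)\star(\phi^*f_2)$. Let $OSP(n,\frac m2)$ be the group of invertible supermatrices $A\in GL(m,n)$ with entries in $\mathcal A$ that leave invariant the standard even symplectic form $\omega(z,z')=\sum_{\mu,\nu} z_\mu\omega_{\mu\nu}z'_\nu$ on $\mathbb R^{m|n}$, with $\omega=\begin{pmatrix}\omega_0&0\\0&2\cdot 1\end{pmatrix}$ and $\omega_0=\begin{pmatrix}0&1\\-1&0\end{pmatrix}$. Then $\mathrm{Aut}(\star)$ is a group for composition, and it is isomorphic to the inhomogeneous orthosymplectic group $OSP(n,\frac m2)\ltimes\mathbb R^{m|n}$. More precisely, there is $D\in GL(m,n)$ with real entries such that $(A,\tau)\mapsto\big(z\mapsto D(A D^{-1}z+\tau)\big)$ is an isomorphism from $OSP(n,\frac m2)\ltimes\mathbb R^{m|n}$ onto $\mathrm{Aut}(\star)$. -/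

import Mathlib

open scoped TensorProduct ContDiff

noncomputable section

namespace SuperMoyal

/-! ### Grassmann numbers -/

/-- The real supercommutative superalgebra `𝒜 = ⋀ V`. -/
abbrev Grass (V : Type*) [AddCommGroup V] [Module ℝ V] : Type _ := ExteriorAlgebra ℝ V

/-- The complexification `𝒜_ℂ = ℂ ⊗ 𝒜`. -/
abbrev GrassC (V : Type*) [AddCommGroup V] [Module ℝ V] : Type _ := ℂ ⊗[ℝ] Grass V

/-- The homogeneous component `𝒜_i` of `𝒜`, for `i ∈ ℤ/2`. -/
abbrev part (V : Type*) [AddCommGroup V] [Module ℝ V] (i : ZMod 2) : Submodule ℝ (Grass V) :=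
  CliffordAlgebra.evenOdd (0 : QuadraticForm ℝ V) i

/-- The parity automorphism of `𝒜`: the identity on `𝒜_0`, minus the identity on `𝒜_1`. -/
abbrev parityAut (V : Type*) [AddCommGroup V] [Module ℝ V] : Grass V →ₐ[ℝ] Grass V :=
  CliffordAlgebra.involute

/-- The body map `𝒜 → ℝ`, the quotient by the ideal of nilpotent elements. -/
abbrev body (V : Type*) [AddCommGroup V] [Module ℝ V] : Grass V →ₐ[ℝ] ℝ :=
  ExteriorAlgebra.algebraMapInv

/-! ### The superspace `ℝ^{m|n}` with `m = 2p` -/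

/-- Indices of the `m = 2p` even coordinates: `inl` for the `x`, `inr` for the `w`. -/
abbrev EvenIdx (p : ℕ) : Type := Fin p ⊕ Fin p

/-- Indices of all the `m + n` coordinates. -/
abbrev Idx (p n : ℕ) : Type := EvenIdx p ⊕ Fin n

/-- The degree of a coordinate. -/
def deg {p n : ℕ} : Idx p n → ZMod 2 := Sum.elim (fun _ => 0) (fun _ => 1)

/-- The flat superspace `ℝ^{m|n} = (𝒜_0)^m × (𝒜_1)^n`, as a space of columns. -/
def Superspace (V : Type*) [AddCommGroup V] [Module ℝ V] (p n : ℕ) :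
    Submodule ℝ (Idx p n → Grass V) where
  carrier := {z | ∀ μ, z μ ∈ part V (deg μ)}
  add_mem' ha hb μ := Submodule.add_mem _ (ha μ) (hb μ)
  zero_mem' _ := Submodule.zero_mem _
  smul_mem' c _ hz μ := Submodule.smul_mem _ c (hz μ)

/-- The body `ℝ^m` of the superspace. -/
abbrev Body (p : ℕ) : Type := EuclideanSpace ℝ (EvenIdx p)

section Points

variable {V : Type*} [AddCommGroup V] [Module ℝ V] {p n : ℕ}

/-- The body `x₀ ∈ ℝ^m` of a point of the superspace. -/
def bodyPt (z : Superspace V p n) : Body p :=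
  WithLp.toLp 2 fun i => body V (z.1 (Sum.inl i))

/-- The nilpotent part `x - x₀` of the even coordinates of a point. -/
def soul (z : Superspace V p n) (i : EvenIdx p) : Grass V :=
  z.1 (Sum.inl i) - algebraMap ℝ (Grass V) (body V (z.1 (Sum.inl i)))

/-- The ordered monomial `ξ^I` in the odd coordinates of a point. -/
def oddMonomial (z : Superspace V p n) (I : Finset (Fin n)) : Grass V :=
  (I.sort.map fun i => z.1 (Sum.inr i)).prod

end Points

/-! ### Superfunctions -/

/-- A superfunction `∑_I f_I ⊗ θ^I`, given by its complex-valued coefficients `f_I` on `ℝ^m`. -/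
abbrev SuperFun (p n : ℕ) : Type := Finset (Fin n) → Body p → ℂ

/-- Smooth superfunctions. -/
def SuperFun.Smooth {p n : ℕ} (f : SuperFun p n) : Prop :=
  ∀ I, ContDiff ℝ ∞ (f I)

/-- The space `ℬ(ℝ^{m|n})`: smooth superfunctions all of whose derivatives are bounded. -/
def SuperFun.Bounded {p n : ℕ} (f : SuperFun p n) : Prop :=
  ∀ I, ContDiff ℝ ∞ (f I) ∧ ∀ k : ℕ, ∃ C : ℝ, ∀ x, ‖iteratedFDeriv ℝ k (f I) x‖ ≤ C

/-- Smooth superfunctions of polynomial growth, of an order common to all derivatives.  On these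
the oscillating integrals below exist. -/
def SuperFun.PolyGrowth {p n : ℕ} (f : SuperFun p n) : Prop :=
  ∀ I, ContDiff ℝ ∞ (f I) ∧ ∃ N : ℕ, ∀ k : ℕ, ∃ C : ℝ, ∀ x,
    ‖iteratedFDeriv ℝ k (f I) x‖ ≤ C * (1 + ‖x‖) ^ N

/-- The extension `g̃` of a smooth `g : ℝ^m → ℂ` to the even coordinates of a point, by the Taylor
series of `g` at the body in powers of the soul.  The term of degree `k` is
`(1/k!) ∑_{i₁,…,i_k} ∂_{i₁}⋯∂_{i_k} g(x₀) n_{i₁}⋯n_{i_k} = ∑_{|α|=k} (1/α!) ∂^α g(x₀) n^α`,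
and only finitely many terms are non-zero. -/
def taylorExt {V : Type*} [AddCommGroup V] [Module ℝ V] {p n : ℕ} (g : Body p → ℂ)
    (z : Superspace V p n) : GrassC V :=
  ∑ᶠ k : ℕ, ∑ i : Fin k → EvenIdx p,
    ((k.factorial : ℂ)⁻¹ *
        iteratedFDeriv ℝ k g (bodyPt z) (fun j => EuclideanSpace.single (i j) (1 : ℝ)))
      ⊗ₜ[ℝ] (List.ofFn fun j => soul z (i j)).prod

/-- The value `f(x, ξ) = ∑_I f̃_I(x) ξ^I` of a superfunction at a point. -/
def SuperFun.eval {V : Type*} [AddCommGroup V] [Module ℝ V] {p n : ℕ} (f : SuperFun p n)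
    (z : Superspace V p n) : GrassC V :=
  ∑ I, taylorExt (f I) z * ((1 : ℂ) ⊗ₜ[ℝ] oddMonomial z I)

/-- A superfunction with coefficients in `𝒜`: a finite sum `∑_j a_j f_j` with `a_j ∈ 𝒜` and `f_j`
a superfunction. -/
structure GSuperFun (V : Type*) [AddCommGroup V] [Module ℝ V] (p n : ℕ) where
  /-- the number of terms -/
  size : ℕ
  /-- the coefficients in `𝒜` -/
  coeff : Fin size → Grass V
  /-- the superfunctions -/
  term : Fin size → SuperFun p n

/-- The value `∑_j a_j f_j(z)`. -/
def GSuperFun.eval {V : Type*} [AddCommGroup V] [Module ℝ V] {p n : ℕ} (F : GSuperFun V p n)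
    (z : Superspace V p n) : GrassC V :=
  ∑ j, ((1 : ℂ) ⊗ₜ[ℝ] F.coeff j) * (F.term j).eval z

/-- A bijection of `ℝ^{m|n}` is a superdiffeomorphism if its components and those of its inverse
are smooth superfunctions with coefficients in `𝒜`.  (That the component of index `μ` has degree
`deg μ` is part of the type; taking real parts, the superfunctions involved may be taken real.) -/
def IsSuperdiffeo {V : Type*} [AddCommGroup V] [Module ℝ V] {p n : ℕ}
    (φ : Equiv.Perm (Superspace V p n)) : Prop :=
  (∀ μ, ∃ F : GSuperFun V p n, (∀ j, (F.term j).Smooth) ∧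
      ∀ z, (1 : ℂ) ⊗ₜ[ℝ] (φ z).1 μ = F.eval z) ∧
  (∀ μ, ∃ F : GSuperFun V p n, (∀ j, (F.term j).Smooth) ∧
      ∀ z, (1 : ℂ) ⊗ₜ[ℝ] (φ.symm z).1 μ = F.eval z)

/-! ### Oscillating integrals over the even coordinates -/

/-- The symplectic form `ω₀(u, v) = ∑ (u_x v_w - u_w v_x)` on `ℝ^m`. -/
def omegaBody {p : ℕ} (u v : Body p) : ℝ :=
  ∑ i : Fin p, (u (Sum.inl i) * v (Sum.inr i) - u (Sum.inr i) * v (Sum.inl i))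

/-- The operator `O F = (1 - Δ)(F / (1 + c²(|u|² + |v|²)))` on functions of `(u, v)`, with `Δ` the
Laplacian in both variables.  It is the transpose of the operator `(1 + c²(|u|² + |v|²))⁻¹ (1 - Δ)`,
which fixes `exp(i c ω₀(u, v))`. -/
def oscOp {p : ℕ} (c : ℝ) (F : Body p × Body p → ℂ) : Body p × Body p → ℂ :=
  fun q =>
    let G : Body p × Body p → ℂ := fun r =>
      F r / ((1 + c ^ 2 * (‖r.1‖ ^ 2 + ‖r.2‖ ^ 2) : ℝ) : ℂ)
    G q - Laplacian.laplacian (fun u => G (u, q.2)) q.1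
      - Laplacian.laplacian (fun v => G (q.1, v)) q.2

/-- `I` is the oscillating integral `∫∫ du dv exp(i c ω₀(u, v)) F(u, v)`: for all large `k`, the
function `O^k F` is integrable and `∫∫ du dv exp(i c ω₀(u, v)) (O^k F)(u, v) = I`. -/
def IsOscIntegral {p : ℕ} (c : ℝ) (F : Body p × Body p → ℂ) (I : ℂ) : Prop :=
  ∀ᶠ k in Filter.atTop, MeasureTheory.Integrable ((oscOp c)^[k] F) ∧
    ∫ q : Body p × Body p,
      Complex.exp (Complex.I * ((c * omegaBody q.1 q.2 : ℝ) : ℂ)) * ((oscOp c)^[k] F) q = I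

/-- The value of the oscillating integral. -/
def oscIntegral {p : ℕ} (c : ℝ) (F : Body p × Body p → ℂ) : ℂ :=
  Classical.epsilon (IsOscIntegral c F)

/-- The even part of the star-product, without its constant: writing `y = (x, w)`,
`y₁ = (x₁, w₁)` and `y₂ = (x₂, w₂)`,
`∫ dy₁ dy₂ f(y₁) g(y₂) exp((2i/θ)((x₂ - x)·w₁ + (x - x₁)·w₂ + (x₁ - x₂)·w))`,
where the exponent equals `-(2i/θ) ω₀(y₁ - y, y₂ - y)`; the variables are `u = y₁ - y` and
`v = y₂ - y`. -/
def evenStar {p : ℕ} (θ : ℝ) (f g : Body p → ℂ) (y : Body p) : ℂ :=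
  oscIntegral (-2 / θ) fun q => f (y + q.1) * g (y + q.2)

/-! ### Berezin integrals over the odd coordinates -/

/-- The complex Grassmann algebra on the generators `ξ^i`, `ξ₁^i`, `ξ₂^i`. -/
abbrev OddAlg (n : ℕ) : Type := ExteriorAlgebra ℂ (Fin 3 × Fin n → ℂ)

/-- The generators: `gen 0 i = ξ^i`, `gen 1 i = ξ₁^i`, `gen 2 i = ξ₂^i`. -/
def gen {n : ℕ} (a : Fin 3) (i : Fin n) : OddAlg n :=
  ExteriorAlgebra.ι ℂ (Pi.single (a, i) (1 : ℂ))

/-- The ordered monomial `ξ_a^I`. -/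
def genMonomial {n : ℕ} (a : Fin 3) (I : Finset (Fin n)) : OddAlg n :=
  (I.sort.map (gen a)).prod

/-- The left derivative with respect to `ξ_a^i`. -/
def oddDeriv {n : ℕ} (a : Fin 3) (i : Fin n) : OddAlg n →ₗ[ℂ] OddAlg n :=
  CliffordAlgebra.contractLeft (Q := (0 : QuadraticForm ℂ (Fin 3 × Fin n → ℂ)))
    (LinearMap.proj (a, i))

/-- The left derivatives with respect to the `ξ_a^i`, `i ∈ I`, taken in increasing order, so that
`ξ_a^I c` is sent to `c` if `c` does not contain the `ξ_a^i`. -/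
def oddDerivs {n : ℕ} (a : Fin 3) (I : Finset (Fin n)) (G : OddAlg n) : OddAlg n :=
  I.sort.foldl (fun H i => oddDeriv a i H) G

/-- The Berezin integral over the `ξ_a`: `ξ_a^1 ⋯ ξ_a^n c` is sent to `c`, and a monomial that lacks
one of the `ξ_a^i` is sent to zero. -/
def berezin {n : ℕ} (a : Fin 3) (G : OddAlg n) : OddAlg n := oddDerivs a Finset.univ G

/-- The exponent `ξ ξ₁ + ξ₁ ξ₂ + ξ₂ ξ`. -/
def oddPhase (n : ℕ) : OddAlg n :=
  ∑ i : Fin n, (gen 0 i * gen 1 i + gen 1 i * gen 2 i + gen 2 i * gen 0 i)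

/-- The coefficient of `ξ^K` in `∫ dξ₁ dξ₂ ξ₁^I ξ₂^J exp(b (ξ ξ₁ + ξ₁ ξ₂ + ξ₂ ξ))`.
The inner integral is the one over `ξ₂`, so that `∫ dξ₁ dξ₂ ξ₁^1⋯ξ₁^n ξ₂^1⋯ξ₂^n = (-1)^n`; with the
constant `kappa` below this gives `1 ⋆ 1 = 1`. -/
def oddKernel {n : ℕ} (b : ℂ) (I J K : Finset (Fin n)) : ℂ :=
  ExteriorAlgebra.algebraMapInv (oddDerivs 0 K (berezin 1 (berezin 2
    (genMonomial 1 I * genMonomial 2 J * IsNilpotent.exp (b • oddPhase n)))))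

/-! ### The star-product and its internal symmetries -/

/-- The constant `κ`, with `m = 2p`. -/
def kappa (p n : ℕ) (θ α : ℝ) : ℂ :=
  (Complex.I * θ) ^ n * (-1) ^ (n * (n + 1) / 2) * (α : ℂ) ^ n /
    ((Real.pi * θ : ℂ) ^ (2 * p) * (1 + α : ℂ) ^ (2 * n))

/-- The star-product of superfunctions, coefficient by coefficient. -/
def starProduct {p n : ℕ} (θ α : ℝ) (f g : SuperFun p n) : SuperFun p n :=
  fun K y => kappa p n θ α * ∑ I, ∑ J,
    oddKernel (-Complex.I * (1 + α : ℂ) ^ 2 / (α * θ)) I J K * evenStar θ (f I) (g J) y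

/-- The component `f_I ⊗ θ^I` of a superfunction. -/
def SuperFun.component {p n : ℕ} (f : SuperFun p n) (I : Finset (Fin n)) : SuperFun p n :=
  fun J => if J = I then f J else 0

/-- The `𝒜`-bilinear extension of the star-product, as a function on `ℝ^{m|n}`:
`(a f_I θ^I) ⋆ (b g) = (-1)^{|I||b|} a b ((f_I θ^I) ⋆ g)`. -/
def GSuperFun.star {V : Type*} [AddCommGroup V] [Module ℝ V] {p n : ℕ} (θ α : ℝ)
    (F G : GSuperFun V p n) (z : Superspace V p n) : GrassC V :=
  ∑ j, ∑ k, ∑ I : Finset (Fin n),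
    ((1 : ℂ) ⊗ₜ[ℝ] (F.coeff j * (parityAut V)^[I.card] (G.coeff k))) *
      (starProduct θ α ((F.term j).component I) (G.term k)).eval z

/-- `φ ∈ Aut(⋆)`: `φ` is a superdiffeomorphism and, for all `f₁, f₂ ∈ ℬ(ℝ^{m|n})`, the pullbacks
`φ^* f₁` and `φ^* f₂` are superfunctions of polynomial growth (so that their star-product is
defined) and `φ^*(f₁ ⋆ f₂) = (φ^* f₁) ⋆ (φ^* f₂)`. -/
def IsInternalSymmetry {V : Type*} [AddCommGroup V] [Module ℝ V] {p n : ℕ} (θ α : ℝ)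
    (φ : Equiv.Perm (Superspace V p n)) : Prop :=
  IsSuperdiffeo φ ∧
  ∀ f₁ f₂ : SuperFun p n, f₁.Bounded → f₂.Bounded →
    ∃ F₁ F₂ : GSuperFun V p n,
      (∀ j, (F₁.term j).PolyGrowth) ∧ (∀ j, (F₂.term j).PolyGrowth) ∧
      (∀ z, f₁.eval (φ z) = F₁.eval z) ∧ (∀ z, f₂.eval (φ z) = F₂.eval z) ∧
      ∀ z, (starProduct θ α f₁ f₂).eval (φ z) = F₁.star θ α F₂ z

/-! ### The inhomogeneous orthosymplectic group -/

section Groups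

variable (V : Type*) [AddCommGroup V] [Module ℝ V] (p n : ℕ)

/-- Supermatrices: the diagonal blocks are even, the off-diagonal blocks are odd. -/
def IsSupermatrix {V : Type*} [AddCommGroup V] [Module ℝ V] {p n : ℕ}
    (A : Matrix (Idx p n) (Idx p n) (Grass V)) : Prop :=
  ∀ μ ν, A μ ν ∈ part V (deg μ + deg ν)

theorem zmodTwo_add_cancel (a b c : ZMod 2) : (a + b) + (b + c) = a + c := by
  revert a b c; decide

theorem zmodTwo_add_self (a : ZMod 2) : a + a = 0 := by
  revert a; decide

theorem zmodTwo_add_right (a b : ZMod 2) : (a + b) + b = a := by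
  revert a b; decide

theorem mul_mem_part {i j : ZMod 2} {a b : Grass V} (ha : a ∈ part V i) (hb : b ∈ part V j) :
    a * b ∈ part V (i + j) :=
  CliffordAlgebra.evenOdd_mul_le (0 : QuadraticForm ℝ V) i j (Submodule.mul_mem_mul ha hb)

variable {V p n} in
theorem IsSupermatrix.mul {A B : Matrix (Idx p n) (Idx p n) (Grass V)}
    (hA : IsSupermatrix A) (hB : IsSupermatrix B) : IsSupermatrix (A * B) := by
  intro μ ν
  rw [Matrix.mul_apply]
  refine Submodule.sum_mem _ fun ρ _ => ?_
  have h := mul_mem_part V (hA μ ρ) (hB ρ ν)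
  rwa [zmodTwo_add_cancel] at h

variable {V p n} in
theorem IsSupermatrix.one : IsSupermatrix (1 : Matrix (Idx p n) (Idx p n) (Grass V)) := by
  intro μ ν
  by_cases h : μ = ν
  · subst h
    rw [Matrix.one_apply_eq, zmodTwo_add_self]
    exact Submodule.one_le.mp (CliffordAlgebra.one_le_evenOdd_zero (0 : QuadraticForm ℝ V))
  · rw [Matrix.one_apply_ne h]
    exact Submodule.zero_mem _

/-- `GL(m, n)`: the supermatrices that are invertible among supermatrices. -/
def SuperGL : Subgroup (Matrix (Idx p n) (Idx p n) (Grass V))ˣ where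
  carrier := {A | IsSupermatrix A.val ∧ IsSupermatrix A.inv}
  mul_mem' hA hB := ⟨hA.1.mul hB.1, hB.2.mul hA.2⟩
  one_mem' := ⟨IsSupermatrix.one, IsSupermatrix.one⟩
  inv_mem' hA := ⟨hA.2, hA.1⟩

/-- `GL(m, n)` acts on the columns of `ℝ^{m|n}` by matrix multiplication. -/
instance : DistribMulAction (SuperGL V p n) (Superspace V p n) where
  smul A z := ⟨A.1.val.mulVec z.1, by
    intro μ
    change ∑ ν, A.1.val μ ν * z.1 ν ∈ part V (deg μ)
    refine Submodule.sum_mem _ fun ν _ => ?_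
    have h := mul_mem_part V (A.2.1 μ ν) (z.2 ν)
    rwa [zmodTwo_add_right] at h⟩
  one_smul z := Subtype.ext (Matrix.one_mulVec z.1)
  mul_smul A B z := Subtype.ext (Matrix.mulVec_mulVec z.1 A.1.val B.1.val).symm
  smul_zero A := Subtype.ext (Matrix.mulVec_zero A.1.val)
  smul_add A z z' := Subtype.ext (Matrix.mulVec_add A.1.val z.1 z'.1)

/-- The matrix of the standard even symplectic form: `ω₀` on the even coordinates, `2` times the
identity on the odd ones. -/
def omega : Matrix (Idx p n) (Idx p n) ℝ :=
  Matrix.fromBlocks (Matrix.fromBlocks 0 1 (-1) 0) 0 0 ((2 : ℝ) • 1)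

variable {V p n} in
/-- The standard even symplectic form `ω(z, z') = ∑ z_μ ω_{μν} z'_ν`. -/
def symplForm (z z' : Superspace V p n) : Grass V :=
  ∑ μ, ∑ ν, omega p n μ ν • (z.1 μ * z'.1 ν)

/-- `OSP(n, m/2)`: the elements of `GL(m, n)` that leave the standard even symplectic form
invariant. -/
def OSp : Subgroup (SuperGL V p n) where
  carrier := {A | ∀ z z' : Superspace V p n, symplForm (A • z) (A • z') = symplForm z z'}
  mul_mem' {A B} hA hB z z' := by
    rw [mul_smul, mul_smul, hA, hB]
  one_mem' z z' := by rw [one_smul, one_smul]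
  inv_mem' {A} hA z z' := by
    rw [← hA (A⁻¹ • z) (A⁻¹ • z'), smul_inv_smul, smul_inv_smul]

/-- `OSP(n, m/2)` acts on the additive group `ℝ^{m|n}` by automorphisms. -/
def ospAct : OSp V p n →* MulAut (Multiplicative (Superspace V p n)) :=
  (MulAutMultiplicative (Superspace V p n)).symm.toMonoidHom.comp
    (DistribMulAction.toAddAut (OSp V p n) (Superspace V p n))

/-- The inhomogeneous orthosymplectic group `OSP(n, m/2) ⋉ ℝ^{m|n}`. -/
abbrev InhomOSp : Type _ := Multiplicative (Superspace V p n) ⋊[ospAct V p n] OSp V p n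

variable {V p n} in
/-- The affine map `z ↦ A z + τ` given by an element `(τ, A)` of `OSP(n, m/2) ⋉ ℝ^{m|n}`. -/
def affineAct (g : InhomOSp V p n) (z : Superspace V p n) : Superspace V p n :=
  g.right • z + Multiplicative.toAdd g.left

end Groups

end SuperMoyal

end

/-!
The star-product is studied through *plane waves*, superfunctions `E` whose values are `exp(i κ·z)`
for a covector `κ` with entries in `𝒜`.  Acting by star-multiplication on the left, `E` multiplies
by `E` and translates the argument, by a vector that depends bijectively on `κ` (`IsPlaneWave`).

For real `κ` this is a property of oscillating integrals of symbols.  A conjugated derivative has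
integral zero (`oscIntegral_DD`), since an oscillating integral is a limit of cut-offs
(`tendsto_oscIntegral_cutoff`); with Hadamard's lemma, `evenStar_chr_left` follows.  Together with a
recursion for the Berezin kernel (`oddKernel_insert`) integration by parts also describes the left
multiplication by a coordinate (`starT_zT`).  An arbitrary `κ` is reached from its body by adding
finitely many square-zero increments (`IsPlaneWave.step`), for which the exponential is affine.

*Symmetries are affine.*  If `φ` is a symmetry, the pull-back of a plane wave acts on compactly
supported superfunctions as a plane wave does, so by non-degeneracy (`eq_zero_of_starT_zero`) it is
a multiple of one.  Taking logarithms gives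
`κ·(φ z - φ 0) = cov(φ⁻¹(φ 0 + pvec κ))·z` (`dotp_symmetry`), where `pvec κ` is the translation
belonging to `κ` and `cov` is the inverse of `pvec`.  Hence `φ` is affine, with a linear part
leaving `cov(w)·z` invariant (`exists_affine_of_isInternalSymmetry`).  Only covectors with plane
waves in `ℬ` are available here; the odd ones suffice because `V` is infinite-dimensional, so that
an odd parameter not occurring in the data can be cancelled (`exists_fresh`).

*Affine maps are symmetries.*  An affine map that preserves `cov(w)·z` sends plane waves to
multiples of plane waves and intertwines the translations, so both sides of
`φ*(f ⋆ g) = φ*f ⋆ φ*g` agree if `f` is a plane wave.  At a fixed point both are functionals of `f`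
of the form `f ↦ ∑ (f_I ⋆ G_I)(Y) a_I`; such a functional is determined by its values on plane waves
(`starFun_eq_zero`, `eq_zero_of_planeWave`).

A diagonal matrix `D` turns `cov(w)·z` into a multiple of the standard form (`dotp_cov_scaling`), so
that the linear parts of the symmetries are the conjugates by `D` of `OSP` (`mem_range_affineHom`).
-/

open scoped TensorProduct ContDiff

noncomputable section

namespace SuperMoyal

/-! ### Symbol classes -/

section Symbols

variable {X : Type*} [NormedAddCommGroup X] [NormedSpace ℝ X]
variable {F : Type*} [NormedAddCommGroup F] [NormedSpace ℝ F]

/-- The partial derivative of `f` in the direction `a`. -/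
def pd {F : Type*} [NormedAddCommGroup F] [NormedSpace ℝ F] (a : X) (f : X → F) : X → F :=
  fun q => fderiv ℝ f q a

/-- The derivatives of `f` of order at most `K` are bounded by `C (1 + ‖q‖) ^ N`. -/
def SymBound (K : ℕ) (N : ℤ) (C : ℝ) (f : X → F) : Prop :=
  ∀ i ≤ K, ∀ q, ‖iteratedFDeriv ℝ i f q‖ ≤ C * (1 + ‖q‖) ^ N

/-- Symbols of order `N`: smooth functions all of whose derivatives are `O((1 + ‖q‖) ^ N)`. -/
def IsSym (N : ℤ) (f : X → F) : Prop :=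
  ContDiff ℝ ∞ f ∧ ∀ K, ∃ C, SymBound K N C f

theorem SymBound.nonneg {K : ℕ} {N : ℤ} {C : ℝ} {f : X → F} (h : SymBound K N C f) : 0 ≤ C := by
  have := h 0 (Nat.zero_le _) 0
  simp at this
  exact (norm_nonneg _).trans this

theorem SymBound.mono {K K' : ℕ} {N N' : ℤ} {C C' : ℝ} {f : X → F} (h : SymBound K N C f)
    (hK : K' ≤ K) (hN : N ≤ N') (hC : C ≤ C') : SymBound K' N' C' f := by
  intro i hi q
  refine (h i (hi.trans hK) q).trans ?_
  have h1 : (1 : ℝ) ≤ 1 + ‖q‖ := by linarith [norm_nonneg q]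
  have : (0 : ℝ) ≤ C' := h.nonneg.trans hC
  gcongr

theorem IsSym.mono {N N' : ℤ} {f : X → F} (h : IsSym N f) (hN : N ≤ N') : IsSym N' f :=
  ⟨h.1, fun K => (h.2 K).imp fun _ hC => hC.mono le_rfl hN le_rfl⟩

/-- Leibniz' formula for symbols, with an explicit constant. -/
theorem SymBound.smul {𝕜' : Type*} [NormedField 𝕜'] [NormedAlgebra ℝ 𝕜'] [NormedSpace 𝕜' F]
    [IsScalarTower ℝ 𝕜' F]
    {K : ℕ} {N M : ℤ} {C D : ℝ} {f : X → 𝕜'} {g : X → F}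
    (hf : ContDiff ℝ ∞ f) (hg : ContDiff ℝ ∞ g) (h : SymBound K N C f) (h' : SymBound K M D g) :
    SymBound K (N + M) (2 ^ K * (C * D)) (fun q => f q • g q) := by
  intro i hi q
  have hC := h.nonneg
  have hD := h'.nonneg
  have hq : (0 : ℝ) < 1 + ‖q‖ := by positivity
  refine (norm_iteratedFDeriv_smul_le (N := ∞) hf hg q (by exact_mod_cast le_top)).trans ?_
  calc _ ≤ ∑ j ∈ Finset.range (i + 1), (i.choose j : ℝ) * ((C * (1 + ‖q‖) ^ N) *
        (D * (1 + ‖q‖) ^ M)) := by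
        refine Finset.sum_le_sum fun j hj => ?_
        rw [mul_assoc]
        have hj' := Finset.mem_range.mp hj
        have a1 := h j (by omega) q
        have a2 := h' (i - j) (by omega) q
        exact mul_le_mul_of_nonneg_left (mul_le_mul a1 a2 (norm_nonneg _) (by positivity))
          (Nat.cast_nonneg _)
    _ = 2 ^ i * (C * D) * (1 + ‖q‖) ^ (N + M) := by
        rw [← Finset.sum_mul, zpow_add₀ hq.ne', ← Nat.cast_sum, Nat.sum_range_choose,
          Nat.cast_pow, Nat.cast_ofNat]
        ring
    _ ≤ _ := by
        refine mul_le_mul_of_nonneg_right (mul_le_mul_of_nonneg_right ?_ (by positivity))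
          (by positivity)
        exact pow_le_pow_right₀ one_le_two hi

theorem IsSym.smul {𝕜' : Type*} [NormedField 𝕜'] [NormedAlgebra ℝ 𝕜'] [NormedSpace 𝕜' F]
    [IsScalarTower ℝ 𝕜' F]
    {N M : ℤ} {f : X → 𝕜'} {g : X → F}
    (h : IsSym N f) (h' : IsSym M g) : IsSym (N + M) (fun q => f q • g q) :=
  ⟨h.1.smul h'.1, fun K => by
    obtain ⟨C, hC⟩ := h.2 K
    obtain ⟨D, hD⟩ := h'.2 K
    exact ⟨_, SymBound.smul h.1 h'.1 hC hD⟩⟩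

theorem IsSym.mul {N M : ℤ} {f g : X → ℂ}
    (h : IsSym N f) (h' : IsSym M g) : IsSym (N + M) (fun q => f q * g q) :=
  IsSym.smul h h'

theorem SymBound.add {K : ℕ} {N : ℤ} {C D : ℝ} {f g : X → F}
    (hf : ContDiff ℝ ∞ f) (hg : ContDiff ℝ ∞ g) (h : SymBound K N C f) (h' : SymBound K N D g) :
    SymBound K N (C + D) (fun q => f q + g q) := by
  intro i hi q
  have hle : (i : ℕ∞ω) ≤ ∞ := by exact_mod_cast le_top
  have : iteratedFDeriv ℝ i (fun q => f q + g q) q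
      = iteratedFDeriv ℝ i f q + iteratedFDeriv ℝ i g q :=
    iteratedFDeriv_add_apply (hf.contDiffAt.of_le hle) (hg.contDiffAt.of_le hle)
  rw [this, add_mul]
  exact (norm_add_le _ _).trans (add_le_add (h i hi q) (h' i hi q))

theorem IsSym.add {N : ℤ} {f g : X → F} (h : IsSym N f) (h' : IsSym N g) :
    IsSym N (fun q => f q + g q) :=
  ⟨h.1.add h'.1, fun K => by
    obtain ⟨C, hC⟩ := h.2 K
    obtain ⟨D, hD⟩ := h'.2 K
    exact ⟨_, SymBound.add h.1 h'.1 hC hD⟩⟩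

theorem SymBound.const (K : ℕ) (c : F) : SymBound K 0 ‖c‖ (fun _ : X => c) := by
  intro i _ q
  rcases i with _ | i
  · simp
  · rw [iteratedFDeriv_succ_const]; simp

theorem IsSym.const (c : F) : IsSym 0 (fun _ : X => c) :=
  ⟨contDiff_const, fun K => ⟨_, SymBound.const K c⟩⟩

theorem IsSym.zero (N : ℤ) : IsSym N (fun _ : X => (0 : F)) :=
  ⟨contDiff_const, fun K => ⟨0, fun i _ q => by
    rcases i with _ | i
    · simp
    · rw [iteratedFDeriv_succ_const]; simp⟩⟩

theorem IsSym.const_smul {𝕜' : Type*} [NormedField 𝕜'] [NormedAlgebra ℝ 𝕜'] [NormedSpace 𝕜' F]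
    [IsScalarTower ℝ 𝕜' F] {N : ℤ} {f : X → F} (c : 𝕜') (h : IsSym N f) :
    IsSym N (fun q => c • f q) := by
  simpa using (IsSym.const (X := X) c).smul h

theorem IsSym.const_mul {N : ℤ} {f : X → ℂ} (c : ℂ) (h : IsSym N f) :
    IsSym N (fun q => c * f q) := h.const_smul c

theorem IsSym.neg {N : ℤ} {f : X → F} (h : IsSym N f) : IsSym N (fun q => - f q) := by
  simpa using h.const_smul (-1 : ℝ)

theorem IsSym.sub {N : ℤ} {f g : X → F} (h : IsSym N f) (h' : IsSym N g) :
    IsSym N (fun q => f q - g q) := by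
  simpa [sub_eq_add_neg] using h.add h'.neg

theorem IsSym.sum {ι : Type*} {s : Finset ι} {N : ℤ} {f : ι → X → F}
    (h : ∀ i ∈ s, IsSym N (f i)) : IsSym N (fun q => ∑ i ∈ s, f i q) := by
  classical
  induction s using Finset.induction_on with
  | empty => simpa using IsSym.zero N
  | insert a s ha ih =>
    simp only [Finset.sum_insert ha]
    exact (h a (Finset.mem_insert_self _ _)).add
      (ih fun i hi => h i (Finset.mem_insert_of_mem hi))

theorem SymBound.fderivBound {K : ℕ} {N : ℤ} {C : ℝ} {f : X → F} (h : SymBound (K + 1) N C f) :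
    SymBound K N C (fderiv ℝ f) := by
  intro i hi q
  rw [norm_iteratedFDeriv_fderiv]
  exact h (i + 1) (by omega) q

theorem contDiff_fderiv {f : X → F} (h : ContDiff ℝ ∞ f) : ContDiff ℝ ∞ (fderiv ℝ f) :=
  h.fderiv_right (by simp)

theorem contDiff_pd {f : X → F} (h : ContDiff ℝ ∞ f) (a : X) : ContDiff ℝ ∞ (pd a f) :=
  (contDiff_fderiv h).clm_apply contDiff_const

theorem IsSym.fderivSym {N : ℤ} {f : X → F} (h : IsSym N f) : IsSym N (fderiv ℝ f) :=
  ⟨contDiff_fderiv h.1, fun K => (h.2 (K + 1)).imp fun _ hC => hC.fderivBound⟩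

theorem SymBound.partialDeriv {K : ℕ} {N : ℤ} {C : ℝ} {f : X → F} (hf : ContDiff ℝ ∞ f)
    (h : SymBound (K + 1) N C f) (a : X) : SymBound K N (‖a‖ * C) (pd a f) := by
  intro i hi q
  refine (norm_iteratedFDeriv_clm_apply_const (N := ∞) (contDiff_fderiv hf).contDiffAt
    (by exact_mod_cast le_top)).trans ?_
  rw [mul_assoc]
  gcongr
  exact h.fderivBound i hi q

theorem IsSym.partialDeriv {N : ℤ} {f : X → F} (h : IsSym N f) (a : X) : IsSym N (pd a f) :=
  ⟨contDiff_pd h.1 a, fun K => by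
    obtain ⟨C, hC⟩ := h.2 (K + 1)
    exact ⟨_, hC.partialDeriv h.1 a⟩⟩

theorem isSym_clm (L : X →L[ℝ] F) : IsSym 1 (fun q => L q) := by
  refine ⟨L.contDiff, fun K => ⟨‖L‖, fun i _ q => ?_⟩⟩
  have hq := norm_nonneg q
  rcases i with _ | _ | i
  · simp only [norm_iteratedFDeriv_zero, zpow_one]
    refine (L.le_opNorm q).trans ?_
    gcongr; linarith
  · rw [← norm_iteratedFDeriv_fderiv]
    simp only [norm_iteratedFDeriv_zero, zpow_one, ContinuousLinearMap.fderiv]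
    exact le_mul_of_one_le_right (norm_nonneg _) (by linarith)
  · rw [← norm_iteratedFDeriv_fderiv]
    have : fderiv ℝ (fun q => L q) = fun _ => L := by ext1 x; exact L.fderiv
    rw [this, iteratedFDeriv_succ_const]
    simp only [Pi.zero_apply, norm_zero]; positivity

theorem IsSym.comp_affine {Y : Type*} [NormedAddCommGroup Y] [NormedSpace ℝ Y]
    {N : ℕ} {f : X → F} (h : IsSym N f) (L : Y →L[ℝ] X) (s : X) :
    IsSym N (fun q => f (L q + s)) := by
  have hsm : ContDiff ℝ ∞ (fun q => f (L q + s)) := h.1.comp (L.contDiff.add contDiff_const)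
  refine ⟨hsm, fun K => ?_⟩
  obtain ⟨C, hC⟩ := h.2 K
  have hC0 := hC.nonneg
  refine ⟨C * (1 + ‖L‖ + ‖s‖) ^ N * (1 + ‖L‖) ^ K, fun i hi q => ?_⟩
  have e1 : iteratedFDeriv ℝ i (fun q => f (L q + s)) q
      = (iteratedFDeriv ℝ i f (L q + s)).compContinuousLinearMap fun _ => L := by
    have := L.iteratedFDeriv_comp_right (f := fun x => f (x + s)) (i := i) (n := ∞)
      (h.1.comp (contDiff_id.add contDiff_const)) q (by exact_mod_cast le_top)
    rw [iteratedFDeriv_comp_add_right] at this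
    exact this
  rw [e1]
  refine (ContinuousMultilinearMap.norm_compContinuousLinearMap_le _ _).trans ?_
  have hLs : 1 + ‖L q + s‖ ≤ (1 + ‖L‖ + ‖s‖) * (1 + ‖q‖) := by
    have := (norm_add_le (L q) s).trans (add_le_add_left (L.le_opNorm q) _)
    nlinarith [norm_nonneg q, norm_nonneg s, norm_nonneg L, mul_nonneg (norm_nonneg s) (norm_nonneg q)]
  have h2 := hC i hi (L q + s)
  simp only [zpow_natCast] at h2 ⊢
  calc _ ≤ (C * ((1 + ‖L‖ + ‖s‖) * (1 + ‖q‖)) ^ N) * (1 + ‖L‖) ^ K := by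
        rw [Finset.prod_const, Finset.card_univ, Fintype.card_fin]
        gcongr
        · exact h2.trans (by gcongr)
        · calc ‖L‖ ^ i ≤ (1 + ‖L‖) ^ i := by gcongr; linarith
            _ ≤ _ := pow_le_pow_right₀ (by linarith [norm_nonneg L]) hi
    _ = _ := by rw [mul_pow]; ring

theorem pd_add {f g : X → F} (hf : ContDiff ℝ ∞ f) (hg : ContDiff ℝ ∞ g) (a : X) :
    pd a (fun q => f q + g q) = fun q => pd a f q + pd a g q := by
  ext q
  simp only [pd]
  rw [fderiv_fun_add (hf.differentiable (by simp) q) (hg.differentiable (by simp) q)]; rfl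

theorem pd_mul {f g : X → ℂ} (hf : ContDiff ℝ ∞ f) (hg : ContDiff ℝ ∞ g) (a : X) :
    pd a (fun q => f q * g q) = fun q => pd a f q * g q + f q * pd a g q := by
  ext q
  simp only [pd]
  rw [fderiv_fun_mul (hf.differentiable (by simp) q) (hg.differentiable (by simp) q)]
  simp [mul_comm, add_comm]

theorem pd_const (c : F) (a : X) : pd a (fun _ : X => c) = fun _ => 0 := by
  ext q; simp [pd]

theorem pd_const_mul {f : X → ℂ} (hf : ContDiff ℝ ∞ f) (c : ℂ) (a : X) :
    pd a (fun q => c * f q) = fun q => c * pd a f q := by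
  rw [pd_mul contDiff_const hf, pd_const]; simp

theorem pd_sum {ι : Type*} {s : Finset ι} {f : ι → X → F} (hf : ∀ i ∈ s, ContDiff ℝ ∞ (f i))
    (a : X) : pd a (fun q => ∑ i ∈ s, f i q) = fun q => ∑ i ∈ s, pd a (f i) q := by
  ext q
  simp only [pd]
  rw [fderiv_fun_sum fun i hi => (hf i hi).differentiable (by simp) q]
  simp

theorem pd_comm {f : X → F} (hf : ContDiff ℝ ∞ f) (a b : X) : pd a (pd b f) = pd b (pd a f) := by
  ext q
  have hd : DifferentiableAt ℝ (fderiv ℝ f) q :=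
    (contDiff_fderiv hf).differentiable (by simp) q
  have key : ∀ a b : X, pd a (pd b f) q = fderiv ℝ (fderiv ℝ f) q a b := by
    intro a b
    have := hd.hasFDerivAt.clm_apply (hasFDerivAt_const b q)
    change fderiv ℝ (fun y => fderiv ℝ f y b) q a = _
    rw [this.fderiv]
    simp
  rw [key, key]
  exact (hf.contDiffAt.isSymmSndFDerivAt (by
    simpa using (WithTop.coe_le_coe.mpr (le_top : (2 : ℕ∞) ≤ ⊤) : ((2 : ℕ∞) : ℕ∞ω) ≤ ∞))) a b

theorem pd_clm (L : X →L[ℝ] F) (a : X) : pd a (fun q => L q) = fun _ => L a := by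
  ext q; simp only [pd]; rw [show (fun q => L q) = L from rfl, L.fderiv]

theorem pd_add_dir (f : X → F) (a b : X) : pd (a + b) f = fun q => pd a f q + pd b f q := by
  ext q; simp [pd]

theorem pd_smul_dir (f : X → F) (r : ℝ) (a : X) : pd (r • a) f = fun q => r • pd a f q := by
  ext q; simp [pd]

theorem pd_zero_dir (f : X → F) : pd 0 f = 0 := by
  ext q; simp [pd]

theorem pd_comp_affine {Y : Type*} [NormedAddCommGroup Y] [NormedSpace ℝ Y]
    {f : X → F} (hf : ContDiff ℝ ∞ f) (L : Y →L[ℝ] X) (s : X) (a : Y) :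
    pd a (fun q => f (L q + s)) = fun q => pd (L a) f (L q + s) := by
  ext q
  have h1 : HasFDerivAt (fun q => L q + s) L q := L.hasFDerivAt.add_const s
  have h2 := (hf.differentiable (by simp) (L q + s)).hasFDerivAt.comp q h1
  simp only [pd]
  rw [show (fun q => f (L q + s)) = f ∘ (fun q => L q + s) from rfl, h2.fderiv]
  rfl

theorem norm_le_of_isSym {N : ℤ} {f : X → F} (h : IsSym N f) :
    ∃ C, 0 ≤ C ∧ ∀ q, ‖f q‖ ≤ C * (1 + ‖q‖) ^ N := by
  obtain ⟨C, hC⟩ := h.2 0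
  exact ⟨C, hC.nonneg, fun q => by simpa using hC 0 le_rfl q⟩

theorem integrable_of_bound {F : Type*} [NormedAddCommGroup F] [FiniteDimensional ℝ X] [MeasurableSpace X] [BorelSpace X]
    {μ : MeasureTheory.Measure X} [μ.IsAddHaarMeasure] {N : ℤ}
    (hN : N ≤ -(Module.finrank ℝ X + 1 : ℤ)) {f : X → F} (hf : Continuous f)
    {C : ℝ} (hC : ∀ q, ‖f q‖ ≤ C * (1 + ‖q‖) ^ N) : MeasureTheory.Integrable f μ := by
  have hi : MeasureTheory.Integrable
      (fun q : X => C * (1 + ‖q‖) ^ (-((Module.finrank ℝ X : ℝ) + 1))) μ :=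
    (integrable_one_add_norm (by linarith)).const_mul C
  have hC0 : 0 ≤ C := by have := (norm_nonneg _).trans (hC 0); simpa using this
  refine hi.mono' hf.aestronglyMeasurable (Filter.Eventually.of_forall fun q => ?_)
  refine (hC q).trans ?_
  gcongr
  rw [← Real.rpow_intCast]
  refine Real.rpow_le_rpow_of_exponent_le (by linarith [norm_nonneg q]) ?_
  have : (N : ℝ) ≤ ((-(Module.finrank ℝ X + 1 : ℤ) : ℤ) : ℝ) := by exact_mod_cast hN
  push_cast at this; linarith

theorem IsSym.integrable [FiniteDimensional ℝ X] [MeasurableSpace X] [BorelSpace X]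
    {μ : MeasureTheory.Measure X} [μ.IsAddHaarMeasure] {N : ℤ}
    (hN : N ≤ -(Module.finrank ℝ X + 1 : ℤ)) {f : X → F} (hf : IsSym N f) :
    MeasureTheory.Integrable f μ := by
  obtain ⟨C, _, hC⟩ := norm_le_of_isSym hf
  exact integrable_of_bound hN hf.1.continuous hC

theorem isSym_of_forall {N : ℤ} {f : X → F} (hf : ContDiff ℝ ∞ f)
    (h : ∀ i : ℕ, ∃ C, ∀ q, ‖iteratedFDeriv ℝ i f q‖ ≤ C * (1 + ‖q‖) ^ N) : IsSym N f := by
  choose C hC using h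
  refine ⟨hf, fun K => ⟨∑ i ∈ Finset.range (K + 1), |C i|, fun i hi q => (hC i q).trans ?_⟩⟩
  have hpos : (0 : ℝ) ≤ (1 + ‖q‖) ^ N := by positivity
  gcongr
  exact (le_abs_self _).trans (Finset.single_le_sum (f := fun i => |C i|)
    (fun j _ => abs_nonneg _) (Finset.mem_range.mpr (by omega)))

theorem isSym_of_hasCompactSupport {f : X → F} (hf : ContDiff ℝ ∞ f) (hs : HasCompactSupport f)
    (N : ℤ) : IsSym N f := by
  refine isSym_of_forall hf fun i => ?_
  have hc : Continuous (fun q => (1 + ‖q‖) ^ (-N) * ‖iteratedFDeriv ℝ i f q‖) := by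
    refine Continuous.mul ?_ (hf.continuous_iteratedFDeriv (by exact_mod_cast le_top)).norm
    refine Continuous.zpow₀ (by fun_prop) _ fun q => Or.inl (by positivity)
  have hsi : HasCompactSupport (fun q => (1 + ‖q‖) ^ (-N) * ‖iteratedFDeriv ℝ i f q‖) :=
    (hs.iteratedFDeriv (𝕜 := ℝ) i).norm.mul_left
  obtain ⟨C, hC⟩ := hsi.exists_bound_of_continuous hc
  refine ⟨C, fun q => ?_⟩
  have h1 := hC q
  have hpos : (0 : ℝ) < 1 + ‖q‖ := by positivity
  rw [norm_mul, norm_norm, Real.norm_of_nonneg (by positivity), zpow_neg,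
    inv_mul_le_iff₀ (by positivity)] at h1
  linarith

/-- Dilations of a bounded symbol tend to its value at the origin, as symbols of order one. -/
theorem IsSym.dilation {χ : X → F} (h : IsSym 0 χ) (K : ℕ) :
    ∃ C, ∀ ε : ℝ, 0 < ε → ε ≤ 1 → SymBound K 1 (C * ε) (fun q => χ (ε • q) - χ 0) := by
  obtain ⟨C, hC⟩ := h.2 (K + 1)
  have hC0 := hC.nonneg
  refine ⟨C, fun ε hε hε1 i hi q => ?_⟩
  rw [zpow_one]
  rcases i with _ | i
  · rw [norm_iteratedFDeriv_zero]
    have h1 := (convex_univ (𝕜 := ℝ) (E := X)).norm_image_sub_le_of_norm_fderiv_le (𝕜 := ℝ)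
      (f := χ) (C := C) (fun x _ => h.1.differentiable (by simp) x)
      (fun x _ => by
        have := hC 1 (by omega) x
        rwa [zpow_zero, mul_one, ← norm_iteratedFDeriv_fderiv, norm_iteratedFDeriv_zero] at this)
      (Set.mem_univ 0) (Set.mem_univ (ε • q))
    refine h1.trans ?_
    rw [sub_zero, norm_smul, Real.norm_of_nonneg hε.le]
    have := norm_nonneg q
    have := mul_nonneg hC0 hε.le
    nlinarith
  · have hsm : ContDiff ℝ ∞ (fun q => χ (ε • q)) := h.1.comp (contDiff_const_smul ε)
    have e0 : iteratedFDeriv ℝ (i + 1) (fun q => χ (ε • q) - χ 0) q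
        = iteratedFDeriv ℝ (i + 1) (fun q => χ (ε • q)) q := by
      have := iteratedFDeriv_sub_apply (i := i + 1) (x := q)
        (hsm.contDiffAt.of_le (by exact_mod_cast le_top))
        ((contDiff_const (c := χ 0)).contDiffAt.of_le (by exact_mod_cast le_top) :
          ContDiffAt ℝ (i + 1 : ℕ) (fun _ : X => χ 0) q)
      rw [iteratedFDeriv_const_of_ne (by omega), Pi.zero_apply, sub_zero] at this
      exact this
    have e1 := (ε • ContinuousLinearMap.id ℝ X).iteratedFDeriv_comp_right (f := χ) (i := i + 1)
      (n := ∞) h.1 q (by exact_mod_cast le_top)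
    have e2 : (χ ∘ (ε • ContinuousLinearMap.id ℝ X : X →L[ℝ] X)) = fun q => χ (ε • q) := by
      ext q; simp
    rw [e2] at e1
    rw [e0, e1]
    refine (ContinuousMultilinearMap.norm_compContinuousLinearMap_le _ _).trans ?_
    have h2 := hC (i + 1) (by omega) ((ε • ContinuousLinearMap.id ℝ X : X →L[ℝ] X) q)
    rw [zpow_zero, mul_one] at h2
    rw [Finset.prod_const, Finset.card_univ, Fintype.card_fin]
    have hn : ‖(ε • ContinuousLinearMap.id ℝ X : X →L[ℝ] X)‖ ≤ ε := by
      refine ContinuousLinearMap.opNorm_le_bound _ hε.le fun x => ?_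
      simp [norm_smul, abs_of_pos hε]
    calc _ ≤ C * ε ^ (i + 1) := by gcongr
      _ ≤ C * ε := by
        gcongr
        exact pow_le_of_le_one hε.le hε1 (by omega)
      _ ≤ _ := le_mul_of_one_le_right (by positivity) (by linarith [norm_nonneg q])

/-- A smooth function with compact support that is `1` at the origin. -/
theorem exists_bump (X : Type*) [NormedAddCommGroup X] [NormedSpace ℝ X] [FiniteDimensional ℝ X] :
    ∃ b : X → ℂ, ContDiff ℝ ∞ b ∧ HasCompactSupport b ∧ b 0 = 1 := by
  obtain ⟨b⟩ : Nonempty (ContDiffBump (0 : X)) := inferInstance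
  refine ⟨fun x => ((b x : ℝ) : ℂ), Complex.ofRealCLM.contDiff.comp b.contDiff,
    b.hasCompactSupport.comp_left (g := fun r : ℝ => (r : ℂ)) (by simp), ?_⟩
  simp [b.one_of_mem_closedBall (Metric.mem_closedBall_self b.rIn_pos.le)]

end Symbols


/-! ### The operator `O` and its transpose -/

section Osc

variable {p : ℕ}

/-- The symplectic form on the body, as a bilinear map. -/
def omegaLin (p : ℕ) : Body p →ₗ[ℝ] Body p →ₗ[ℝ] ℝ :=
  LinearMap.mk₂ ℝ omegaBody
    (fun a b c => by simp only [omegaBody, ← Finset.sum_add_distrib, PiLp.add_apply]; congr 1; ext; ring)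
    (fun r a b => by
      simp only [omegaBody, PiLp.smul_apply, smul_eq_mul, Finset.mul_sum]
      exact Finset.sum_congr rfl fun i _ => by ring)
    (fun a b c => by simp only [omegaBody, ← Finset.sum_add_distrib, PiLp.add_apply]; congr 1; ext; ring)
    (fun r a b => by
      simp only [omegaBody, PiLp.smul_apply, smul_eq_mul, Finset.mul_sum]
      exact Finset.sum_congr rfl fun i _ => by ring)

theorem omegaLin_apply (u v : Body p) : omegaLin p u v = omegaBody u v := rfl

theorem omegaBody_zero_left (v : Body p) : omegaBody 0 v = 0 := (omegaLin p).map_zero₂ v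

theorem omegaBody_zero_right (u : Body p) : omegaBody u 0 = 0 := (omegaLin p u).map_zero

theorem omegaBody_swap (u v : Body p) : omegaBody u v = - omegaBody v u := by
  simp only [omegaBody, ← Finset.sum_neg_distrib]; congr 1; ext; ring

/-- The derivative of the phase `c ω₀(u, v)` at `q`, in the direction `a`. -/
def tau (c : ℝ) (a : Body p × Body p) : Body p × Body p →L[ℝ] ℂ :=
  (Complex.ofRealCLM ∘L LinearMap.toContinuousLinearMap
    (c • ((omegaLin p a.1) ∘ₗ LinearMap.snd ℝ _ _ + ((omegaLin p).flip a.2) ∘ₗ LinearMap.fst ℝ _ _)))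

theorem tau_apply (c : ℝ) (a q : Body p × Body p) :
    tau c a q = ((c * (omegaBody a.1 q.2 + omegaBody q.1 a.2) : ℝ) : ℂ) := rfl

theorem tau_comm (c : ℝ) (a b : Body p × Body p) : tau c a b = tau c b a := by
  simp only [tau_apply]; congr 2; ring

/-- The standard basis of `ℝ^m × ℝ^m`. -/
def bas : EvenIdx p ⊕ EvenIdx p → Body p × Body p :=
  Sum.elim (fun i => (EuclideanSpace.single i 1, 0)) (fun i => (0, EuclideanSpace.single i 1))

theorem omegaBody_single_inl (i : Fin p) (v : Body p) :
    omegaBody (EuclideanSpace.single (Sum.inl i) 1) v = v (Sum.inr i) := by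
  simp [omegaBody]

theorem omegaBody_single_inr (i : Fin p) (v : Body p) :
    omegaBody (EuclideanSpace.single (Sum.inr i) 1) v = - v (Sum.inl i) := by
  simp [omegaBody]

theorem sum_tau_sq (c : ℝ) (q : Body p × Body p) :
    ∑ a, tau c (bas a) q ^ 2 = ((c ^ 2 * (‖q.1‖ ^ 2 + ‖q.2‖ ^ 2) : ℝ) : ℂ) := by
  have key : ∀ v : Body p, ∑ i, (omegaBody (EuclideanSpace.single i 1) v) ^ 2 = ‖v‖ ^ 2 := by
    intro v
    rw [EuclideanSpace.norm_sq_eq, Fintype.sum_sum_type, Fintype.sum_sum_type, add_comm]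
    simp [omegaBody_single_inl, omegaBody_single_inr]
  rw [Fintype.sum_sum_type, ← key q.1, ← key q.2]
  simp only [bas, Sum.elim_inl, Sum.elim_inr, tau_apply, omegaBody_zero_left, omegaBody_zero_right,
    add_zero, zero_add]
  push_cast
  rw [mul_add, Finset.mul_sum, Finset.mul_sum, add_comm]
  congr 1
  · refine Finset.sum_congr rfl fun i _ => ?_
    rw [omegaBody_swap]; push_cast; ring
  · exact Finset.sum_congr rfl fun i _ => by ring

/-- The symbol `1 + c² (|u|² + |v|²)`. -/
def psym (c : ℝ) (q : Body p × Body p) : ℂ := 1 + ∑ a, tau c (bas a) q ^ 2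

theorem psym_eq (c : ℝ) (q : Body p × Body p) :
    psym c q = ((1 + c ^ 2 * (‖q.1‖ ^ 2 + ‖q.2‖ ^ 2) : ℝ) : ℂ) := by
  rw [psym, sum_tau_sq]; push_cast; ring

theorem psym_ne_zero (c : ℝ) (q : Body p × Body p) : psym c q ≠ 0 := by
  rw [psym_eq]
  exact_mod_cast (by positivity : (1 + c ^ 2 * (‖q.1‖ ^ 2 + ‖q.2‖ ^ 2) : ℝ) ≠ 0)

theorem isSym_tau (c : ℝ) (a : Body p × Body p) : IsSym 1 (fun q => tau c a q) := isSym_clm _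

theorem isSym_psym (c : ℝ) : IsSym 2 (psym (p := p) c) := by
  refine ((IsSym.const (1 : ℂ)).mono (by norm_num)).add (IsSym.sum fun a _ => ?_)
  simpa [sq] using (isSym_tau c (bas a)).mul (isSym_tau c (bas a))

theorem contDiff_psym (c : ℝ) : ContDiff ℝ ∞ (psym (p := p) c) := (isSym_psym c).1

theorem pd_psym (c : ℝ) (a : Body p × Body p) :
    pd a (psym c) = fun q => 2 * ∑ b, tau c a (bas b) * tau c (bas b) q := by
  have h : ∀ b : EvenIdx p ⊕ EvenIdx p, ContDiff ℝ ∞ (fun q => tau c (bas b) q ^ 2) :=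
    fun b => ((tau c (bas b)).contDiff).pow 2
  have : psym (p := p) c = fun q => (fun _ => (1 : ℂ)) q + (fun q => ∑ b, tau c (bas b) q ^ 2) q := rfl
  rw [this, pd_add contDiff_const (ContDiff.sum fun b _ => h b), pd_const, pd_sum fun b _ => h b]
  ext q
  simp only [zero_add, Finset.mul_sum]
  refine Finset.sum_congr rfl fun b _ => ?_
  simp only [sq]
  rw [pd_mul (tau c (bas b)).contDiff (tau c (bas b)).contDiff, pd_clm, tau_comm c a]
  ring

theorem isSym_fderiv_psym (c : ℝ) : IsSym 1 (fderiv ℝ (psym (p := p) c)) := by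
  have h : fderiv ℝ (psym (p := p) c)
      = fun q => ∑ b, (2 * tau c (bas b) q) • tau c (bas b) := by
    refine funext fun q => ContinuousLinearMap.ext fun a => ?_
    have := congrFun (pd_psym (p := p) c a) q
    simp only [pd] at this
    rw [this, Finset.mul_sum]
    simp only [FunLike.coe_sum, Finset.sum_apply]
    refine Finset.sum_congr rfl fun b _ => ?_
    rw [tau_comm c a]
    simp [mul_comm, mul_left_comm]
  rw [h]
  refine IsSym.sum fun b _ => ?_
  simpa using ((isSym_tau c (bas b)).const_mul 2).smul (IsSym.const (tau c (bas b)))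

/-- The weight `(1 + c² (|u|² + |v|²))⁻¹`. -/
def wt (c : ℝ) (q : Body p × Body p) : ℂ := (psym c q)⁻¹

theorem contDiff_wt (c : ℝ) : ContDiff ℝ ∞ (wt (p := p) c) :=
  (contDiff_psym c).inv (psym_ne_zero c)

theorem psym_mul_wt (c : ℝ) (q : Body p × Body p) : psym c q * wt c q = 1 :=
  mul_inv_cancel₀ (psym_ne_zero c q)

theorem fderiv_wt (c : ℝ) :
    fderiv ℝ (wt (p := p) c) = fun q => (- (wt c q * wt c q)) • fderiv ℝ (psym c) q := by
  ext1 q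
  have h := ((contDiff_psym (p := p) c).differentiable (by simp) q).hasFDerivAt
  have h2 := (hasDerivAt_inv (psym_ne_zero c q)).comp_hasFDerivAt_of_eq q h rfl
  have h3 : fderiv ℝ (wt (p := p) c) q = _ := h2.fderiv
  rw [h3, wt, ← mul_inv, ← sq]

theorem norm_wt_le {c : ℝ} (hc : c ≠ 0) :
    ∃ C, ∀ q : Body p × Body p, ‖wt c q‖ ≤ C * (1 + ‖q‖) ^ (-2 : ℤ) := by
  have hm : 0 < min 1 (c ^ 2) := lt_min one_pos (by positivity)
  refine ⟨2 / min 1 (c ^ 2), fun q => ?_⟩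
  have hq : 0 < 1 + ‖q‖ := by positivity
  rw [wt, norm_inv, psym_eq, Complex.norm_real, Real.norm_of_nonneg (by positivity), zpow_neg,
    div_mul_eq_mul_div, le_div_iff₀ hm, inv_mul_eq_div, div_le_iff₀ (by positivity)]
  have hmax : ‖q‖ ^ 2 ≤ ‖q.1‖ ^ 2 + ‖q.2‖ ^ 2 := by
    rw [Prod.norm_def]
    rcases max_choice ‖q.1‖ ‖q.2‖ with h | h <;> rw [h] <;> nlinarith [norm_nonneg q.1, norm_nonneg q.2]
  have h1 : min 1 (c ^ 2) * (1 + ‖q‖ ^ 2) ≤ 1 + c ^ 2 * (‖q.1‖ ^ 2 + ‖q.2‖ ^ 2) := by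
    have a1 := min_le_left 1 (c ^ 2)
    have a2 := min_le_right 1 (c ^ 2)
    nlinarith [sq_nonneg ‖q‖, mul_le_mul a2 hmax (sq_nonneg _) (sq_nonneg c)]
  have h3 : (1 + ‖q‖) ^ (2 : ℤ) ≤ 2 * (1 + ‖q‖ ^ 2) := by
    rw [show (2 : ℤ) = ((2 : ℕ) : ℤ) from rfl, zpow_natCast]; nlinarith [sq_nonneg (1 - ‖q‖)]
  have h4 : (0:ℝ) < (1 + ‖q‖) ^ (2 : ℤ) := by positivity
  calc min 1 (c ^ 2) ≤ min 1 (c ^ 2) * (2 * (1 + ‖q‖ ^ 2) * ((1 + ‖q‖) ^ (2 : ℤ))⁻¹) := by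
        refine le_mul_of_one_le_right hm.le ?_
        rw [← div_eq_mul_inv, one_le_div h4]; exact h3
    _ = 2 * ((1 + ‖q‖) ^ (2 : ℤ))⁻¹ * (min 1 (c ^ 2) * (1 + ‖q‖ ^ 2)) := by ring
    _ ≤ _ := by gcongr

/-- By induction on the number of derivatives: `d wt = -wt² d psym`. -/
theorem isSym_wt {c : ℝ} (hc : c ≠ 0) : IsSym (-2) (wt (p := p) c) := by
  refine ⟨contDiff_wt c, fun K => ?_⟩
  induction K with
  | zero =>
    obtain ⟨C, hC⟩ := norm_wt_le (p := p) hc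
    refine ⟨C, fun i hi q => ?_⟩
    obtain rfl : i = 0 := by omega
    simpa using hC q
  | succ K ih =>
    obtain ⟨C, hC⟩ := ih
    obtain ⟨C1, hC1⟩ := (isSym_fderiv_psym (p := p) c).2 K
    have h2 := SymBound.smul (contDiff_wt c) (contDiff_wt c) hC hC
    simp only [smul_eq_mul] at h2
    have h2n : SymBound K (-2 + -2) (2 ^ K * (C * C)) fun q : Body p × Body p => -(wt c q * wt c q) := by
      intro i hi q
      have : iteratedFDeriv ℝ i (fun q : Body p × Body p => -(wt c q * wt c q)) q
        = - iteratedFDeriv ℝ i (fun q => (wt c q * wt c q)) q := iteratedFDeriv_neg_apply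
      rw [this, norm_neg]
      exact h2 i hi q
    have h3 := SymBound.smul ((contDiff_wt c).mul (contDiff_wt c)).neg
      (isSym_fderiv_psym (p := p) c).1 h2n hC1
    rw [← fderiv_wt] at h3
    have h4 := h3.mono le_rfl (show _ ≤ (-2 : ℤ) by norm_num) le_rfl
    refine ⟨max C (2 ^ K * (2 ^ K * (C * C) * C1)), fun i hi q => ?_⟩
    rcases i with _ | i
    · exact (hC 0 (by omega) q).trans (by gcongr; exact le_max_left _ _)
    · rw [← norm_iteratedFDeriv_fderiv]
      exact (h4 i (by omega) q).trans (by gcongr; exact le_max_right _ _)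

/-- The Laplacian on `ℝ^m × ℝ^m`. -/
def lap (G : Body p × Body p → ℂ) : Body p × Body p → ℂ :=
  fun q => ∑ a, pd (bas a) (pd (bas a) G) q

theorem laplacian_eq_sum {f : Body p → ℂ} (hf : ContDiff ℝ ∞ f) (x : Body p) :
    Laplacian.laplacian f x
      = ∑ i, pd (EuclideanSpace.single i (1 : ℝ)) (pd (EuclideanSpace.single i (1 : ℝ)) f) x := by
  rw [InnerProductSpace.laplacian_eq_iteratedFDeriv_orthonormalBasis f
    (EuclideanSpace.basisFun (EvenIdx p) ℝ)]
  refine Finset.sum_congr rfl fun i _ => ?_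
  rw [iteratedFDeriv_two_apply]
  simp only [EuclideanSpace.basisFun_apply, Matrix.cons_val_zero, Matrix.cons_val_one]
  have hd : DifferentiableAt ℝ (fderiv ℝ f) x := (contDiff_fderiv hf).differentiable (by simp) x
  have := hd.hasFDerivAt.clm_apply (hasFDerivAt_const (EuclideanSpace.single i (1 : ℝ)) x)
  change _ = fderiv ℝ (fun y => fderiv ℝ f y _) x _
  rw [this.fderiv]
  simp

theorem oscOp_eq (c : ℝ) {F : Body p × Body p → ℂ} (hF : ContDiff ℝ ∞ F) :
    oscOp c F = fun q => wt c q * F q - lap (fun r => wt c r * F r) q := by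
  have hG : ContDiff ℝ ∞ (fun r => wt c r * F r) := (contDiff_wt c).mul hF
  have e : ∀ r : Body p × Body p,
      F r / ((1 + c ^ 2 * (‖r.1‖ ^ 2 + ‖r.2‖ ^ 2) : ℝ) : ℂ) = wt c r * F r := by
    intro r; rw [wt, psym_eq, div_eq_mul_inv, mul_comm]
  ext q
  simp only [oscOp, e, lap]
  set G := fun r => wt c r * F r
  have h1 : ContDiff ℝ ∞ (fun u => G (u, q.2)) := hG.comp (contDiff_id.prodMk contDiff_const)
  have h2 : ContDiff ℝ ∞ (fun v => G (q.1, v)) := hG.comp (contDiff_const.prodMk contDiff_id)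
  have k1 : ∀ (H : Body p × Body p → ℂ), ContDiff ℝ ∞ H → ∀ a : Body p,
      pd a (fun u => H (u, q.2)) = fun u => pd (a, (0 : Body p)) H (u, q.2) := by
    intro H hH a
    have := pd_comp_affine hH (ContinuousLinearMap.inl ℝ (Body p) (Body p)) (0, q.2) a
    simpa using this
  have k2 : ∀ (H : Body p × Body p → ℂ), ContDiff ℝ ∞ H → ∀ a : Body p,
      pd a (fun v => H (q.1, v)) = fun v => pd ((0 : Body p), a) H (q.1, v) := by
    intro H hH a
    have := pd_comp_affine hH (ContinuousLinearMap.inr ℝ (Body p) (Body p)) (q.1, 0) a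
    simpa using this
  rw [laplacian_eq_sum h1, laplacian_eq_sum h2, sub_sub,
    Fintype.sum_sum_type (f := fun a => pd (bas a) (pd (bas a) G) q)]
  simp only [bas, Sum.elim_inl, Sum.elim_inr]
  refine congrArg₂ _ rfl (congrArg₂ _ ?_ ?_)
  · refine Finset.sum_congr rfl fun i _ => ?_
    rw [k1 G hG, k1 _ (contDiff_pd hG _)]
  · refine Finset.sum_congr rfl fun i _ => ?_
    rw [k2 G hG, k2 _ (contDiff_pd hG _)]

/-- The operator `O` lowers the order of a symbol by two, with bounds linear in those of the
symbol. -/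
theorem SymBound.osc {c : ℝ} (hc : c ≠ 0) (K : ℕ) : ∃ A, 0 ≤ A ∧ ∀ (N : ℤ) (B : ℝ)
    (F : Body p × Body p → ℂ), ContDiff ℝ ∞ F → SymBound (K + 2) N B F →
      SymBound K (N - 2) (A * B) (oscOp c F) := by
  obtain ⟨C, hC⟩ := (isSym_wt (p := p) hc).2 (K + 2)
  refine ⟨(2 ^ (K + 2) * C) * (1 + ∑ a : EvenIdx p ⊕ EvenIdx p, ‖bas a‖ * ‖bas a‖), ?_,
    fun N B F hF h => ?_⟩
  · have := hC.nonneg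
    positivity
  have hG : ContDiff ℝ ∞ (fun r => wt c r * F r) := (contDiff_wt c).mul hF
  have h1 : SymBound (K + 2) (N - 2) (2 ^ (K + 2) * (C * B)) (fun r => wt c r * F r) := by
    have := SymBound.smul (contDiff_wt c) hF hC h
    rwa [show (-2 + N : ℤ) = N - 2 by ring] at this
  have hl : ∀ s : Finset (EvenIdx p ⊕ EvenIdx p), SymBound K (N - 2)
      (2 ^ (K + 2) * (C * B) * ∑ a ∈ s, ‖bas a‖ * ‖bas a‖)
      (fun q => ∑ a ∈ s, - pd (bas a) (pd (bas a) (fun r => wt c r * F r)) q) := by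
    intro s
    induction s using Finset.induction_on with
    | empty =>
      intro i _ q
      simp only [Finset.sum_empty, mul_zero, zero_mul]
      rcases i with _ | i
      · simp
      · rw [iteratedFDeriv_succ_const]; simp
    | insert a s ha ih =>
      simp only [Finset.sum_insert ha, mul_add]
      have e2 := (h1.partialDeriv hG (bas a)).partialDeriv (contDiff_pd hG _) (bas a)
      refine SymBound.add (contDiff_pd (contDiff_pd hG _) _).neg
        (ContDiff.sum fun b _ => (contDiff_pd (contDiff_pd hG _) _).neg) ?_ ih
      intro i hi q
      have : iteratedFDeriv ℝ i (fun q => - pd (bas a) (pd (bas a) (fun r => wt c r * F r)) q) q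
        = - iteratedFDeriv ℝ i (pd (bas a) (pd (bas a) (fun r => wt c r * F r))) q :=
          iteratedFDeriv_neg_apply
      rw [this, norm_neg]
      refine (e2 i hi q).trans (le_of_eq ?_)
      ring
  have := SymBound.add hG (ContDiff.sum fun b _ => (contDiff_pd (contDiff_pd hG _) _).neg)
    (h1.mono (show K ≤ K + 2 by omega) le_rfl le_rfl) (hl Finset.univ)
  have e : oscOp c F = fun q => (fun r => wt c r * F r) q +
      ∑ a, - pd (bas a) (pd (bas a) (fun r => wt c r * F r)) q := by
    rw [oscOp_eq c hF]
    ext q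
    simp only [lap, Finset.sum_neg_distrib, sub_eq_add_neg]
  rw [e]
  refine this.mono le_rfl le_rfl (le_of_eq ?_)
  ring

theorem contDiff_lap {G : Body p × Body p → ℂ} (hG : ContDiff ℝ ∞ G) : ContDiff ℝ ∞ (lap G) :=
  ContDiff.sum fun _ _ => contDiff_pd (contDiff_pd hG _) _

theorem contDiff_oscOp (c : ℝ) {F : Body p × Body p → ℂ} (hF : ContDiff ℝ ∞ F) :
    ContDiff ℝ ∞ (oscOp c F) := by
  rw [oscOp_eq c hF]
  exact ((contDiff_wt c).mul hF).sub (contDiff_lap ((contDiff_wt c).mul hF))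

theorem IsSym.osc {c : ℝ} (hc : c ≠ 0) {N : ℤ} {F : Body p × Body p → ℂ} (h : IsSym N F) :
    IsSym (N - 2) (oscOp c F) := by
  refine ⟨contDiff_oscOp c h.1, fun K => ?_⟩
  obtain ⟨A, _, hA⟩ := SymBound.osc (p := p) hc K
  obtain ⟨C, hC⟩ := h.2 (K + 2)
  exact ⟨_, hA N C F h.1 hC⟩

theorem IsSym.osc_iterate {c : ℝ} (hc : c ≠ 0) {N : ℤ} {F : Body p × Body p → ℂ}
    (h : IsSym N F) (k : ℕ) : IsSym (N - 2 * k) ((oscOp c)^[k] F) := by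
  induction k with
  | zero => simpa using h
  | succ k ih =>
    rw [Function.iterate_succ_apply']
    have := ih.osc hc
    rwa [show N - 2 * (k : ℤ) - 2 = N - 2 * ((k + 1 : ℕ) : ℤ) by push_cast; ring] at this

theorem SymBound.osc_iterate {c : ℝ} (hc : c ≠ 0) (K k : ℕ) : ∃ A, 0 ≤ A ∧ ∀ (N : ℤ) (B : ℝ)
    (F : Body p × Body p → ℂ), ContDiff ℝ ∞ F → SymBound (K + 2 * k) N B F →
      SymBound K (N - 2 * k) (A * B) ((oscOp c)^[k] F) := by
  induction k with
  | zero => exact ⟨1, zero_le_one, fun N B F _ h => by simpa using h⟩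
  | succ k ih =>
    obtain ⟨A, hA0, hA⟩ := ih
    obtain ⟨A', hA0', hA'⟩ := SymBound.osc (p := p) hc (K + 2 * k)
    refine ⟨A * A', by positivity, fun N B F hF h => ?_⟩
    have h1 := hA' N B F hF h
    have h2 := hA _ _ _ (contDiff_oscOp c hF) h1
    rw [Function.iterate_succ_apply, mul_assoc]
    rwa [show N - 2 - 2 * (k : ℤ) = N - 2 * ((k + 1 : ℕ) : ℤ) by push_cast; ring] at h2

end Osc


/-! ### Oscillating integrals of symbols -/

section OscInt

open MeasureTheory Filter Topology

variable {p : ℕ}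

/-- The phase factor `exp(i c ω₀(u, v))`. -/
def eph (c : ℝ) (q : Body p × Body p) : ℂ :=
  Complex.exp (Complex.I * ((c * omegaBody q.1 q.2 : ℝ) : ℂ))

theorem norm_eph (c : ℝ) (q : Body p × Body p) : ‖eph c q‖ = 1 := by
  rw [eph, mul_comm, Complex.norm_exp_ofReal_mul_I]

theorem hasFDerivAt_omega (c : ℝ) (q : Body p × Body p) :
    HasFDerivAt (fun q : Body p × Body p => ((c * omegaBody q.1 q.2 : ℝ) : ℂ)) (tau c q) q := by
  have hB := (((omegaLin p).toContinuousBilinearMap).isBoundedBilinearMap).hasFDerivAt q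
  have h2 : HasFDerivAt (fun q : Body p × Body p => omegaBody q.1 q.2) _ q := hB
  have h3 := Complex.ofRealCLM.hasFDerivAt.comp q (h2.const_mul c)
  refine h3.congr_fderiv ?_
  ext a
  · simp [tau_apply, omegaLin_apply, omegaBody_zero_right]
  · simp [tau_apply, omegaLin_apply, omegaBody_zero_left]

theorem hasFDerivAt_eph (c : ℝ) (q : Body p × Body p) :
    HasFDerivAt (eph c) ((Complex.I * eph c q) • tau c q) q := by
  have h1 := ((hasFDerivAt_omega c q).const_mul Complex.I).cexp
  refine h1.congr_fderiv ?_
  rw [smul_smul, mul_comm]; rfl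

theorem pd_eph (c : ℝ) (a : Body p × Body p) :
    pd a (eph c) = fun q => Complex.I * tau c a q * eph c q := by
  ext q
  simp only [pd, (hasFDerivAt_eph c q).fderiv, smul_apply, smul_eq_mul]
  rw [tau_comm]; ring

theorem contDiff_eph (c : ℝ) : ContDiff ℝ ∞ (eph (p := p) c) := by
  have h : ContDiff ℝ ∞ (fun q : Body p × Body p => ((c * omegaBody q.1 q.2 : ℝ) : ℂ)) := by
    have hB := (((omegaLin p).toContinuousBilinearMap).isBoundedBilinearMap).contDiff (n := ∞)
    have h2 : ContDiff ℝ ∞ (fun q : Body p × Body p => omegaBody q.1 q.2) := hB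
    exact Complex.ofRealCLM.contDiff.comp (contDiff_const.mul h2)
  exact (contDiff_const.mul h).cexp

/-- The derivative in the direction `a`, conjugated by the phase factor. -/
def DD (c : ℝ) (a : Body p × Body p) (F : Body p × Body p → ℂ) : Body p × Body p → ℂ :=
  fun q => pd a F q + Complex.I * tau c a q * F q

theorem IsSym.DD {N : ℤ} {F : Body p × Body p → ℂ} (h : IsSym N F) (c : ℝ)
    (a : Body p × Body p) : IsSym (N + 1) (DD c a F) := by
  refine ((h.partialDeriv a).mono (by omega)).add ?_
  have := ((isSym_tau c a).const_mul Complex.I).mul h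
  rwa [add_comm] at this

instance instIsAddHaarMeasureBodyProd :
    (volume : Measure (Body p × Body p)).IsAddHaarMeasure :=
  Measure.prod.instIsAddHaarMeasure _ _

/-- The dimension of `ℝ^m × ℝ^m`. -/
abbrev dimE (p : ℕ) : ℕ := Module.finrank ℝ (Body p × Body p)

theorem integrable_eph_mul {c : ℝ} {N : ℤ} {F : Body p × Body p → ℂ} (h : IsSym N F)
    (hN : N ≤ -(dimE p + 1 : ℤ)) : Integrable (fun q => eph c q * F q) := by
  have := h.integrable (μ := volume) hN
  refine this.bdd_mul (c := 1) (contDiff_eph c).continuous.aestronglyMeasurable ?_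
  exact Filter.Eventually.of_forall fun q => (norm_eph c q).le

theorem integral_eph_mul_DD {c : ℝ} {N : ℤ} {F : Body p × Body p → ℂ} (h : IsSym N F)
    (hN : N + 1 ≤ -(dimE p + 1 : ℤ)) (a : Body p × Body p) :
    ∫ q, eph c q * DD c a F q = 0 := by
  have h1 : Integrable (fun q => eph c q * pd a F q) :=
    integrable_eph_mul (h.partialDeriv a) (by omega)
  have h2 : Integrable (fun q => pd a (eph c) q * F q) := by
    have h3 := integrable_eph_mul (c := c) (((isSym_tau c a).const_mul Complex.I).mul h)
      (by omega)
    refine h3.congr (Filter.Eventually.of_forall fun q => ?_)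
    simp only [pd_eph]; ring
  have key := integral_mul_fderiv_eq_neg_fderiv_mul_of_integrable (v := a) (f := eph c) (g := F)
    (μ := volume) h2 h1 (integrable_eph_mul h (by omega))
    (fun x _ => (contDiff_eph c).differentiable (by simp) x)
    (fun x _ => h.1.differentiable (by simp) x)
  have e : ∀ q, eph c q * DD c a F q = eph c q * pd a F q + pd a (eph c) q * F q := by
    intro q; simp only [DD, pd_eph]; ring
  simp only [e]
  rw [integral_add h1 h2]
  change (∫ q, eph c q * fderiv ℝ F q a) + ∫ q, fderiv ℝ (eph c) q a * F q = 0
  rw [key]; ring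

/-- The transpose relation: `O F - F` is a sum of conjugated derivatives. -/
theorem oscOp_eq_add_DD (c : ℝ) {F : Body p × Body p → ℂ} (hF : ContDiff ℝ ∞ F) :
    oscOp c F = fun q => F q + ∑ a, DD c (bas a) (fun r =>
      -(pd (bas a) (fun r => wt c r * F r) r - Complex.I * tau c (bas a) r * (wt c r * F r))) q := by
  have hG : ContDiff ℝ ∞ (fun r => wt c r * F r) := (contDiff_wt c).mul hF
  obtain ⟨G, hGdef⟩ : ∃ G, G = fun r => wt c r * F r := ⟨_, rfl⟩
  have hFG : ∀ q, F q = psym c q * G q := fun q => by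
    rw [hGdef]; simp only; rw [← mul_assoc, psym_mul_wt, one_mul]
  rw [oscOp_eq c hF]
  ext q
  have hwG : ∀ r, wt c r * F r = G r := fun r => by rw [hGdef]
  have hG' : ContDiff ℝ ∞ G := hGdef ▸ hG
  simp only [hwG]
  rw [hFG q]
  clear hG hGdef hwG
  rename' hG' => hG
  have e : ∀ a : EvenIdx p ⊕ EvenIdx p, DD c (bas a) (fun r => -(pd (bas a) G r
      - Complex.I * tau c (bas a) r * G r)) q
      = - pd (bas a) (pd (bas a) G) q - tau c (bas a) q ^ 2 * G q := by
    intro a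
    have ht : tau c (bas a) (bas a) = (0 : ℂ) := by
      rcases a with i | i <;> simp [bas, tau_apply, omegaBody_zero_left, omegaBody_zero_right]
    have e1 : (fun r => -(pd (bas a) G r - Complex.I * tau c (bas a) r * G r))
      = fun r => (-1 : ℂ) * pd (bas a) G r + Complex.I * (tau c (bas a) r * G r) := by
      ext r; ring
    have s1 : ContDiff ℝ ∞ (fun r => tau c (bas a) r * G r) := (tau c (bas a)).contDiff.mul hG
    simp only [DD]
    rw [e1, pd_add (contDiff_const.mul (contDiff_pd hG _)) (contDiff_const.mul s1),
      pd_const_mul (contDiff_pd hG _), pd_const_mul s1, pd_mul (tau c (bas a)).contDiff hG, pd_clm, ht]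
    simp only
    linear_combination (-(tau c (bas a) q) ^ 2 * G q) * Complex.I_sq * (-1)
  simp only [e, Finset.sum_sub_distrib, Finset.sum_neg_distrib, lap, psym, add_mul, one_mul,
    Finset.sum_mul]
  ring

/-- The definition of the oscillating integral is consistent: `O` does not change an absolutely
convergent integral. -/
theorem integral_eph_mul_oscOp {c : ℝ} (hc : c ≠ 0) {N : ℤ} {F : Body p × Body p → ℂ}
    (h : IsSym N F) (hN : N ≤ -(dimE p + 1 : ℤ)) :
    ∫ q, eph c q * oscOp c F q = ∫ q, eph c q * F q := by
  have hG : IsSym (N - 2) (fun r => wt c r * F r) := by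
    have := (isSym_wt hc).mul h
    rwa [show (-2 + N : ℤ) = N - 2 by ring] at this
  have hH : ∀ a : EvenIdx p ⊕ EvenIdx p, IsSym (N - 1) (fun r =>
      -(pd (bas a) (fun r => wt c r * F r) r - Complex.I * tau c (bas a) r * (wt c r * F r))) := by
    intro a
    refine (((hG.partialDeriv _).mono (by omega)).sub ?_).neg
    have := ((isSym_tau c (bas a)).const_mul Complex.I).mul hG
    rwa [show 1 + (N - 2) = N - 1 by ring] at this
  rw [oscOp_eq_add_DD c h.1]
  simp only [mul_add, Finset.mul_sum]
  have hi : ∀ a : EvenIdx p ⊕ EvenIdx p, Integrable (fun q => eph c q * DD c (bas a) (fun r =>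
      -(pd (bas a) (fun r => wt c r * F r) r - Complex.I * tau c (bas a) r * (wt c r * F r))) q) :=
    fun a => integrable_eph_mul ((hH a).DD c _) (by omega)
  rw [integral_add (integrable_eph_mul h hN) (integrable_finsetSum _ fun a _ => hi a),
    integral_finsetSum _ fun a _ => hi a,
    Finset.sum_eq_zero fun a _ => integral_eph_mul_DD (hH a) (by omega) _, add_zero]

theorem integral_eph_mul_oscOp_iterate {c : ℝ} (hc : c ≠ 0) {N : ℤ} {F : Body p × Body p → ℂ}
    (h : IsSym N F) (hN : N ≤ -(dimE p + 1 : ℤ)) (k : ℕ) :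
    ∫ q, eph c q * (oscOp c)^[k] F q = ∫ q, eph c q * F q := by
  induction k with
  | zero => rfl
  | succ k ih =>
    rw [Function.iterate_succ_apply', integral_eph_mul_oscOp hc (h.osc_iterate hc k) (by omega), ih]

theorem isOscIntegral_of_isSym {c : ℝ} (hc : c ≠ 0) {N : ℤ} {F : Body p × Body p → ℂ}
    (h : IsSym N F) {k : ℕ} (hk : N - 2 * k ≤ -(dimE p + 1 : ℤ)) :
    IsOscIntegral c F (∫ q, eph c q * (oscOp c)^[k] F q) := by
  filter_upwards [Filter.eventually_ge_atTop k] with j hj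
  obtain ⟨l, rfl⟩ := Nat.exists_eq_add_of_le' hj
  refine ⟨(h.osc_iterate hc (l + k)).integrable
    (show _ ≤ -(dimE p + 1 : ℤ) by push_cast; omega), ?_⟩
  rw [Function.iterate_add_apply]
  exact integral_eph_mul_oscOp_iterate hc (h.osc_iterate hc k) hk l

theorem oscIntegral_eq {c : ℝ} (hc : c ≠ 0) {N : ℤ} {F : Body p × Body p → ℂ}
    (h : IsSym N F) {k : ℕ} (hk : N - 2 * k ≤ -(dimE p + 1 : ℤ)) :
    oscIntegral c F = ∫ q, eph c q * (oscOp c)^[k] F q := by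
  have h1 := isOscIntegral_of_isSym hc h hk
  have h2 : IsOscIntegral c F (oscIntegral c F) := Classical.epsilon_spec ⟨_, h1⟩
  obtain ⟨j, h3, h4⟩ := (h1.and h2).exists
  exact h4.2.symm.trans h3.2

/-- A number of applications of `O` that makes symbols of order `N` integrable. -/
theorem exists_order (p : ℕ) (N : ℤ) : ∃ k : ℕ, N - 2 * k ≤ -(dimE p + 1 : ℤ) :=
  ⟨(N + (dimE p + 1)).toNat, by have := Int.self_le_toNat (N + (dimE p + 1)); omega⟩

theorem oscIntegral_of_decay {c : ℝ} (hc : c ≠ 0) {N : ℤ} {F : Body p × Body p → ℂ}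
    (h : IsSym N F) (hN : N ≤ -(dimE p + 1 : ℤ)) :
    oscIntegral c F = ∫ q, eph c q * F q :=
  oscIntegral_eq hc h (k := 0) (by simpa using hN)

theorem oscOp_add (c : ℝ) {F G : Body p × Body p → ℂ} (hF : ContDiff ℝ ∞ F)
    (hG : ContDiff ℝ ∞ G) :
    oscOp c (fun q => F q + G q) = fun q => oscOp c F q + oscOp c G q := by
  rw [oscOp_eq c hF, oscOp_eq c hG, oscOp_eq c (hF.add hG)]
  have h1 := (contDiff_wt (p := p) c).mul hF
  have h2 := (contDiff_wt (p := p) c).mul hG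
  ext q
  simp only [lap, mul_add]
  have : ∀ a : EvenIdx p ⊕ EvenIdx p, pd (bas a) (pd (bas a) (fun r => wt c r * F r + wt c r * G r)) q
    = pd (bas a) (pd (bas a) (fun r => wt c r * F r)) q +
      pd (bas a) (pd (bas a) (fun r => wt c r * G r)) q := by
    intro a
    rw [pd_add h1 h2, pd_add (contDiff_pd h1 _) (contDiff_pd h2 _)]
  simp only [this, Finset.sum_add_distrib]
  ring

theorem oscOp_const_mul (c : ℝ) (r : ℂ) {F : Body p × Body p → ℂ} (hF : ContDiff ℝ ∞ F) :
    oscOp c (fun q => r * F q) = fun q => r * oscOp c F q := by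
  rw [oscOp_eq c hF, oscOp_eq c (contDiff_const.mul hF)]
  have h1 := (contDiff_wt (p := p) c).mul hF
  ext q
  simp only [lap, mul_left_comm _ r]
  have : ∀ a : EvenIdx p ⊕ EvenIdx p, pd (bas a) (pd (bas a) (fun s => r * (wt c s * F s))) q
    = r * pd (bas a) (pd (bas a) (fun s => wt c s * F s)) q := by
    intro a
    rw [pd_const_mul h1, pd_const_mul (contDiff_pd h1 _)]
  simp only [this, mul_sub, Finset.mul_sum]

theorem contDiff_oscOp_iterate (c : ℝ) {F : Body p × Body p → ℂ} (hF : ContDiff ℝ ∞ F) (k : ℕ) :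
    ContDiff ℝ ∞ ((oscOp c)^[k] F) := by
  induction k with
  | zero => exact hF
  | succ k ih => rw [Function.iterate_succ_apply']; exact contDiff_oscOp c ih

theorem oscOp_iterate_add (c : ℝ) {F G : Body p × Body p → ℂ} (hF : ContDiff ℝ ∞ F)
    (hG : ContDiff ℝ ∞ G) (k : ℕ) :
    (oscOp c)^[k] (fun q => F q + G q) = fun q => (oscOp c)^[k] F q + (oscOp c)^[k] G q := by
  induction k with
  | zero => rfl
  | succ k ih =>
    simp only [Function.iterate_succ_apply']
    rw [ih, oscOp_add c (contDiff_oscOp_iterate c hF k) (contDiff_oscOp_iterate c hG k)]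

theorem oscOp_iterate_const_mul (c : ℝ) (r : ℂ) {F : Body p × Body p → ℂ} (hF : ContDiff ℝ ∞ F)
    (k : ℕ) : (oscOp c)^[k] (fun q => r * F q) = fun q => r * (oscOp c)^[k] F q := by
  induction k with
  | zero => rfl
  | succ k ih =>
    simp only [Function.iterate_succ_apply']
    rw [ih, oscOp_const_mul c r (contDiff_oscOp_iterate c hF k)]

theorem oscIntegral_add {c : ℝ} (hc : c ≠ 0) {N M : ℤ} {F G : Body p × Body p → ℂ}
    (hF : IsSym N F) (hG : IsSym M G) :
    oscIntegral c (fun q => F q + G q) = oscIntegral c F + oscIntegral c G := by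
  have hF' := hF.mono (le_max_left N M)
  have hG' := hG.mono (le_max_right N M)
  obtain ⟨k, hk⟩ := exists_order p (max N M)
  rw [oscIntegral_eq hc (hF'.add hG') hk, oscIntegral_eq hc hF' hk, oscIntegral_eq hc hG' hk,
    oscOp_iterate_add c hF.1 hG.1, ← integral_add (integrable_eph_mul (hF'.osc_iterate hc k) hk)
      (integrable_eph_mul (hG'.osc_iterate hc k) hk)]
  simp only [mul_add]

theorem oscIntegral_const_mul {c : ℝ} (hc : c ≠ 0) {N : ℤ} {F : Body p × Body p → ℂ}
    (hF : IsSym N F) (r : ℂ) :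
    oscIntegral c (fun q => r * F q) = r * oscIntegral c F := by
  obtain ⟨k, hk⟩ := exists_order p N
  rw [oscIntegral_eq hc (hF.const_mul r) hk, oscIntegral_eq hc hF hk,
    oscOp_iterate_const_mul c r hF.1, ← integral_const_mul]
  simp only [mul_left_comm]

theorem oscIntegral_zero {c : ℝ} (hc : c ≠ 0) :
    oscIntegral c (fun _ : Body p × Body p => (0 : ℂ)) = 0 := by
  have := oscIntegral_const_mul hc (IsSym.zero (X := Body p × Body p) (F := ℂ) 0) 0
  simpa using this

/-- Oscillating integrals are bounded by finitely many symbol seminorms. -/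
theorem norm_oscIntegral_le {c : ℝ} (hc : c ≠ 0) (N : ℤ) : ∃ (K : ℕ) (A : ℝ), 0 ≤ A ∧
    ∀ (F : Body p × Body p → ℂ) (B : ℝ), IsSym N F → SymBound K N B F →
      ‖oscIntegral c F‖ ≤ A * B := by
  obtain ⟨k, hk⟩ := exists_order p N
  obtain ⟨A, hA0, hA⟩ := SymBound.osc_iterate (p := p) hc 0 k
  have hint : Integrable (fun q : Body p × Body p => (1 + ‖q‖) ^ (N - 2 * k : ℤ)) := by
    refine integrable_of_bound (C := 1) hk ?_ fun q => ?_
    · exact Continuous.zpow₀ (by fun_prop) _ fun q => Or.inl (by positivity)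
    · rw [Real.norm_of_nonneg (by positivity), one_mul]
  refine ⟨0 + 2 * k, A * ∫ q : Body p × Body p, (1 + ‖q‖) ^ (N - 2 * k : ℤ),
    mul_nonneg hA0 (integral_nonneg fun q => by positivity), fun F B hF hB => ?_⟩
  rw [oscIntegral_eq hc hF hk]
  have h1 := hA N B F hF.1 hB 0 le_rfl
  refine (norm_integral_le_of_norm_le (hint.const_mul (A * B))
    (Filter.Eventually.of_forall fun q => ?_)).trans (le_of_eq ?_)
  · rw [norm_mul, norm_eph, one_mul]
    simpa using h1 q
  · rw [integral_const_mul]; ring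

theorem oscIntegral_sub {c : ℝ} (hc : c ≠ 0) {N M : ℤ} {F G : Body p × Body p → ℂ}
    (hF : IsSym N F) (hG : IsSym M G) :
    oscIntegral c (fun q => F q - G q) = oscIntegral c F - oscIntegral c G := by
  have h := oscIntegral_add hc hF (hG.const_mul (-1))
  rw [oscIntegral_const_mul hc hG] at h
  simp only [neg_one_mul, ← sub_eq_add_neg] at h
  exact h

/-- Oscillating integrals may be computed as limits of cut-offs. -/
theorem tendsto_oscIntegral_cutoff {c : ℝ} (hc : c ≠ 0) {χ : Body p × Body p → ℂ}
    (hχ : IsSym 0 χ) {N : ℤ} {Φ : Body p × Body p → ℂ} (hΦ : IsSym N Φ) :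
    Tendsto (fun ε : ℝ => oscIntegral c fun q => χ (ε • q) * Φ q) (𝓝[>] 0)
      (𝓝 (χ 0 * oscIntegral c Φ)) := by
  obtain ⟨K, A, hA, hbd⟩ := norm_oscIntegral_le (p := p) hc (1 + N)
  obtain ⟨C, hC⟩ := hχ.dilation K
  obtain ⟨D, hD⟩ := hΦ.2 K
  rw [tendsto_iff_norm_sub_tendsto_zero]
  have hlim : Tendsto (fun ε : ℝ => A * (2 ^ K * (C * ε * D))) (𝓝[>] 0) (𝓝 0) := by
    have : Tendsto (fun ε : ℝ => A * (2 ^ K * (C * ε * D))) (𝓝 0)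
        (𝓝 (A * (2 ^ K * (C * 0 * D)))) := Continuous.tendsto (by fun_prop) 0
    simp only [mul_zero, zero_mul] at this
    exact this.mono_left nhdsWithin_le_nhds
  refine squeeze_zero' (Eventually.of_forall fun _ => norm_nonneg _) ?_ hlim
  filter_upwards [Ioc_mem_nhdsGT (zero_lt_one (α := ℝ))] with ε hε
  have hsm : IsSym 0 (fun q : Body p × Body p => χ (ε • q)) := by
    simpa using hχ.comp_affine (N := 0) (ε • ContinuousLinearMap.id ℝ (Body p × Body p)) 0
  have h1 : IsSym 1 (fun q : Body p × Body p => χ (ε • q) - χ 0) :=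
    (hsm.sub (IsSym.const (χ 0))).mono (by norm_num)
  have h2 := SymBound.smul h1.1 hΦ.1 (hC ε hε.1 hε.2) hD
  have h3 := hbd _ _ (h1.mul hΦ) h2
  have e : oscIntegral c (fun q => (χ (ε • q) - χ 0) * Φ q)
      = (oscIntegral c fun q => χ (ε • q) * Φ q) - χ 0 * oscIntegral c Φ := by
    rw [← oscIntegral_const_mul hc hΦ, ← oscIntegral_sub hc (hsm.mul hΦ) (hΦ.const_mul (χ 0))]
    simp only [sub_mul]
  rw [← e]
  exact h3

theorem isSym_cutoff {χ F : Body p × Body p → ℂ} (hχ : ContDiff ℝ ∞ χ) (hs : HasCompactSupport χ)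
    (hF : ContDiff ℝ ∞ F) {ε : ℝ} (hε : ε ≠ 0) (N : ℤ) : IsSym N fun q => χ (ε • q) * F q :=
  isSym_of_hasCompactSupport ((hχ.comp (contDiff_const_smul ε)).mul hF)
    ((hs.comp_homeomorph (Homeomorph.smulOfNeZero ε hε)).mul_right) N

/-- Conjugated derivatives have vanishing oscillating integrals. -/
theorem oscIntegral_DD {c : ℝ} (hc : c ≠ 0) {N : ℤ} {F : Body p × Body p → ℂ}
    (h : IsSym N F) (a : Body p × Body p) : oscIntegral c (DD c a F) = 0 := by
  obtain ⟨χ, hχ, hs, h1⟩ := exists_bump (Body p × Body p)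
  have hS := isSym_of_hasCompactSupport hχ hs 0
  have t1 := tendsto_oscIntegral_cutoff hc hS (h.DD c a)
  have t2 := ((Complex.continuous_ofReal.tendsto 0).mono_left nhdsWithin_le_nhds).mul
    (tendsto_oscIntegral_cutoff hc (hS.partialDeriv a) h)
  have t3 := t1.add t2
  rw [h1, one_mul, Complex.ofReal_zero, zero_mul, add_zero] at t3
  refine tendsto_nhds_unique t3 (tendsto_const_nhds.congr' ?_)
  filter_upwards [self_mem_nhdsWithin] with ε hε
  have hε : ε ≠ 0 := ne_of_gt hε
  have e : DD c a (fun q => χ (ε • q) * F q)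
      = fun q => χ (ε • q) * DD c a F q + ε * (pd a χ (ε • q) * F q) := by
    have e1 := pd_comp_affine hχ (ε • ContinuousLinearMap.id ℝ (Body p × Body p)) 0 a
    simp only [smul_apply, ContinuousLinearMap.id_apply, add_zero, pd_smul_dir] at e1
    have e2 : ContDiff ℝ ∞ fun q => χ (ε • q) := hχ.comp (contDiff_const_smul ε)
    ext q
    simp only [DD]
    rw [pd_mul e2 h.1, e1]
    simp only [Complex.real_smul]
    ring
  have i1 := (isSym_cutoff hχ hs h.1 hε (-(dimE p + 2))).DD c a
  rw [← oscIntegral_const_mul hc (isSym_cutoff (contDiff_pd hχ a)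
      (hs.fderiv_apply (𝕜 := ℝ) a) h.1 hε 0), ← oscIntegral_add hc (isSym_cutoff hχ hs (h.DD c a).1 hε 0)
    ((isSym_cutoff (contDiff_pd hχ a) (hs.fderiv_apply (𝕜 := ℝ) a) h.1 hε 0).const_mul _), ← e,
    oscIntegral_of_decay hc i1 (by omega),
    integral_eph_mul_DD (isSym_cutoff hχ hs h.1 hε (-(dimE p + 2))) (by omega)]

/-- A linear change of variables in an oscillating integral. -/
theorem oscIntegral_comp {c c' : ℝ} (hc : c ≠ 0) (hc' : c' ≠ 0)
    (B : (Body p × Body p) ≃L[ℝ] (Body p × Body p)) (hB : MeasurePreserving B volume volume)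
    (hphase : ∀ q, eph c (B q) = eph c' q) {N : ℕ} {F : Body p × Body p → ℂ} (hF : IsSym N F) :
    oscIntegral c' (fun q => F (B q)) = oscIntegral c F := by
  obtain ⟨χ, hχ, hs, h1⟩ := exists_bump (Body p × Body p)
  have hcomp : ∀ {M : ℕ} {H : Body p × Body p → ℂ}, IsSym M H → IsSym M fun q => H (B q) :=
    fun h => by simpa using h.comp_affine (B : (Body p × Body p) →L[ℝ] (Body p × Body p)) 0
  have hS : IsSym (0 : ℕ) χ := isSym_of_hasCompactSupport hχ hs 0
  have t1 := tendsto_oscIntegral_cutoff hc hS hF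
  have t2 := tendsto_oscIntegral_cutoff hc' (hcomp hS) (hcomp hF)
  rw [map_zero, h1, one_mul] at t2
  rw [h1, one_mul] at t1
  refine tendsto_nhds_unique t2 (t1.congr' ?_)
  filter_upwards [self_mem_nhdsWithin] with ε hε
  have hε : ε ≠ 0 := ne_of_gt hε
  have hd := oscIntegral_of_decay hc' (isSym_cutoff (hχ.comp B.contDiff)
    (hs.comp_homeomorph B.toHomeomorph) (hcomp hF).1 hε _) le_rfl
  simp only [Function.comp_apply] at hd
  rw [oscIntegral_of_decay hc (isSym_cutoff hχ hs hF.1 hε _) le_rfl, hd, ← hB.integral_comp B.toHomeomorph.measurableEmbedding]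
  simp only [hphase, map_smul]

end OscInt


/-! ### The even star-product -/

section EvenStar

open MeasureTheory

variable {p : ℕ}

/-- Smooth functions of polynomial growth on the body, of an order common to all derivatives. -/
def PolyB (f : Body p → ℂ) : Prop := ∃ N : ℕ, IsSym N f

theorem PolyB.smooth {f : Body p → ℂ} (h : PolyB f) : ContDiff ℝ ∞ f := h.choose_spec.1

theorem polyB_iff {f : Body p → ℂ} : PolyB f ↔ ContDiff ℝ ∞ f ∧ ∃ N : ℕ, ∀ k : ℕ, ∃ C : ℝ, ∀ x,
    ‖iteratedFDeriv ℝ k f x‖ ≤ C * (1 + ‖x‖) ^ N := by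
  constructor
  · rintro ⟨N, h, h'⟩
    refine ⟨h, N, fun k => ?_⟩
    obtain ⟨C, hC⟩ := h' k
    exact ⟨C, fun x => by simpa using hC k le_rfl x⟩
  · rintro ⟨h, N, h'⟩
    exact ⟨N, isSym_of_forall h fun i => by simpa using h' i⟩

theorem PolyB.add {f g : Body p → ℂ} (hf : PolyB f) (hg : PolyB g) :
    PolyB (fun x => f x + g x) := by
  obtain ⟨N, hN⟩ := hf
  obtain ⟨M, hM⟩ := hg
  exact ⟨N + M, (hN.mono (by push_cast; omega)).add (hM.mono (by push_cast; omega))⟩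

theorem PolyB.mul {f g : Body p → ℂ} (hf : PolyB f) (hg : PolyB g) :
    PolyB (fun x => f x * g x) := by
  obtain ⟨N, hN⟩ := hf
  obtain ⟨M, hM⟩ := hg
  exact ⟨N + M, by simpa using hN.mul hM⟩

theorem PolyB.const (c : ℂ) : PolyB (fun _ : Body p => c) := ⟨0, IsSym.const c⟩

theorem PolyB.const_mul {f : Body p → ℂ} (c : ℂ) (hf : PolyB f) : PolyB (fun x => c * f x) :=
  (PolyB.const c).mul hf

theorem PolyB.clm (L : Body p →L[ℝ] ℂ) : PolyB (fun x => L x) := ⟨1, isSym_clm L⟩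

theorem PolyB.partialDeriv {f : Body p → ℂ} (hf : PolyB f) (a : Body p) : PolyB (pd a f) := by
  obtain ⟨N, hN⟩ := hf
  exact ⟨N, hN.partialDeriv a⟩

theorem PolyB.comp_affine {f : Body p → ℂ} (hf : PolyB f) (L : Body p →L[ℝ] Body p) (s : Body p) :
    PolyB (fun x => f (L x + s)) := by
  obtain ⟨N, hN⟩ := hf
  exact ⟨N, hN.comp_affine L s⟩

theorem PolyB.sum {ι : Type*} {s : Finset ι} {f : ι → Body p → ℂ} (h : ∀ i ∈ s, PolyB (f i)) :
    PolyB (fun x => ∑ i ∈ s, f i x) := by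
  classical
  induction s using Finset.induction_on with
  | empty => simpa using PolyB.const 0
  | insert a s ha ih =>
    simp only [Finset.sum_insert ha]
    exact (h a (Finset.mem_insert_self _ _)).add
      (ih fun i hi => h i (Finset.mem_insert_of_mem hi))

theorem isSym_tensor {N M : ℕ} {f g : Body p → ℂ} (hf : IsSym N f) (hg : IsSym M g) (y y' : Body p) :
    IsSym (N + M) (fun q : Body p × Body p => f (y + q.1) * g (y' + q.2)) := by
  have h1 := hf.comp_affine (ContinuousLinearMap.fst ℝ (Body p) (Body p)) y
  have h2 := hg.comp_affine (ContinuousLinearMap.snd ℝ (Body p) (Body p)) y'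
  simpa [add_comm] using h1.mul h2

theorem phase_ne_zero {θ : ℝ} (hθ : θ ≠ 0) : -2 / θ ≠ 0 := div_ne_zero (by norm_num) hθ

theorem evenStar_add_left {θ : ℝ} (hθ : θ ≠ 0) {f f' g : Body p → ℂ} (hf : PolyB f)
    (hf' : PolyB f') (hg : PolyB g) (y : Body p) :
    evenStar θ (fun x => f x + f' x) g y = evenStar θ f g y + evenStar θ f' g y := by
  obtain ⟨N, hN⟩ := hf
  obtain ⟨N', hN'⟩ := hf'
  obtain ⟨M, hM⟩ := hg
  rw [evenStar, evenStar, evenStar, ← oscIntegral_add (phase_ne_zero hθ) (isSym_tensor hN hM y y)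
    (isSym_tensor hN' hM y y)]
  simp only [add_mul]

theorem evenStar_const_mul_left {θ : ℝ} (hθ : θ ≠ 0) {f g : Body p → ℂ} (hf : PolyB f)
    (hg : PolyB g) (r : ℂ) (y : Body p) :
    evenStar θ (fun x => r * f x) g y = r * evenStar θ f g y := by
  obtain ⟨N, hN⟩ := hf
  obtain ⟨M, hM⟩ := hg
  rw [evenStar, evenStar, ← oscIntegral_const_mul (phase_ne_zero hθ) (isSym_tensor hN hM y y)]
  simp only [mul_assoc]

/-- Exchanging the factors of the even star-product amounts to changing the sign of `θ`. -/
theorem evenStar_swap {θ : ℝ} (hθ : θ ≠ 0) {f g : Body p → ℂ} (hf : PolyB f) (hg : PolyB g)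
    (y : Body p) : evenStar θ f g y = evenStar (-θ) g f y := by
  obtain ⟨N, hN⟩ := hf
  obtain ⟨M, hM⟩ := hg
  have hT : IsSym (M + N : ℕ) (fun q : Body p × Body p => g (y + q.1) * f (y + q.2)) := by
    simpa using isSym_tensor hM hN y y
  rw [evenStar, evenStar, ← oscIntegral_comp (phase_ne_zero (neg_ne_zero.mpr hθ)) (phase_ne_zero hθ)
    (ContinuousLinearEquiv.prodComm ℝ (Body p) (Body p)) Measure.measurePreserving_swap
    (fun q => ?_) hT]
  · exact congrArg _ (funext fun q => mul_comm _ _)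
  · change Complex.exp (Complex.I * ((-2 / -θ * omegaBody q.2 q.1 : ℝ) : ℂ)) = _
    rw [omegaBody_swap, div_neg, neg_mul_neg]; rfl

theorem evenStar_add_right {θ : ℝ} (hθ : θ ≠ 0) {f g g' : Body p → ℂ} (hf : PolyB f)
    (hg : PolyB g) (hg' : PolyB g') (y : Body p) :
    evenStar θ f (fun x => g x + g' x) y = evenStar θ f g y + evenStar θ f g' y := by
  rw [evenStar_swap hθ hf (hg.add hg'), evenStar_swap hθ hf hg, evenStar_swap hθ hf hg',
    evenStar_add_left (neg_ne_zero.mpr hθ) hg hg' hf]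

theorem evenStar_const_mul_right {θ : ℝ} (hθ : θ ≠ 0) {f g : Body p → ℂ} (hf : PolyB f)
    (hg : PolyB g) (r : ℂ) (y : Body p) :
    evenStar θ f (fun x => r * g x) y = r * evenStar θ f g y := by
  rw [evenStar_swap hθ hf (hg.const_mul r), evenStar_swap hθ hf hg,
    evenStar_const_mul_left (neg_ne_zero.mpr hθ) hg hf]

theorem evenStar_zero_right {θ : ℝ} (hθ : θ ≠ 0) (g : Body p → ℂ) (y : Body p) :
    evenStar θ g (fun _ => 0) y = 0 := by
  simp only [evenStar, mul_zero]; exact oscIntegral_zero (phase_ne_zero hθ)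

theorem evenStar_zero_left {θ : ℝ} (hθ : θ ≠ 0) (g : Body p → ℂ) (y : Body p) :
    evenStar θ (fun _ => 0) g y = 0 := by
  simp only [evenStar, zero_mul]; exact oscIntegral_zero (phase_ne_zero hθ)

theorem evenStar_sum_left {θ : ℝ} (hθ : θ ≠ 0) {ι : Type*} (s : Finset ι) {f : ι → Body p → ℂ}
    {g : Body p → ℂ} (hf : ∀ i ∈ s, PolyB (f i)) (hg : PolyB g) (y : Body p) :
    evenStar θ (fun x => ∑ i ∈ s, f i x) g y = ∑ i ∈ s, evenStar θ (f i) g y := by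
  classical
  induction s using Finset.induction_on with
  | empty => simpa using evenStar_zero_left hθ g y
  | insert a s ha ih =>
    simp only [Finset.sum_insert ha]
    rw [evenStar_add_left hθ (hf a (Finset.mem_insert_self _ _))
      (PolyB.sum fun i hi => hf i (Finset.mem_insert_of_mem hi)) hg,
      ih fun i hi => hf i (Finset.mem_insert_of_mem hi)]

/-- A function `ω₀(·, b)` on the body. -/
def omR (b : Body p) : Body p →L[ℝ] ℂ :=
  Complex.ofRealCLM ∘L LinearMap.toContinuousLinearMap ((omegaLin p).flip b)

theorem omR_apply (b y : Body p) : omR b y = ((omegaBody y b : ℝ) : ℂ) := rfl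

theorem pd_tensor {f g : Body p → ℂ} (hf : ContDiff ℝ ∞ f) (hg : ContDiff ℝ ∞ g)
    (y y' a b : Body p) :
    pd (a, b) (fun q : Body p × Body p => f (y + q.1) * g (y' + q.2))
      = fun q => pd a f (y + q.1) * g (y' + q.2) + f (y + q.1) * pd b g (y' + q.2) := by
  have e1 := pd_comp_affine hf (ContinuousLinearMap.fst ℝ (Body p) (Body p)) y (a, b)
  have e2 := pd_comp_affine hg (ContinuousLinearMap.snd ℝ (Body p) (Body p)) y' (a, b)
  simp only [ContinuousLinearMap.coe_fst', ContinuousLinearMap.coe_snd'] at e1 e2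
  simp only [add_comm y, add_comm y']
  have s1 : ContDiff ℝ ∞ (fun q : Body p × Body p => f (q.1 + y)) :=
    hf.comp (contDiff_fst.add contDiff_const)
  have s2 : ContDiff ℝ ∞ (fun q : Body p × Body p => g (q.2 + y')) :=
    hg.comp (contDiff_snd.add contDiff_const)
  rw [pd_mul s1 s2, e1, e2]

/-- Integration by parts in `v`: a factor `c ω₀(u, b)` becomes `i ∂_b` on the second function. -/
theorem oscIntegral_ibp_right {c : ℝ} (hc : c ≠ 0) {f g : Body p → ℂ} (hf : PolyB f)
    (hg : PolyB g) (y y' b : Body p) :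
    oscIntegral c (fun q : Body p × Body p =>
        ((c * omegaBody q.1 b : ℝ) : ℂ) * (f (y + q.1) * g (y' + q.2)))
      = Complex.I * oscIntegral c (fun q => f (y + q.1) * pd b g (y' + q.2)) := by
  obtain ⟨N, hN⟩ := hf
  obtain ⟨M, hM⟩ := hg
  have hT := isSym_tensor hN hM y y'
  have h0 := oscIntegral_DD hc hT ((0 : Body p), b)
  have e : DD c ((0 : Body p), b) (fun q : Body p × Body p => f (y + q.1) * g (y' + q.2))
      = fun q => f (y + q.1) * pd b g (y' + q.2)
        + Complex.I * (((c * omegaBody q.1 b : ℝ) : ℂ) * (f (y + q.1) * g (y' + q.2))) := by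
    ext q
    simp only [DD]
    rw [pd_tensor hN.1 hM.1, tau_apply, pd_zero_dir]
    simp only [omegaBody_zero_left, Pi.zero_apply]; ring_nf
  have hX : IsSym (1 + (N + M)) (fun q : Body p × Body p =>
      ((c * omegaBody q.1 b : ℝ) : ℂ) * (f (y + q.1) * g (y' + q.2))) := by
    have := (isSym_tau c ((0 : Body p), b)).mul hT
    simpa [tau_apply, omegaBody_zero_left] using this
  rw [e, oscIntegral_add hc (isSym_tensor hN (hM.partialDeriv b) y y') (hX.const_mul _),
    oscIntegral_const_mul hc hX] at h0
  linear_combination (-Complex.I) * h0 +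
    (oscIntegral c (fun q : Body p × Body p =>
        ((c * omegaBody q.1 b : ℝ) : ℂ) * (f (y + q.1) * g (y' + q.2)))) * Complex.I_sq

/-- Left multiplication by a linear function. -/
theorem evenStar_omR_mul {θ : ℝ} (hθ : θ ≠ 0) {f g : Body p → ℂ} (hf : PolyB f) (hg : PolyB g)
    (b y : Body p) :
    evenStar θ (fun x => omR b x * f x) g y
      = omR b y * evenStar θ f g y + (-(Complex.I * θ / 2)) * evenStar θ f (pd b g) y := by
  have hc := phase_ne_zero hθ
  have h1 := oscIntegral_ibp_right hc hf hg y y b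
  obtain ⟨N, hN⟩ := hf
  obtain ⟨M, hM⟩ := hg
  have hT := isSym_tensor hN hM y y
  have hX : IsSym (1 + (N + M)) (fun q : Body p × Body p =>
      ((-2 / θ * omegaBody q.1 b : ℝ) : ℂ) * (f (y + q.1) * g (y + q.2))) := by
    have := (isSym_tau (-2 / θ) ((0 : Body p), b)).mul hT
    simpa [tau_apply, omegaBody_zero_left] using this
  have e : (fun q : Body p × Body p => omR b (y + q.1) * f (y + q.1) * g (y + q.2))
      = fun q => omR b y * (f (y + q.1) * g (y + q.2)) + (-(θ : ℂ) / 2) *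
        (((-2 / θ * omegaBody q.1 b : ℝ) : ℂ) * (f (y + q.1) * g (y + q.2))) := by
    ext q
    have hθ' : (θ : ℂ) ≠ 0 := by exact_mod_cast hθ
    simp only [map_add, omR_apply]
    push_cast
    field_simp
  rw [evenStar, e, oscIntegral_add hc (hT.const_mul _) (hX.const_mul _),
    oscIntegral_const_mul hc hT, oscIntegral_const_mul hc hX, h1, evenStar, evenStar]
  ring

/-- A derivative on the first function, at a given point, becomes the multiplication of the second
one by a linear function that vanishes at the point. -/
theorem evenStar_pd_left {θ : ℝ} (hθ : θ ≠ 0) {f g : Body p → ℂ} (hf : PolyB f) (hg : PolyB g)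
    (a y : Body p) :
    evenStar θ (pd a f) g y
      = evenStar θ f (fun x => (2 * Complex.I / θ) * ((omR a y - omR a x) * g x)) y := by
  have h := evenStar_omR_mul (neg_ne_zero.mpr hθ) hg hf a y
  have hm := (PolyB.clm (omR a)).mul hg
  rw [← evenStar_swap hθ hf hm, ← evenStar_swap hθ hf hg,
    ← evenStar_swap hθ (hf.partialDeriv a) hg] at h
  have e : (fun x => (2 * Complex.I / θ) * ((omR a y - omR a x) * g x)) = fun x =>
      (2 * Complex.I / θ * omR a y) * g x + (-(2 * Complex.I / θ)) * (omR a x * g x) := by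
    ext x; ring
  rw [e, evenStar_add_right hθ hf (hg.const_mul _) (hm.const_mul _),
    evenStar_const_mul_right hθ hf hg, evenStar_const_mul_right hθ hf hm, h]
  have hθ' : (θ : ℂ) ≠ 0 := by exact_mod_cast hθ
  have e1 : 2 * Complex.I / θ * (Complex.I * θ / 2) = -1 := by field_simp; exact Complex.I_sq
  push_cast
  linear_combination (evenStar θ (pd a f) g y) * e1

/-- The even star-product is covariant under affine symplectic maps. -/
theorem evenStar_comp {θ : ℝ} (hθ : θ ≠ 0) (R : Body p ≃L[ℝ] Body p)
    (hR : MeasurePreserving R volume volume)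
    (hω : ∀ u v, omegaBody (R u) (R v) = omegaBody u v) (s : Body p) {f g : Body p → ℂ}
    (hf : PolyB f) (hg : PolyB g) (y : Body p) :
    evenStar θ (fun x => f (R x + s)) (fun x => g (R x + s)) y = evenStar θ f g (R y + s) := by
  obtain ⟨N, hN⟩ := hf
  obtain ⟨M, hM⟩ := hg
  have hT : IsSym (N + M : ℕ) (fun q : Body p × Body p =>
      f (R y + s + q.1) * g (R y + s + q.2)) := by
    simpa using isSym_tensor hN hM (R y + s) (R y + s)
  rw [evenStar, evenStar, ← oscIntegral_comp (phase_ne_zero hθ) (phase_ne_zero hθ) (R.prodCongr R)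
    (hR.prod hR) (fun q => by simp only [eph, ContinuousLinearEquiv.prodCongr_apply, hω]) hT]
  congr 1
  ext q
  simp only [ContinuousLinearEquiv.prodCongr_apply, map_add]
  congr 2 <;> abel

end EvenStar


/-! ### Smoothness of the even star-product -/

section Smoothness

variable {X : Type*} [NormedAddCommGroup X] [NormedSpace ℝ X]
variable {F : Type*} [NormedAddCommGroup F] [NormedSpace ℝ F]

theorem pd_pd_apply {f : X → F} (hf : ContDiff ℝ ∞ f) (a b q : X) :
    pd a (pd b f) q = fderiv ℝ (fderiv ℝ f) q a b := by
  have hd : DifferentiableAt ℝ (fderiv ℝ f) q :=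
    (contDiff_fderiv hf).differentiable (by simp) q
  have := hd.hasFDerivAt.clm_apply (hasFDerivAt_const b q)
  change fderiv ℝ (fun y => fderiv ℝ f y b) q a = _
  rw [this.fderiv]
  simp

theorem pd_iteratedFDeriv {f : X → F} (hf : ContDiff ℝ ∞ f) (i : ℕ) (h : X) :
    pd h (iteratedFDeriv ℝ i f) = iteratedFDeriv ℝ i (pd h f) := by
  induction i with
  | zero =>
    ext x m
    have hd : DifferentiableAt ℝ f x := hf.differentiable (by simp) x
    simp only [pd, iteratedFDeriv_zero_eq_comp]
    rw [LinearIsometryEquiv.comp_fderiv]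
    rfl
  | succ i ih =>
    have hT : ContDiff ℝ ∞ (iteratedFDeriv ℝ i f) :=
      hf.iteratedFDeriv_right (by exact_mod_cast le_top)
    ext1 x
    rw [iteratedFDeriv_succ_eq_comp_left, iteratedFDeriv_succ_eq_comp_left, ← ih, pd]
    let Z : (X →L[ℝ] X [×i]→L[ℝ] F) ≃ₗᵢ[ℝ] (X [×i + 1]→L[ℝ] F) :=
      (continuousMultilinearCurryLeftEquiv ℝ (fun _ : Fin (i + 1) => X) F).symm
    have hfd := LinearIsometryEquiv.comp_fderiv (𝕜 := ℝ) (E := X →L[ℝ] X [×i]→L[ℝ] F)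
      (F := X [×i + 1]→L[ℝ] F) Z (f := fderiv ℝ (iteratedFDeriv ℝ i f)) (x := x)
    refine (congrArg (fun L => L h) hfd).trans ?_
    refine congrArg Z ?_
    ext1 a
    have h2 := pd_pd_apply hT h a x
    rw [pd_comm hT] at h2
    exact h2.symm

/-- The Taylor remainder of first order of a symbol, bounded as a symbol. -/
theorem SymBound.remainder {K N : ℕ} {C : ℝ} {f : X → F} (hf : ContDiff ℝ ∞ f)
    (h : SymBound (K + 2) N C f) {a : X} (ha : ‖a‖ ≤ 1) :
    SymBound K N (2 ^ N * C * ‖a‖ ^ 2) (fun q => f (q + a) - f q - pd a f q) := by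
  have hC0 := h.nonneg
  intro i hi q
  have hsh : ContDiff ℝ ∞ (fun q => f (q + a)) := hf.comp (contDiff_id.add contDiff_const)
  have hii : ((i : ℕ) : ℕ∞ω) ≤ ∞ := by exact_mod_cast le_top
  have e : iteratedFDeriv ℝ i (fun q => f (q + a) - f q - pd a f q) q
      = iteratedFDeriv ℝ i f (q + a) - iteratedFDeriv ℝ i f q
        - fderiv ℝ (iteratedFDeriv ℝ i f) q a := by
    have e1 := iteratedFDeriv_sub_apply (i := i) (x := q) ((hsh.sub hf).contDiffAt.of_le hii)
      ((contDiff_pd hf a).contDiffAt.of_le hii)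
    have e2 := iteratedFDeriv_sub_apply (i := i) (x := q) (hsh.contDiffAt.of_le hii)
      (hf.contDiffAt.of_le hii)
    have e3 := congrFun (pd_iteratedFDeriv hf i a) q
    rw [iteratedFDeriv_comp_add_right] at e2
    rw [← e2]
    rw [pd] at e3
    rw [e3]
    exact e1
  rw [e]
  set T := iteratedFDeriv ℝ i f with hTdef
  have hT : ContDiff ℝ ∞ T := hf.iteratedFDeriv_right (by exact_mod_cast le_top)
  have hb : ∀ j ≤ K + 2, ∀ x ∈ Metric.closedBall q ‖a‖,
      ‖iteratedFDeriv ℝ j f x‖ ≤ 2 ^ N * C * (1 + ‖q‖) ^ N := by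
    intro j hj x hx
    refine (h j hj x).trans ?_
    rw [zpow_natCast]
    have hx' : ‖x‖ ≤ ‖q‖ + 1 := by
      have h1 : ‖x - q‖ ≤ ‖a‖ := by simpa [dist_eq_norm] using hx
      have h2 : ‖x‖ ≤ ‖x - q‖ + ‖q‖ := by simpa using norm_add_le (x - q) q
      linarith
    calc C * (1 + ‖x‖) ^ N ≤ C * (2 * (1 + ‖q‖)) ^ N := by
          gcongr; linarith [norm_nonneg q]
      _ = _ := by rw [mul_pow]; ring
  have hconv : Convex ℝ (Metric.closedBall q ‖a‖) := convex_closedBall q ‖a‖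
  have hq : q ∈ Metric.closedBall q ‖a‖ := by simp
  have hqa : q + a ∈ Metric.closedBall q ‖a‖ := by simp
  have hlip : ∀ x ∈ Metric.closedBall q ‖a‖,
      ‖fderiv ℝ T x - fderiv ℝ T q‖ ≤ 2 ^ N * C * (1 + ‖q‖) ^ N * ‖a‖ := by
    intro x hx
    have hT1 : ContDiff ℝ ∞ (iteratedFDeriv ℝ (i + 1) f) :=
      hf.iteratedFDeriv_right (by exact_mod_cast le_top)
    have h1 := hconv.norm_image_sub_le_of_norm_fderiv_le (𝕜 := ℝ)
      (f := iteratedFDeriv ℝ (i + 1) f) (C := 2 ^ N * C * (1 + ‖q‖) ^ N)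
      (fun x _ => hT1.differentiable (by simp) x)
      (fun x hx => by rw [norm_fderiv_iteratedFDeriv]; exact hb _ (by omega) x hx) hq hx
    have h2 : ‖iteratedFDeriv ℝ (i + 1) f x - iteratedFDeriv ℝ (i + 1) f q‖
        = ‖fderiv ℝ T x - fderiv ℝ T q‖ := by
      rw [iteratedFDeriv_succ_eq_comp_left, Function.comp_apply, Function.comp_apply]
      let Z := (continuousMultilinearCurryLeftEquiv ℝ (fun _ : Fin (i + 1) => X) F).symm
      exact (congrArg norm (Z.map_sub (fderiv ℝ T x) (fderiv ℝ T q)).symm).trans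
        (Z.norm_map (fderiv ℝ T x - fderiv ℝ T q))
    rw [h2] at h1
    refine h1.trans ?_
    have : ‖x - q‖ ≤ ‖a‖ := by simpa [dist_eq_norm] using hx
    gcongr
  have h3 := hconv.norm_image_sub_le_of_norm_fderiv_le' (𝕜 := ℝ) (f := T)
    (fun x _ => hT.differentiable (by simp) x) hlip hq hqa
  simp only [add_sub_cancel_left] at h3
  rw [zpow_natCast]
  refine h3.trans (le_of_eq ?_)
  ring

variable {p : ℕ}

theorem IsSym.comp_add {N : ℕ} {f : X → F} (h : IsSym N f) (s : X) :
    IsSym N (fun q => f (q + s)) := h.comp_affine (ContinuousLinearMap.id ℝ X) s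

/-- Oscillating integrals depend differentiably on a translation of the amplitude. -/
theorem hasFDerivAt_oscIntegral_translate {c : ℝ} (hc : c ≠ 0) {N : ℕ}
    {Φ : Body p × Body p → ℂ} (hΦ : IsSym N Φ) (s : Body p × Body p) :
    ∃ L : Body p × Body p →L[ℝ] ℂ, HasFDerivAt (fun s => oscIntegral c fun q => Φ (q + s)) L s ∧
      ∀ a, L a = oscIntegral c fun q => pd a Φ (q + s) := by
  let L₀ : Body p × Body p →ₗ[ℝ] ℂ :=
    { toFun := fun a => oscIntegral c fun q => pd a Φ (q + s)
      map_add' := fun a b => by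
        simp only [pd_add_dir]
        exact oscIntegral_add hc ((hΦ.partialDeriv a).comp_add s) ((hΦ.partialDeriv b).comp_add s)
      map_smul' := fun r a => by
        simp only [pd_smul_dir, RingHom.id_apply, Complex.real_smul]
        exact oscIntegral_const_mul hc ((hΦ.partialDeriv a).comp_add s) _ }
  refine ⟨LinearMap.toContinuousLinearMap L₀, ?_, fun a => rfl⟩
  obtain ⟨K, A, hA, hbd⟩ := norm_oscIntegral_le (p := p) hc N
  have hs := hΦ.comp_add s
  obtain ⟨C, hC⟩ := hs.2 (K + 2)
  have hC0 := hC.nonneg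
  have key : ∀ a : Body p × Body p, ‖a‖ ≤ 1 →
      ‖(oscIntegral c fun q => Φ (q + (s + a))) - (oscIntegral c fun q => Φ (q + s)) - L₀ a‖
        ≤ A * (2 ^ N * C) * ‖a‖ ^ 2 := by
    intro a ha
    have hr := SymBound.remainder hs.1 hC ha
    have h2 := hs.partialDeriv a
    have e2 : pd a (fun q => Φ (q + s)) = fun q => pd a Φ (q + s) :=
      pd_comp_affine hΦ.1 (ContinuousLinearMap.id ℝ (Body p × Body p)) s a
    have h1' : IsSym N (fun q => Φ (q + a + s)) := hs.comp_add a
    have e : oscIntegral c (fun q => Φ (q + a + s) - Φ (q + s) - pd a (fun q => Φ (q + s)) q)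
        = (oscIntegral c fun q => Φ (q + (s + a))) - (oscIntegral c fun q => Φ (q + s)) - L₀ a := by
      rw [oscIntegral_sub hc (h1'.sub hs) h2, oscIntegral_sub hc h1' hs, e2]
      have : (fun q => Φ (q + (s + a))) = fun q => Φ (q + a + s) := by
        ext q; congr 1; abel
      rw [this]; rfl
    rw [← e]
    refine (hbd _ _ ((h1'.sub hs).sub h2) hr).trans (le_of_eq ?_)
    ring
  rw [hasFDerivAt_iff_isLittleO_nhds_zero]
  refine Asymptotics.IsBigO.trans_isLittleO (g := fun a : Body p × Body p => ‖a‖ ^ 2) ?_ ?_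
  · refine Asymptotics.IsBigO.of_bound (A * (2 ^ N * C)) ?_
    filter_upwards [Metric.closedBall_mem_nhds (0 : Body p × Body p) one_pos] with a ha
    have := key a (by simpa using ha)
    rw [norm_pow, norm_norm]
    exact this
  · exact Asymptotics.isLittleO_norm_pow_id one_lt_two

theorem contDiff_oscIntegral_translate {c : ℝ} (hc : c ≠ 0) {N : ℕ}
    {Φ : Body p × Body p → ℂ} (hΦ : IsSym N Φ) :
    ContDiff ℝ ∞ (fun s => oscIntegral c fun q => Φ (q + s)) := by
  rw [contDiff_infty]
  intro n
  induction n generalizing Φ with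
  | zero =>
    refine contDiff_zero.mpr (continuous_iff_continuousAt.mpr fun s => ?_)
    obtain ⟨L, hL, -⟩ := hasFDerivAt_oscIntegral_translate hc hΦ s
    exact hL.continuousAt
  | succ n ih =>
    push_cast
    rw [contDiff_succ_iff_fderiv_apply]
    refine ⟨fun s => ?_, by simp, fun a => ?_⟩
    · obtain ⟨L, hL, -⟩ := hasFDerivAt_oscIntegral_translate hc hΦ s
      exact hL.differentiableAt
    · have : (fun s => fderiv ℝ (fun s => oscIntegral c fun q => Φ (q + s)) s a)
          = fun s => oscIntegral c fun q => pd a Φ (q + s) := by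
        ext s
        obtain ⟨L, hL, hLa⟩ := hasFDerivAt_oscIntegral_translate hc hΦ s
        rw [hL.fderiv, hLa]
      rw [this]
      exact ih (hΦ.partialDeriv a)

theorem contDiff_evenStar {θ : ℝ} (hθ : θ ≠ 0) {f g : Body p → ℂ} (hf : PolyB f) (hg : PolyB g) :
    ContDiff ℝ ∞ (evenStar θ f g) := by
  obtain ⟨N, hN⟩ := hf
  obtain ⟨M, hM⟩ := hg
  have hT : IsSym (N + M : ℕ) (fun q : Body p × Body p => f (0 + q.1) * g (0 + q.2)) := by
    simpa using isSym_tensor hN hM 0 0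
  have h1 := contDiff_oscIntegral_translate (phase_ne_zero hθ) hT
  have h2 : ContDiff ℝ ∞ (fun y : Body p => (y, y)) := contDiff_id.prodMk contDiff_id
  have e : evenStar θ f g = (fun s : Body p × Body p => oscIntegral (-2 / θ) fun q =>
      f (0 + (q + s).1) * g (0 + (q + s).2)) ∘ fun y => (y, y) := by
    ext y
    simp [evenStar, add_comm]
  rw [e]
  exact h1.comp h2

/-- The Leibniz rule. -/
theorem pd_evenStar {θ : ℝ} (hθ : θ ≠ 0) {f g : Body p → ℂ} (hf : PolyB f) (hg : PolyB g)
    (a : Body p) :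
    pd a (evenStar θ f g) = fun y => evenStar θ (pd a f) g y + evenStar θ f (pd a g) y := by
  obtain ⟨N, hN⟩ := hf
  obtain ⟨M, hM⟩ := hg
  have hT : IsSym (N + M : ℕ) (fun q : Body p × Body p => f (0 + q.1) * g (0 + q.2)) := by
    simpa using isSym_tensor hN hM 0 0
  have hc := phase_ne_zero hθ
  have e : evenStar θ f g = (fun s : Body p × Body p => oscIntegral (-2 / θ) fun q =>
      f (0 + (q + s).1) * g (0 + (q + s).2)) ∘ fun y => (y, y) := by
    ext y
    simp [evenStar, add_comm]
  ext y
  obtain ⟨L, hL, hLa⟩ := hasFDerivAt_oscIntegral_translate hc hT (y, y)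
  have h1 : HasFDerivAt (fun y : Body p => (y, y))
      ((ContinuousLinearMap.id ℝ (Body p)).prod (ContinuousLinearMap.id ℝ (Body p))) y :=
    (hasFDerivAt_id y).prodMk (hasFDerivAt_id y)
  have h2 : HasFDerivAt _ _ y := HasFDerivAt.comp (f := fun y : Body p => (y, y)) y hL h1
  rw [e, pd, h2.fderiv]
  simp only [ContinuousLinearMap.comp_apply, ContinuousLinearMap.prod_apply,
    ContinuousLinearMap.id_apply, hLa]
  rw [pd_tensor hN.1 hM.1]
  simp only [evenStar, Prod.fst_add, Prod.snd_add, zero_add, add_comm y]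
  have h4 : IsSym (N + M) fun q : Body p × Body p => pd a f (q.1 + y) * g (q.2 + y) := by
    simpa [add_comm] using isSym_tensor (hN.partialDeriv a) hM y y
  have h5 : IsSym (N + M) fun q : Body p × Body p => f (q.1 + y) * pd a g (q.2 + y) := by
    simpa [add_comm] using isSym_tensor hN (hM.partialDeriv a) y y
  exact oscIntegral_add hc h4 h5

end Smoothness

/-! ### Hadamard's lemma for functions of polynomial growth -/

section Hadamard

open MeasureTheory

/-- The weighted average of a function over the segment from `s` to a variable point. -/
def segAvg {X F : Type} [NormedAddCommGroup X] [NormedSpace ℝ X] [NormedAddCommGroup F]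
    [NormedSpace ℝ F] (w : ℝ → ℝ) (s : X) (G : X → F) (v : X) : F :=
  ∫ t in (0 : ℝ)..1, w t • G (s + t • (v - s))

variable {X F : Type} [NormedAddCommGroup X] [NormedSpace ℝ X] [NormedAddCommGroup F]
    [NormedSpace ℝ F]

theorem hasFDerivAt_segAvg {w : ℝ → ℝ} (hw : Continuous w) (s : X) {N : ℕ} {G : X → F}
    (hG : IsSym N G) (v : X) :
    HasFDerivAt (segAvg w s G) (segAvg (fun t => w t * t) s (fderiv ℝ G) v) v := by
  obtain ⟨C, hC0, hC⟩ := norm_le_of_isSym hG.fderivSym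
  have hGc : Continuous G := hG.1.continuous
  have hG' : Continuous (fderiv ℝ G) := (contDiff_fderiv hG.1).continuous
  refine intervalIntegral.hasFDerivAt_integral_of_dominated_of_fderiv_le
    (μ := volume) (s := Metric.ball v 1) (Metric.ball_mem_nhds v one_pos)
    (F := fun v t => w t • G (s + t • (v - s)))
    (F' := fun v t => (w t * t) • fderiv ℝ G (s + t • (v - s)))
    (bound := fun t => |w t * t| * (C * (1 + (‖s‖ + |t| * (‖v‖ + 1 + ‖s‖))) ^ N)) ?_ ?_ ?_ ?_ ?_ ?_
  · refine Filter.Eventually.of_forall fun x => Continuous.aestronglyMeasurable ?_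
    fun_prop
  · refine Continuous.intervalIntegrable ?_ _ _
    fun_prop
  · have : SecondCountableTopologyEither ℝ (X →L[ℝ] F) :=
      secondCountableTopologyEither_of_left _ _
    refine Continuous.aestronglyMeasurable ?_
    fun_prop
  · refine Filter.Eventually.of_forall fun t _ x hx => ?_
    rw [norm_smul, Real.norm_eq_abs]
    refine mul_le_mul_of_nonneg_left ((hC _).trans ?_) (abs_nonneg _)
    rw [zpow_natCast]
    have h1 : ‖x‖ ≤ ‖v‖ + 1 := by
      have h1 : ‖x - v‖ ≤ 1 := by simpa [dist_eq_norm] using (Metric.mem_ball.mp hx).le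
      have h2 : ‖x‖ ≤ ‖x - v‖ + ‖v‖ := by simpa using norm_add_le (x - v) v
      linarith
    have h2 : ‖s + t • (x - s)‖ ≤ ‖s‖ + |t| * (‖v‖ + 1 + ‖s‖) := by
      refine (norm_add_le _ _).trans ?_
      rw [norm_smul, Real.norm_eq_abs]
      gcongr
      exact (norm_sub_le _ _).trans (by linarith)
    gcongr
  · refine Continuous.intervalIntegrable ?_ _ _
    fun_prop
  · refine Filter.Eventually.of_forall fun t _ x _ => ?_
    have h1 : HasFDerivAt (fun x : X => s + t • (x - s)) (t • ContinuousLinearMap.id ℝ X) x :=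
      (((hasFDerivAt_id x).sub_const s).const_smul t).const_add s
    have h2 := ((hG.1.differentiable (by simp) (s + t • (x - s))).hasFDerivAt.comp x h1).const_smul
      (w t)
    convert! h2 using 1
    ext a
    simp [mul_smul]

theorem norm_segAvg_le {w : ℝ → ℝ} {W : ℝ} (hw : ∀ t ∈ Set.uIoc (0 : ℝ) 1, |w t| ≤ W) (s : X)
    {N : ℕ} {G : X → F} {C : ℝ} (hC : ∀ q, ‖G q‖ ≤ C * (1 + ‖q‖) ^ N) (v : X) :
    ‖segAvg w s G v‖ ≤ W * C * (1 + ‖s‖) ^ N * (1 + ‖v‖) ^ N := by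
  have hC0 : 0 ≤ C := by
    have := (norm_nonneg _).trans (hC 0)
    simpa using this
  have := intervalIntegral.norm_integral_le_of_norm_le_const (a := (0 : ℝ)) (b := 1)
    (f := fun t => w t • G (s + t • (v - s))) (C := W * C * (1 + ‖s‖) ^ N * (1 + ‖v‖) ^ N)
    (fun t ht => ?_)
  · simpa [segAvg] using this
  rw [norm_smul, Real.norm_eq_abs, mul_assoc, mul_assoc]
  have hW : 0 ≤ W := (abs_nonneg _).trans (hw t ht)
  refine mul_le_mul (hw t ht) ((hC _).trans ?_) (norm_nonneg _) hW
  rw [← mul_pow]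
  rw [Set.uIoc_of_le zero_le_one] at ht
  have h2 : ‖s + t • (v - s)‖ ≤ ‖s‖ + ‖v‖ := by
    have e : s + t • (v - s) = (1 - t) • s + t • v := by module
    rw [e]
    refine (norm_add_le _ _).trans ?_
    rw [norm_smul, norm_smul, Real.norm_eq_abs, Real.norm_eq_abs, abs_of_nonneg ht.1.le,
      abs_of_nonneg (by linarith [ht.2] : 0 ≤ 1 - t)]
    nlinarith [norm_nonneg s, norm_nonneg v, ht.1, ht.2]
  gcongr
  nlinarith [norm_nonneg s, norm_nonneg v]

theorem isSym_segAvg {w : ℝ → ℝ} (hw : Continuous w) (s : X) {N : ℕ} {G : X → F}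
    (hG : IsSym N G) : IsSym N (segAvg w s G) := by
  have key : ∀ (K : ℕ) (F : Type) [NormedAddCommGroup F] [NormedSpace ℝ F] (w : ℝ → ℝ)
      (G : X → F), Continuous w → IsSym N G → ContDiff ℝ K (segAvg w s G) ∧
        ∃ C, ∀ v, ‖iteratedFDeriv ℝ K (segAvg w s G) v‖ ≤ C * (1 + ‖v‖) ^ N := by
    intro K
    induction K with
    | zero =>
      intro F _ _ w G hw hG
      refine ⟨contDiff_zero.mpr (continuous_iff_continuousAt.mpr fun v =>
        (hasFDerivAt_segAvg hw s hG v).continuousAt), ?_⟩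
      obtain ⟨C, hC0, hC⟩ := norm_le_of_isSym hG
      obtain ⟨W, hW⟩ := isCompact_Icc.exists_bound_of_continuousOn
        (hw.continuousOn (s := Set.Icc (0 : ℝ) 1))
      refine ⟨W * C * (1 + ‖s‖) ^ N, fun v => ?_⟩
      rw [norm_iteratedFDeriv_zero]
      refine norm_segAvg_le (W := W) (fun t ht => hW t ?_) s (fun q => by simpa using hC q) v
      rw [Set.uIoc_of_le zero_le_one] at ht
      exact ⟨ht.1.le, ht.2⟩
    | succ K ih =>
      intro F _ _ w G hw hG
      obtain ⟨h1, C, hC⟩ := ih _ (fun t => w t * t) (fderiv ℝ G) (hw.mul continuous_id)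
        hG.fderivSym
      have e : fderiv ℝ (segAvg w s G) = segAvg (fun t => w t * t) s (fderiv ℝ G) := by
        ext1 v
        exact (hasFDerivAt_segAvg hw s hG v).fderiv
      refine ⟨?_, C, fun v => ?_⟩
      · push_cast
        rw [contDiff_succ_iff_fderiv]
        exact ⟨fun v => (hasFDerivAt_segAvg hw s hG v).differentiableAt, by simp, e ▸ h1⟩
      · rw [← norm_iteratedFDeriv_fderiv, e]
        exact hC v
  exact isSym_of_forall (contDiff_infty.mpr fun K => (key K F w G hw hG).1)
    fun i => by simpa using (key i F w G hw hG).2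

variable {p : ℕ}

/-- Hadamard's lemma. -/
theorem PolyB.exists_hadamard {g : Body p → ℂ} (hg : PolyB g) (s : Body p) :
    ∃ h : EvenIdx p → Body p → ℂ, (∀ b, PolyB (h b)) ∧
      ∀ x, g x = g s + ∑ b, ((x b - s b : ℝ) : ℂ) * h b x := by
  obtain ⟨N, hN⟩ := hg
  refine ⟨fun b => segAvg (fun _ => 1) s (pd (EuclideanSpace.single b (1 : ℝ)) g),
    fun b => ⟨N, isSym_segAvg continuous_const s (hN.partialDeriv _)⟩, fun x => ?_⟩
  have hd : ∀ t : ℝ, HasDerivAt (fun t : ℝ => g (s + t • (x - s)))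
      (fderiv ℝ g (s + t • (x - s)) (x - s)) t := by
    intro t
    have h1 : HasDerivAt (fun t : ℝ => s + t • (x - s)) (x - s) t := by
      simpa using ((hasDerivAt_id t).smul_const (x - s)).const_add s
    exact (hN.1.differentiable (by simp) _).hasFDerivAt.comp_hasDerivAt t h1
  have hG' : Continuous (fderiv ℝ g) := (contDiff_fderiv hN.1).continuous
  have hint := intervalIntegral.integral_eq_sub_of_hasDerivAt (a := 0) (b := 1)
    (fun t _ => hd t) (Continuous.intervalIntegrable (by fun_prop) _ _)
  simp only [one_smul, add_sub_cancel, zero_smul, add_zero] at hint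
  rw [← sub_eq_iff_eq_add', ← hint]
  have e : ∀ t : ℝ, fderiv ℝ g (s + t • (x - s)) (x - s)
      = ∑ b, ((x b - s b : ℝ) : ℂ) *
        pd (EuclideanSpace.single b (1 : ℝ)) g (s + t • (x - s)) := by
    intro t
    have hx : x - s = ∑ b, (x b - s b) • EuclideanSpace.single b (1 : ℝ) := by
      have := (EuclideanSpace.basisFun (EvenIdx p) ℝ).sum_repr (x - s)
      simpa only [EuclideanSpace.basisFun_apply, EuclideanSpace.basisFun_repr, PiLp.sub_apply]
        using this.symm
    conv_lhs => rw [hx]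
    rw [map_sum]
    simp only [map_smul, Complex.real_smul]
    conv_rhs => simp only [pd]
    rw [← hx]
  simp only [e, segAvg, one_smul]
  rw [intervalIntegral.integral_finsetSum]
  · simp only [intervalIntegral.integral_const_mul]
  · intro b _
    refine Continuous.intervalIntegrable ?_ _ _
    simp only [pd]
    fun_prop

end Hadamard

/-! ### Products with characters -/

section Characters

variable {p : ℕ}

/-- The rotation `K` with `ω₀(u, v) = ⟨K u, v⟩`. -/
def rotJ (p : ℕ) : Body p ≃ₗᵢ[ℝ] Body p where
  toFun u := WithLp.toLp 2 (Sum.elim (fun i => - u (Sum.inr i)) (fun i => u (Sum.inl i)))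
  invFun u := WithLp.toLp 2 (Sum.elim (fun i => u (Sum.inr i)) (fun i => - u (Sum.inl i)))
  left_inv u := by ext (i | i) <;> simp
  right_inv u := by ext (i | i) <;> simp
  map_add' u v := by ext (i | i) <;> simp [add_comm]
  map_smul' r u := by ext (i | i) <;> simp
  norm_map' u := by
    rw [← sq_eq_sq₀ (norm_nonneg _) (norm_nonneg _), EuclideanSpace.norm_sq_eq,
      EuclideanSpace.norm_sq_eq, Fintype.sum_sum_type, Fintype.sum_sum_type, add_comm]
    simp

theorem inner_rotJ (u v : Body p) : inner ℝ (rotJ p u) v = omegaBody u v := by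
  rw [PiLp.inner_apply, Fintype.sum_sum_type, omegaBody, ← Finset.sum_add_distrib]
  refine Finset.sum_congr rfl fun i _ => ?_
  simp [rotJ]; ring

theorem omegaBody_rotJ (u v : Body p) : omegaBody u (rotJ p v) = inner ℝ u v := by
  rw [← inner_rotJ, LinearIsometryEquiv.inner_map_map]

/-- The character `exp(i ⟨κ, x⟩)`. -/
def chr (κ : Body p) (x : Body p) : ℂ := Complex.exp (Complex.I * ((inner ℝ κ x : ℝ) : ℂ))

theorem norm_chr (κ x : Body p) : ‖chr κ x‖ = 1 := by
  rw [chr, mul_comm, Complex.norm_exp_ofReal_mul_I]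

theorem chr_zero (x : Body p) : chr (0 : Body p) x = 1 := by simp [chr]

theorem chr_apply_zero (κ : Body p) : chr κ 0 = 1 := by simp [chr]

theorem hasFDerivAt_chr (κ x : Body p) : HasFDerivAt (chr κ)
    (chr κ x • (Complex.I • (Complex.ofRealCLM ∘L innerSL ℝ κ))) x := by
  have h1 : HasFDerivAt (fun x : Body p => Complex.I * ((inner ℝ κ x : ℝ) : ℂ))
      (Complex.I • (Complex.ofRealCLM ∘L innerSL ℝ κ)) x :=
    (Complex.ofRealCLM ∘L innerSL ℝ κ).hasFDerivAt.const_mul Complex.I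
  exact h1.cexp

theorem contDiff_chr (κ : Body p) : ContDiff ℝ ∞ (chr κ) :=
  (contDiff_const.mul (Complex.ofRealCLM.contDiff.comp (innerSL ℝ κ).contDiff)).cexp

theorem pd_chr (κ a : Body p) :
    pd a (chr κ) = fun x => (Complex.I * ((inner ℝ κ a : ℝ) : ℂ)) * chr κ x := by
  ext x
  rw [pd, (hasFDerivAt_chr κ x).fderiv]
  simp [mul_comm]

theorem isSym_chr (κ : Body p) : IsSym 0 (chr κ) := by
  refine ⟨contDiff_chr κ, fun K => ?_⟩
  induction K with
  | zero =>
    refine ⟨1, fun i hi q => ?_⟩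
    obtain rfl : i = 0 := by omega
    simp [norm_chr]
  | succ K ih =>
    obtain ⟨C, hC⟩ := ih
    have hcst := SymBound.const (X := Body p) K (Complex.I • (Complex.ofRealCLM ∘L innerSL ℝ κ))
    have h3 := SymBound.smul (contDiff_chr κ) contDiff_const hC hcst
    have e : (fun q => chr κ q • (Complex.I • (Complex.ofRealCLM ∘L innerSL ℝ κ)))
        = fderiv ℝ (chr κ) := by
      ext1 q; exact (hasFDerivAt_chr κ q).fderiv.symm
    rw [e] at h3
    refine ⟨max C (2 ^ K * (C * ‖Complex.I • (Complex.ofRealCLM ∘L innerSL ℝ κ)‖)),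
      fun i hi q => ?_⟩
    rcases i with _ | i
    · exact (hC 0 (by omega) q).trans (by gcongr; exact le_max_left _ _)
    · rw [← norm_iteratedFDeriv_fderiv]
      exact (h3 i (by omega) q).trans (by
        simp only [add_zero, zpow_zero, mul_one]; exact le_max_right _ _)

theorem polyB_chr (κ : Body p) : PolyB (chr κ) := ⟨0, isSym_chr κ⟩

theorem omR_rotJ_single (b : EvenIdx p) (x : Body p) :
    omR (rotJ p (EuclideanSpace.single b 1)) x = ((x b : ℝ) : ℂ) := by
  rw [omR_apply, omegaBody_rotJ, EuclideanSpace.inner_single_right]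
  simp

/-- Products by a character on the right only depend on a value of the other factor. -/
theorem evenStar_chr_right_aux {θ : ℝ} (hθ : θ ≠ 0) (κ : Body p) {f : Body p → ℂ} (hf : PolyB f)
    (y : Body p) :
    evenStar θ f (chr κ) y
      = f (y - (θ / 2) • rotJ p κ) * evenStar θ (fun _ => 1) (chr κ) y := by
  set s := y - (θ / 2) • rotJ p κ with hs
  have hlin : ∀ (b : EvenIdx p), PolyB fun x : Body p => ((x b - s b : ℝ) : ℂ) := by
    intro b
    have := (PolyB.clm (omR (rotJ p (EuclideanSpace.single b 1)))).add
      (PolyB.const (p := p) (-(s b : ℂ)))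
    simpa [omR_rotJ_single, sub_eq_add_neg] using this
  have kill : ∀ (b : EvenIdx p) {h : Body p → ℂ}, PolyB h →
      evenStar θ (fun x => ((x b - s b : ℝ) : ℂ) * h x) (chr κ) y = 0 := by
    intro b h hh
    set a := rotJ p (EuclideanSpace.single b 1) with ha
    have h1 := evenStar_omR_mul hθ hh (polyB_chr κ) a y
    rw [pd_chr, evenStar_const_mul_right hθ hh (polyB_chr κ)] at h1
    have e : (fun x => ((x b - s b : ℝ) : ℂ) * h x)
        = fun x => omR a x * h x + (-(s b : ℂ)) * h x := by
      ext x; rw [ha, omR_rotJ_single]; push_cast; ring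
    rw [e, evenStar_add_left hθ ((PolyB.clm (omR a)).mul hh) (hh.const_mul _) (polyB_chr κ), h1,
      evenStar_const_mul_left hθ hh (polyB_chr κ)]
    have e1 : inner ℝ κ a = - (rotJ p κ) b := by
      have : inner ℝ (rotJ p κ) (EuclideanSpace.single b (1 : ℝ)) = (rotJ p κ) b := by
        rw [EuclideanSpace.inner_single_right]; simp
      rw [← this, inner_rotJ, omegaBody_swap, ← inner_rotJ, ← ha, real_inner_comm, neg_neg]
    rw [e1, ha, omR_rotJ_single, hs]
    simp only [PiLp.sub_apply, PiLp.smul_apply, smul_eq_mul]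
    push_cast
    linear_combination (-(θ : ℂ) / 2 * ((rotJ p κ) b : ℂ) *
      evenStar θ h (chr κ) y) * (-Complex.I_sq)
  obtain ⟨h, hh, hgh⟩ := hf.exists_hadamard s
  have e : f = fun x => f s * (1 : ℂ) + ∑ b, ((x b - s b : ℝ) : ℂ) * h b x := by
    ext x; rw [mul_one]; exact hgh x
  conv_lhs => rw [e]
  rw [evenStar_add_left hθ ((PolyB.const 1).const_mul _)
    (PolyB.sum fun b _ => (hlin b).mul (hh b)) (polyB_chr κ), evenStar_const_mul_left hθ
    (PolyB.const 1) (polyB_chr κ),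
    evenStar_sum_left hθ _ (fun b _ => (hlin b).mul (hh b)) (polyB_chr κ),
    Finset.sum_eq_zero fun b _ => kill b (hh b), add_zero]

theorem evenStar_chr_left_aux {θ : ℝ} (hθ : θ ≠ 0) (κ : Body p) {g : Body p → ℂ} (hg : PolyB g)
    (y : Body p) :
    evenStar θ (chr κ) g y
      = g (y + (θ / 2) • rotJ p κ) * evenStar θ (chr κ) (fun _ => 1) y := by
  rw [evenStar_swap hθ (polyB_chr κ) hg, evenStar_chr_right_aux (neg_ne_zero.mpr hθ) κ hg,
    evenStar_swap hθ (polyB_chr κ) (PolyB.const 1), neg_div, neg_smul, sub_neg_eq_add]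

end Characters

/-! ### Cut-offs, the normalization, and non-degeneracy of the even star-product -/

section Cutoff

open MeasureTheory Filter Topology

variable {p : ℕ}

/-- The normalization of the oscillating integral.  The integral of `1 ⊗ b`, with `b` a bump
function,
is computed by Fourier inversion, and it only depends on `b 0 = 1`. -/
theorem oscIntegral_one {c : ℝ} (hc : c ≠ 0) :
    oscIntegral c (fun _ : Body p × Body p => (1 : ℂ)) = ((2 * Real.pi / c) ^ (2 * p) : ℝ) := by
  obtain ⟨b, hb, hbs, hb0⟩ := exists_bump (Body p)
  have hχ : IsSym 0 (fun q : Body p × Body p => b q.1 * b q.2) := by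
    have h0 := isSym_of_hasCompactSupport hb hbs 0
    simpa [add_comm] using isSym_tensor (N := 0) (M := 0) h0 h0 0 0
  have hχ1 : IsSym 0 (fun q : Body p × Body p => b q.1) := by
    simpa using (isSym_of_hasCompactSupport hb hbs 0).comp_affine (N := 0)
      (ContinuousLinearMap.fst ℝ (Body p) (Body p)) 0
  have hχ2 : IsSym (0 : ℕ) (fun q : Body p × Body p => b q.2) := by
    simpa using (isSym_of_hasCompactSupport hb hbs 0).comp_affine (N := 0)
      (ContinuousLinearMap.snd ℝ (Body p) (Body p)) 0
  -- the value on `1 ⊗ b`, as a limit of cut-offs in the first variable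
  have hlim1 := tendsto_oscIntegral_cutoff hc hχ1 hχ2
  simp only [Prod.fst_zero, hb0, one_mul] at hlim1
  let β : SchwartzMap (Body p) ℂ := hbs.toSchwartzMap hb
  have hβ : ∀ x, β x = b x := fun x => rfl
  set r : ℝ := -(c / (2 * Real.pi)) with hr
  have hr0 : r ≠ 0 := neg_ne_zero.mpr (div_ne_zero hc (by positivity))
  let γ : SchwartzMap (Body p) ℂ := FourierTransform.fourier β
  have hγ : ∀ u : Body p, ∫ v, eph c (u, v) * b v = γ (r • rotJ p u) := by
    intro u
    change _ = (FourierTransform.fourier β) _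
    rw [SchwartzMap.fourier_coe, Real.fourier_eq']
    refine integral_congr_ae (Eventually.of_forall fun v => ?_)
    simp only [eph, smul_eq_mul, hβ]
    congr 2
    rw [mul_comm]
    congr 2
    rw [inner_smul_right, real_inner_comm, inner_rotJ, hr]
    have := Real.pi_ne_zero
    field_simp
  have hcompute : ∀ ε : ℝ, 0 < ε → oscIntegral c (fun q : Body p × Body p => b (ε • q).1 * b q.2)
      = ∫ u, b (ε • u) * γ (r • rotJ p u) := by
    intro ε hε
    have hεb : ContDiff ℝ ∞ fun u : Body p => b (ε • u) := hb.comp (contDiff_const_smul ε)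
    have hεs : HasCompactSupport fun u : Body p => b (ε • u) :=
      hbs.comp_homeomorph (Homeomorph.smulOfNeZero ε hε.ne')
    have hsm : ContDiff ℝ ∞ (fun q : Body p × Body p => b (ε • q).1 * b q.2) :=
      (hεb.comp contDiff_fst).mul (hb.comp contDiff_snd)
    have hcs : HasCompactSupport (fun q : Body p × Body p => b (ε • q).1 * b q.2) := by
      refine HasCompactSupport.intro (hεs.isCompact.prod hbs.isCompact) fun q hq => ?_
      by_contra hne
      refine hq ⟨subset_tsupport _ (left_ne_zero_of_mul hne),
        subset_tsupport _ (right_ne_zero_of_mul hne)⟩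
    have hS := isSym_of_hasCompactSupport hsm hcs (-(dimE p + 1 : ℤ))
    rw [oscIntegral_of_decay hc hS le_rfl, Measure.volume_eq_prod,
      integral_prod _ (integrable_eph_mul hS le_rfl)]
    refine integral_congr_ae (Eventually.of_forall fun u => ?_)
    simp only
    rw [← hγ, ← integral_const_mul]
    refine integral_congr_ae (Eventually.of_forall fun v => ?_)
    simp only [Prod.smul_fst]
    ring
  let Γ : Body p → ℂ := fun u => γ (r • rotJ p u)
  have hΓ : Integrable Γ := by
    have h1 : Integrable (fun u : Body p => γ (r • u)) := (γ.integrable (μ := volume)).comp_smul hr0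
    exact (rotJ p).measurePreserving.integrable_comp_of_integrable h1
  have hΓint : ∫ u, Γ u = (|r ^ (2 * p)|⁻¹ : ℝ) := by
    have h1 := (rotJ p).measurePreserving.integral_comp
      (rotJ p).toHomeomorph.measurableEmbedding (fun u => γ (r • u))
    have h2 : ∫ u, γ u = 1 := by
      have h3 : (FourierTransformInv.fourierInv γ) 0 = β 0 :=
        congrArg (fun f : SchwartzMap (Body p) ℂ => f 0)
          (FourierTransform.fourierInv_fourier_eq β)
      rw [SchwartzMap.fourierInv_coe, Real.fourierInv_eq', hβ, hb0] at h3
      rw [← h3]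
      simp [γ]
    calc ∫ u, Γ u = ∫ u, γ (r • u) := h1
      _ = _ := by
        rw [Measure.integral_comp_smul, h2]
        simp [finrank_euclideanSpace, two_mul]
  have hlim2 : Tendsto (fun ε : ℝ => oscIntegral c fun q : Body p × Body p => b (ε • q).1 * b q.2)
      (𝓝[>] 0) (𝓝 (∫ u, Γ u)) := by
    obtain ⟨C, hC⟩ := hbs.exists_bound_of_continuous hb.continuous
    have h1 : Tendsto (fun ε : ℝ => ∫ u, b (ε • u) * Γ u) (𝓝[>] 0) (𝓝 (∫ u, Γ u)) := by
      refine tendsto_integral_filter_of_dominated_convergence (fun u => C * ‖Γ u‖) ?_ ?_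
        (hΓ.norm.const_mul C) ?_
      · refine Eventually.of_forall fun ε => ?_
        refine (Continuous.aestronglyMeasurable ?_).mul hΓ.aestronglyMeasurable
        exact hb.continuous.comp (continuous_const_smul ε)
      · refine Eventually.of_forall fun ε => Eventually.of_forall fun u => ?_
        rw [norm_mul]
        gcongr
        exact hC _
      · refine Eventually.of_forall fun u => ?_
        have h2 : Tendsto (fun ε : ℝ => b (ε • u) * Γ u) (𝓝 0) (𝓝 (b ((0 : ℝ) • u) * Γ u)) := by
          refine Continuous.tendsto ?_ 0
          exact (hb.continuous.comp (by fun_prop)).mul continuous_const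
        rw [zero_smul, hb0, one_mul] at h2
        exact h2.mono_left nhdsWithin_le_nhds
    refine h1.congr' ?_
    filter_upwards [self_mem_nhdsWithin] with ε hε
    exact (hcompute ε hε).symm
  have h1 := tendsto_nhds_unique hlim1 hlim2
  -- the value on `1 ⊗ b` only involves `b 0`
  have h2 := evenStar_chr_left_aux (θ := -2 / c) (div_ne_zero (by norm_num) hc) 0
    (⟨0, isSym_of_hasCompactSupport hb hbs 0⟩ : PolyB b) 0
  have e : chr (0 : Body p) = fun _ => 1 := by ext x; exact chr_zero x
  have e2 : -2 / (-2 / c) = c := by field_simp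
  simp only [evenStar, e, e2, map_zero, smul_zero, add_zero, hb0, one_mul, zero_add] at h2
  rw [← h2, h1, hΓint]
  congr 1
  rw [abs_of_nonneg ((even_two_mul p).pow_nonneg r), hr, (even_two_mul p).neg_pow, ← inv_pow,
    inv_div]

theorem evenStar_one_one {θ : ℝ} (hθ : θ ≠ 0) (y : Body p) :
    evenStar θ (fun _ => 1) (fun _ => 1) y = (Real.pi * θ : ℂ) ^ (2 * p) := by
  have := oscIntegral_one (p := p) (phase_ne_zero hθ)
  simp only [evenStar, mul_one, this]
  have e : 2 * Real.pi / (-2 / θ) = -(Real.pi * θ) := by field_simp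
  rw [e, (even_two_mul p).neg_pow]
  push_cast
  rfl

theorem evenStar_chr_left {θ : ℝ} (hθ : θ ≠ 0) (κ : Body p) {g : Body p → ℂ} (hg : PolyB g)
    (y : Body p) :
    evenStar θ (chr κ) g y
      = (Real.pi * θ : ℂ) ^ (2 * p) * (chr κ y * g (y + (θ / 2) • rotJ p κ)) := by
  have h1 := evenStar_chr_right_aux hθ 0 (polyB_chr κ) y
  have e : chr (0 : Body p) = fun _ => 1 := by ext x; exact chr_zero x
  rw [e, evenStar_one_one hθ, map_zero, smul_zero, sub_zero] at h1
  rw [evenStar_chr_left_aux hθ κ hg, h1]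
  ring

/-- The even star-product at the origin with all test functions determines a function. -/
theorem eq_zero_of_evenStar_zero {θ : ℝ} (hθ : θ ≠ 0) {f : Body p → ℂ} (hf : PolyB f)
    (h : ∀ g : Body p → ℂ, ContDiff ℝ ∞ g → HasCompactSupport g → evenStar θ f g 0 = 0) :
    f = 0 := by
  have key : ∀ κ : Body p, evenStar θ f (chr κ) 0 = 0 := by
    intro κ
    obtain ⟨N, hN⟩ := hf
    obtain ⟨b, hb, hbs, hb0⟩ := exists_bump (Body p)
    have hχ : IsSym 0 (fun q : Body p × Body p => b q.2) := by
      simpa using (isSym_of_hasCompactSupport hb hbs 0).comp_affine (N := 0)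
        (ContinuousLinearMap.snd ℝ (Body p) (Body p)) 0
    have hT : IsSym (N : ℕ) (fun q : Body p × Body p => f (0 + q.1) * chr κ (0 + q.2)) := by
      have := isSym_tensor (M := 0) hN (isSym_chr κ) 0 0
      simpa only [Nat.cast_zero, add_zero] using this
    have h1 := tendsto_oscIntegral_cutoff (phase_ne_zero hθ) hχ hT
    simp only [Prod.snd_zero, hb0, one_mul] at h1
    refine tendsto_nhds_unique h1 (Tendsto.congr' ?_ tendsto_const_nhds)
    filter_upwards [self_mem_nhdsWithin] with ε hε
    have hε : ε ≠ 0 := ne_of_gt hε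
    have h2 := h (fun x => b (ε • x) * chr κ x)
      ((hb.comp (contDiff_const_smul ε)).mul (contDiff_chr κ))
      ((hbs.comp_homeomorph (Homeomorph.smulOfNeZero ε hε)).mul_right)
    rw [← h2, evenStar]
    congr 1
    ext q
    simp only [zero_add, Prod.smul_snd]
    ring
  ext x
  have h1 := key ((rotJ p).symm (-(2 / θ) • x))
  rw [evenStar_chr_right_aux hθ _ hf] at h1
  have h2 := evenStar_chr_left hθ 0 (polyB_chr ((rotJ p).symm (-(2 / θ) • x))) 0
  have e : chr (0 : Body p) = fun _ => 1 := by ext x; exact chr_zero x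
  rw [e, map_zero, smul_zero, add_zero, chr_apply_zero] at h2
  rw [h2, LinearIsometryEquiv.apply_symm_apply, smul_smul, zero_sub, ← neg_smul] at h1
  have e2 : -(θ / 2 * -(2 / θ)) = 1 := by field_simp
  rw [e2, one_smul] at h1
  have hne : (Real.pi * θ : ℂ) ^ (2 * p) ≠ 0 := pow_ne_zero _ (mul_ne_zero
    (by exact_mod_cast Real.pi_ne_zero) (by exact_mod_cast hθ))
  simpa [hne] using h1

/-- Taking determinants in `MᵀJM = J` shows that `det M = ±1`. -/
theorem measurePreserving_of_symplectic (R : Body p ≃L[ℝ] Body p)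
    (hω : ∀ u v, omegaBody (R u) (R v) = omegaBody u v) :
    MeasurePreserving R volume volume := by
  classical
  let b := (EuclideanSpace.basisFun (EvenIdx p) ℝ).toBasis
  let M := LinearMap.toMatrix b b (R : Body p →ₗ[ℝ] Body p)
  let J := LinearMap.BilinForm.toMatrix b (omegaLin p)
  have hcomp : LinearMap.BilinForm.comp (omegaLin p) (R : Body p →ₗ[ℝ] Body p) R = omegaLin p := by
    ext u v
    exact hω u v
  have hM : M.transpose * J * M = J := by
    have := LinearMap.BilinForm.toMatrix_comp b b (omegaLin p) (R : Body p →ₗ[ℝ] Body p)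
      (R : Body p →ₗ[ℝ] Body p)
    rw [hcomp] at this
    exact this.symm
  have hJ : J.det ≠ 0 := by
    rw [← LinearMap.BilinForm.nondegenerate_iff_det_ne_zero b]
    have hsep : ∀ u : Body p, omegaBody u (rotJ p u) = 0 → u = 0 := fun u hu => by
      rwa [omegaBody_rotJ, inner_self_eq_zero] at hu
    refine ⟨fun u hu => hsep u (hu (rotJ p u)), fun u hu => hsep u ?_⟩
    rw [omegaBody_swap, ← omegaLin_apply, hu, neg_zero]
  have hdet : LinearMap.det (R : Body p →ₗ[ℝ] Body p) ^ 2 = 1 := by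
    have h1 := congrArg Matrix.det hM
    rw [Matrix.det_mul, Matrix.det_mul, Matrix.det_transpose, LinearMap.det_toMatrix] at h1
    refine mul_right_cancel₀ hJ ?_
    linear_combination h1
  have habs : |LinearMap.det (R : Body p →ₗ[ℝ] Body p)| = 1 := by
    rw [← sq_eq_sq₀ (abs_nonneg _) zero_le_one, sq_abs, hdet, one_pow]
  refine ⟨R.continuous.measurable, ?_⟩
  have h2 := Measure.map_linearMap_addHaar_eq_smul_addHaar (volume : Measure (Body p))
    (f := (R : Body p →ₗ[ℝ] Body p)) (fun h => by rw [h] at habs; simp at habs)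
  rw [abs_inv, habs, inv_one, ENNReal.ofReal_one, one_smul] at h2
  exact h2

end Cutoff

/-! ### Ordered monomials in anticommuting variables -/

section Monomials

variable {n : ℕ} {R : Type*} [Ring R]

/-- The number of elements of `I` below `i`. -/
def lowCard (i : Fin n) (I : Finset (Fin n)) : ℕ := (I.filter (· < i)).card

/-- The ordered monomial `x^I`. -/
def mono (x : Fin n → R) (I : Finset (Fin n)) : R := (I.sort.map x).prod

theorem lowCard_insert_lt {a i : Fin n} {s : Finset (Fin n)} (ha : a ∉ s) (h : a < i) :
    lowCard i (insert a s) = lowCard i s + 1 := by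
  rw [lowCard, Finset.filter_insert, if_pos h, Finset.card_insert_of_notMem]
  · rfl
  · simp [ha]

theorem lowCard_of_forall_le {i : Fin n} {s : Finset (Fin n)} (h : ∀ b ∈ s, i ≤ b) :
    lowCard i s = 0 := by
  rw [lowCard, Finset.card_eq_zero, Finset.filter_eq_empty_iff]
  exact fun b hb => not_lt.mpr (h b hb)

theorem lowCard_insert_self (i : Fin n) (s : Finset (Fin n)) :
    lowCard i (insert i s) = lowCard i s := by
  rw [lowCard, Finset.filter_insert, if_neg (lt_irrefl i), lowCard]

theorem lowCard_erase_self (i : Fin n) (s : Finset (Fin n)) :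
    lowCard i (s.erase i) = lowCard i s := by
  rw [lowCard, Finset.filter_erase, Finset.erase_eq_of_notMem (by simp), lowCard]

theorem mono_empty (x : Fin n → R) : mono x ∅ = 1 := by simp [mono]

theorem mono_insert {x : Fin n → R} {a : Fin n} {s : Finset (Fin n)} (h : ∀ b ∈ s, a < b) :
    mono x (insert a s) = x a * mono x s := by
  rw [mono, Finset.sort_insert (· ≤ ·) (fun b hb => (h b hb).le) fun ha => lt_irrefl _ (h a ha),
    List.map_cons, List.prod_cons, mono]

/-- Sorting a factor into an ordered monomial. -/
theorem mul_mono {x : Fin n → R} (hx : ∀ i j, x i * x j = -(x j * x i)) (hsq : ∀ i, x i * x i = 0)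
    (i : Fin n) (I : Finset (Fin n)) :
    x i * mono x I = if i ∈ I then 0 else (-1) ^ lowCard i I * mono x (insert i I) := by
  induction I using Finset.induction_on_min with
  | empty =>
    rw [if_neg (Finset.notMem_empty i), mono_insert (by simp)]
    simp [lowCard]
  | insert a s ha ih =>
    have has : a ∉ s := fun h => lt_irrefl _ (ha a h)
    rw [mono_insert ha]
    rcases lt_trichotomy i a with hi | rfl | hi
    · have h1 : ∀ b ∈ insert a s, i < b := by
        intro b hb
        rcases Finset.mem_insert.mp hb with rfl | hb
        · exact hi
        · exact hi.trans (ha b hb)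
      rw [if_neg fun h => lt_irrefl _ (h1 i h), lowCard_of_forall_le fun b hb => (h1 b hb).le,
        pow_zero, one_mul, mono_insert h1, mono_insert ha]
    · rw [if_pos (Finset.mem_insert_self _ _), ← mul_assoc, hsq, zero_mul]
    · rw [← mul_assoc, hx, neg_mul, mul_assoc, ih]
      by_cases his : i ∈ s
      · rw [if_pos his, if_pos (Finset.mem_insert_of_mem his), mul_zero, neg_zero]
      · have h2 : i ∉ insert a s := by simp [his, hi.ne']
        have h3 : ∀ b ∈ insert i s, a < b := by
          intro b hb
          rcases Finset.mem_insert.mp hb with rfl | hb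
          · exact hi
          · exact ha b hb
        rw [if_neg his, if_neg h2, Finset.insert_comm, mono_insert h3, lowCard_insert_lt has hi,
          pow_succ]
        have hc := ((Commute.neg_one_left (x a)).pow_left (lowCard i s)).eq
        rw [← mul_assoc, ← hc]
        noncomm_ring

theorem anticomm_mono {x : Fin n → R} {z : R} (hz : ∀ j, z * x j = -(x j * z))
    (I : Finset (Fin n)) : z * mono x I = (-1) ^ I.card * (mono x I * z) := by
  induction I using Finset.induction_on_min with
  | empty => simp [mono_empty]
  | insert a s ha ih =>
    have has : a ∉ s := fun h => lt_irrefl _ (ha a h)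
    have hc := ((Commute.neg_one_left (x a)).pow_left s.card).eq
    rw [mono_insert ha, ← mul_assoc, hz, neg_mul, mul_assoc, ih, Finset.card_insert_of_notMem has,
      pow_succ, ← mul_assoc, ← hc]
    noncomm_ring

/-- An odd derivation on a product with a monomial in which it vanishes. -/
theorem odd_mono_mul {x : Fin n → R} {D : R →+ R} (hD : ∀ j y, D (x j * y) = -(x j * D y))
    (I : Finset (Fin n)) (y : R) : D (mono x I * y) = (-1) ^ I.card * (mono x I * D y) := by
  induction I using Finset.induction_on_min with
  | empty => simp [mono_empty]
  | insert a s ha ih =>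
    have has : a ∉ s := fun h => lt_irrefl _ (ha a h)
    have hc := ((Commute.neg_one_left (x a)).pow_left s.card).eq
    rw [mono_insert ha, mul_assoc, hD, ih, Finset.card_insert_of_notMem has, pow_succ,
      ← mul_assoc, ← hc]
    noncomm_ring

/-- The odd derivation `∂_i` on a product with a monomial. -/
theorem oddDer_mono_mul {x : Fin n → R} {D : R →+ R} {i : Fin n}
    (hD : ∀ j y, D (x j * y) = (if i = j then y else 0) - x j * D y)
    (I : Finset (Fin n)) (y : R) :
    D (mono x I * y) = (if i ∈ I then (-1) ^ lowCard i I * mono x (I.erase i) else 0) * y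
      + (-1) ^ I.card * (mono x I * D y) := by
  induction I using Finset.induction_on_min with
  | empty => simp [mono_empty]
  | insert a s ha ih =>
    have has : a ∉ s := fun h => lt_irrefl _ (ha a h)
    have hc := ((Commute.neg_one_left (x a)).pow_left s.card).eq
    have hlast : x a * ((-1) ^ s.card * (mono x s * D y))
        = (-1) ^ s.card * (x a * (mono x s * D y)) := by
      rw [← mul_assoc, ← hc, mul_assoc]
    rw [mono_insert ha, mul_assoc, hD, ih, Finset.card_insert_of_notMem has, pow_succ, mul_add,
      hlast]
    rcases eq_or_ne i a with rfl | hia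
    · rw [if_pos rfl, if_neg has, if_pos (Finset.mem_insert_self _ _), Finset.erase_insert has,
        lowCard_of_forall_le (fun b hb => ?_)]
      · noncomm_ring
      · rcases Finset.mem_insert.mp hb with rfl | hb
        · exact le_rfl
        · exact (ha b hb).le
    · rw [if_neg hia]
      by_cases his : i ∈ s
      · have hai := ha i his
        have h3 : ∀ b ∈ s.erase i, a < b := fun b hb => ha b (Finset.mem_of_mem_erase hb)
        have hc' := ((Commute.neg_one_left (x a)).pow_left (lowCard i s)).eq
        have e : x a * ((-1) ^ lowCard i s * mono x (s.erase i) * y)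
            = (-1) ^ lowCard i s * (x a * (mono x (s.erase i) * y)) := by
          rw [mul_assoc, ← mul_assoc, ← hc', mul_assoc]
        rw [if_pos his, if_pos (Finset.mem_insert_of_mem his), Finset.erase_insert_of_ne hia.symm,
          mono_insert h3, lowCard_insert_lt has hai, pow_succ, e]
        noncomm_ring
      · rw [if_neg his, if_neg (by simp [his, hia])]
        noncomm_ring

end Monomials

/-! ### The kernel of the odd star-product -/

section OddKernel

variable {n : ℕ}

theorem gen_mul_gen (a a' : Fin 3) (i j : Fin n) : gen a i * gen a' j = -(gen a' j * gen a i) :=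
  eq_neg_of_add_eq_zero_left (ExteriorAlgebra.ι_add_mul_swap _ _)

theorem gen_mul_self (a : Fin 3) (i : Fin n) : gen a i * gen a i = 0 :=
  ExteriorAlgebra.ι_sq_zero _

theorem oddDeriv_gen_mul (a a' : Fin 3) (i j : Fin n) (y : OddAlg n) :
    oddDeriv a i (gen a' j * y) = (if a = a' ∧ i = j then y else 0) - gen a' j * oddDeriv a i y := by
  have h := CliffordAlgebra.contractLeft_ι_mul (Q := (0 : QuadraticForm ℂ (Fin 3 × Fin n → ℂ)))
    (LinearMap.proj (a, i)) (Pi.single (a', j) (1 : ℂ)) y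
  rw [LinearMap.proj_apply, Pi.single_apply] at h
  refine Eq.trans h ?_
  simp only [Prod.mk.injEq, ite_smul, one_smul, zero_smul]
  rfl

theorem oddDeriv_one (a : Fin 3) (i : Fin n) : oddDeriv a i (1 : OddAlg n) = 0 :=
  CliffordAlgebra.contractLeft_one _ _

theorem oddDeriv_self (a : Fin 3) (i : Fin n) (y : OddAlg n) :
    oddDeriv a i (oddDeriv a i y) = 0 := CliffordAlgebra.contractLeft_contractLeft _ _

theorem oddDeriv_comm (a a' : Fin 3) (i j : Fin n) (y : OddAlg n) :
    oddDeriv a i (oddDeriv a' j y) = -oddDeriv a' j (oddDeriv a i y) :=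
  CliffordAlgebra.contractLeft_comm _ _ _

/-- The derivatives along a list of odd variables, taken from left to right. -/
def derivList (a : Fin 3) (l : List (Fin n)) : OddAlg n →ₗ[ℂ] OddAlg n :=
  l.foldl (fun L i => oddDeriv a i ∘ₗ L) LinearMap.id

theorem foldl_oddDeriv_comp (a : Fin 3) (l : List (Fin n)) (L : OddAlg n →ₗ[ℂ] OddAlg n)
    (y : OddAlg n) : l.foldl (fun L i => oddDeriv a i ∘ₗ L) L y
      = l.foldl (fun H i => oddDeriv a i H) (L y) := by
  induction l generalizing L with
  | nil => rfl
  | cons i l ih => exact ih _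

theorem derivList_eq_foldl (a : Fin 3) (l : List (Fin n)) (y : OddAlg n) :
    derivList a l y = l.foldl (fun H i => oddDeriv a i H) y := foldl_oddDeriv_comp a l _ y

theorem derivList_nil (a : Fin 3) (y : OddAlg n) : derivList a [] y = y := rfl

theorem derivList_cons (a : Fin 3) (i : Fin n) (l : List (Fin n)) (y : OddAlg n) :
    derivList a (i :: l) y = derivList a l (oddDeriv a i y) := by
  rw [derivList_eq_foldl, derivList_eq_foldl, List.foldl_cons]

theorem oddDerivs_eq (a : Fin 3) (I : Finset (Fin n)) (y : OddAlg n) :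
    oddDerivs a I y = derivList a I.sort y := (derivList_eq_foldl _ _ _).symm

/-- Odd derivatives pass, with a sign, an odd element that they annihilate. -/
theorem derivList_anticomm_mul {a : Fin 3} {u : OddAlg n}
    (hu : ∀ i y, oddDeriv a i (u * y) = -(u * oddDeriv a i y)) (l : List (Fin n)) (y : OddAlg n) :
    derivList a l (u * y) = (-1) ^ l.length * (u * derivList a l y) := by
  induction l generalizing y with
  | nil => simp [derivList_nil]
  | cons i l ih =>
    rw [derivList_cons, derivList_cons, hu, map_neg, ih, List.length_cons, pow_succ]
    noncomm_ring

theorem derivList_oddDeriv (a a' : Fin 3) (i : Fin n) (l : List (Fin n)) (y : OddAlg n) :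
    derivList a l (oddDeriv a' i y) = (-1) ^ l.length * oddDeriv a' i (derivList a l y) := by
  have hs : ∀ (k : ℕ) (x : OddAlg n), oddDeriv a' i ((-1) ^ k * x) = (-1) ^ k * oddDeriv a' i x := by
    intro k x
    rcases neg_one_pow_eq_or (OddAlg n) k with h | h <;> simp [h]
  induction l generalizing y with
  | nil => simp [derivList_nil]
  | cons j l ih =>
    rw [derivList_cons, derivList_cons, oddDeriv_comm, map_neg, ih, List.length_cons, pow_succ]
    noncomm_ring

theorem derivList_oddDeriv_mem {a : Fin 3} {i : Fin n} {l : List (Fin n)} (h : i ∈ l)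
    (y : OddAlg n) : derivList a l (oddDeriv a i y) = 0 := by
  induction l generalizing y with
  | nil => simp at h
  | cons j l ih =>
    rw [derivList_cons]
    rcases List.mem_cons.mp h with rfl | h
    · rw [oddDeriv_self, map_zero]
    · rw [oddDeriv_comm, map_neg, ih h, neg_zero]

theorem berezin_eq (a : Fin 3) (y : OddAlg n) :
    berezin a y = derivList a (Finset.univ : Finset (Fin n)).sort y := oddDerivs_eq _ _ _

/-- Berezin integrals annihilate derivatives. -/
theorem berezin_oddDeriv (a : Fin 3) (i : Fin n) (y : OddAlg n) :
    berezin a (oddDeriv a i y) = 0 := by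
  rw [berezin_eq]
  exact derivList_oddDeriv_mem (by simp) y

theorem berezin_add (a : Fin 3) (y y' : OddAlg n) :
    berezin a (y + y') = berezin a y + berezin a y' := by
  simp only [berezin_eq, map_add]

theorem berezin_smul (a : Fin 3) (r : ℂ) (y : OddAlg n) :
    berezin a (r • y) = r • berezin a y := by
  simp only [berezin_eq, map_smul]

/-- Multiplication by a generator that is not integrated. -/
theorem berezin_gen_mul {a a' : Fin 3} (h : a ≠ a') (i : Fin n) (y : OddAlg n) :
    berezin a (gen a' i * y) = (-1) ^ n * (gen a' i * berezin a y) := by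
  rw [berezin_eq, berezin_eq, derivList_anticomm_mul]
  · simp
  · intro j y
    rw [oddDeriv_gen_mul, if_neg (fun h' => h h'.1), zero_sub]

/-- The coefficient of `ξ^K`. -/
def coefK (K : Finset (Fin n)) : OddAlg n →ₗ[ℂ] ℂ :=
  (ExteriorAlgebra.algebraMapInv (R := ℂ)).toLinearMap ∘ₗ derivList 0 K.sort

theorem algebraMapInv_gen (a : Fin 3) (i : Fin n) :
    (ExteriorAlgebra.algebraMapInv (gen a i) : ℂ) = 0 := by
  simp [gen, ExteriorAlgebra.algebraMapInv]

theorem algebraMapInv_derivList_gen_mul (i : Fin n) (l : List (Fin n)) (hl : i ∉ l)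
    (y : OddAlg n) :
    (ExteriorAlgebra.algebraMapInv (derivList 0 l (gen 0 i * y)) : ℂ) = 0 := by
  induction l generalizing y with
  | nil => rw [derivList_nil, map_mul, algebraMapInv_gen, zero_mul]
  | cons j l ih =>
    rw [List.mem_cons, not_or] at hl
    rw [derivList_cons, oddDeriv_gen_mul, if_neg (fun h => hl.1 h.2.symm), zero_sub, map_neg,
      map_neg, ih hl.2, neg_zero]

theorem coefK_gen_mul (i : Fin n) (K : Finset (Fin n)) (y : OddAlg n) :
    coefK K (gen 0 i * y) = if i ∈ K then (-1) ^ lowCard i K * coefK (K.erase i) y else 0 := by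
  simp only [coefK, LinearMap.comp_apply]
  induction K using Finset.induction_on_min generalizing y with
  | empty =>
    simp only [Finset.sort_empty, derivList_nil, AlgHom.toLinearMap_apply, map_mul,
      algebraMapInv_gen, zero_mul]
    simp
  | insert a s ha ih =>
    have has : a ∉ s := fun h => lt_irrefl _ (ha a h)
    rw [Finset.sort_insert (· ≤ ·) (fun b hb => (ha b hb).le) has, derivList_cons,
      oddDeriv_gen_mul]
    rcases eq_or_ne a i with rfl | hia
    · have h0 := algebraMapInv_derivList_gen_mul a s.sort (by simpa using has) (oddDeriv 0 a y)
      rw [if_pos ⟨rfl, rfl⟩, if_pos (Finset.mem_insert_self _ _), Finset.erase_insert has,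
        lowCard_of_forall_le (fun b hb => ?_), map_sub, map_sub, AlgHom.toLinearMap_apply,
        AlgHom.toLinearMap_apply, h0]
      · simp
      · rcases Finset.mem_insert.mp hb with rfl | hb
        · exact le_rfl
        · exact (ha b hb).le
    · rw [if_neg (fun h => hia h.2), zero_sub, map_neg, map_neg, ih]
      by_cases his : i ∈ s
      · have h3 : ∀ b ∈ s.erase i, a < b := fun b hb => ha b (Finset.mem_of_mem_erase hb)
        rw [if_pos his, if_pos (Finset.mem_insert_of_mem his), Finset.erase_insert_of_ne hia,
          Finset.sort_insert (· ≤ ·) (fun b hb => (h3 b hb).le)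
            (fun h => has (Finset.mem_of_mem_erase h)), derivList_cons,
          lowCard_insert_lt has (ha i his), pow_succ]
        ring
      · rw [if_neg his, if_neg (by simp [his, hia.symm]), neg_zero]

theorem coefK_one (K : Finset (Fin n)) :
    coefK K (1 : OddAlg n) = if K = ∅ then 1 else 0 := by
  rcases K.eq_empty_or_nonempty with rfl | ⟨i, hi⟩
  · simp [coefK, derivList_nil]
  · rw [if_neg (Finset.ne_empty_of_mem hi), coefK, LinearMap.comp_apply]
    have : derivList 0 K.sort (1 : OddAlg n) = 0 := by
      cases h : K.sort with
      | nil => simp [← Finset.mem_sort (· ≤ ·), h] at hi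
      | cons j l => rw [derivList_cons, oddDeriv_one, map_zero]
    rw [this, map_zero]

theorem coefK_genMonomial (J K : Finset (Fin n)) :
    coefK K (genMonomial 0 J) = if J = K then 1 else 0 := by
  change coefK K (mono (gen 0) J) = _
  induction J using Finset.induction_on_min generalizing K with
  | empty => simp only [mono_empty, coefK_one, eq_comm]
  | insert a s ha ih =>
    have has : a ∉ s := fun h => lt_irrefl _ (ha a h)
    rw [mono_insert ha, coefK_gen_mul]
    by_cases haK : a ∈ K
    · rw [if_pos haK, ih]
      by_cases hs : s = K.erase a
      · have hK : insert a s = K := by rw [hs, Finset.insert_erase haK]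
        rw [if_pos hs, if_pos hK, mul_one, ← hK, lowCard_insert_self,
          lowCard_of_forall_le fun b hb => (ha b hb).le, pow_zero]
      · rw [if_neg hs, mul_zero, if_neg]
        rintro rfl
        exact hs (Finset.erase_insert has).symm
    · rw [if_neg haK, if_neg]
      rintro rfl
      exact haK (Finset.mem_insert_self _ _)

/-! #### The phase and its exponential -/

theorem gen_mul_gen_commute (a a' a'' : Fin 3) (i j k : Fin n) :
    Commute (gen a i * gen a' j) (gen a'' k) := by
  rw [Commute, SemiconjBy, mul_assoc, gen_mul_gen a' a'', mul_neg, ← mul_assoc, gen_mul_gen a a'']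
  noncomm_ring

theorem oddPhase_commute_gen (a : Fin 3) (i : Fin n) : Commute (oddPhase n) (gen a i) := by
  refine Commute.sum_left _ _ _ fun j _ => ?_
  exact ((gen_mul_gen_commute _ _ _ _ _ _).add_left (gen_mul_gen_commute _ _ _ _ _ _)).add_left
    (gen_mul_gen_commute _ _ _ _ _ _)

theorem isNilpotent_oddPhase (n : ℕ) : IsNilpotent (oddPhase n) := by
  have hc : ∀ (a a' b b' : Fin 3) (i j : Fin n),
      Commute (gen a i * gen a' i) (gen b j * gen b' j) := fun a a' b b' i j =>
    (gen_mul_gen_commute a a' b i i j).mul_right (gen_mul_gen_commute a a' b' i i j)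
  have hn : ∀ (a a' : Fin 3) (i : Fin n), IsNilpotent (gen a i * gen a' i) := fun a a' i => by
    refine ⟨2, ?_⟩
    rw [pow_two, ← mul_assoc, (gen_mul_gen_commute a a' a i i i).eq, ← mul_assoc, gen_mul_self,
      zero_mul, zero_mul]
  refine Commute.isNilpotent_sum (fun i _ => ?_) fun i j _ _ => ?_
  · exact ((hc _ _ _ _ _ _).add_left (hc _ _ _ _ _ _)).isNilpotent_add
      ((hc _ _ _ _ _ _).isNilpotent_add (hn _ _ _) (hn _ _ _)) (hn _ _ _)
  · exact (((hc _ _ _ _ _ _).add_left (hc _ _ _ _ _ _)).add_left (hc _ _ _ _ _ _)).add_right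
      (((hc _ _ _ _ _ _).add_left (hc _ _ _ _ _ _)).add_left (hc _ _ _ _ _ _)) |>.add_right
      (((hc _ _ _ _ _ _).add_left (hc _ _ _ _ _ _)).add_left (hc _ _ _ _ _ _))

/-- The derivative of the exponential of the phase, as soon as the derivative of the phase is
known. -/
theorem oddDeriv_exp {a : Fin 3} {i : Fin n} {w : OddAlg n}
    (hw : ∀ y, oddDeriv a i (oddPhase n * y) = w * y + oddPhase n * oddDeriv a i y)
    (hcw : Commute (oddPhase n) w) (b : ℂ) :
    oddDeriv a i (IsNilpotent.exp (b • oddPhase n))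
      = b • (w * IsNilpotent.exp (b • oddPhase n)) := by
  obtain ⟨k, hk⟩ := isNilpotent_oddPhase n
  have hk1 : (b • oddPhase n) ^ k = 0 := by rw [smul_pow, hk, smul_zero]
  have hk2 : (b • oddPhase n) ^ (k + 1) = 0 := by rw [pow_succ, hk1, zero_mul]
  have hpow : ∀ j : ℕ, oddDeriv a i (oddPhase n ^ (j + 1))
      = ((j + 1 : ℕ) : ℂ) • (w * oddPhase n ^ j) := by
    intro j
    induction j with
    | zero => simpa [oddDeriv_one] using hw 1
    | succ j ih =>
      rw [pow_succ' _ (j + 1), hw, ih, mul_smul_comm, ← mul_assoc, hcw.eq, mul_assoc,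
        ← pow_succ', Nat.cast_succ (j + 1), add_smul, one_smul, add_comm]
  conv_lhs => rw [IsNilpotent.exp_eq_sum hk2]
  rw [IsNilpotent.exp_eq_sum hk1, Finset.sum_range_succ', map_add, map_sum, Finset.mul_sum,
    Finset.smul_sum]
  rw [pow_zero, map_rat_smul, oddDeriv_one, smul_zero, add_zero]
  refine Finset.sum_congr rfl fun j _ => ?_
  rw [map_rat_smul, smul_pow, map_smul, hpow, smul_pow, mul_smul_comm, mul_smul_comm,
    Nat.factorial_succ]
  have hj : ((j + 1 : ℕ) : ℂ) ≠ 0 := by exact_mod_cast Nat.succ_ne_zero j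
  have hf : ((j.factorial : ℕ) : ℂ) ≠ 0 := by exact_mod_cast Nat.factorial_ne_zero j
  have hq : ∀ (q : ℚ) (y : OddAlg n), q • y = (q : ℂ) • y := fun q y => by
    rw [← Rat.smul_one_eq_cast (A := ℂ), smul_assoc, one_smul]
  rw [hq, hq, smul_smul, smul_smul, smul_smul, smul_smul]
  congr 1
  push_cast at hj ⊢
  field_simp
  ring

end OddKernel

section OddKernelRecursion

variable {n : ℕ}

theorem oddDeriv_two_oddPhase (i : Fin n) (y : OddAlg n) :
    oddDeriv 2 i (oddPhase n * y) = (gen 0 i - gen 1 i) * y + oddPhase n * oddDeriv 2 i y := by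
  have h : ∀ j : Fin n, oddDeriv 2 i
      ((gen 0 j * gen 1 j + gen 1 j * gen 2 j + gen 2 j * gen 0 j) * y)
      = (if i = j then (gen 0 j - gen 1 j) * y else 0)
        + (gen 0 j * gen 1 j + gen 1 j * gen 2 j + gen 2 j * gen 0 j) * oddDeriv 2 i y := by
    intro j
    simp only [add_mul, mul_assoc, map_add, oddDeriv_gen_mul]
    by_cases hij : i = j
    · simp only [hij]
      simp
      noncomm_ring
    · simp [hij]
  rw [oddPhase, Finset.sum_mul, map_sum, Finset.sum_mul]
  simp only [h]
  rw [Finset.sum_add_distrib, Finset.sum_ite_eq, if_pos (Finset.mem_univ i)]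

theorem oddDeriv_one_oddPhase (i : Fin n) (y : OddAlg n) :
    oddDeriv 1 i (oddPhase n * y) = (gen 2 i - gen 0 i) * y + oddPhase n * oddDeriv 1 i y := by
  have h : ∀ j : Fin n, oddDeriv 1 i
      ((gen 0 j * gen 1 j + gen 1 j * gen 2 j + gen 2 j * gen 0 j) * y)
      = (if i = j then (gen 2 j - gen 0 j) * y else 0)
        + (gen 0 j * gen 1 j + gen 1 j * gen 2 j + gen 2 j * gen 0 j) * oddDeriv 1 i y := by
    intro j
    simp only [add_mul, mul_assoc, map_add, oddDeriv_gen_mul]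
    by_cases hij : i = j
    · simp only [hij]
      simp
      noncomm_ring
    · simp [hij]
  rw [oddPhase, Finset.sum_mul, map_sum, Finset.sum_mul]
  simp only [h]
  rw [Finset.sum_add_distrib, Finset.sum_ite_eq, if_pos (Finset.mem_univ i)]

/-- The exponential in the odd kernel. -/
def oddExp (n : ℕ) (b : ℂ) : OddAlg n := IsNilpotent.exp (b • oddPhase n)

theorem oddDeriv_two_oddExp (b : ℂ) (i : Fin n) :
    oddDeriv 2 i (oddExp n b) = b • ((gen 0 i - gen 1 i) * oddExp n b) :=
  oddDeriv_exp (oddDeriv_two_oddPhase i)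
    ((oddPhase_commute_gen 0 i).sub_right (oddPhase_commute_gen 1 i)) b

theorem oddDeriv_one_oddExp (b : ℂ) (i : Fin n) :
    oddDeriv 1 i (oddExp n b) = b • ((gen 2 i - gen 0 i) * oddExp n b) :=
  oddDeriv_exp (oddDeriv_one_oddPhase i)
    ((oddPhase_commute_gen 2 i).sub_right (oddPhase_commute_gen 0 i)) b

/-- The Berezin integral over `ξ₁` and `ξ₂` against the kernel. -/
def oddInt (b : ℂ) (y : OddAlg n) : OddAlg n := berezin 1 (berezin 2 (y * oddExp n b))

theorem oddInt_add (b : ℂ) (y y' : OddAlg n) : oddInt b (y + y') = oddInt b y + oddInt b y' := by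
  simp only [oddInt, add_mul, berezin_add]

theorem oddInt_smul (b r : ℂ) (y : OddAlg n) : oddInt b (r • y) = r • oddInt b y := by
  simp only [oddInt, smul_mul_assoc, berezin_smul]

theorem oddInt_zero (b : ℂ) : oddInt (n := n) b 0 = 0 := by
  simpa using oddInt_smul (n := n) b 0 0

theorem neg_one_pow_mul_eq_smul {k : ℕ} (y : OddAlg n) : (-1) ^ k * y = ((-1) ^ k : ℂ) • y := by
  rcases neg_one_pow_eq_or ℂ k with h | h
  · rw [h, one_smul]
    rcases (Nat.even_or_odd k) with hk | hk
    · rw [hk.neg_one_pow, one_mul]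
    · rw [hk.neg_one_pow] at h; norm_num at h
  · rw [h, neg_one_smul]
    rcases (Nat.even_or_odd k) with hk | hk
    · rw [hk.neg_one_pow] at h; norm_num at h
    · rw [hk.neg_one_pow, neg_one_mul]

theorem neg_one_pow_mul_self {R : Type*} [Ring R] (k : ℕ) (y : R) :
    (-1) ^ k * ((-1) ^ k * y) = y := by
  rw [← mul_assoc, ← pow_add, ← two_mul, pow_mul]; simp

theorem oddInt_gen_zero_mul (b : ℂ) (i : Fin n) (y : OddAlg n) :
    oddInt b (gen 0 i * y) = gen 0 i * oddInt b y := by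
  rw [oddInt, mul_assoc, berezin_gen_mul (by decide), neg_one_pow_mul_eq_smul, berezin_smul,
    berezin_gen_mul (by decide), ← neg_one_pow_mul_eq_smul, neg_one_pow_mul_self, oddInt]

theorem oddKernel_eq (b : ℂ) (I J K : Finset (Fin n)) :
    oddKernel b I J K = coefK K (oddInt b (genMonomial 1 I * genMonomial 2 J)) := by
  rw [oddKernel, oddDerivs_eq]
  rfl

theorem genMonomial_eq (a : Fin 3) (I : Finset (Fin n)) : genMonomial a I = mono (gen a) I := rfl

theorem gen_mul_genMonomial (a : Fin 3) (i : Fin n) (I : Finset (Fin n)) :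
    gen a i * genMonomial a I
      = if i ∈ I then 0 else (-1) ^ lowCard i I * genMonomial a (insert i I) :=
  mul_mono (gen_mul_gen a a) (gen_mul_self a) i I

/-- Integration by parts in `ξ₂`. -/
theorem oddInt_gen_one_mul {b : ℂ} (hb : b ≠ 0) (i : Fin n) (I J : Finset (Fin n)) :
    oddInt b (gen 1 i * genMonomial 1 I * genMonomial 2 J)
      = gen 0 i * oddInt b (genMonomial 1 I * genMonomial 2 J)
        + (b⁻¹ * (-1) ^ I.card) • oddInt b (genMonomial 1 I *
          (if i ∈ J then (-1) ^ lowCard i J * genMonomial 2 (J.erase i) else 0)) := by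
  set X : OddAlg n := genMonomial 1 I * genMonomial 2 J with hX
  set E := oddExp n b with hE
  -- the boundary term of the integration by parts
  have h1 : oddDeriv 2 i (X * E)
      = (-1) ^ I.card * ((genMonomial 1 I *
          (if i ∈ J then (-1) ^ lowCard i J * genMonomial 2 (J.erase i) else 0)) * E)
        + b • ((gen 0 i - gen 1 i) * X * E) := by
    have hI := odd_mono_mul (x := gen 1) (D := (oddDeriv 2 i).toAddMonoidHom)
      (fun j y => by
        change oddDeriv 2 i (gen 1 j * y) = -(gen 1 j * oddDeriv 2 i y)
        rw [oddDeriv_gen_mul, if_neg (fun h => absurd h.1 (by decide)), zero_sub]) I (genMonomial 2 J * E)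
    have hJ := oddDer_mono_mul (x := gen 2) (D := (oddDeriv 2 i).toAddMonoidHom) (i := i)
      (fun j y => by
        change oddDeriv 2 i (gen 2 j * y) = _ - gen 2 j * oddDeriv 2 i y
        rw [oddDeriv_gen_mul]; simp) J E
    simp only [LinearMap.toAddMonoidHom_coe, ← genMonomial_eq] at hI hJ
    have hpass : ∀ z : OddAlg n, (∀ (a : Fin 3) (j : Fin n), z * gen a j = -(gen a j * z)) →
        z * X = (-1) ^ I.card * ((-1) ^ J.card * (X * z)) := by
      intro z hz
      have e1 : z * genMonomial 1 I = (-1) ^ I.card * (genMonomial 1 I * z) :=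
        anticomm_mono (hz 1) I
      have e2 : z * genMonomial 2 J = (-1) ^ J.card * (genMonomial 2 J * z) :=
        anticomm_mono (hz 2) J
      rw [hX, ← mul_assoc, e1, mul_assoc, mul_assoc, e2, mul_assoc,
        neg_one_pow_mul_eq_smul (k := J.card), neg_one_pow_mul_eq_smul (k := J.card),
        mul_smul_comm]
    have hz : (gen 0 i - gen 1 i) * X
        = (-1) ^ I.card * ((-1) ^ J.card * (X * (gen 0 i - gen 1 i))) := by
      refine hpass _ fun a j => ?_
      rw [sub_mul, mul_sub, gen_mul_gen 0 a, gen_mul_gen 1 a]; abel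
    rw [hz, hX, mul_assoc, hI, hJ, oddDeriv_two_oddExp, ← hE]
    simp only [mul_add, neg_one_pow_mul_eq_smul, mul_smul_comm, smul_mul_assoc, mul_assoc,
      smul_smul, mul_comm b]
  have h2 : berezin 1 (berezin 2 (oddDeriv 2 i (X * E))) = 0 := by
    rw [berezin_oddDeriv]
    simpa using berezin_smul (n := n) 1 0 0
  rw [h1, neg_one_pow_mul_eq_smul, berezin_add, berezin_add, berezin_smul, berezin_smul,
    berezin_smul, berezin_smul] at h2
  change _ • oddInt b _ + b • oddInt b ((gen 0 i - gen 1 i) * X) = 0 at h2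
  have h3 : (gen 0 i - gen 1 i) * X = gen 0 i * X + (-1 : ℂ) • (gen 1 i * X) := by
    rw [sub_mul, neg_one_smul, sub_eq_add_neg]
  rw [h3, oddInt_add, oddInt_smul, oddInt_gen_zero_mul, neg_one_smul] at h2
  rw [mul_assoc, ← hX]
  have h4 := congrArg (fun y => b⁻¹ • y) h2
  simp only [smul_add, smul_smul, inv_mul_cancel₀ hb, one_smul, smul_zero] at h4
  refine sub_eq_zero.mp (neg_eq_zero.mp (Eq.trans ?_ h4))
  abel

/-- The recursion for the kernel in its first argument. -/
theorem oddKernel_insert {b : ℂ} (hb : b ≠ 0) (i : Fin n) (I J K : Finset (Fin n)) :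
    (if i ∈ I then 0 else (-1) ^ lowCard i I * oddKernel b (insert i I) J K)
      = (if i ∈ K then (-1) ^ lowCard i K * oddKernel b I J (K.erase i) else 0)
        + b⁻¹ * ((-1) ^ I.card *
          (if i ∈ J then (-1) ^ lowCard i J * oddKernel b I (J.erase i) K else 0)) := by
  have h := congrArg (coefK K) (oddInt_gen_one_mul hb i I J)
  rw [gen_mul_genMonomial, map_add, coefK_gen_mul, map_smul] at h
  simp only [oddKernel_eq]
  convert! h using 1
  · by_cases hi : i ∈ I
    · simp [hi, oddInt_zero]
    · simp only [hi, if_false]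
      rw [mul_assoc, neg_one_pow_mul_eq_smul, oddInt_smul, map_smul, smul_eq_mul]
  · congr 1
    rw [smul_eq_mul, mul_assoc]
    by_cases hi : i ∈ J
    · simp only [hi, if_true]
      rw [neg_one_pow_mul_eq_smul, mul_smul_comm, oddInt_smul, map_smul, smul_eq_mul]
    · simp [hi, oddInt_zero]

/-- Integration by parts in `ξ₁`, when the first argument is `1`. -/
theorem oddInt_gen_two_mul {b : ℂ} (hb : b ≠ 0) (i : Fin n) (J : Finset (Fin n)) :
    oddInt b (gen 2 i * genMonomial 2 J) = gen 0 i * oddInt b (genMonomial 2 J) := by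
  set X : OddAlg n := genMonomial 2 J with hX
  set E := oddExp n b with hE
  have h1 : oddDeriv 1 i (X * E) = b • ((gen 2 i - gen 0 i) * X * E) := by
    have hI := odd_mono_mul (x := gen 2) (D := (oddDeriv 1 i).toAddMonoidHom)
      (fun j y => by
        change oddDeriv 1 i (gen 2 j * y) = -(gen 2 j * oddDeriv 1 i y)
        rw [oddDeriv_gen_mul, if_neg (fun h => absurd h.1 (by decide)), zero_sub]) J E
    simp only [LinearMap.toAddMonoidHom_coe, ← genMonomial_eq] at hI
    have hz : (gen 2 i - gen 0 i) * X = (-1) ^ J.card * (X * (gen 2 i - gen 0 i)) := by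
      refine anticomm_mono (fun j => ?_) J
      rw [sub_mul, mul_sub, gen_mul_gen 2 2, gen_mul_gen 0 2]; abel
    rw [hz, hX, hI, oddDeriv_one_oddExp, ← hE]
    simp only [neg_one_pow_mul_eq_smul, mul_smul_comm, smul_mul_assoc, mul_assoc, smul_smul,
      mul_comm b]
  have h2 : berezin 1 (berezin 2 (oddDeriv 1 i (X * E))) = 0 := by
    have hc : ∀ y : OddAlg n, berezin 2 (oddDeriv 1 i y)
        = ((-1) ^ (Finset.univ : Finset (Fin n)).sort.length : ℂ) • oddDeriv 1 i (berezin 2 y) := by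
      intro y
      rw [berezin_eq, derivList_oddDeriv, ← berezin_eq, neg_one_pow_mul_eq_smul]
    rw [hc, berezin_smul, berezin_oddDeriv, smul_zero]
  rw [h1, berezin_smul, berezin_smul] at h2
  change b • oddInt b ((gen 2 i - gen 0 i) * X) = 0 at h2
  have h3 : (gen 2 i - gen 0 i) * X = gen 2 i * X + (-1 : ℂ) • (gen 0 i * X) := by
    rw [sub_mul, neg_one_smul, sub_eq_add_neg]
  rw [h3, oddInt_add, oddInt_smul, oddInt_gen_zero_mul, neg_one_smul] at h2
  exact add_neg_eq_zero.mp ((smul_eq_zero.mp h2).resolve_left hb)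

/-- The odd variable `ξ_i - ξ₁_i`, that divides the `i`-th summand of the phase. -/
def genDiff (i : Fin n) : OddAlg n := gen 0 i - gen 1 i

theorem genDiff_mul_genDiff (i j : Fin n) :
    genDiff i * genDiff j = -(genDiff j * genDiff i) := by
  simp only [genDiff, sub_mul, mul_sub]
  rw [gen_mul_gen 0 0 i j, gen_mul_gen 0 1 i j, gen_mul_gen 1 0 i j, gen_mul_gen 1 1 i j]
  abel

theorem genDiff_mul_self (i : Fin n) : genDiff i * genDiff i = 0 := by
  simp only [genDiff, sub_mul, mul_sub, gen_mul_self]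
  rw [gen_mul_gen 0 1 i i]
  abel

theorem oddPhase_eq (n : ℕ) : oddPhase n = ∑ i, genDiff i * (gen 0 i - gen 2 i) := by
  refine Finset.sum_congr rfl fun i _ => ?_
  simp only [genDiff, sub_mul, mul_sub, gen_mul_self]
  rw [gen_mul_gen 0 2 i i, gen_mul_gen 1 0 i i]
  abel

theorem derivList_two_oddExp (b : ℂ) (l : List (Fin n)) :
    derivList 2 l (oddExp n b)
      = (b ^ l.length * (-1) ^ (l.length * (l.length - 1) / 2)) •
        ((l.map genDiff).prod * oddExp n b) := by
  induction l with
  | nil => simp [derivList_nil]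
  | cons i l ih =>
    have hpass : ∀ (j : Fin n) (y : OddAlg n),
        oddDeriv 2 j (genDiff i * y) = -(genDiff i * oddDeriv 2 j y) := by
      intro j y
      rw [genDiff, sub_mul, map_sub, oddDeriv_gen_mul, oddDeriv_gen_mul,
        if_neg (fun h => absurd h.1 (by decide)), if_neg (fun h => absurd h.1 (by decide)), sub_mul]
      abel
    rw [derivList_cons, oddDeriv_two_oddExp, map_smul, ← genDiff, derivList_anticomm_mul hpass, ih,
      neg_one_pow_mul_eq_smul, mul_smul_comm, smul_smul, smul_smul, List.map_cons, List.prod_cons,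
      List.length_cons, Nat.triangle_succ, pow_succ, pow_add]
    congr 1
    · ring
    · rw [mul_assoc]

theorem mono_genDiff_mul_oddExp (b : ℂ) :
    mono genDiff (Finset.univ : Finset (Fin n)) * oddExp n b = mono genDiff Finset.univ := by
  have h0 : mono genDiff (Finset.univ : Finset (Fin n)) * oddPhase n = 0 := by
    rw [oddPhase_eq, Finset.mul_sum]
    refine Finset.sum_eq_zero fun i _ => ?_
    have h1 := mul_mono genDiff_mul_genDiff genDiff_mul_self i (Finset.univ : Finset (Fin n))
    rw [if_pos (Finset.mem_univ i), anticomm_mono (genDiff_mul_genDiff i)] at h1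
    have h2 := neg_one_pow_mul_self (Finset.univ : Finset (Fin n)).card
      (mono genDiff (Finset.univ : Finset (Fin n)) * genDiff i)
    rw [h1, mul_zero] at h2
    rw [← mul_assoc, ← h2, zero_mul]
  obtain ⟨k, hk⟩ := isNilpotent_oddPhase n
  have hk2 : (b • oddPhase n) ^ (k + 1) = 0 := by rw [smul_pow, pow_succ (oddPhase n), hk, zero_mul, smul_zero]
  rw [oddExp, IsNilpotent.exp_eq_sum hk2, Finset.sum_range_succ', mul_add, Finset.mul_sum,
    Finset.sum_eq_zero fun j _ => ?_]
  · simp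
  · rw [mul_smul_comm, smul_pow, mul_smul_comm, pow_succ' (oddPhase n), ← mul_assoc, h0, zero_mul, smul_zero,
      smul_zero]

theorem derivList_one_genDiff {l : List (Fin n)} (hl : l.Nodup) :
    derivList 1 l (l.map genDiff).prod = ((-1) ^ l.length : ℂ) • (1 : OddAlg n) := by
  have hD : ∀ (i j : Fin n) (y : OddAlg n), oddDeriv 1 i (genDiff j * y)
      = -(if i = j then y else 0) - genDiff j * oddDeriv 1 i y := by
    intro i j y
    rw [genDiff, sub_mul, map_sub, oddDeriv_gen_mul, oddDeriv_gen_mul,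
      if_neg (fun h => absurd h.1 (by decide)), sub_mul]
    simp only [true_and]
    abel
  have h0 : ∀ (i : Fin n) (l : List (Fin n)), i ∉ l → oddDeriv 1 i (l.map genDiff).prod = 0 := by
    intro i l
    induction l with
    | nil => intro _; exact oddDeriv_one _ _
    | cons j l ih =>
      intro h
      rw [List.mem_cons, not_or] at h
      rw [List.map_cons, List.prod_cons, hD, if_neg h.1, ih h.2]
      simp
  induction l with
  | nil => simp [derivList_nil]
  | cons i l ih =>
    rw [List.nodup_cons] at hl
    rw [derivList_cons, List.map_cons, List.prod_cons, hD, if_pos rfl, h0 i l hl.1, mul_zero,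
      sub_zero, map_neg, ih hl.2, List.length_cons, pow_succ, mul_neg_one, neg_smul]

/-- The normalization of the odd kernel. -/
theorem oddInt_one (b : ℂ) :
    oddInt b (1 : OddAlg n) = (b ^ n * (-1) ^ (n * (n + 1) / 2)) • (1 : OddAlg n) := by
  have hlen : (Finset.univ : Finset (Fin n)).sort.length = n := by simp
  have h := derivList_one_genDiff (Finset.sort_nodup (Finset.univ : Finset (Fin n)) (· ≤ ·))
  have hm := mono_genDiff_mul_oddExp (n := n) b
  rw [mono] at hm
  rw [oddInt, one_mul, berezin_eq, berezin_eq, derivList_two_oddExp, hm, map_smul, h, hlen,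
    smul_smul]
  congr 1
  have := Nat.triangle_succ n
  rw [Nat.add_sub_cancel, mul_comm] at this
  rw [this, pow_add]
  ring

theorem oddInt_genMonomial_two {b : ℂ} (hb : b ≠ 0) (J : Finset (Fin n)) :
    oddInt b (genMonomial 2 J) = (b ^ n * (-1) ^ (n * (n + 1) / 2)) • genMonomial 0 J := by
  induction J using Finset.induction_on_min with
  | empty => simpa [genMonomial_eq, mono_empty] using oddInt_one (n := n) b
  | insert a s ha ih =>
    rw [genMonomial_eq, mono_insert ha, ← genMonomial_eq, oddInt_gen_two_mul hb, ih,
      genMonomial_eq 0 (insert a s), mono_insert ha, ← genMonomial_eq, mul_smul_comm]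

theorem oddKernel_empty_left {b : ℂ} (hb : b ≠ 0) (J K : Finset (Fin n)) :
    oddKernel b ∅ J K = if J = K then b ^ n * (-1) ^ (n * (n + 1) / 2) else 0 := by
  rw [oddKernel_eq, genMonomial_eq 1, mono_empty, one_mul, oddInt_genMonomial_two hb, map_smul,
    coefK_genMonomial]
  simp

/-- The component of degree zero of the product is a perfect pairing. -/
theorem oddKernel_empty_right {b : ℂ} (hb : b ≠ 0) (I J : Finset (Fin n)) :
    ∃ r : ℂ, r ≠ 0 ∧ oddKernel b I J ∅ = if I = J then r else 0 := by
  induction I using Finset.induction_on_min generalizing J with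
  | empty =>
    refine ⟨b ^ n * (-1) ^ (n * (n + 1) / 2), ?_, by
      rw [oddKernel_empty_left hb]; simp only [eq_comm]⟩
    exact mul_ne_zero (pow_ne_zero _ hb) (pow_ne_zero _ (by norm_num))
  | insert a s ha ih =>
    have has : a ∉ s := fun h => lt_irrefl _ (ha a h)
    have h := oddKernel_insert hb a s J ∅
    rw [if_neg has, if_neg (Finset.notMem_empty a), zero_add,
      lowCard_of_forall_le fun b hb => (ha b hb).le, pow_zero, one_mul] at h
    by_cases haJ : a ∈ J
    · obtain ⟨r, hr, hr'⟩ := ih (J.erase a)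
      refine ⟨b⁻¹ * ((-1) ^ s.card * ((-1) ^ lowCard a J * r)), ?_, ?_⟩
      · exact mul_ne_zero (inv_ne_zero hb) (mul_ne_zero (pow_ne_zero _ (by norm_num))
          (mul_ne_zero (pow_ne_zero _ (by norm_num)) hr))
      · rw [h, if_pos haJ, hr']
        have : s = J.erase a ↔ insert a s = J := by
          constructor
          · rintro rfl; exact Finset.insert_erase haJ
          · rintro rfl; exact (Finset.erase_insert has).symm
        simp only [this]
        split_ifs <;> simp
    · refine ⟨1, one_ne_zero, ?_⟩
      rw [h, if_neg haJ, if_neg, mul_zero, mul_zero]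
      rintro rfl
      exact haJ (Finset.mem_insert_self _ _)

end OddKernelRecursion

/-! ### The star-product of superfunctions of polynomial growth -/

section StarProduct

variable {p n : ℕ}

/-- The superfunctions of polynomial growth. -/
def PGS (p n : ℕ) : Submodule ℂ (SuperFun p n) where
  carrier := {f | ∀ I, PolyB (f I)}
  add_mem' hf hg I := (hf I).add (hg I)
  zero_mem' _ := PolyB.const 0
  smul_mem' r _ hf I := (hf I).const_mul r

/-- Left multiplication by the odd coordinate `ξ_i`. -/
def xiMul (i : Fin n) : SuperFun p n →ₗ[ℂ] SuperFun p n where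
  toFun f I := if i ∈ I then (-1 : ℂ) ^ lowCard i I • f (I.erase i) else 0
  map_add' f g := by ext I x; by_cases h : i ∈ I <;> simp [h, mul_add]
  map_smul' r f := by ext I x; by_cases h : i ∈ I <;> simp [h, mul_left_comm]

/-- The left derivative `∂/∂ξ_i`. -/
def dXi (i : Fin n) : SuperFun p n →ₗ[ℂ] SuperFun p n where
  toFun f I := if i ∈ I then 0 else (-1 : ℂ) ^ lowCard i I • f (insert i I)
  map_add' f g := by ext I x; by_cases h : i ∈ I <;> simp [h, mul_add]
  map_smul' r f := by ext I x; by_cases h : i ∈ I <;> simp [h, mul_left_comm]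

/-- The parity operator on superfunctions. -/
def parS : SuperFun p n →ₗ[ℂ] SuperFun p n where
  toFun f I := (-1 : ℂ) ^ I.card • f I
  map_add' f g := by ext I x; simp [mul_add]
  map_smul' r f := by ext I x; simp [mul_left_comm]

/-- Multiplication by a function on the body. -/
def bodyMul (h : Body p → ℂ) : SuperFun p n →ₗ[ℂ] SuperFun p n where
  toFun f I x := h x * f I x
  map_add' f g := by ext I x; simp [mul_add]
  map_smul' r f := by ext I x; simp [mul_left_comm]

/-- The projection onto the component of index `I`. -/
def compS (I : Finset (Fin n)) : SuperFun p n →ₗ[ℂ] SuperFun p n where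
  toFun f := f.component I
  map_add' f g := by ext J x; by_cases h : J = I <;> simp [SuperFun.component, h]
  map_smul' r f := by ext J x; by_cases h : J = I <;> simp [SuperFun.component, h]

theorem xiMul_apply (i : Fin n) (f : SuperFun p n) (I : Finset (Fin n)) :
    xiMul i f I = if i ∈ I then (-1 : ℂ) ^ lowCard i I • f (I.erase i) else 0 := rfl

theorem dXi_apply (i : Fin n) (f : SuperFun p n) (I : Finset (Fin n)) :
    dXi i f I = if i ∈ I then 0 else (-1 : ℂ) ^ lowCard i I • f (insert i I) := rfl

theorem parS_apply (f : SuperFun p n) (I : Finset (Fin n)) :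
    parS f I = (-1 : ℂ) ^ I.card • f I := rfl

theorem bodyMul_apply (h : Body p → ℂ) (f : SuperFun p n) (I : Finset (Fin n)) (x : Body p) :
    bodyMul h f I x = h x * f I x := rfl

theorem compS_apply (f : SuperFun p n) (I J : Finset (Fin n)) :
    compS I f J = if J = I then f J else 0 := rfl

theorem xiMul_mem {f : SuperFun p n} (hf : f ∈ PGS p n) (i : Fin n) : xiMul i f ∈ PGS p n := by
  intro I
  rw [xiMul_apply]
  split_ifs
  · exact (hf _).const_mul _
  · exact PolyB.const 0

theorem dXi_mem {f : SuperFun p n} (hf : f ∈ PGS p n) (i : Fin n) : dXi i f ∈ PGS p n := by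
  intro I
  rw [dXi_apply]
  split_ifs
  · exact PolyB.const 0
  · exact (hf _).const_mul _

theorem parS_mem {f : SuperFun p n} (hf : f ∈ PGS p n) : parS f ∈ PGS p n :=
  fun I => (hf I).const_mul _

theorem bodyMul_mem {f : SuperFun p n} (hf : f ∈ PGS p n) {h : Body p → ℂ} (hh : PolyB h) :
    bodyMul h f ∈ PGS p n := fun I => hh.mul (hf I)

theorem compS_mem {f : SuperFun p n} (hf : f ∈ PGS p n) (I : Finset (Fin n)) :
    compS I f ∈ PGS p n := by
  intro J
  rw [compS_apply]
  split_ifs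
  · exact hf J
  · exact PolyB.const 0

/-- The partial derivative of all the coefficients. -/
def pdS (a : Body p) (f : SuperFun p n) : SuperFun p n := fun I => pd a (f I)

theorem pdS_mem {f : SuperFun p n} (hf : f ∈ PGS p n) (a : Body p) : pdS a f ∈ PGS p n :=
  fun I => (hf I).partialDeriv a

/-- The constant in the exponent of the odd kernel. -/
def oddConst (θ α : ℝ) : ℂ := -Complex.I * (1 + α : ℂ) ^ 2 / (α * θ)

theorem one_add_ne_zero {α : ℝ} (hα₁ : α ≠ -1) : (1 + α : ℂ) ≠ 0 := by
  intro h
  have h' : ((1 + α : ℝ) : ℂ) = 0 := by push_cast; exact h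
  exact hα₁ (by linarith [Complex.ofReal_eq_zero.mp h'])

theorem oddConst_ne_zero {θ α : ℝ} (hθ : θ ≠ 0) (hα₀ : α ≠ 0) (hα₁ : α ≠ -1) :
    oddConst θ α ≠ 0 := by
  have h1 : (θ : ℂ) ≠ 0 := by exact_mod_cast hθ
  have h2 : (α : ℂ) ≠ 0 := by exact_mod_cast hα₀
  exact div_ne_zero (mul_ne_zero (neg_ne_zero.mpr Complex.I_ne_zero)
    (pow_ne_zero _ (one_add_ne_zero hα₁))) (mul_ne_zero h2 h1)

theorem kappa_ne_zero {θ α : ℝ} (hθ : θ ≠ 0) (hα₀ : α ≠ 0) (hα₁ : α ≠ -1) :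
    kappa p n θ α ≠ 0 := by
  have h1 : (θ : ℂ) ≠ 0 := by exact_mod_cast hθ
  have h2 : (α : ℂ) ≠ 0 := by exact_mod_cast hα₀
  have h3 : (Real.pi : ℂ) ≠ 0 := by exact_mod_cast Real.pi_ne_zero
  exact div_ne_zero (mul_ne_zero (mul_ne_zero (pow_ne_zero _ (mul_ne_zero Complex.I_ne_zero h1))
    (pow_ne_zero _ (by norm_num))) (pow_ne_zero _ h2)) (mul_ne_zero (pow_ne_zero _
    (mul_ne_zero h3 h1)) (pow_ne_zero _ (one_add_ne_zero hα₁)))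

/-- The constant `κ` compensates the normalizations of the even and odd integrals. -/
theorem kappa_mul {θ α : ℝ} (hθ : θ ≠ 0) (hα₀ : α ≠ 0) (hα₁ : α ≠ -1) :
    kappa p n θ α * ((oddConst θ α) ^ n * (-1) ^ (n * (n + 1) / 2)
      * (Real.pi * θ : ℂ) ^ (2 * p)) = 1 := by
  have h1 : (θ : ℂ) ≠ 0 := by exact_mod_cast hθ
  have h2 : (α : ℂ) ≠ 0 := by exact_mod_cast hα₀
  have h3 : (Real.pi : ℂ) ≠ 0 := by exact_mod_cast Real.pi_ne_zero
  have h4 := one_add_ne_zero hα₁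
  have hs : ((-1 : ℂ) ^ (n * (n + 1) / 2)) * (-1) ^ (n * (n + 1) / 2) = 1 := by
    rw [← mul_pow]; norm_num
  have hb : (Complex.I * θ * α / (1 + α : ℂ) ^ 2) * oddConst θ α = 1 := by
    rw [oddConst]
    field_simp
    rw [Complex.I_sq, neg_neg]
  have h5 : (Real.pi * θ : ℂ) ^ (2 * p) ≠ 0 := pow_ne_zero _ (mul_ne_zero h3 h1)
  have e : kappa p n θ α = (Complex.I * θ * α / (1 + α : ℂ) ^ 2) ^ n
      * (-1) ^ (n * (n + 1) / 2) / (Real.pi * θ : ℂ) ^ (2 * p) := by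
    rw [kappa, pow_mul (1 + α : ℂ) 2 n, div_pow, mul_pow _ (α : ℂ)]
    field_simp
  rw [e]
  calc _ = ((Complex.I * θ * α / (1 + α : ℂ) ^ 2) * oddConst θ α) ^ n
        * (((-1 : ℂ) ^ (n * (n + 1) / 2)) * (-1) ^ (n * (n + 1) / 2)) := by
        rw [mul_pow _ (oddConst θ α), div_mul_eq_mul_div, div_eq_iff h5]; ring
    _ = 1 := by rw [hb, hs, one_pow, one_mul]

theorem starProduct_apply (θ α : ℝ) (f g : SuperFun p n) (K : Finset (Fin n)) (y : Body p) :
    starProduct θ α f g K y = kappa p n θ α * ∑ I, ∑ J,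
      oddKernel (oddConst θ α) I J K * evenStar θ (f I) (g J) y := rfl

theorem starProduct_add_left {θ : ℝ} (hθ : θ ≠ 0) (α : ℝ) {f f' g : SuperFun p n}
    (hf : f ∈ PGS p n) (hf' : f' ∈ PGS p n) (hg : g ∈ PGS p n) :
    starProduct θ α (f + f') g = starProduct θ α f g + starProduct θ α f' g := by
  ext K y
  simp only [starProduct_apply, Pi.add_apply, ← mul_add, ← Finset.sum_add_distrib]
  congr 1
  refine Finset.sum_congr rfl fun I _ => Finset.sum_congr rfl fun J _ => ?_
  rw [← evenStar_add_left hθ (hf I) (hf' I) (hg J)]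
  rfl

theorem starProduct_add_right {θ : ℝ} (hθ : θ ≠ 0) (α : ℝ) {f g g' : SuperFun p n}
    (hf : f ∈ PGS p n) (hg : g ∈ PGS p n) (hg' : g' ∈ PGS p n) :
    starProduct θ α f (g + g') = starProduct θ α f g + starProduct θ α f g' := by
  ext K y
  simp only [starProduct_apply, Pi.add_apply, ← mul_add, ← Finset.sum_add_distrib]
  congr 1
  refine Finset.sum_congr rfl fun I _ => Finset.sum_congr rfl fun J _ => ?_
  rw [← evenStar_add_right hθ (hf I) (hg J) (hg' J)]
  rfl

theorem starProduct_smul_left {θ : ℝ} (hθ : θ ≠ 0) (α : ℝ) (r : ℂ) {f g : SuperFun p n}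
    (hf : f ∈ PGS p n) (hg : g ∈ PGS p n) :
    starProduct θ α (r • f) g = r • starProduct θ α f g := by
  ext K y
  simp only [starProduct_apply, Pi.smul_apply, smul_eq_mul]
  rw [mul_left_comm r]
  congr 1
  rw [Finset.mul_sum]
  refine Finset.sum_congr rfl fun I _ => ?_
  rw [Finset.mul_sum]
  refine Finset.sum_congr rfl fun J _ => ?_
  rw [mul_left_comm, ← evenStar_const_mul_left hθ (hf I) (hg J)]
  rfl

theorem starProduct_smul_right {θ : ℝ} (hθ : θ ≠ 0) (α : ℝ) (r : ℂ) {f g : SuperFun p n}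
    (hf : f ∈ PGS p n) (hg : g ∈ PGS p n) :
    starProduct θ α f (r • g) = r • starProduct θ α f g := by
  ext K y
  simp only [starProduct_apply, Pi.smul_apply, smul_eq_mul]
  rw [mul_left_comm r]
  congr 1
  rw [Finset.mul_sum]
  refine Finset.sum_congr rfl fun I _ => ?_
  rw [Finset.mul_sum]
  refine Finset.sum_congr rfl fun J _ => ?_
  rw [mul_left_comm, ← evenStar_const_mul_right hθ (hf I) (hg J)]
  rfl

theorem contDiff_starProduct {θ : ℝ} (hθ : θ ≠ 0) (α : ℝ) {f g : SuperFun p n}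
    (hf : f ∈ PGS p n) (hg : g ∈ PGS p n) (K : Finset (Fin n)) :
    ContDiff ℝ ∞ (starProduct θ α f g K) := by
  refine contDiff_const.mul (ContDiff.sum fun I _ => ContDiff.sum fun J _ => ?_)
  exact contDiff_const.mul (contDiff_evenStar hθ (hf I) (hg J))

/-- Left multiplication by a linear function. -/
theorem starProduct_bodyMul {θ : ℝ} (hθ : θ ≠ 0) (α : ℝ) {f g : SuperFun p n}
    (hf : f ∈ PGS p n) (hg : g ∈ PGS p n) (b : Body p) :
    starProduct θ α (bodyMul (omR b) f) g
      = bodyMul (omR b) (starProduct θ α f g)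
        + (-(Complex.I * θ / 2)) • starProduct θ α f (pdS b g) := by
  ext K y
  simp only [starProduct_apply, Pi.add_apply, Pi.smul_apply, smul_eq_mul, bodyMul_apply]
  rw [mul_left_comm, mul_left_comm _ (kappa p n θ α), ← mul_add]
  congr 1
  rw [Finset.mul_sum, Finset.mul_sum, ← Finset.sum_add_distrib]
  refine Finset.sum_congr rfl fun I _ => ?_
  rw [Finset.mul_sum, Finset.mul_sum, ← Finset.sum_add_distrib]
  refine Finset.sum_congr rfl fun J _ => ?_
  have h := evenStar_omR_mul hθ (hf I) (hg J) b y
  have e : bodyMul (omR b) f I = fun x => omR b x * f I x := rfl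
  rw [e, h, pdS]
  ring

theorem sum_mem_erase {M : Type*} [AddCommMonoid M] (i : Fin n)
    (F : Finset (Fin n) → Finset (Fin n) → M) :
    ∑ I, (if i ∈ I then F (I.erase i) I else 0) = ∑ I, (if i ∈ I then 0 else F I (insert i I)) := by
  rw [← Finset.sum_filter]
  simp only [← ite_not (i ∈ _)]
  rw [← Finset.sum_filter]
  refine Finset.sum_bij' (fun I _ => I.erase i) (fun I _ => insert i I) ?_ ?_ ?_ ?_ ?_
  · intro I _; simp
  · intro I _; simp
  · intro I hI; exact Finset.insert_erase (by simpa using hI)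
  · intro I hI; exact Finset.erase_insert (by simpa using hI)
  · intro I hI; rw [Finset.insert_erase (by simpa using hI)]

/-- Left multiplication by an odd coordinate. -/
theorem starProduct_xiMul {θ α : ℝ} (hθ : θ ≠ 0) (hα₀ : α ≠ 0) (hα₁ : α ≠ -1)
    {f g : SuperFun p n} (hf : f ∈ PGS p n) (hg : g ∈ PGS p n) (i : Fin n) :
    starProduct θ α (xiMul i f) g = xiMul i (starProduct θ α f g)
        + (oddConst θ α)⁻¹ • starProduct θ α (parS f) (dXi i g) := by
  ext K y
  have hb := oddConst_ne_zero hθ hα₀ hα₁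
  set b := oddConst θ α with hbdef
  have h1 : ∑ I, ∑ J, oddKernel b I J K * evenStar θ (xiMul i f I) (g J) y
      = ∑ I, ∑ J, (if i ∈ I then 0 else (-1) ^ lowCard i I * oddKernel b (insert i I) J K)
        * evenStar θ (f I) (g J) y := by
    have := sum_mem_erase i (fun I' I => ∑ J, (-1) ^ lowCard i I * oddKernel b I J K
      * evenStar θ (f I') (g J) y)
    calc _ = ∑ I, (if i ∈ I then ∑ J, (-1) ^ lowCard i I * oddKernel b I J K
            * evenStar θ (f (I.erase i)) (g J) y else 0) := by
          refine Finset.sum_congr rfl fun I _ => ?_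
          rw [xiMul_apply]
          by_cases h : i ∈ I
          · simp only [h, if_true]
            refine Finset.sum_congr rfl fun J _ => ?_
            have e := evenStar_const_mul_left hθ (hf (I.erase i)) (hg J) ((-1) ^ lowCard i I) y
            rw [show ((-1 : ℂ) ^ lowCard i I • f (I.erase i))
              = fun x => (-1) ^ lowCard i I * f (I.erase i) x from rfl, e]
            ring
          · simp only [h, if_false]
            refine Finset.sum_eq_zero fun J _ => ?_
            have := evenStar_zero_left hθ (g J) y
            rw [show (0 : Body p → ℂ) = fun _ => 0 from rfl, this, mul_zero]
      _ = _ := by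
          rw [this]
          refine Finset.sum_congr rfl fun I _ => ?_
          by_cases h : i ∈ I
          · simp [h]
          · simp [h, lowCard_insert_self]
  have h2 : ∑ I, ∑ J, oddKernel b I J K * evenStar θ (parS f I) (dXi i g J) y
      = ∑ I, ∑ J, ((-1) ^ I.card * (if i ∈ J then (-1) ^ lowCard i J *
        oddKernel b I (J.erase i) K else 0)) * evenStar θ (f I) (g J) y := by
    refine Finset.sum_congr rfl fun I _ => ?_
    have := sum_mem_erase i (fun J' J => (-1) ^ I.card * ((-1) ^ lowCard i J *
      oddKernel b I J' K) * evenStar θ (f I) (g J) y)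
    calc _ = ∑ J, (if i ∈ J then 0 else (-1) ^ I.card * ((-1) ^ lowCard i (insert i J) *
            oddKernel b I J K) * evenStar θ (f I) (g (insert i J)) y) := by
          refine Finset.sum_congr rfl fun J _ => ?_
          have e1 : evenStar θ (parS f I) (dXi i g J) y
              = (-1) ^ I.card * evenStar θ (f I) (dXi i g J) y :=
            evenStar_const_mul_left hθ (hf I) (dXi_mem hg i J) _ y
          rw [e1, dXi_apply]
          by_cases h : i ∈ J
          · simp only [h, if_true]
            have := evenStar_zero_right hθ (f I) y
            rw [show (0 : Body p → ℂ) = fun _ => 0 from rfl, this, mul_zero, mul_zero]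
          · simp only [h, if_false]
            have e := evenStar_const_mul_right hθ (hf I) (hg (insert i J)) ((-1) ^ lowCard i J) y
            rw [show ((-1 : ℂ) ^ lowCard i J • g (insert i J))
              = fun x => (-1) ^ lowCard i J * g (insert i J) x from rfl, e, lowCard_insert_self]
            ring
      _ = _ := by
          rw [← this]
          refine Finset.sum_congr rfl fun J _ => ?_
          by_cases h : i ∈ J <;> simp [h]
  have h3 : xiMul i (starProduct θ α f g) K y = kappa p n θ α * ∑ I, ∑ J,
      (if i ∈ K then (-1) ^ lowCard i K * oddKernel b I J (K.erase i) else 0)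
        * evenStar θ (f I) (g J) y := by
    rw [xiMul_apply]
    by_cases h : i ∈ K
    · simp only [h, if_true, Pi.smul_apply, smul_eq_mul, starProduct_apply, mul_assoc,
        ← Finset.mul_sum]
      ring
    · simp [h]
  rw [Pi.add_apply, Pi.add_apply, h3, Pi.smul_apply, Pi.smul_apply, starProduct_apply,
    starProduct_apply, ← hbdef, h1, h2, smul_eq_mul, mul_left_comm, ← mul_add]
  congr 1
  rw [Finset.mul_sum, ← Finset.sum_add_distrib]
  refine Finset.sum_congr rfl fun I _ => ?_
  rw [Finset.mul_sum, ← Finset.sum_add_distrib]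
  refine Finset.sum_congr rfl fun J _ => ?_
  rw [oddKernel_insert hb]
  ring

/-- A function on the body, as a superfunction. -/
def ofBody (h : Body p → ℂ) : SuperFun p n := fun I => if I = ∅ then h else 0

theorem ofBody_mem {h : Body p → ℂ} (hh : PolyB h) : (ofBody h : SuperFun p n) ∈ PGS p n := by
  intro I
  rw [ofBody]
  split_ifs
  · exact hh
  · exact PolyB.const 0

/-- Left multiplication by a character is a translation. -/
theorem starProduct_chr {θ α : ℝ} (hθ : θ ≠ 0) (hα₀ : α ≠ 0) (hα₁ : α ≠ -1) (κ : Body p)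
    {g : SuperFun p n} (hg : g ∈ PGS p n) :
    starProduct θ α (ofBody (chr κ)) g
      = fun K y => chr κ y * g K (y + (θ / 2) • rotJ p κ) := by
  ext K y
  have hb := oddConst_ne_zero hθ hα₀ hα₁
  rw [starProduct_apply, Finset.sum_eq_single ∅, Finset.sum_eq_single K]
  · rw [oddKernel_empty_left hb, if_pos rfl, ofBody, if_pos rfl, evenStar_chr_left hθ κ (hg K)]
    have := kappa_mul (p := p) (n := n) hθ hα₀ hα₁
    linear_combination (chr κ y * g K (y + (θ / 2) • rotJ p κ)) * this
  · intro J _ hJ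
    rw [oddKernel_empty_left hb, if_neg hJ, zero_mul]
  · simp
  · intro I _ hI
    refine Finset.sum_eq_zero fun J _ => ?_
    rw [ofBody, if_neg hI]
    have := evenStar_zero_left hθ (g J) y
    rw [show (0 : Body p → ℂ) = fun _ => 0 from rfl, this, mul_zero]
  · simp

end StarProduct

/-! ### Grassmann numbers: supercommutation and generators -/

section Grassmann

variable {V : Type*} [AddCommGroup V] [Module ℝ V]

/-- The inclusion of `𝒜` in its complexification. -/
def ofG : Grass V →ₐ[ℝ] GrassC V := Algebra.TensorProduct.includeRight

theorem ofG_apply (a : Grass V) : ofG a = (1 : ℂ) ⊗ₜ[ℝ] a := rfl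

/-- The parity automorphism of the complexification. -/
def parC : GrassC V →ₐ[ℂ] GrassC V :=
  Algebra.TensorProduct.map (AlgHom.id ℂ ℂ) (parityAut V)

theorem parC_ofG (a : Grass V) : parC (ofG a) = ofG (parityAut V a) := rfl

theorem tmul_eq_smul (c : ℂ) (a : Grass V) : c ⊗ₜ[ℝ] a = c • ofG a := by
  rw [ofG_apply, TensorProduct.smul_tmul', smul_eq_mul, mul_one]

theorem GrassC.induction {P : GrassC V → Prop} (h : ∀ (c : ℂ) (a : Grass V), P (c • ofG a))
    (hadd : ∀ x y, P x → P y → P (x + y)) (x : GrassC V) : P x := by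
  induction x using TensorProduct.induction_on with
  | zero => simpa using h 0 0
  | tmul c a => rw [tmul_eq_smul]; exact h c a
  | add x y hx hy => exact hadd x y hx hy

theorem parC_parC (x : GrassC V) : parC (parC x) = x := by
  induction x using GrassC.induction with
  | h c a => rw [map_smul, map_smul, parC_ofG, parC_ofG, CliffordAlgebra.involute_involute]
  | hadd x y hx hy => rw [map_add, map_add, hx, hy]

theorem parityAut_of_mem {i : ZMod 2} {a : Grass V} (ha : a ∈ part V i) :
    (i = 0 → parityAut V a = a) ∧ (i = 1 → parityAut V a = -a) :=
  ⟨fun h => CliffordAlgebra.involute_eq_of_mem_even (h ▸ ha),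
    fun h => CliffordAlgebra.involute_eq_of_mem_odd (h ▸ ha)⟩

theorem parityAut_even {a : Grass V} (ha : a ∈ part V 0) : parityAut V a = a :=
  (parityAut_of_mem ha).1 rfl

theorem parityAut_odd {a : Grass V} (ha : a ∈ part V 1) : parityAut V a = -a :=
  (parityAut_of_mem ha).2 rfl

theorem ι_mul_eq (m : V) (b : Grass V) :
    ExteriorAlgebra.ι ℝ m * b = parityAut V b * ExteriorAlgebra.ι ℝ m := by
  induction b using ExteriorAlgebra.induction with
  | algebraMap r => rw [AlgHom.commutes]; exact (Algebra.commutes r _).symm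
  | ι x =>
    have h : parityAut V (ExteriorAlgebra.ι ℝ x) = -ExteriorAlgebra.ι ℝ x :=
      CliffordAlgebra.involute_ι x
    rw [h, neg_mul]
    exact eq_neg_of_add_eq_zero_left (ExteriorAlgebra.ι_add_mul_swap m x)
  | mul a b ha hb => rw [← mul_assoc, ha, mul_assoc, hb, map_mul, mul_assoc]
  | add a b ha hb => rw [mul_add, ha, hb, map_add, add_mul]

theorem odd_mul_eq {a : Grass V} (ha : a ∈ part V 1) (b : Grass V) :
    a * b = parityAut V b * a := by
  induction a, ha using CliffordAlgebra.odd_induction with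
  | ι m => exact ι_mul_eq m b
  | add x y hx hy h1 h2 => rw [add_mul, h1, h2, mul_add]
  | ι_mul_ι_mul m m' x hx h1 =>
    have e1 := ι_mul_eq m' (parityAut V b)
    have e2 := ι_mul_eq m b
    rw [CliffordAlgebra.involute_involute] at e1
    change ExteriorAlgebra.ι ℝ m * ExteriorAlgebra.ι ℝ m' * x * b
      = parityAut V b * (ExteriorAlgebra.ι ℝ m * ExteriorAlgebra.ι ℝ m' * x)
    rw [mul_assoc, h1, mul_assoc, ← mul_assoc (ExteriorAlgebra.ι ℝ m'), e1, ← mul_assoc,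
      ← mul_assoc, e2]
    simp only [mul_assoc]

theorem even_mul_eq {a : Grass V} (ha : a ∈ part V 0) (b : Grass V) : a * b = b * a := by
  induction a, ha using CliffordAlgebra.even_induction with
  | algebraMap r => exact Algebra.commutes r b
  | add x y hx hy h1 h2 => rw [add_mul, h1, h2, mul_add]
  | ι_mul_ι_mul m m' x hx h1 =>
    have e1 := ι_mul_eq m' b
    have e2 := ι_mul_eq m (parityAut V b)
    rw [CliffordAlgebra.involute_involute] at e2
    change ExteriorAlgebra.ι ℝ m * ExteriorAlgebra.ι ℝ m' * x * b
      = b * (ExteriorAlgebra.ι ℝ m * ExteriorAlgebra.ι ℝ m' * x)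
    rw [mul_assoc, h1, mul_assoc, ← mul_assoc (ExteriorAlgebra.ι ℝ m'), e1, ← mul_assoc,
      ← mul_assoc, e2]
    simp only [mul_assoc]

theorem ofG_odd_mul {a : Grass V} (ha : a ∈ part V 1) (x : GrassC V) :
    ofG a * x = parC x * ofG a := by
  induction x using GrassC.induction with
  | h c b => rw [map_smul, mul_smul_comm, smul_mul_assoc, parC_ofG, ← map_mul, ← map_mul,
      odd_mul_eq ha]
  | hadd x y hx hy => rw [mul_add, hx, hy, map_add, add_mul]

theorem ofG_even_mul {a : Grass V} (ha : a ∈ part V 0) (x : GrassC V) :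
    ofG a * x = x * ofG a := by
  induction x using GrassC.induction with
  | h c b => rw [mul_smul_comm, smul_mul_assoc, ← map_mul, ← map_mul, even_mul_eq ha]
  | hadd x y hx hy => rw [mul_add, hx, hy, add_mul]

theorem zmodTwo_cases (i : ZMod 2) : i = 0 ∨ i = 1 := by
  revert i; decide

/-- The parity automorphism, to the power of a degree. -/
def parPow (i : ZMod 2) : GrassC V →ₐ[ℂ] GrassC V := if i = 0 then AlgHom.id ℂ _ else parC

theorem parPow_zero : parPow (V := V) 0 = AlgHom.id ℂ _ := if_pos rfl

theorem parPow_one : parPow (V := V) 1 = parC := if_neg (by decide)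

theorem ofG_mul_eq {i : ZMod 2} {a : Grass V} (ha : a ∈ part V i) (x : GrassC V) :
    ofG a * x = parPow i x * ofG a := by
  rcases zmodTwo_cases i with rfl | rfl
  · rw [parPow_zero]; exact ofG_even_mul ha x
  · rw [parPow_one]; exact ofG_odd_mul ha x

/-- Elements `ε` such that `ε b ε = 0` for all `b`. -/
def Sqz (ε : Grass V) : Prop := ∀ b, ε * b * ε = 0

theorem Sqz.sq {ε : Grass V} (h : Sqz ε) : ε * ε = 0 := by simpa using h 1

theorem Sqz.ofG {ε : Grass V} (h : Sqz ε) (x : GrassC V) :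
    SuperMoyal.ofG ε * x * SuperMoyal.ofG ε = 0 := by
  induction x using GrassC.induction with
  | h c b => rw [mul_smul_comm, smul_mul_assoc, ← map_mul, ← map_mul, h, map_zero, smul_zero]
  | hadd x y hx hy => rw [mul_add, add_mul, hx, hy, add_zero]

theorem sqz_ι_mul (m : V) (c : Grass V) : Sqz (ExteriorAlgebra.ι ℝ m * c) := by
  intro b
  rw [mul_assoc (ExteriorAlgebra.ι ℝ m) c b, ι_mul_eq m (c * b), mul_assoc,
    ← mul_assoc (ExteriorAlgebra.ι ℝ m), ExteriorAlgebra.ι_sq_zero, zero_mul, mul_zero]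

theorem sqz_odd {a : Grass V} (ha : a ∈ part V 1) : Sqz a := by
  have hsq : a * a = 0 := by
    have h := odd_mul_eq ha a
    rw [parityAut_odd ha, neg_mul, eq_neg_iff_add_eq_zero, ← two_smul ℝ (a * a),
      smul_eq_zero] at h
    exact h.resolve_left two_ne_zero
  intro b
  rw [odd_mul_eq ha, mul_assoc, hsq, mul_zero]

theorem body_ι (m : V) : body V (ExteriorAlgebra.ι ℝ m) = 0 := by
  simp [ExteriorAlgebra.algebraMapInv]

theorem body_algebraMap (r : ℝ) : body V (algebraMap ℝ (Grass V) r) = r :=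
  ExteriorAlgebra.algebraMap_leftInverse V r

/-- The even elements that square to zero in the strong sense. -/
def evenSqz (V : Type*) [AddCommGroup V] [Module ℝ V] : Set (Grass V) := {ε | ε ∈ part V 0 ∧ Sqz ε}

theorem algebraMap_mem_even (r : ℝ) : algebraMap ℝ (Grass V) r ∈ part V 0 := by
  rw [Algebra.algebraMap_eq_smul_one]
  exact Submodule.smul_mem _ _
    (Submodule.one_le.mp (CliffordAlgebra.one_le_evenOdd_zero (0 : QuadraticForm ℝ V)))

theorem one_mem_even : (1 : Grass V) ∈ part V 0 := by
  simpa using algebraMap_mem_even (V := V) 1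

theorem ι_mem_odd (m : V) : ExteriorAlgebra.ι ℝ m ∈ part V 1 :=
  CliffordAlgebra.ι_mem_evenOdd_one (0 : QuadraticForm ℝ V) m

/-- The nilpotent part of an even element is a sum of even elements that square to zero. -/
theorem sub_body_mem_closure {a : Grass V} (ha : a ∈ part V 0) :
    a - algebraMap ℝ _ (body V a) ∈ AddSubmonoid.closure (evenSqz V) := by
  induction a, ha using CliffordAlgebra.even_induction with
  | algebraMap r =>
    have : body V (algebraMap ℝ (Grass V) r) = r := body_algebraMap r
    rw [this]
    change algebraMap ℝ (Grass V) r - _ ∈ _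
    rw [sub_self]; exact AddSubmonoid.zero_mem _
  | add x y hx hy h1 h2 =>
    have := AddSubmonoid.add_mem _ h1 h2
    rwa [sub_add_sub_comm, ← map_add, ← map_add] at this
  | ι_mul_ι_mul m m' x hx h1 =>
    change ExteriorAlgebra.ι ℝ m * ExteriorAlgebra.ι ℝ m' * x - _ ∈ _
    have : body V (ExteriorAlgebra.ι ℝ m * ExteriorAlgebra.ι ℝ m' * x) = 0 := by
      rw [map_mul, map_mul, body_ι, zero_mul, zero_mul]
    change ExteriorAlgebra.ι ℝ m * ExteriorAlgebra.ι ℝ m' * x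
      - algebraMap ℝ _ (body V (ExteriorAlgebra.ι ℝ m * ExteriorAlgebra.ι ℝ m' * x)) ∈ _
    rw [this, map_zero, sub_zero]
    refine AddSubmonoid.subset_closure ⟨?_, ?_⟩
    · have h2 := mul_mem_part V (mul_mem_part V (ι_mem_odd m) (ι_mem_odd m')) hx
      exact h2
    · rw [mul_assoc]; exact sqz_ι_mul _ _

theorem body_sqz {ε : Grass V} (h : Sqz ε) : body V ε = 0 := by
  have := congrArg (body V) h.sq
  rw [map_mul, map_zero] at this
  exact mul_self_eq_zero.mp this

theorem body_odd {a : Grass V} (ha : a ∈ part V 1) : body V a = 0 := body_sqz (sqz_odd ha)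

/-! #### Generators that do not occur in given elements -/

/-- The contraction by a linear form, on the complexification. -/
def contrC (d : Module.Dual ℝ V) : GrassC V →ₗ[ℂ] GrassC V :=
  LinearMap.baseChange ℂ (CliffordAlgebra.contractLeft (Q := (0 : QuadraticForm ℝ V)) d)

theorem contrC_ofG (d : Module.Dual ℝ V) (a : Grass V) :
    contrC d (ofG a) = ofG (CliffordAlgebra.contractLeft (Q := (0 : QuadraticForm ℝ V)) d a) := rfl

theorem contrC_ι_mul (d : Module.Dual ℝ V) (m : V) (x : GrassC V) :
    contrC d (ofG (ExteriorAlgebra.ι ℝ m) * x)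
      = (d m : ℂ) • x - ofG (ExteriorAlgebra.ι ℝ m) * contrC d x := by
  induction x using GrassC.induction with
  | h c b =>
    have h : CliffordAlgebra.contractLeft (Q := (0 : QuadraticForm ℝ V)) d
        (ExteriorAlgebra.ι ℝ m * b) = d m • b - ExteriorAlgebra.ι ℝ m *
          CliffordAlgebra.contractLeft (Q := (0 : QuadraticForm ℝ V)) d b :=
      CliffordAlgebra.contractLeft_ι_mul d m b
    have h' : ofG (d m • b) = (d m : ℂ) • ofG b := by
      rw [map_smul]; exact (algebraMap_smul ℂ (d m) (ofG b)).symm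
    rw [mul_smul_comm, ← map_mul, map_smul, contrC_ofG, h, map_sub, map_mul, h',
      map_smul (contrC d), contrC_ofG, mul_smul_comm, smul_sub, smul_comm]
  | hadd x y hx hy => rw [mul_add, map_add, hx, hy, map_add, mul_add, smul_add]; abel

/-- An element of `𝒜_ℂ` involves only finitely many basis vectors. -/
theorem contrC_finite {ι : Type*} (b : Module.Basis ι ℝ V) (x : GrassC V) :
    {i | contrC (b.coord i) x ≠ 0}.Finite := by
  induction x using GrassC.induction with
  | h c a =>
    have h : {i | CliffordAlgebra.contractLeft (Q := (0 : QuadraticForm ℝ V)) (b.coord i) a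
        ≠ 0}.Finite := by
      induction a using CliffordAlgebra.left_induction with
      | algebraMap r => simp [CliffordAlgebra.contractLeft_algebraMap]
      | add x y hx hy =>
        refine (hx.union hy).subset fun i hi => ?_
        by_contra hn
        simp only [Set.mem_union, Set.mem_ofPred_eq, not_or, not_not] at hn
        exact hi (by rw [map_add, hn.1, hn.2, add_zero])
      | ι_mul x m hx =>
        refine ((b.repr m).support.finite_toSet.union hx).subset fun i hi => ?_
        by_contra hn
        simp only [Set.mem_union, Finset.mem_coe, Finsupp.mem_support_iff, Set.mem_ofPred_eq,
          not_or, not_not] at hn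
        refine hi ?_
        rw [CliffordAlgebra.contractLeft_ι_mul, hn.2, Module.Basis.coord_apply, hn.1]
        simp
    refine h.subset fun i hi h0 => hi ?_
    rw [map_smul, contrC_ofG, h0, map_zero, smul_zero]
  | hadd x y hx hy =>
    refine (hx.union hy).subset fun i hi => ?_
    by_contra hn
    simp only [Set.mem_union, Set.mem_ofPred_eq, not_or, not_not] at hn
    exact hi (by rw [map_add, hn.1, hn.2, add_zero])

/-- As `V` is infinite-dimensional, there is a generator that does not occur in given elements. -/
theorem exists_fresh (hV : ¬ Module.Finite ℝ V) (C : Finset (GrassC V)) :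
    ∃ (v : V) (d : Module.Dual ℝ V), d v = 1 ∧ ∀ x ∈ C, contrC d x = 0 := by
  let b := Module.Basis.ofVectorSpace ℝ V
  have hinf : Infinite (Module.Basis.ofVectorSpaceIndex ℝ V) := by
    by_contra h
    rw [not_infinite_iff_finite] at h
    exact hV (Module.Finite.of_basis b)
  have hfin : (⋃ x ∈ C, {i | contrC (b.coord i) x ≠ 0}).Finite :=
    C.finite_toSet.biUnion fun x _ => contrC_finite b x
  obtain ⟨i, hi⟩ := hfin.infinite_compl.nonempty
  refine ⟨b i, b.coord i, by simp, fun x hx => ?_⟩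
  by_contra h
  exact hi (Set.mem_biUnion hx h)

theorem eq_zero_of_fresh_mul {v : V} {d : Module.Dual ℝ V} (hv : d v = 1) {x : GrassC V}
    (hx : contrC d x = 0) (h : ofG (ExteriorAlgebra.ι ℝ v) * x = 0) : x = 0 := by
  have := contrC_ι_mul d v x
  rw [h, map_zero, hv, hx, mul_zero, sub_zero, Complex.ofReal_one, one_smul] at this
  exact this.symm

end Grassmann

/-! ### Points of the superspace and Taylor extensions -/

section Points

variable {V : Type*} [AddCommGroup V] [Module ℝ V] {p n : ℕ}

/-- The point with the single non-zero coordinate `a`, of index `μ`. -/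
def sg (μ : Idx p n) : part V (deg μ) →ₗ[ℝ] Superspace V p n where
  toFun a := ⟨fun ν => if ν = μ then a.1 else 0, fun ν => by
    change (if ν = μ then a.1 else 0) ∈ _
    split_ifs with h
    · subst h; exact a.2
    · exact Submodule.zero_mem _⟩
  map_add' a b := Subtype.ext (funext fun ν => by
    change (if ν = μ then a.1 + b.1 else 0) = (if ν = μ then a.1 else 0) + if ν = μ then b.1 else 0
    split_ifs <;> simp)
  map_smul' r a := Subtype.ext (funext fun ν => by
    change (if ν = μ then r • a.1 else 0) = r • if ν = μ then a.1 else 0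
    split_ifs <;> simp)

theorem sg_apply (μ : Idx p n) (a : part V (deg μ)) (ν : Idx p n) :
    (sg μ a).1 ν = if ν = μ then a.1 else 0 := rfl

theorem sum_sg (z : Superspace V p n) : ∑ μ, sg μ ⟨z.1 μ, z.2 μ⟩ = z := by
  refine Subtype.ext (funext fun ν => ?_)
  rw [AddSubmonoidClass.coe_finsetSum, Finset.sum_apply]
  simp [sg_apply]

/-- The real points. -/
def rl : Body p →ₗ[ℝ] Superspace V p n where
  toFun y := ⟨Sum.elim (fun i => algebraMap ℝ (Grass V) (y i)) 0, by
    rintro (i | i)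
    · exact algebraMap_mem_even _
    · exact Submodule.zero_mem _⟩
  map_add' a b := Subtype.ext (funext fun ν => by rcases ν with i | i <;> simp)
  map_smul' r a := Subtype.ext (funext fun ν => by
    rcases ν with i | i <;> simp [Algebra.algebraMap_eq_smul_one, mul_smul])

theorem rl_inl (y : Body p) (i : EvenIdx p) :
    (rl y : Superspace V p n).1 (Sum.inl i) = algebraMap ℝ (Grass V) (y i) := rfl

theorem rl_inr (y : Body p) (i : Fin n) : (rl y : Superspace V p n).1 (Sum.inr i) = 0 := rfl

theorem bodyPt_apply (z : Superspace V p n) (i : EvenIdx p) :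
    bodyPt z i = body V (z.1 (Sum.inl i)) := rfl

theorem bodyPt_rl (y : Body p) : bodyPt (rl y : Superspace V p n) = y := by
  ext i; rw [bodyPt_apply, rl_inl, body_algebraMap]

theorem bodyPt_add (z z' : Superspace V p n) : bodyPt (z + z') = bodyPt z + bodyPt z' := by
  ext i; exact map_add _ _ _

theorem soul_rl (y : Body p) : soul (rl y : Superspace V p n) = 0 := by
  ext i; rw [soul, rl_inl, body_algebraMap, sub_self]; rfl

theorem bodyPt_sg {μ : Idx p n} {ε : part V (deg μ)} (h : body V ε.1 = 0) :
    bodyPt (sg μ ε) = 0 := by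
  ext i
  rw [bodyPt_apply, sg_apply]
  split_ifs
  · exact h
  · exact map_zero _

theorem bodyPt_add_sg (z : Superspace V p n) {μ : Idx p n} {ε : part V (deg μ)} (h : Sqz ε.1) :
    bodyPt (z + sg μ ε) = bodyPt z := by
  rw [bodyPt_add, bodyPt_sg (body_sqz h), add_zero]

theorem soul_add_sg_inl (z : Superspace V p n) (j : EvenIdx p)
    {ε : part V (deg (Sum.inl j : Idx p n))} (h : Sqz ε.1) :
    soul (z + sg (Sum.inl j) ε) = soul z + Pi.single j ε.1 := by
  ext i
  have e : (z + sg (Sum.inl j) ε).1 (Sum.inl i) = z.1 (Sum.inl i) + if i = j then ε.1 else 0 := by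
    change z.1 _ + (sg (Sum.inl j) ε).1 _ = _
    simp [sg_apply]
  rw [soul, Pi.add_apply, soul, e, map_add, Pi.single_apply]
  have : body V (if i = j then ε.1 else 0) = 0 := by
    split_ifs
    · exact body_sqz h
    · exact map_zero _
  rw [this, add_zero]; abel

theorem soul_add_sg_inr (z : Superspace V p n) (j : Fin n)
    (ε : part V (deg (Sum.inr j : Idx p n))) : soul (z + sg (Sum.inr j) ε) = soul z := by
  ext i
  have e : (z + sg (Sum.inr j) ε).1 (Sum.inl i) = z.1 (Sum.inl i) := by
    change z.1 _ + (sg (Sum.inr j) ε).1 _ = _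
    simp [sg_apply]
  rw [soul, soul, e]

theorem sqz_of_inr {j : Fin n} (ε : part V (deg (Sum.inr j : Idx p n))) : Sqz ε.1 :=
  sqz_odd ε.2

/-- A property of elements of `𝒜` that is preserved under sums and holds for the even elements that
square to zero holds for the nilpotent part of an even element. -/
theorem soul_induction {Q : Grass V → Prop} (h0 : Q 0) (hadd : ∀ a b, Q a → Q b → Q (a + b))
    (hs : ∀ ε ∈ evenSqz V, Q ε) {a : Grass V} (ha : a ∈ part V 0) :
    Q (a - algebraMap ℝ _ (body V a)) :=
  AddSubmonoid.closure_induction (motive := fun a _ => Q a) hs h0 (fun a b _ _ => hadd a b)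
    (sub_body_mem_closure ha)

/-- A property of points that holds at the real points and is preserved if a coordinate is moved by
an element that squares to zero holds everywhere. -/
theorem Superspace.induction {P : Superspace V p n → Prop} (h0 : ∀ y, P (rl y))
    (h1 : ∀ z μ (ε : part V (deg μ)), Sqz ε.1 → P z → P (z + sg μ ε)) (z : Superspace V p n) :
    P z := by
  let S : AddSubmonoid (Superspace V p n) :=
    { carrier := {N | ∀ z, P z → P (z + N)}
      zero_mem' := fun z hz => by rwa [add_zero]
      add_mem' := fun {a b} ha hb z hz => by rw [← add_assoc]; exact hb _ (ha _ hz) }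
  have key : ∀ μ : Idx p n, ∃ N ∈ S, sg μ ⟨z.1 μ, z.2 μ⟩
      = N + sg μ ⟨(rl (bodyPt z) : Superspace V p n).1 μ, (rl (bodyPt z)).2 μ⟩ := by
    rintro (i | i)
    · have hz : z.1 (Sum.inl i) ∈ part V 0 := z.2 (Sum.inl i)
      obtain ⟨h, h'⟩ := soul_induction
        (Q := fun a => ∃ h : a ∈ part V (deg (Sum.inl i : Idx p n)), sg _ ⟨a, h⟩ ∈ S)
        ⟨Submodule.zero_mem _, (map_zero (sg (V := V) (Sum.inl i : Idx p n))) ▸ S.zero_mem⟩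
        (fun a b ⟨ha, ha'⟩ ⟨hb, hb'⟩ => ⟨Submodule.add_mem _ ha hb,
          (map_add (sg (V := V) (Sum.inl i : Idx p n)) ⟨a, ha⟩ ⟨b, hb⟩) ▸ S.add_mem ha' hb'⟩)
        (fun a ha => ⟨ha.1, fun z hz => h1 z _ _ ha.2 hz⟩) hz
      refine ⟨_, h', ?_⟩
      rw [← map_add]
      congr 1
      refine Subtype.ext ?_
      change _ = z.1 (Sum.inl i) - algebraMap ℝ _ (body V (z.1 (Sum.inl i)))
        + algebraMap ℝ _ (body V (z.1 (Sum.inl i)))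
      rw [sub_add_cancel]
    · refine ⟨sg (Sum.inr i) ⟨z.1 _, z.2 _⟩, fun z hz => h1 z _ _ (sqz_of_inr _) hz, ?_⟩
      have : (⟨(rl (bodyPt z) : Superspace V p n).1 (Sum.inr i), (rl (bodyPt z)).2 _⟩ :
          part V (deg (Sum.inr i : Idx p n))) = 0 := Subtype.ext rfl
      rw [this, map_zero, add_zero]
  choose N hN hN' using key
  have e : z = rl (bodyPt z) + ∑ μ, N μ := by
    conv_lhs => rw [← sum_sg z]
    rw [Finset.sum_congr rfl fun μ _ => hN' μ, Finset.sum_add_distrib, sum_sg, add_comm]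
  rw [e]
  exact S.sum_mem (fun μ _ => hN μ) _ (h0 _)

end Points

section Taylor

variable {V : Type*} [AddCommGroup V] [Module ℝ V] {p n : ℕ}

/-- The vectors of the standard basis of the body. -/
abbrev eb (j : EvenIdx p) : Body p := EuclideanSpace.single j (1 : ℝ)

/-- The sum `∑ ∂_{i₁}⋯∂_{i_k} g(x) s_{i₁}⋯s_{i_k}`. -/
def taylorTerm (k : ℕ) (g : Body p → ℂ) (x : Body p) (s : EvenIdx p → Grass V) : GrassC V :=
  ∑ i : Fin k → EvenIdx p, iteratedFDeriv ℝ k g x (fun j => eb (i j))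
    • ofG (List.ofFn fun j => s (i j)).prod

theorem taylorExt_eq_finsum (g : Body p → ℂ) (z : Superspace V p n) :
    taylorExt g z
      = ∑ᶠ k : ℕ, (k.factorial : ℂ)⁻¹ • taylorTerm k g (bodyPt z) (soul z) := by
  simp only [taylorExt, taylorTerm, tmul_eq_smul, Finset.smul_sum, smul_smul]

theorem taylorTerm_zero (g : Body p → ℂ) (x : Body p) (s : EvenIdx p → Grass V) :
    taylorTerm 0 g x s = g x • 1 := by
  simp [taylorTerm]

theorem taylorTerm_succ {g : Body p → ℂ} (hg : ContDiff ℝ ∞ g) (k : ℕ) (x : Body p)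
    (s : EvenIdx p → Grass V) :
    taylorTerm (k + 1) g x s = ∑ j, ofG (s j) * taylorTerm k (pd (eb j) g) x s := by
  rw [taylorTerm, ← (Fin.consEquiv fun _ : Fin (k + 1) => EvenIdx p).sum_comp,
    Fintype.sum_prod_type]
  refine Finset.sum_congr rfl fun j _ => ?_
  rw [taylorTerm, Finset.mul_sum]
  refine Finset.sum_congr rfl fun i _ => ?_
  rw [List.ofFn_succ, List.prod_cons, map_mul, mul_smul_comm, iteratedFDeriv_succ_apply_left,
    ← pd_iteratedFDeriv hg]
  rfl

theorem taylorTerm_shift {s : EvenIdx p → Grass V} (hs : ∀ i, s i ∈ part V 0) {ε : Grass V}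
    (hq : Sqz ε) (j : EvenIdx p) (x : Body p) (k : ℕ) {g : Body p → ℂ}
    (hg : ContDiff ℝ ∞ g) :
    taylorTerm k g x (s + Pi.single j ε)
      = taylorTerm k g x s + (k : ℂ) • (ofG ε * taylorTerm (k - 1) (pd (eb j) g) x s) := by
  induction k generalizing g with
  | zero => simp [taylorTerm_zero]
  | succ k ih =>
    have h1 : ∀ i, ofG ((s + Pi.single j ε : EvenIdx p → Grass V) i) * taylorTerm k (pd (eb i) g) x
          (s + Pi.single j ε : EvenIdx p → Grass V)
        = ofG (s i) * taylorTerm k (pd (eb i) g) x s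
          + (k : ℂ) • (ofG ε * (ofG (s i) * taylorTerm (k - 1) (pd (eb i) (pd (eb j) g)) x s))
          + if i = j then ofG ε * taylorTerm k (pd (eb i) g) x s else 0 := by
      intro i
      rw [ih (contDiff_pd hg _), Pi.add_apply, Pi.single_apply, pd_comm hg, map_add, add_mul,
        mul_add, mul_smul_comm, ← mul_assoc (ofG (s i)), ofG_even_mul (hs i) (ofG ε), mul_assoc]
      congr 1
      split_ifs
      · rw [mul_add, mul_smul_comm, ← mul_assoc (ofG ε), ← map_mul, hq.sq, map_zero, zero_mul,
          smul_zero, add_zero]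
      · rw [map_zero, zero_mul]
    rw [taylorTerm_succ hg, taylorTerm_succ hg, Finset.sum_congr rfl fun i _ => h1 i,
      Finset.sum_add_distrib, Finset.sum_add_distrib, add_assoc, add_tsub_cancel_right]
    congr 1
    rw [Finset.sum_ite_eq' Finset.univ j, if_pos (Finset.mem_univ j), ← Finset.smul_sum,
      ← Finset.mul_sum]
    rcases k with _ | k
    · simp
    · rw [add_tsub_cancel_right, ← taylorTerm_succ (contDiff_pd hg _), Nat.cast_succ (k + 1),
        add_smul, one_smul]

theorem soul_mem (z : Superspace V p n) (i : EvenIdx p) : soul z i ∈ part V 0 :=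
  Submodule.sub_mem _ (z.2 (Sum.inl i)) (algebraMap_mem_even _)

theorem exists_taylorTerm_eq_zero (z : Superspace V p n) :
    ∃ N : ℕ, ∀ k, N ≤ k → ∀ g : Body p → ℂ, ContDiff ℝ ∞ g →
      taylorTerm k g (bodyPt z) (soul z) = 0 := by
  induction z using Superspace.induction with
  | h0 y =>
    refine ⟨1, fun k hk g hg => ?_⟩
    obtain ⟨k, rfl⟩ := Nat.exists_eq_add_of_le' hk
    rw [taylorTerm_succ hg, soul_rl]
    simp
  | h1 z μ ε hε ih =>
    obtain ⟨N, hN⟩ := ih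
    rcases μ with j | j
    · refine ⟨N + 1, fun k hk g hg => ?_⟩
      rw [bodyPt_add_sg z hε, soul_add_sg_inl z j hε,
        taylorTerm_shift (soul_mem z) hε j _ _ hg, hN k (by omega) g hg,
        hN (k - 1) (by omega) _ (contDiff_pd hg _)]
      simp
    · rw [bodyPt_add_sg z hε, soul_add_sg_inr z j ε]
      exact ⟨N, hN⟩

theorem taylorExt_eq_sum (z : Superspace V p n) :
    ∃ N : ℕ, ∀ M, N ≤ M → ∀ g : Body p → ℂ, ContDiff ℝ ∞ g → taylorExt g z
      = ∑ k ∈ Finset.range M, (k.factorial : ℂ)⁻¹ • taylorTerm k g (bodyPt z) (soul z) := by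
  obtain ⟨N, hN⟩ := exists_taylorTerm_eq_zero z
  refine ⟨N, fun M hM g hg => ?_⟩
  rw [taylorExt_eq_finsum]
  refine finsum_eq_sum_of_support_subset _ fun k hk => ?_
  rw [Finset.coe_range, Set.mem_Iio]
  by_contra h
  exact hk (by simp only [hN k (by omega) g hg, smul_zero])

theorem taylorExt_rl (g : Body p → ℂ) (hg : ContDiff ℝ ∞ g) (y : Body p) :
    taylorExt g (rl y : Superspace V p n) = g y • 1 := by
  obtain ⟨N, hN⟩ := taylorExt_eq_sum (rl y : Superspace V p n)
  rw [hN (N + 1) (by omega) g hg, Finset.sum_range_succ']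
  simp only [taylorTerm_succ hg, soul_rl, Pi.zero_apply, map_zero, zero_mul,
    Finset.sum_const_zero, smul_zero, zero_add, taylorTerm_zero, bodyPt_rl]
  simp

/-- The first order Taylor formula is exact for an increment that squares to zero. -/
theorem taylorExt_shift {g : Body p → ℂ} (hg : ContDiff ℝ ∞ g) (z : Superspace V p n)
    (j : EvenIdx p) (ε : part V (deg (Sum.inl j : Idx p n))) (hε : Sqz ε.1) :
    taylorExt g (z + sg (Sum.inl j) ε) = taylorExt g z + ofG ε.1 * taylorExt (pd (eb j) g) z := by
  obtain ⟨N, hN⟩ := taylorExt_eq_sum z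
  obtain ⟨N', hN'⟩ := taylorExt_eq_sum (z + sg (Sum.inl j) ε)
  rw [hN' (N + N' + 1) (by omega) g hg, hN (N + N' + 1) (by omega) g hg,
    hN (N + N') (by omega) _ (contDiff_pd hg _)]
  rw [Finset.sum_congr rfl fun k _ => by
    rw [bodyPt_add_sg z hε, soul_add_sg_inl z j hε,
      taylorTerm_shift (soul_mem z) hε j _ _ hg, smul_add], Finset.sum_add_distrib]
  congr 1
  rw [Finset.sum_range_succ', Nat.cast_zero, zero_smul, smul_zero, add_zero, Finset.mul_sum]
  refine Finset.sum_congr rfl fun k _ => ?_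
  have h : ((k + 1 : ℕ) : ℂ) ≠ 0 := by exact_mod_cast k.succ_ne_zero
  rw [mul_smul_comm, smul_smul, Nat.factorial_succ, add_tsub_cancel_right, Nat.cast_mul, mul_inv,
    mul_right_comm, inv_mul_cancel₀ h, one_mul]

theorem taylorExt_shift_inr (g : Body p → ℂ) (z : Superspace V p n)
    (j : Fin n) (ε : part V (deg (Sum.inr j : Idx p n))) :
    taylorExt g (z + sg (Sum.inr j) ε) = taylorExt g z := by
  rw [taylorExt_eq_finsum, taylorExt_eq_finsum, bodyPt_add_sg z (sqz_of_inr ε),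
    soul_add_sg_inr z j ε]

theorem parC_taylorExt {g : Body p → ℂ} (hg : ContDiff ℝ ∞ g) (z : Superspace V p n) :
    parC (taylorExt g z) = taylorExt g z := by
  induction z using Superspace.induction generalizing g with
  | h0 y => rw [taylorExt_rl _ hg, map_smul, map_one]
  | h1 z μ ε hε ih =>
    rcases μ with j | j
    · rw [taylorExt_shift hg z j ε hε, map_add, map_mul, parC_ofG, parityAut_even ε.2, ih hg,
        ih (contDiff_pd hg _)]
    · rw [taylorExt_shift_inr, ih hg]

theorem mul_taylorExt {g : Body p → ℂ} (hg : ContDiff ℝ ∞ g) (z : Superspace V p n)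
    (x : GrassC V) : x * taylorExt g z = taylorExt g z * x := by
  induction z using Superspace.induction generalizing g with
  | h0 y => rw [taylorExt_rl _ hg, mul_smul_comm, smul_mul_assoc, mul_one, one_mul]
  | h1 z μ ε hε ih =>
    rcases μ with j | j
    · rw [taylorExt_shift hg z j ε hε, mul_add, add_mul, ih hg, mul_assoc, ← ih (contDiff_pd hg _),
        ← mul_assoc, ← ofG_even_mul ε.2, mul_assoc]
    · rw [taylorExt_shift_inr, ih hg]

theorem taylorExt_add {g h : Body p → ℂ} (hg : ContDiff ℝ ∞ g) (hh : ContDiff ℝ ∞ h)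
    (z : Superspace V p n) : taylorExt (fun y => g y + h y) z = taylorExt g z + taylorExt h z := by
  induction z using Superspace.induction generalizing g h with
  | h0 y => rw [taylorExt_rl _ hg, taylorExt_rl _ hh, taylorExt_rl _ (hg.add hh), add_smul]
  | h1 z μ ε hε ih =>
    rcases μ with j | j
    · rw [taylorExt_shift hg z j ε hε, taylorExt_shift hh z j ε hε,
        taylorExt_shift (hg.add hh) z j ε hε, pd_add hg hh, ih hg hh,
        ih (contDiff_pd hg _) (contDiff_pd hh _), mul_add]
      abel
    · simp only [taylorExt_shift_inr, ih hg hh]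

theorem taylorExt_mul {g h : Body p → ℂ} (hg : ContDiff ℝ ∞ g) (hh : ContDiff ℝ ∞ h)
    (z : Superspace V p n) : taylorExt (fun y => g y * h y) z = taylorExt g z * taylorExt h z := by
  induction z using Superspace.induction generalizing g h with
  | h0 y =>
    rw [taylorExt_rl _ hg, taylorExt_rl _ hh, taylorExt_rl _ (hg.mul hh), smul_mul_smul_comm,
      one_mul]
  | h1 z μ ε hε ih =>
    rcases μ with j | j
    · rw [taylorExt_shift hg z j ε hε, taylorExt_shift hh z j ε hε,
        taylorExt_shift (hg.mul hh) z j ε hε, pd_mul hg hh, ih hg hh,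
        taylorExt_add ((contDiff_pd hg _).mul hh) (hg.mul (contDiff_pd hh _)),
        ih (contDiff_pd hg _) hh, ih hg (contDiff_pd hh _)]
      have h0 : ofG ε.1 * taylorExt (pd (eb j) g) z * (ofG ε.1 * taylorExt (pd (eb j) h) z) = 0 := by
        rw [← mul_assoc, hε.ofG, zero_mul]
      have h1 : taylorExt g z * (ofG ε.1 * taylorExt (pd (eb j) h) z)
          = ofG ε.1 * (taylorExt g z * taylorExt (pd (eb j) h) z) := by
        rw [← mul_assoc, ← ofG_even_mul ε.2, mul_assoc]
      rw [add_mul, mul_add (taylorExt g z), mul_add (ofG ε.1 * _), h0, h1, mul_add, mul_assoc]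
      abel
    · simp only [taylorExt_shift_inr, ih hg hh]

theorem taylorExt_const (c : ℂ) (z : Superspace V p n) :
    taylorExt (fun _ : Body p => c) z = c • 1 := by
  induction z using Superspace.induction generalizing c with
  | h0 y => rw [taylorExt_rl _ contDiff_const]
  | h1 z μ ε hε ih =>
    rcases μ with j | j
    · rw [taylorExt_shift contDiff_const z j ε hε, pd_const, ih, ih, zero_smul, mul_zero, add_zero]
    · rw [taylorExt_shift_inr, ih]

theorem taylorExt_const_mul {g : Body p → ℂ} (hg : ContDiff ℝ ∞ g) (c : ℂ)
    (z : Superspace V p n) : taylorExt (fun y => c * g y) z = c • taylorExt g z := by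
  rw [taylorExt_mul contDiff_const hg, taylorExt_const, smul_mul_assoc, one_mul]

end Taylor

/-! ### Values of superfunctions -/

section Eval

variable {V : Type*} [AddCommGroup V] [Module ℝ V] {p n : ℕ}

/-- The derivative with respect to the coordinate of index `μ`, a left derivative if it is odd. -/
def dS (μ : Idx p n) (f : SuperFun p n) : SuperFun p n :=
  Sum.elim (fun j => pdS (eb j) f) (fun i => dXi i f) μ

/-- Left multiplication by the coordinate of index `μ`. -/
def zS (μ : Idx p n) : SuperFun p n →ₗ[ℂ] SuperFun p n :=
  Sum.elim (fun j => bodyMul fun y => (y j : ℂ)) xiMul μ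

theorem dS_inr (i : Fin n) (f : SuperFun p n) : dS (Sum.inr i) f = dXi i f := rfl

theorem zS_inl (j : EvenIdx p) (f : SuperFun p n) :
    zS (Sum.inl j) f = bodyMul (fun y => (y j : ℂ)) f := rfl

theorem zS_inr (i : Fin n) (f : SuperFun p n) : zS (Sum.inr i) f = xiMul i f := rfl

theorem smooth_of_mem {f : SuperFun p n} (hf : f ∈ PGS p n) : f.Smooth := fun I => (hf I).smooth

theorem contDiff_coord (j : EvenIdx p) : ContDiff ℝ ∞ fun y : Body p => (y j : ℂ) :=
  Complex.ofRealCLM.contDiff.comp (EuclideanSpace.proj j : Body p →L[ℝ] ℝ).contDiff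

theorem pd_coord (a : Body p) (j : EvenIdx p) :
    pd a (fun y : Body p => (y j : ℂ)) = fun _ => (a j : ℂ) :=
  pd_clm (Complex.ofRealCLM.comp (EuclideanSpace.proj j : Body p →L[ℝ] ℝ)) a

theorem taylorExt_coord (j : EvenIdx p) (z : Superspace V p n) :
    taylorExt (fun y : Body p => (y j : ℂ)) z = ofG (z.1 (Sum.inl j)) := by
  induction z using Superspace.induction with
  | h0 y =>
    rw [taylorExt_rl _ (contDiff_coord j), rl_inl, AlgHom.commutes, Algebra.algebraMap_eq_smul_one]
    exact algebraMap_smul ℂ (y j) _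
  | h1 z μ ε hε ih =>
    change _ = ofG (z.1 _ + (sg μ ε).1 _)
    rw [map_add, sg_apply]
    rcases μ with i | i
    · rw [taylorExt_shift (contDiff_coord j) z i ε hε, ih, pd_coord, taylorExt_const]
      congr 1
      by_cases h : j = i
      · subst h; simp
      · simp [h]
    · rw [taylorExt_shift_inr, ih]; simp

theorem parC_mono (z : Superspace V p n) (I : Finset (Fin n)) :
    parC (ofG (oddMonomial z I)) = (-1 : ℂ) ^ I.card • ofG (oddMonomial z I) := by
  change parC (ofG (mono _ I)) = _ • ofG (mono _ I)
  induction I using Finset.induction_on_min with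
  | empty => simp [mono_empty]
  | insert a s ha ih =>
    have h : parC (ofG (z.1 (Sum.inr a))) = (-1 : ℂ) • ofG (z.1 (Sum.inr a)) := by
      rw [parC_ofG, parityAut_odd (z.2 (Sum.inr a)), map_neg, neg_one_smul]
    rw [mono_insert ha, map_mul, map_mul, ih, h, smul_mul_smul_comm,
      Finset.card_insert_of_notMem fun h => lt_irrefl _ (ha a h), pow_succ']

theorem xi_anticomm (z : Superspace V p n) (i j : Fin n) :
    z.1 (Sum.inr i) * z.1 (Sum.inr j) = -(z.1 (Sum.inr j) * z.1 (Sum.inr i)) := by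
  rw [odd_mul_eq (z.2 (Sum.inr i)), parityAut_odd (z.2 (Sum.inr j)), neg_mul]

theorem mono_shift {R : Type*} [Ring R] {x : Fin n → R} {e : R} (he : ∀ j, x j * e = -(e * x j))
    (i : Fin n) (I : Finset (Fin n)) :
    mono (fun k => x k + if Sum.inr k = (Sum.inr i : Idx p n) then e else 0) I
      = mono x I + if i ∈ I then (-1) ^ lowCard i I * (e * mono x (I.erase i)) else 0 := by
  induction I using Finset.induction_on_min with
  | empty => simp [mono_empty]
  | insert a s ha ih =>
    have has : a ∉ s := fun h => lt_irrefl _ (ha a h)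
    rw [mono_insert ha, mono_insert ha, ih]
    by_cases h : a = i
    · subst h
      rw [if_pos rfl, if_neg has, if_pos (Finset.mem_insert_self a s), Finset.erase_insert has,
        lowCard_of_forall_le, pow_zero, one_mul, add_zero, add_mul]
      intro b hb
      rcases Finset.mem_insert.mp hb with rfl | hb
      exacts [le_rfl, (ha b hb).le]
    · have h' : (Sum.inr a : Idx p n) ≠ Sum.inr i := fun h' => h (Sum.inr_injective h')
      rw [if_neg h', add_zero, mul_add]
      congr 1
      by_cases his : i ∈ s
      · rw [if_pos his, if_pos (Finset.mem_insert_of_mem his), lowCard_insert_lt has (ha i his),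
          Finset.erase_insert_of_ne h, mono_insert fun b hb => ha b (Finset.mem_of_mem_erase hb),
          pow_succ, ← mul_assoc (x a), ((Commute.neg_one_right (x a)).pow_right _).eq, mul_assoc,
          ← mul_assoc (x a), he]
        noncomm_ring
      · rw [if_neg his, if_neg, mul_zero]
        rintro h
        rcases Finset.mem_insert.mp h with h | h
        exacts [‹¬a = i› h.symm, his h]

theorem oddMonomial_rl (y : Body p) (I : Finset (Fin n)) :
    oddMonomial (rl y : Superspace V p n) I = if I = ∅ then 1 else 0 := by
  change mono _ I = _
  induction I using Finset.induction_on_min with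
  | empty => simp [mono_empty]
  | insert a s ha ih =>
    rw [mono_insert ha, rl_inr, zero_mul, if_neg (Finset.insert_ne_empty a s)]

theorem eval_eq (f : SuperFun p n) (z : Superspace V p n) :
    f.eval z = ∑ I, taylorExt (f I) z * ofG (oddMonomial z I) := rfl

theorem eval_rl {f : SuperFun p n} (hf : f.Smooth) (y : Body p) :
    f.eval (rl y : Superspace V p n) = f ∅ y • 1 := by
  rw [eval_eq, Finset.sum_eq_single ∅]
  · rw [oddMonomial_rl, if_pos rfl, map_one, mul_one, taylorExt_rl _ (hf ∅)]
  · intro I _ h; rw [oddMonomial_rl, if_neg h, map_zero, mul_zero]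
  · simp

/-- The first order Taylor formula for superfunctions. -/
theorem eval_shift {f : SuperFun p n} (hf : f.Smooth) (z : Superspace V p n) {μ : Idx p n}
    {ε : part V (deg μ)} (hε : Sqz ε.1) :
    f.eval (z + sg μ ε) = f.eval z + ofG ε.1 * (dS μ f).eval z := by
  rcases μ with j | i
  · have h : ∀ I, oddMonomial (z + sg (Sum.inl j) ε) I = oddMonomial z I := by
      intro I
      have : (fun i : Fin n => (z + sg (Sum.inl j) ε).1 (Sum.inr i))
          = fun i => z.1 (Sum.inr i) := by
        ext i
        change z.1 _ + (sg (Sum.inl j) ε).1 _ = _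
        simp [sg_apply]
      rw [oddMonomial, this]; rfl
    simp only [eval_eq, h, taylorExt_shift (hf _) z j ε hε, add_mul, Finset.sum_add_distrib,
      Finset.mul_sum, mul_assoc]
    rfl
  · have hm : ∀ I, oddMonomial (z + sg (Sum.inr i) ε) I = oddMonomial z I
        + if i ∈ I then (-1) ^ lowCard i I * (ε.1 * oddMonomial z (I.erase i)) else 0 := by
      intro I
      refine mono_shift (p := p) (fun j => ?_) i I
      rw [odd_mul_eq (z.2 (Sum.inr j)), parityAut_odd ε.2, neg_mul]
    have h1 : ∀ I, taylorExt (f I) z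
        * ofG (if i ∈ I then (-1) ^ lowCard i I * (ε.1 * oddMonomial z (I.erase i)) else 0)
        = if i ∈ I then ofG ε.1 * ((-1 : ℂ) ^ lowCard i (I.erase i) •
            (taylorExt (f I) z * ofG (oddMonomial z (I.erase i)))) else 0 := by
      intro I
      split_ifs
      · have hc : ofG ε.1 * (taylorExt (f I) z * ofG (oddMonomial z (I.erase i)))
            = taylorExt (f I) z * ofG (ε.1 * oddMonomial z (I.erase i)) := by
          rw [← mul_assoc, mul_taylorExt (hf I), mul_assoc, ← map_mul]
        rw [lowCard_erase_self, mul_smul_comm, hc, ← mul_smul_comm]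
        congr 1
        rcases Nat.even_or_odd (lowCard i I) with h' | h' <;> simp [h'.neg_one_pow]
      · rw [map_zero, mul_zero]
    rw [eval_eq, eval_eq, eval_eq]
    simp only [hm, taylorExt_shift_inr, map_add, mul_add, Finset.sum_add_distrib, h1]
    congr 1
    rw [sum_mem_erase i fun J I => ofG ε.1 * ((-1 : ℂ) ^ lowCard i J •
      (taylorExt (f I) z * ofG (oddMonomial z J))), Finset.mul_sum]
    refine Finset.sum_congr rfl fun I _ => ?_
    rw [dS_inr, dXi_apply]
    split_ifs
    · rw [show (0 : Body p → ℂ) = fun _ => 0 from rfl, taylorExt_const, zero_smul, zero_mul, mul_zero]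
    · rw [show ((-1 : ℂ) ^ lowCard i I • f (insert i I))
        = fun y => (-1 : ℂ) ^ lowCard i I * f (insert i I) y from rfl,
        taylorExt_const_mul (hf _), smul_mul_assoc]

theorem eval_add {f g : SuperFun p n} (hf : f.Smooth) (hg : g.Smooth) (z : Superspace V p n) :
    (f + g).eval z = f.eval z + g.eval z := by
  rw [eval_eq, eval_eq, eval_eq, ← Finset.sum_add_distrib]
  exact Finset.sum_congr rfl fun I _ => by rw [← add_mul, ← taylorExt_add (hf I) (hg I)]; rfl

theorem eval_smul {f : SuperFun p n} (hf : f.Smooth) (c : ℂ) (z : Superspace V p n) :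
    (c • f).eval z = c • f.eval z := by
  rw [eval_eq, eval_eq, Finset.smul_sum]
  exact Finset.sum_congr rfl fun I _ => by
    rw [← smul_mul_assoc, ← taylorExt_const_mul (hf I)]; rfl

theorem parC_eval {f : SuperFun p n} (hf : f.Smooth) (z : Superspace V p n) :
    parC (f.eval z) = (parS f).eval z := by
  rw [eval_eq, eval_eq, map_sum]
  refine Finset.sum_congr rfl fun I _ => ?_
  rw [map_mul, parC_taylorExt (hf I), parC_mono, parS_apply, mul_smul_comm,
    show ((-1 : ℂ) ^ I.card • f I) = fun y => (-1 : ℂ) ^ I.card * f I y from rfl,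
    taylorExt_const_mul (hf I), smul_mul_assoc]

theorem coord_mul_eval {f : SuperFun p n} (hf : f.Smooth) (z : Superspace V p n) (μ : Idx p n) :
    ofG (z.1 μ) * f.eval z = (zS μ f).eval z := by
  rcases μ with j | i
  · rw [eval_eq, eval_eq, Finset.mul_sum]
    refine Finset.sum_congr rfl fun I _ => ?_
    rw [← mul_assoc, ← taylorExt_coord, ← taylorExt_mul (contDiff_coord j) (hf I)]; rfl
  · have h : ∀ I, ofG (z.1 (Sum.inr i)) * (taylorExt (f I) z * ofG (oddMonomial z I))
        = if i ∈ I then 0 else (-1 : ℂ) ^ lowCard i (insert i I) •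
          (taylorExt (f I) z * ofG (oddMonomial z (insert i I))) := by
      intro I
      have hm : z.1 (Sum.inr i) * oddMonomial z I
          = if i ∈ I then 0 else (-1) ^ lowCard i I * oddMonomial z (insert i I) :=
        mul_mono (x := fun i => z.1 (Sum.inr i)) (xi_anticomm z)
          (fun i => (sqz_odd (z.2 (Sum.inr i))).sq) i I
      rw [← mul_assoc, mul_taylorExt (hf I), mul_assoc, ← map_mul, hm]
      split_ifs
      · rw [map_zero, mul_zero]
      · rw [lowCard_insert_self, ← mul_smul_comm]
        congr 1
        rcases Nat.even_or_odd (lowCard i I) with h' | h' <;> simp [h'.neg_one_pow]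
    rw [eval_eq, eval_eq, Finset.mul_sum, Finset.sum_congr rfl fun I _ => h I,
      ← sum_mem_erase i fun J I => (-1 : ℂ) ^ lowCard i I •
        (taylorExt (f J) z * ofG (oddMonomial z I))]
    refine Finset.sum_congr rfl fun I _ => ?_
    rw [zS_inr, xiMul_apply]
    split_ifs
    · rw [show ((-1 : ℂ) ^ lowCard i I • f (I.erase i))
        = fun y => (-1 : ℂ) ^ lowCard i I * f (I.erase i) y from rfl,
        taylorExt_const_mul (hf _), smul_mul_assoc]
    · rw [show (0 : Body p → ℂ) = fun _ => 0 from rfl, taylorExt_const, zero_smul, zero_mul]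

end Eval

/-! ### Superfunctions with coefficients in the Grassmann algebra -/

section Coefficients

variable {V : Type*} [AddCommGroup V] [Module ℝ V] {p n : ℕ}

theorem exists_even_add_odd (a : Grass V) : ∃ b ∈ part V 0, ∃ c ∈ part V 1, b + c = a := by
  have h := (CliffordAlgebra.evenOdd_isCompl (Q := (0 : QuadraticForm ℝ V))).sup_eq_top
  exact Submodule.mem_sup.mp (h ▸ Submodule.mem_top : a ∈ part V 0 ⊔ part V 1)

theorem GrassC.induction_hom {P : GrassC V → Prop}
    (h : ∀ (c : ℂ) (i : ZMod 2) (a : Grass V), a ∈ part V i → P (c • ofG a))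
    (hadd : ∀ x y, P x → P y → P (x + y)) (x : GrassC V) : P x := by
  induction x using GrassC.induction with
  | h c a =>
    obtain ⟨b, hb, d, hd, rfl⟩ := exists_even_add_odd a
    rw [map_add, smul_add]
    exact hadd _ _ (h c 0 b hb) (h c 1 d hd)
  | hadd x y hx hy => exact hadd x y hx hy

/-- The superfunctions of polynomial growth with coefficients in `𝒜_ℂ`. -/
abbrev TT (V : Type*) [AddCommGroup V] [Module ℝ V] (p n : ℕ) : Type _ := GrassC V ⊗[ℂ] PGS p n

theorem TT.induction {P : TT V p n → Prop}
    (h : ∀ (i : ZMod 2) (a : Grass V) (f : PGS p n), a ∈ part V i → P (ofG a ⊗ₜ f))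
    (hadd : ∀ x y, P x → P y → P (x + y)) (x : TT V p n) : P x := by
  have h0 : P 0 := by simpa using h 0 0 0 (Submodule.zero_mem _)
  induction x using TensorProduct.induction_on with
  | zero => exact h0
  | tmul a f =>
    induction a using GrassC.induction_hom with
    | h c i a ha => rw [TensorProduct.smul_tmul]; exact h i a _ ha
    | hadd x y hx hy => rw [TensorProduct.add_tmul]; exact hadd _ _ hx hy
  | add x y hx hy => exact hadd x y hx hy

/-- The derivative with respect to a coordinate. -/
def dP (μ : Idx p n) : PGS p n →ₗ[ℂ] PGS p n where
  toFun f := ⟨dS μ f.1, by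
    rcases μ with j | i
    · exact pdS_mem f.2 _
    · exact dXi_mem f.2 _⟩
  map_add' f g := Subtype.ext (by
    rcases μ with j | i
    · ext I y; exact congrFun (pd_add (f.2 I).smooth (g.2 I).smooth _) y
    · exact map_add (dXi i) f.1 g.1)
  map_smul' r f := Subtype.ext (by
    rcases μ with j | i
    · ext I y; exact congrFun (pd_const_mul (f.2 I).smooth r _) y
    · exact map_smul (dXi i) r f.1)

theorem polyB_coord (j : EvenIdx p) : PolyB fun y : Body p => (y j : ℂ) :=
  PolyB.clm (Complex.ofRealCLM.comp (EuclideanSpace.proj j : Body p →L[ℝ] ℝ))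

theorem zS_mem (μ : Idx p n) {f : SuperFun p n} (hf : f ∈ PGS p n) : zS μ f ∈ PGS p n := by
  rcases μ with j | i
  · exact bodyMul_mem hf (polyB_coord j)
  · exact xiMul_mem hf i

/-- Left multiplication by a coordinate. -/
def zP (μ : Idx p n) : PGS p n →ₗ[ℂ] PGS p n := (zS μ).restrict fun _ hf => zS_mem μ hf

/-- The parity operator. -/
def parP : PGS p n →ₗ[ℂ] PGS p n := parS.restrict fun _ hf => parS_mem hf

/-- The parity operator, to the power of a degree. -/
def parPP (i : ZMod 2) : PGS p n →ₗ[ℂ] PGS p n := if i = 0 then LinearMap.id else parP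

theorem parPP_zero : parPP (p := p) (n := n) 0 = LinearMap.id := if_pos rfl

theorem parPP_one : parPP (p := p) (n := n) 1 = parP := if_neg (by decide)

theorem parP_apply (f : PGS p n) : (parP f).1 = parS f.1 := rfl

theorem parP_parP (f : PGS p n) : parP (parP f) = f := by
  refine Subtype.ext (funext fun I => ?_)
  rw [parP_apply, parS_apply, parP_apply, parS_apply, smul_smul, ← mul_pow]
  norm_num

theorem parP_zP (μ : Idx p n) (f : PGS p n) :
    parP (zP μ f) = (if deg μ = 0 then (1 : ℂ) else -1) • zP μ (parP f) := by
  refine Subtype.ext (funext fun I => ?_)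
  rcases μ with j | i
  · ext y
    change (-1 : ℂ) ^ I.card • ((y j : ℂ) * f.1 I y)
      = (1 : ℂ) • ((y j : ℂ) * ((-1 : ℂ) ^ I.card • f.1 I y))
    simp only [smul_eq_mul]; ring
  · change (-1 : ℂ) ^ I.card • xiMul i f.1 I = (-1 : ℂ) • xiMul i (parS f.1) I
    rw [xiMul_apply, xiMul_apply]
    split_ifs with h
    · rw [parS_apply, ← Finset.card_erase_add_one h, smul_comm, pow_succ, mul_neg_one, neg_smul,
        smul_neg, neg_one_smul]
    · rw [smul_zero, smul_zero]

/-- The value of a superfunction at a point. -/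
def evalP (z : Superspace V p n) : PGS p n →ₗ[ℂ] GrassC V where
  toFun f := f.1.eval z
  map_add' f g := eval_add (smooth_of_mem f.2) (smooth_of_mem g.2) z
  map_smul' r f := eval_smul (smooth_of_mem f.2) r z

/-- The value of a superfunction with coefficients. -/
def evalT (z : Superspace V p n) : TT V p n →ₗ[ℂ] GrassC V :=
  TensorProduct.lift ((LinearMap.mul ℂ (GrassC V)).compl₂ (evalP z))

theorem evalT_tmul (z : Superspace V p n) (a : GrassC V) (f : PGS p n) :
    evalT z (a ⊗ₜ f) = a * f.1.eval z := rfl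

/-- The left derivative with respect to a coordinate. -/
def dT (μ : Idx p n) : TT V p n →ₗ[ℂ] TT V p n :=
  TensorProduct.map (parPow (deg μ)).toLinearMap (dP μ)

/-- Left multiplication by a coordinate. -/
def zT (μ : Idx p n) : TT V p n →ₗ[ℂ] TT V p n :=
  TensorProduct.map (parPow (deg μ)).toLinearMap (zP μ)

/-- The parity operator. -/
def parT : TT V p n →ₗ[ℂ] TT V p n := TensorProduct.map parC.toLinearMap parP

/-- The parity operator, to the power of a degree. -/
def parTP (i : ZMod 2) : TT V p n →ₗ[ℂ] TT V p n :=
  TensorProduct.map (parPow i).toLinearMap (parPP i)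

theorem parTP_zero (x : TT V p n) : parTP 0 x = x := by
  rw [parTP, parPow_zero, parPP_zero]
  exact LinearMap.congr_fun TensorProduct.map_id x

theorem parTP_one (x : TT V p n) : parTP 1 x = parT x := by
  rw [parTP, parPow_one, parPP_one]; rfl

theorem evalT_smul (z : Superspace V p n) (a : GrassC V) (x : TT V p n) :
    evalT z (a • x) = a * evalT z x := by
  induction x using TT.induction with
  | h i b f hb => rw [TensorProduct.smul_tmul', evalT_tmul, evalT_tmul, smul_eq_mul, mul_assoc]
  | hadd x y hx hy => rw [smul_add, map_add, map_add, hx, hy, mul_add]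

theorem evalT_parT (z : Superspace V p n) (x : TT V p n) :
    evalT z (parT x) = parC (evalT z x) := by
  induction x using TT.induction with
  | h i b f hb =>
    rw [evalT_tmul, map_mul, parC_eval (smooth_of_mem f.2)]; rfl
  | hadd x y hx hy => simp only [map_add, hx, hy]

theorem evalT_zT (z : Superspace V p n) (μ : Idx p n) (x : TT V p n) :
    evalT z (zT μ x) = ofG (z.1 μ) * evalT z x := by
  induction x using TT.induction with
  | h i b f hb =>
    rw [evalT_tmul, ← mul_assoc, ofG_mul_eq (z.2 μ), mul_assoc,
      coord_mul_eval (smooth_of_mem f.2)]; rfl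
  | hadd x y hx hy => simp only [map_add, hx, hy, mul_add]

theorem evalT_shift (z : Superspace V p n) {μ : Idx p n} {ε : part V (deg μ)} (hε : Sqz ε.1)
    (x : TT V p n) : evalT (z + sg μ ε) x = evalT z x + ofG ε.1 * evalT z (dT μ x) := by
  induction x using TT.induction with
  | h i b f hb =>
    rw [evalT_tmul, evalT_tmul, eval_shift (smooth_of_mem f.2) z hε, mul_add]
    congr 1
    change _ = ofG ε.1 * (parPow (deg μ) (ofG b) * (dS μ f.1).eval z)
    rw [← mul_assoc, ← mul_assoc, ofG_mul_eq ε.2]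
    congr 2
    rcases zmodTwo_cases (deg μ) with h | h <;> rw [h]
    · rw [parPow_zero]; rfl
    · rw [parPow_one, parC_parC]
  | hadd x y hx hy => simp only [map_add, hx, hy, mul_add]; abel

/-- The coefficient of `ξ^K` at a real point. -/
def coefT (K : Finset (Fin n)) (y : Body p) : TT V p n →ₗ[ℂ] GrassC V :=
  (TensorProduct.rid ℂ (GrassC V)).toLinearMap.comp
    (LinearMap.lTensor _ ((LinearMap.proj y).comp ((LinearMap.proj K).comp (PGS p n).subtype)))

theorem coefT_tmul (K : Finset (Fin n)) (y : Body p) (a : GrassC V) (f : PGS p n) :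
    coefT K y (a ⊗ₜ f) = f.1 K y • a := rfl

theorem evalT_rl (y : Body p) (x : TT V p n) : evalT (rl y) x = coefT ∅ y x := by
  induction x using TT.induction with
  | h i b f hb =>
    rw [evalT_tmul, eval_rl (smooth_of_mem f.2), mul_smul_comm, mul_one, coefT_tmul]
  | hadd x y hx hy => simp only [map_add, hx, hy]

theorem coefT_dT {i : Fin n} {K : Finset (Fin n)} (h : ∀ b ∈ K, i < b) (y : Body p)
    (x : TT V p n) : coefT K y (dT (Sum.inr i) x) = parC (coefT (insert i K) y x) := by
  induction x using TT.induction with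
  | h _ a f _ =>
    change dXi i f.1 K y • parPow 1 (ofG a) = parC (f.1 (insert i K) y • ofG a)
    rw [map_smul, parPow_one, dXi_apply, if_neg fun hi => lt_irrefl _ (h i hi),
      lowCard_of_forall_le fun b hb => (h b hb).le, pow_zero, one_smul]
  | hadd x y hx hy => simp only [map_add, hx, hy]

/-- The contraction by a linear form on the coefficients. -/
def cont {M : Type*} [AddCommGroup M] [Module ℂ M] (l : GrassC V →ₗ[ℂ] ℂ) :
    GrassC V ⊗[ℂ] M →ₗ[ℂ] M :=
  (TensorProduct.lid ℂ M).toLinearMap.comp (LinearMap.rTensor M l)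

theorem cont_tmul {M : Type*} [AddCommGroup M] [Module ℂ M] (l : GrassC V →ₗ[ℂ] ℂ) (a : GrassC V)
    (f : M) : cont l (a ⊗ₜ f) = l a • f := rfl

theorem eq_zero_of_cont {M : Type*} [AddCommGroup M] [Module ℂ M] {x : GrassC V ⊗[ℂ] M}
    (h : ∀ l, cont l x = 0) : x = 0 := by
  classical
  let b := Module.Basis.ofVectorSpace ℂ (GrassC V)
  refine (TensorProduct.equivFinsuppOfBasisLeft b).injective ?_
  rw [map_zero]
  ext i
  have key : ∀ x : GrassC V ⊗[ℂ] M, TensorProduct.equivFinsuppOfBasisLeft b x i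
      = cont (b.coord i) x := by
    intro x
    induction x using TensorProduct.induction_on with
    | zero => simp
    | tmul a f => rw [TensorProduct.equivFinsuppOfBasisLeft_apply_tmul_apply, cont_tmul]; rfl
    | add x y hx hy => simp only [map_add, Finsupp.add_apply, hx, hy]
  rw [key, h]; rfl

theorem eq_zero_of_coefT {x : TT V p n} (h : ∀ K y, coefT K y x = 0) : x = 0 := by
  refine eq_zero_of_cont fun l => Subtype.ext (funext fun K => funext fun y => ?_)
  have key : ∀ x : TT V p n, (cont l x).1 K y = l (coefT K y x) := by
    intro x
    induction x using TT.induction with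
    | h _ a f _ => rw [cont_tmul, coefT_tmul, map_smul]; exact mul_comm _ _
    | hadd x y hx hy => simp only [map_add, Submodule.coe_add, Pi.add_apply, hx, hy]
  rw [key, h, map_zero]; rfl

/-- A superfunction with coefficients is determined by its values: its derivatives with respect to
the odd coordinates are detected by increments that do not occur in their values. -/
theorem eq_zero_of_evalT (hV : ¬ Module.Finite ℝ V) {x : TT V p n} (h : ∀ z, evalT z x = 0) :
    x = 0 := by
  refine eq_zero_of_coefT fun K => ?_
  induction K using Finset.induction_on_min generalizing x with
  | empty => intro y; rw [← evalT_rl, h]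
  | insert i K hi ih =>
    intro y
    have hd : ∀ z, evalT z (dT (Sum.inr i) x) = 0 := by
      intro z
      obtain ⟨v, d, hv, hd⟩ := exists_fresh hV {evalT z (dT (Sum.inr i) x)}
      have := evalT_shift z (μ := Sum.inr i) (ε := ⟨_, ι_mem_odd v⟩) (sqz_of_inr _) x
      rw [h, h, zero_add] at this
      exact eq_zero_of_fresh_mul hv (hd _ (Finset.mem_singleton_self _)) this.symm
    rw [← parC_parC (coefT (insert i K) y x), ← coefT_dT hi, ih hd, map_zero]

theorem evalT_injective (hV : ¬ Module.Finite ℝ V) {x y : TT V p n}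
    (h : ∀ z, evalT z x = evalT z y) : x = y :=
  sub_eq_zero.mp (eq_zero_of_evalT hV fun z => by rw [map_sub, h, sub_self])

end Coefficients

/-! ### The star-product with coefficients -/

section StarT

variable {V : Type*} [AddCommGroup V] [Module ℝ V] {p n : ℕ} {θ α : ℝ}

/-- The star-product of superfunctions, evaluated at a point. -/
def starP (hθ : θ ≠ 0) (α : ℝ) (z : Superspace V p n) : PGS p n →ₗ[ℂ] PGS p n →ₗ[ℂ] GrassC V :=
  LinearMap.mk₂ ℂ (fun f g => (starProduct θ α f.1 g.1).eval z)
    (fun f f' g => by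
      rw [Submodule.coe_add, starProduct_add_left hθ α f.2 f'.2 g.2,
        eval_add (contDiff_starProduct hθ α f.2 g.2) (contDiff_starProduct hθ α f'.2 g.2)])
    (fun r f g => by
      rw [Submodule.coe_smul, starProduct_smul_left hθ α r f.2 g.2,
        eval_smul (contDiff_starProduct hθ α f.2 g.2)])
    (fun f g g' => by
      rw [Submodule.coe_add, starProduct_add_right hθ α f.2 g.2 g'.2,
        eval_add (contDiff_starProduct hθ α f.2 g.2) (contDiff_starProduct hθ α f.2 g'.2)])
    (fun r f g => by
      rw [Submodule.coe_smul, starProduct_smul_right hθ α r f.2 g.2,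
        eval_smul (contDiff_starProduct hθ α f.2 g.2)])

theorem starP_apply (hθ : θ ≠ 0) (z : Superspace V p n) (f g : PGS p n) :
    starP hθ α z f g = (starProduct θ α f.1 g.1).eval z := rfl

/-- The part of degree `0` (for `s = 1`) or `1` (for `s = -1`) of an element of `𝒜_ℂ`. -/
def homPart (s : ℂ) : GrassC V →ₗ[ℂ] GrassC V :=
  (2⁻¹ : ℂ) • (LinearMap.id + s • parC.toLinearMap)

theorem homPart_hom (s c : ℂ) {i : ZMod 2} {a : Grass V} (ha : a ∈ part V i) :
    homPart s (c • ofG a) = (2⁻¹ * (1 + s * if i = 0 then 1 else -1) : ℂ) • c • ofG a := by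
  have h : parC (ofG a) = (if i = 0 then (1 : ℂ) else -1) • ofG a := by
    rcases zmodTwo_cases i with rfl | rfl
    · rw [parC_ofG, parityAut_even ha, if_pos rfl, one_smul]
    · rw [parC_ofG, parityAut_odd ha, if_neg (by decide), map_neg, neg_one_smul]
  rw [map_smul]
  change c • ((2⁻¹ : ℂ) • (ofG a + s • parC (ofG a))) = _
  rw [h]
  module

/-- The star-product of superfunctions with coefficients, evaluated at a point; it is given by
`(a f) ⋆ (b g) = a b (f ⋆ g)` for even `b` and by `a b (σ f ⋆ g)`, with `σ` the parity operator, for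
odd `b`. -/
def starT (hθ : θ ≠ 0) (α : ℝ) (z : Superspace V p n) :
    TT V p n →ₗ[ℂ] TT V p n →ₗ[ℂ] GrassC V :=
  (TensorProduct.lift (LinearMap.mk₂ ℂ (fun b g => TensorProduct.lift
    (LinearMap.mk₂ ℂ (fun a f =>
        a * (homPart 1 b * starP hθ α z f g + homPart (-1) b * starP hθ α z (parP f) g))
      (fun a a' f => add_mul _ _ _)
      (fun r a f => smul_mul_assoc _ _ _)
      (fun a f f' => by simp only [map_add, LinearMap.add_apply, mul_add]; abel)
      (fun r a f => by
        simp only [map_smul, LinearMap.smul_apply, mul_smul_comm, ← smul_add])))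
    (fun b b' g => TensorProduct.ext' fun a f => by
      simp only [TensorProduct.lift.tmul, LinearMap.add_apply, LinearMap.mk₂_apply, map_add,
        add_mul, mul_add]; abel)
    (fun r b g => TensorProduct.ext' fun a f => by
      simp only [TensorProduct.lift.tmul, LinearMap.smul_apply, LinearMap.mk₂_apply, map_smul,
        smul_mul_assoc, mul_smul_comm, ← smul_add])
    (fun b g g' => TensorProduct.ext' fun a f => by
      simp only [TensorProduct.lift.tmul, LinearMap.add_apply, LinearMap.mk₂_apply, map_add,
        mul_add]; abel)
    (fun r b g => TensorProduct.ext' fun a f => by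
      simp only [TensorProduct.lift.tmul, LinearMap.smul_apply, LinearMap.mk₂_apply, map_smul,
        mul_smul_comm, ← smul_add]))).flip

theorem starT_tmul (hθ : θ ≠ 0) (z : Superspace V p n) (a b : GrassC V) (f g : PGS p n) :
    starT hθ α z (a ⊗ₜ f) (b ⊗ₜ g)
      = a * (homPart 1 b * starP hθ α z f g + homPart (-1) b * starP hθ α z (parP f) g) := rfl

theorem starT_hom (hθ : θ ≠ 0) (z : Superspace V p n) (a : GrassC V) {i : ZMod 2} {b : Grass V}
    (hb : b ∈ part V i) (f g : PGS p n) :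
    starT hθ α z (a ⊗ₜ f) (ofG b ⊗ₜ g) = a * (ofG b * starP hθ α z (parPP i f) g) := by
  have h1 := homPart_hom 1 1 hb
  have h2 := homPart_hom (-1) 1 hb
  rw [one_smul] at h1 h2
  rw [starT_tmul, h1, h2]
  rcases zmodTwo_cases i with rfl | rfl
  · rw [parPP_zero]; norm_num
  · rw [parPP_one]; norm_num

theorem starT_smul_left (hθ : θ ≠ 0) (z : Superspace V p n) (a : GrassC V) (x y : TT V p n) :
    starT hθ α z (a • x) y = a * starT hθ α z x y := by
  induction x using TT.induction with
  | h i c f hc =>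
    induction y using TT.induction with
    | h j b g hb =>
      rw [TensorProduct.smul_tmul', smul_eq_mul, starT_hom hθ z _ hb, starT_hom hθ z _ hb, mul_assoc]
    | hadd x y hx hy => simp only [map_add, hx, hy, mul_add]
  | hadd x y hx hy => simp only [smul_add, map_add, LinearMap.add_apply, hx, hy, mul_add]

theorem parPP_parPP (i j : ZMod 2) (f : PGS p n) : parPP i (parPP j f) = parPP (i + j) f := by
  rcases zmodTwo_cases i with rfl | rfl <;> rcases zmodTwo_cases j with rfl | rfl
  · rw [add_zero, parPP_zero]; rfl
  · rw [zero_add, parPP_zero]; rfl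
  · rw [add_zero, parPP_zero]; rfl
  · rw [zmodTwo_add_self, parPP_one, parPP_zero, parP_parP]; rfl

theorem parPow_parPow (i : ZMod 2) (x : GrassC V) : parPow i (parPow i x) = x := by
  rcases zmodTwo_cases i with rfl | rfl
  · rw [parPow_zero]; rfl
  · rw [parPow_one, parC_parC]

theorem starT_smul_right (hθ : θ ≠ 0) (z : Superspace V p n) {i : ZMod 2} {a : Grass V}
    (ha : a ∈ part V i) (x y : TT V p n) :
    starT hθ α z x (ofG a • y) = ofG a * starT hθ α z (parTP i x) y := by
  induction x using TT.induction with
  | h k c f hc =>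
    induction y using TT.induction with
    | h j b g hb =>
      rw [TensorProduct.smul_tmul', smul_eq_mul, ← map_mul, starT_hom hθ z _ (mul_mem_part V ha hb),
        parTP, TensorProduct.map_tmul, starT_hom hθ z _ hb, parPP_parPP, add_comm j, ← mul_assoc,
        ← mul_assoc, map_mul, ← mul_assoc, ← mul_assoc, ofG_mul_eq ha]
      change _ = parPow i (parPow i (ofG c)) * _ * _ * _
      rw [parPow_parPow]
    | hadd x y hx hy => simp only [smul_add, map_add, hx, hy, mul_add]
  | hadd x y hx hy => simp only [map_add, LinearMap.add_apply, hx, hy, mul_add]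

/-- An even first factor commutes with the coefficients of the second one. -/
theorem starT_smul_right_of_even (hθ : θ ≠ 0) (z : Superspace V p n) (a : GrassC V) {x : TT V p n}
    (hx : parT x = x) (y : TT V p n) :
    starT hθ α z x (a • y) = a * starT hθ α z x y := by
  have h : ∀ i, parTP i x = x := fun i => by
    rcases zmodTwo_cases i with rfl | rfl
    · exact parTP_zero x
    · rw [parTP_one, hx]
  induction a using GrassC.induction_hom with
  | h c i a ha =>
    rw [smul_assoc, map_smul, starT_smul_right hθ z ha, h, smul_mul_assoc]
  | hadd a b ha hb => rw [add_smul, map_add, ha, hb, add_mul]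

/-- The permutation of the coordinates that exchanges the conjugate ones; odd coordinates are
conjugate to themselves. -/
def cj (μ : Idx p n) : Idx p n := Sum.map Sum.swap id μ

theorem cj_cj (μ : Idx p n) : cj (cj μ) = μ := by
  rcases μ with (j | j) | i <;> rfl

theorem deg_cj (μ : Idx p n) : deg (cj μ) = deg μ := by
  rcases μ with (j | j) | i <;> rfl

/-- The constants of the commutation relations between the coordinates. -/
def pc (θ α : ℝ) (μ : Idx p n) : ℝ :=
  Sum.elim (Sum.elim (fun _ => θ / 2) fun _ => -(θ / 2)) (fun _ => -(θ * α / (1 + α) ^ 2)) μ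

theorem pc_ne_zero (hθ : θ ≠ 0) (hα₀ : α ≠ 0) (hα₁ : α ≠ -1) (μ : Idx p n) : pc θ α μ ≠ 0 := by
  have h : 1 + α ≠ 0 := fun h => hα₁ (by linarith)
  rcases μ with (j | j) | i
  · exact div_ne_zero hθ two_ne_zero
  · exact neg_ne_zero.mpr (div_ne_zero hθ two_ne_zero)
  · exact neg_ne_zero.mpr (div_ne_zero (mul_ne_zero hθ hα₀) (pow_ne_zero _ h))

theorem omR_rotJ_eb (j : EvenIdx p) : omR (rotJ p (eb j)) = fun y : Body p => (y j : ℂ) :=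
  funext fun y => by rw [eb, omR_rotJ_single]

theorem starProduct_zS (hθ : θ ≠ 0) (hα₀ : α ≠ 0) (hα₁ : α ≠ -1) (μ : Idx p n)
    (f g : PGS p n) :
    starProduct θ α (zS μ f.1) g.1 = zS μ (starProduct θ α f.1 g.1)
      + (-Complex.I * pc θ α μ) • starProduct θ α (parPP (deg μ) f).1 (dS (cj μ) g.1) := by
  rcases μ with j | i
  · have h0 : parPP (deg (Sum.inl j : Idx p n)) f = f := by
      rw [show deg (Sum.inl j : Idx p n) = 0 from rfl, parPP_zero]; rfl
    have := starProduct_bodyMul hθ α f.2 g.2 (rotJ p (eb j))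
    rw [omR_rotJ_eb] at this
    rw [h0, zS_inl, this]
    congr 1
    rcases j with j | j
    · have hb : rotJ p (eb (Sum.inl j)) = eb (Sum.inr j) := by
        ext (i | i) <;> simp [rotJ, eb]
      rw [hb]
      change _ = _ • starProduct θ α f.1 (pdS (eb (Sum.inr j)) g.1)
      congr 1
      simp [pc]; ring
    · have hb : rotJ p (eb (Sum.inr j)) = (-1 : ℝ) • eb (Sum.inl j) := by
        ext (i | i) <;> simp [rotJ, eb]
      have hc : pdS ((-1 : ℝ) • eb (Sum.inl j)) g.1 = (-1 : ℂ) • pdS (eb (Sum.inl j)) g.1 := by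
        ext I y
        change pd ((-1 : ℝ) • eb (Sum.inl j)) (g.1 I) y = (-1 : ℂ) • pd (eb (Sum.inl j)) (g.1 I) y
        rw [pd_smul_dir]; simp
      rw [hb, hc, starProduct_smul_right hθ α _ f.2 (pdS_mem g.2 _), smul_smul]
      change _ = _ • starProduct θ α f.1 (pdS (eb (Sum.inl j)) g.1)
      congr 1
      simp [pc]; ring
  · have h0 : parPP (deg (Sum.inr i : Idx p n)) f = parP f := by
      rw [show deg (Sum.inr i : Idx p n) = 1 from rfl, parPP_one]
    rw [h0, zS_inr, starProduct_xiMul hθ hα₀ hα₁ f.2 g.2]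
    congr 2
    have h1 : (θ : ℂ) ≠ 0 := by exact_mod_cast hθ
    have h2 : (α : ℂ) ≠ 0 := by exact_mod_cast hα₀
    have h3 := one_add_ne_zero hα₁
    simp only [oddConst, pc, Sum.elim_inr]
    push_cast
    field_simp
    rw [Complex.I_sq]

theorem starP_zP (hθ : θ ≠ 0) (hα₀ : α ≠ 0) (hα₁ : α ≠ -1) (z : Superspace V p n) (μ : Idx p n)
    (f g : PGS p n) :
    starP hθ α z (zP μ f) g = ofG (z.1 μ) * starP hθ α z f g
      + (-Complex.I * pc θ α μ) • starP hθ α z (parPP (deg μ) f) (dP (cj μ) g) := by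
  have hs : (starProduct θ α f.1 g.1).Smooth := contDiff_starProduct hθ α f.2 g.2
  have hs' : (starProduct θ α (parPP (deg μ) f).1 (dS (cj μ) g.1)).Smooth :=
    contDiff_starProduct hθ α (parPP (deg μ) f).2 (dP (cj μ) g).2
  have hz : (zS μ (starProduct θ α f.1 g.1)).Smooth := by
    rcases μ with j | i
    · exact fun I => (contDiff_coord j).mul (hs I)
    · intro I
      rw [zS_inr, xiMul_apply]
      split_ifs
      · exact contDiff_const.mul (hs _)
      · exact contDiff_const
  change (starProduct θ α (zS μ f.1) g.1).eval z = _
  rw [starProduct_zS hθ hα₀ hα₁, eval_add hz (fun I => contDiff_const.mul (hs' I) : (_ • starProduct _ _ _ _).Smooth),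
    eval_smul hs',
    ← coord_mul_eval hs]
  rfl

/-- Left multiplication by a coordinate. -/
theorem starT_zT (hθ : θ ≠ 0) (hα₀ : α ≠ 0) (hα₁ : α ≠ -1) (z : Superspace V p n) (μ : Idx p n)
    (x y : TT V p n) :
    starT hθ α z (zT μ x) y = ofG (z.1 μ) * starT hθ α z x y
      + (-Complex.I * pc θ α μ) • starT hθ α z (parTP (deg μ) x) (dT (cj μ) y) := by
  induction x using TT.induction with
  | h k a f ha =>
    induction y using TT.induction with
    | h j b g hb =>
      have hs : parPow (deg μ) (ofG b) = (if deg μ = 0 ∨ j = 0 then (1 : ℂ) else -1) • ofG b := by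
        rcases zmodTwo_cases (deg μ) with h | h
        · rw [h, parPow_zero, if_pos (Or.inl rfl), one_smul]; rfl
        · rw [h, parPow_one, parC_ofG]
          rcases zmodTwo_cases j with rfl | rfl
          · rw [parityAut_even hb, if_pos (Or.inr rfl), one_smul]
          · rw [parityAut_odd hb, if_neg (by decide), map_neg, neg_one_smul]
      have hz : parPP j (zP μ f) = (if deg μ = 0 ∨ j = 0 then (1 : ℂ) else -1) • zP μ (parPP j f) := by
        rcases zmodTwo_cases j with rfl | rfl
        · rw [parPP_zero, if_pos (Or.inr rfl), one_smul]; rfl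
        · rw [parPP_one, parP_zP]
          congr 1
          have : ¬ (1 : ZMod 2) = 0 := by decide
          simp [this]
      rw [zT, TensorProduct.map_tmul, starT_hom hθ z _ hb, starT_hom hθ z _ hb, hz, parTP, dT,
        TensorProduct.map_tmul, TensorProduct.map_tmul]
      simp only [AlgHom.toLinearMap_apply]
      rw [deg_cj, hs, ← TensorProduct.smul_tmul', map_smul (starT hθ α z _),
        starT_hom hθ z _ hb, map_smul, LinearMap.smul_apply, starP_zP hθ hα₀ hα₁]
      set s : ℂ := if deg μ = 0 ∨ j = 0 then (1 : ℂ) else -1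
      have hc : ofG (z.1 μ) * ofG b = s • (ofG b * ofG (z.1 μ)) := by
        rw [ofG_mul_eq (z.2 μ), hs, smul_mul_assoc]
      rw [← mul_assoc (ofG (z.1 μ)) (ofG a), ofG_mul_eq (z.2 μ) (ofG a), mul_assoc (parPow _ _),
        ← mul_assoc (ofG (z.1 μ)), hc, parPP_parPP, parPP_parPP, add_comm j]
      simp only [smul_add, mul_add, mul_smul_comm, smul_mul_assoc, mul_assoc]
      congr 1
      rw [smul_comm]
    | hadd x y hx hy => simp only [map_add, hx, hy, mul_add, smul_add]; abel
  | hadd x y hx hy => simp only [map_add, LinearMap.add_apply, hx, hy, mul_add, smul_add]; abel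

end StarT

/-! ### Plane waves -/

section PlaneWaves

variable {V : Type*} [AddCommGroup V] [Module ℝ V] {p n : ℕ} {θ α : ℝ}

theorem comm_of_parC {x : GrassC V} (hx : parC x = x) (y : GrassC V) : x * y = y * x := by
  have h : x = homPart 1 x := by
    change x = (2⁻¹ : ℂ) • (x + (1 : ℂ) • parC x)
    rw [hx]; module
  have key : ∀ x : GrassC V, homPart 1 x * y = y * homPart 1 x := by
    intro x
    induction x using GrassC.induction_hom with
    | h c i a ha =>
      rw [homPart_hom 1 c ha]
      rcases zmodTwo_cases i with rfl | rfl
      · simp only [smul_mul_assoc, mul_smul_comm, ofG_even_mul ha]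
      · norm_num
    | hadd x y hx hy => rw [map_add, add_mul, mul_add, hx, hy]
  rw [h, key]

/-- The nilpotent part `a - a₀` of an element of `𝒜`. -/
def nil (a : Grass V) : Grass V := a - algebraMap ℝ _ (body V a)

theorem nil_add (a b : Grass V) : nil (a + b) = nil a + nil b := by
  simp only [nil, map_add]; abel

theorem nil_algebraMap (r : ℝ) : nil (algebraMap ℝ (Grass V) r) = 0 := by
  rw [nil, body_algebraMap, sub_self]

theorem nil_sqz {ε : Grass V} (h : Sqz ε) : nil ε = ε := by
  rw [nil, body_sqz h, map_zero, sub_zero]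

theorem nil_mem {a : Grass V} (ha : a ∈ part V 0) : nil a ∈ part V 0 :=
  Submodule.sub_mem _ ha (algebraMap_mem_even _)

theorem isNilpotent_nil {a : Grass V} (ha : a ∈ part V 0) : IsNilpotent (nil a) :=
  (soul_induction (Q := fun a => a ∈ part V 0 ∧ IsNilpotent a)
    ⟨Submodule.zero_mem _, IsNilpotent.zero⟩
    (fun _ _ h h' => ⟨Submodule.add_mem _ h.1 h'.1,
      Commute.isNilpotent_add (even_mul_eq h.1 _) h.2 h'.2⟩)
    (fun _ h => ⟨h.1, 2, by rw [pow_two, h.2.sq]⟩) ha).2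

/-- The exponential `exp(i a)` of an even element. -/
def expG (a : Grass V) : GrassC V :=
  Complex.exp (Complex.I * (body V a : ℂ)) • IsNilpotent.exp (Complex.I • ofG (nil a))

theorem isNilpotent_I_smul {a : Grass V} (ha : a ∈ part V 0) :
    IsNilpotent (Complex.I • ofG (nil a)) :=
  ((isNilpotent_nil ha).map ofG).smul _

theorem expG_add {a b : Grass V} (ha : a ∈ part V 0) (hb : b ∈ part V 0) :
    expG (a + b) = expG a * expG b := by
  have h0 : Commute (ofG (nil a)) (ofG (nil b)) := ofG_even_mul (nil_mem ha) _
  have hc : Commute (Complex.I • ofG (nil a)) (Complex.I • ofG (nil b)) :=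
    (h0.smul_left _).smul_right _
  rw [expG, expG, expG, nil_add, map_add, map_add, smul_add, IsNilpotent.exp_add_of_commute hc
    (isNilpotent_I_smul ha) (isNilpotent_I_smul hb), smul_mul_smul_comm, Complex.ofReal_add,
    mul_add, Complex.exp_add]

theorem expG_algebraMap (r : ℝ) :
    expG (algebraMap ℝ (Grass V) r) = Complex.exp (Complex.I * r) • 1 := by
  rw [expG, nil_algebraMap, body_algebraMap, map_zero, smul_zero, IsNilpotent.exp_zero]

theorem expG_zero : expG (0 : Grass V) = 1 := by
  have := expG_algebraMap (V := V) 0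
  rwa [map_zero, Complex.ofReal_zero, mul_zero, Complex.exp_zero, one_smul] at this

theorem expG_sqz {ε : Grass V} (h : Sqz ε) : expG ε = 1 + Complex.I • ofG ε := by
  have h2 : (Complex.I • ofG ε) ^ 2 = 0 := by
    rw [pow_two, smul_mul_smul_comm, ← map_mul, h.sq, map_zero, smul_zero]
  rw [expG, body_sqz h, nil_sqz h, IsNilpotent.exp_eq_sum h2]
  simp [Finset.sum_range_succ]

theorem expG_add_sqz {a ε : Grass V} (ha : a ∈ part V 0) (hε : ε ∈ part V 0) (h : Sqz ε) :
    expG (a + ε) = expG a + (Complex.I • ofG ε) * expG a := by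
  rw [expG_add ha hε, expG_sqz h, mul_add, mul_one, smul_mul_assoc, ofG_even_mul hε, mul_smul_comm]

theorem eq_zero_of_exp_eq_one {R : Type*} [Ring R] [Algebra ℚ R] {a : R} (ha : IsNilpotent a)
    (h : IsNilpotent.exp a = 1) : a = 0 := by
  obtain ⟨N, hN⟩ := ha
  have hN' : a ^ (N + 2) = 0 := by rw [pow_add, hN, zero_mul]
  rw [IsNilpotent.exp_eq_sum hN', Finset.sum_range_succ', Finset.sum_range_succ'] at h
  set c : R := ∑ i ∈ Finset.range N, ((i + 1 + 1).factorial : ℚ)⁻¹ • a ^ (i + 1) with hc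
  have hac : Commute a c := Commute.sum_right _ _ _ fun i _ => ((Commute.refl a).pow_right _).smul_right _
  have h1 : a = a * (-c) := by
    have : ∑ i ∈ Finset.range N, ((i + 1 + 1).factorial : ℚ)⁻¹ • a ^ (i + 1 + 1) = a * c := by
      rw [hc, Finset.mul_sum]
      exact Finset.sum_congr rfl fun i _ => by rw [mul_smul_comm, pow_succ' a (i + 1)]
    rw [this] at h
    simp only [zero_add, Nat.factorial_one, Nat.cast_one, inv_one, one_smul, pow_one,
      Nat.factorial_zero, pow_zero, add_eq_right] at h
    rw [mul_neg, eq_neg_iff_add_eq_zero, add_comm, h]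
  have hcN : (-c) ^ N = 0 := by
    have hd : c = a * ∑ i ∈ Finset.range N, ((i + 1 + 1).factorial : ℚ)⁻¹ • a ^ i := by
      rw [hc, Finset.mul_sum]
      exact Finset.sum_congr rfl fun i _ => by rw [mul_smul_comm, pow_succ' a i]
    have hcm : Commute a (∑ i ∈ Finset.range N, ((i + 1 + 1).factorial : ℚ)⁻¹ • a ^ i) :=
      Commute.sum_right _ _ _ fun i _ => ((Commute.refl a).pow_right _).smul_right _
    rw [neg_pow, hd, hcm.mul_pow, hN, zero_mul, mul_zero]
  have h2 : ∀ k : ℕ, a = a * (-c) ^ k := by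
    intro k
    induction k with
    | zero => simp
    | succ k ih => rw [pow_succ', ← mul_assoc, ← h1, ← ih]
  rw [h2 N, hcN, mul_zero]

theorem ofG_injective : Function.Injective (ofG : Grass V → GrassC V) :=
  Algebra.TensorProduct.includeRight_injective (algebraMap ℝ ℂ).injective

/-- If `exp(i a) = 1` then `a` is a real number, in `2πℤ`. -/
theorem eq_of_expG_eq_one {a : Grass V} (ha : a ∈ part V 0) (h : expG a = 1) :
    nil a = 0 ∧ ∃ k : ℤ, body V a = k * (2 * Real.pi) := by
  have hb : Complex.exp (Complex.I * (body V a : ℂ)) = 1 := by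
    have := congrArg (Algebra.TensorProduct.lift (AlgHom.id ℂ ℂ) ((Algebra.ofId ℝ ℂ).comp (body V))
      (fun _ _ => Commute.all _ _)) h
    have hz : Algebra.TensorProduct.lift (AlgHom.id ℂ ℂ) ((Algebra.ofId ℝ ℂ).comp (body V))
        (fun _ _ => Commute.all _ _) (Complex.I • ofG (nil a)) = 0 := by
      rw [map_smul, ofG_apply, Algebra.TensorProduct.lift_tmul]
      simp [nil]
    rw [expG, map_smul, IsNilpotent.map_exp (isNilpotent_I_smul ha), hz, IsNilpotent.exp_zero,
      map_one, smul_eq_mul, mul_one] at this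
    exact this
  constructor
  · rw [expG, hb, one_smul] at h
    have h1 := eq_zero_of_exp_eq_one (isNilpotent_I_smul ha) h
    exact ofG_injective (by
      rw [map_zero]; exact (smul_eq_zero.mp h1).resolve_left Complex.I_ne_zero)
  · obtain ⟨k, hk⟩ := Complex.exp_eq_one_iff.mp hb
    refine ⟨k, ?_⟩
    have : (body V a : ℂ) = k * (2 * Real.pi) :=
      mul_left_cancel₀ Complex.I_ne_zero (by rw [hk]; ring)
    exact_mod_cast this

/-- The pairing `κ · z = ∑ κ_μ z_μ`. -/
def dotp (κ z : Superspace V p n) : Grass V := ∑ μ, κ.1 μ * z.1 μ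

theorem dotp_mem (κ z : Superspace V p n) : dotp κ z ∈ part V 0 := by
  refine Submodule.sum_mem _ fun μ _ => ?_
  have := mul_mem_part V (κ.2 μ) (z.2 μ)
  rwa [zmodTwo_add_self] at this

theorem dotp_add_left (κ κ' z : Superspace V p n) : dotp (κ + κ') z = dotp κ z + dotp κ' z := by
  rw [dotp, dotp, dotp, ← Finset.sum_add_distrib]
  exact Finset.sum_congr rfl fun μ _ => add_mul _ _ _

theorem dotp_add_right (κ z z' : Superspace V p n) : dotp κ (z + z') = dotp κ z + dotp κ z' := by
  rw [dotp, dotp, dotp, ← Finset.sum_add_distrib]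
  exact Finset.sum_congr rfl fun μ _ => mul_add _ _ _

theorem dotp_zero_right (κ : Superspace V p n) : dotp κ 0 = 0 :=
  Finset.sum_eq_zero fun _ _ => mul_zero _

theorem dotp_sg_left {μ : Idx p n} (ε : part V (deg μ)) (z : Superspace V p n) :
    dotp (sg μ ε) z = ε.1 * z.1 μ := by
  simp [dotp, sg_apply]

theorem dotp_sg_right {μ : Idx p n} (ε : part V (deg μ)) (κ : Superspace V p n) :
    dotp κ (sg μ ε) = κ.1 μ * ε.1 := by
  simp [dotp, sg_apply]

theorem dotp_rl (k y : Body p) :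
    dotp (rl k : Superspace V p n) (rl y) = algebraMap ℝ _ (inner ℝ k y) := by
  rw [dotp, Fintype.sum_sum_type]
  simp only [rl_inl, rl_inr, mul_zero, Finset.sum_const_zero, add_zero, ← map_mul, ← map_sum]
  congr 1
  rw [PiLp.inner_apply]
  exact Finset.sum_congr rfl fun i _ => mul_comm _ _

theorem Sqz.mul_right {ε : Grass V} (h : Sqz ε) (a : Grass V) : Sqz (ε * a) := fun b => by
  rw [← mul_assoc, mul_assoc ε a b, h, zero_mul]

theorem Sqz.mul_left {ε : Grass V} (h : Sqz ε) (a : Grass V) : Sqz (a * ε) := fun b => by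
  rw [mul_assoc, mul_assoc, ← mul_assoc b, ← mul_assoc, mul_assoc, ← mul_assoc ε, h, mul_zero]

theorem taylorExt_chr (k : Body p) (z : Superspace V p n) :
    taylorExt (chr k) z = expG (dotp (rl k) z) := by
  induction z using Superspace.induction with
  | h0 y => rw [taylorExt_rl _ (contDiff_chr k), dotp_rl, expG_algebraMap]; rfl
  | h1 z μ ε hε ih =>
    have hm := dotp_mem (rl k) (sg μ ε)
    rw [dotp_add_right]
    rw [dotp_sg_right] at hm ⊢
    rw [expG_add_sqz (dotp_mem _ _) hm (hε.mul_left _)]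
    rcases μ with j | i
    · rw [taylorExt_shift (contDiff_chr k) z j ε hε, pd_chr, taylorExt_const_mul (contDiff_chr k),
        ih, rl_inl, map_mul, AlgHom.commutes, ← Algebra.smul_def, smul_mul_assoc, smul_mul_assoc,
        mul_smul_comm, mul_smul, EuclideanSpace.inner_single_right]
      simp
      rfl
    · rw [taylorExt_shift_inr, ih, rl_inr, zero_mul, map_zero, smul_zero, zero_mul, add_zero]

theorem eval_translate {f : SuperFun p n} (hf : f.Smooth) (w : Body p) (z : Superspace V p n) :
    SuperFun.eval (fun K y => f K (y + w)) z = f.eval (z + rl w) := by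
  have hs : ∀ {f : SuperFun p n}, f.Smooth → SuperFun.Smooth fun K y => f K (y + w) :=
    fun hf K => (hf K).comp (contDiff_id.add contDiff_const)
  induction z using Superspace.induction generalizing f with
  | h0 y => rw [eval_rl (hs hf), ← map_add, eval_rl hf]
  | h1 z μ ε hε ih =>
    have hd : (dS μ fun K y => f K (y + w)) = fun K y => dS μ f K (y + w) := by
      rcases μ with j | i
      · ext K y
        exact congrFun (pd_comp_affine (hf K) (ContinuousLinearMap.id ℝ _) w (eb j)) y
      · ext K y
        rw [dS_inr, dS_inr, dXi_apply, dXi_apply]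
        split_ifs <;> rfl
    have hds : (dS μ f).Smooth := by
      rcases μ with j | i
      · exact fun K => contDiff_pd (hf K) _
      · intro K
        rw [dS_inr, dXi_apply]
        split_ifs
        · exact contDiff_const
        · exact contDiff_const.mul (hf _)
    rw [eval_shift (hs hf) z hε, ih hf, hd, ih hds, add_right_comm, eval_shift hf _ hε]

/-- The translation vector of the plane wave with covector `κ`. -/
def pvec (θ α : ℝ) (κ : Superspace V p n) : Superspace V p n :=
  ⟨fun ν => pc θ α (cj ν) • κ.1 (cj ν), fun ν =>
    Submodule.smul_mem _ _ (deg_cj ν ▸ κ.2 (cj ν))⟩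

theorem pvec_apply (κ : Superspace V p n) (ν : Idx p n) :
    (pvec θ α κ).1 ν = pc θ α (cj ν) • κ.1 (cj ν) := rfl

theorem pvec_add (κ κ' : Superspace V p n) :
    pvec θ α (κ + κ') = pvec θ α κ + pvec θ α κ' :=
  Subtype.ext (funext fun _ => smul_add _ _ _)

theorem pvec_rl (k : Body p) :
    pvec θ α (rl k : Superspace V p n) = rl ((θ / 2) • rotJ p k) := by
  refine Subtype.ext (funext fun ν => ?_)
  rw [pvec_apply]
  rcases ν with (j | j) | i
  · change (-(θ / 2)) • algebraMap ℝ (Grass V) (k (Sum.inr j)) = algebraMap ℝ _ (θ / 2 * -k (Sum.inr j))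
    rw [Algebra.smul_def, ← map_mul]; congr 1; ring
  · change (θ / 2) • algebraMap ℝ (Grass V) (k (Sum.inl j)) = algebraMap ℝ _ (θ / 2 * k (Sum.inl j))
    rw [Algebra.smul_def, ← map_mul]
  · exact smul_zero _

theorem pvec_sg {μ : Idx p n} (ε : part V (deg μ)) :
    pvec θ α (sg μ ε) = sg (cj μ) ⟨pc θ α μ • ε.1, by
      rw [deg_cj]; exact Submodule.smul_mem _ _ ε.2⟩ := by
  refine Subtype.ext (funext fun ν => ?_)
  rw [pvec_apply, sg_apply, sg_apply]
  by_cases h : cj ν = μ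
  · rw [if_pos h, if_pos (by rw [← h, cj_cj]), h]
  · rw [if_neg h, if_neg fun h' => h (by rw [h', cj_cj]), smul_zero]

/-- `E` acts by left star-multiplication as the multiplication by `E` composed with the translation
by `v`. -/
structure IsPlaneWave (hθ : θ ≠ 0) (α : ℝ) (E : TT V p n) (v : Superspace V p n) : Prop where
  even : parT E = E
  star : ∀ z y, starT hθ α z E y = evalT z E * evalT (z + v) y

theorem eval_ofBody (h : Body p → ℂ) (z : Superspace V p n) :
    (ofBody h : SuperFun p n).eval z = taylorExt h z := by
  rw [eval_eq, Finset.sum_eq_single ∅]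
  · rw [ofBody, if_pos rfl, oddMonomial, Finset.sort_empty, List.map_nil, List.prod_nil, map_one,
      mul_one]
  · intro I _ h
    rw [ofBody, if_neg h, show (0 : Body p → ℂ) = fun _ => 0 from rfl, taylorExt_const, zero_smul,
      zero_mul]
  · simp

/-- A function on the body, as a superfunction of polynomial growth. -/
def bodyP (n : ℕ) (h : Body p → ℂ) (hh : PolyB h) : PGS p n := ⟨ofBody h, ofBody_mem hh⟩

theorem parPP_bodyP {h : Body p → ℂ} (hh : PolyB h) (i : ZMod 2) :
    parPP i (bodyP n h hh) = bodyP n h hh := by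
  rcases zmodTwo_cases i with rfl | rfl
  · rw [parPP_zero]; rfl
  · rw [parPP_one]
    refine Subtype.ext (funext fun I => ?_)
    change (-1 : ℂ) ^ I.card • (if I = ∅ then h else 0) = if I = ∅ then h else 0
    split_ifs with h
    · rw [h, Finset.card_empty, pow_zero, one_smul]
    · rw [smul_zero]

theorem starP_chr (hθ : θ ≠ 0) (hα₀ : α ≠ 0) (hα₁ : α ≠ -1) (k : Body p) (z : Superspace V p n)
    (g : PGS p n) : starP hθ α z (bodyP n (chr k) (polyB_chr k)) g
      = taylorExt (chr k) z * g.1.eval (z + pvec θ α (rl k)) := by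
  rw [starP_apply, bodyP, starProduct_chr hθ hα₀ hα₁ k g.2, pvec_rl,
    ← eval_translate (smooth_of_mem g.2), eval_eq, eval_eq, Finset.mul_sum]
  refine Finset.sum_congr rfl fun K _ => ?_
  rw [← mul_assoc]
  congr 1
  exact taylorExt_mul (contDiff_chr k)
    ((smooth_of_mem g.2 K).comp (contDiff_id.add contDiff_const)) z

theorem evalT_chr (k : Body p) (z : Superspace V p n) :
    evalT z ((1 : GrassC V) ⊗ₜ[ℂ] bodyP n (chr k) (polyB_chr k)) = expG (dotp (rl k) z) := by
  rw [evalT_tmul, one_mul, bodyP, eval_ofBody, taylorExt_chr]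

theorem isPlaneWave_chr (hθ : θ ≠ 0) (hα₀ : α ≠ 0) (hα₁ : α ≠ -1) (k : Body p) :
    IsPlaneWave (V := V) hθ α ((1 : GrassC V) ⊗ₜ[ℂ] bodyP n (chr k) (polyB_chr k))
      (pvec θ α (rl k)) := by
  refine ⟨?_, fun z y => ?_⟩
  · rw [parT, TensorProduct.map_tmul, AlgHom.toLinearMap_apply, map_one, ← parPP_one, parPP_bodyP]
  · rw [evalT_chr, ← taylorExt_chr]
    induction y using TT.induction with
    | h i b g hb =>
      rw [starT_hom hθ z _ hb, parPP_bodyP, starP_chr hθ hα₀ hα₁, evalT_tmul, one_mul, ← mul_assoc,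
        mul_taylorExt (contDiff_chr k), mul_assoc]
    | hadd x y hx hy => simp only [map_add, mul_add, hx, hy]

theorem parC_expG {a : Grass V} (ha : a ∈ part V 0) : parC (expG a) = expG a := by
  rw [expG, map_smul, IsNilpotent.map_exp (isNilpotent_I_smul ha), map_smul, parC_ofG,
    parityAut_even (nil_mem ha)]

/-- Adding to the covector of a plane wave an element that squares to zero. -/
theorem IsPlaneWave.step (hV : ¬ Module.Finite ℝ V) (hθ : θ ≠ 0) (hα₀ : α ≠ 0) (hα₁ : α ≠ -1)
    {κ : Superspace V p n} {E : TT V p n} (hE' : IsPlaneWave hθ α E (pvec θ α κ))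
    (hev : ∀ z, evalT z E = expG (dotp κ z)) {μ : Idx p n} {ε : part V (deg μ)} (hε : Sqz ε.1) :
    IsPlaneWave hθ α (E + (Complex.I • ofG ε.1) • zT μ E) (pvec θ α (κ + sg μ ε)) ∧
      ∀ z, evalT z (E + (Complex.I • ofG ε.1) • zT μ E) = expG (dotp (κ + sg μ ε) z) := by
  obtain ⟨hE, hs⟩ := hE'
  have hm : ∀ z : Superspace V p n, ε.1 * z.1 μ ∈ part V 0 := fun z => by
    rw [← dotp_sg_left]; exact dotp_mem _ _
  have hev' : ∀ z, evalT z (E + (Complex.I • ofG ε.1) • zT μ E)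
      = expG (dotp (κ + sg μ ε) z) := by
    intro z
    rw [map_add, evalT_smul, evalT_zT, dotp_add_left, dotp_sg_left,
      expG_add_sqz (dotp_mem _ _) (hm z) (hε.mul_right _), hev, smul_mul_assoc, smul_mul_assoc,
      map_mul, mul_assoc]
  refine ⟨⟨evalT_injective hV fun z => ?_, fun z y => ?_⟩, hev'⟩
  · rw [evalT_parT, hev', parC_expG (dotp_mem _ _)]
  · have hp : parTP (deg μ) E = E := by
      rcases zmodTwo_cases (deg μ) with h | h <;> rw [h]
      · exact parTP_zero E
      · rw [parTP_one, hE]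
    have hq : Sqz (pc θ α μ • ε.1) := fun b => by
      rw [smul_mul_assoc, smul_mul_assoc, mul_smul_comm, hε, smul_zero, smul_zero]
    have hc := comm_of_parC (parC_expG (dotp_mem κ z))
    rw [map_add (starT hθ α z), LinearMap.add_apply, starT_smul_left, starT_zT hθ hα₀ hα₁, hp, hs,
      hs, pvec_add, pvec_sg, ← add_assoc, evalT_shift (z + pvec θ α κ) (μ := cj μ) hq, map_add,
      evalT_smul, evalT_zT, hev]
    have e1 : ofG (pc θ α μ • ε.1) = (pc θ α μ : ℂ) • ofG ε.1 := by
      rw [map_smul]; exact (algebraMap_smul ℂ (pc θ α μ) (ofG ε.1)).symm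
    have e2 : ofG ε.1 * (ofG (z.1 μ) * expG (dotp κ z)) * ofG ε.1 = 0 := hε.ofG _
    rw [e1, add_mul, mul_add, mul_add, add_assoc]
    congr 1
    simp only [smul_mul_assoc, mul_smul_comm, mul_add, ← mul_assoc] at e2 ⊢
    rw [e2, hc (ofG ε.1), smul_smul]
    simp only [zero_mul, smul_zero, add_zero]
    rw [add_comm]
    congr 2
    linear_combination (-(pc θ α μ : ℂ)) * Complex.I_mul_I

/-- There is a plane wave for each covector. -/
theorem exists_planeWave (hV : ¬ Module.Finite ℝ V) (hθ : θ ≠ 0) (hα₀ : α ≠ 0) (hα₁ : α ≠ -1)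
    (κ : Superspace V p n) : ∃ E : TT V p n, IsPlaneWave hθ α E (pvec θ α κ) ∧
      ∀ z, evalT z E = expG (dotp κ z) := by
  induction κ using Superspace.induction with
  | h0 k => exact ⟨_, isPlaneWave_chr hθ hα₀ hα₁ k, evalT_chr k⟩
  | h1 κ μ ε hε ih =>
    obtain ⟨E, hE, hev⟩ := ih
    exact ⟨_, hE.step hV hθ hα₀ hα₁ hev hε⟩

end PlaneWaves

/-! ### Representatives and non-degeneracy -/

section Representatives

variable {V : Type*} [AddCommGroup V] [Module ℝ V] {p n : ℕ} {θ α : ℝ}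

/-- The element of `𝒜_ℂ ⊗ PGS` given by a finite sum `∑ a_j f_j`. -/
def toT (F : GSuperFun V p n) (hF : ∀ j, F.term j ∈ PGS p n) : TT V p n :=
  ∑ j, ofG (F.coeff j) ⊗ₜ[ℂ] (⟨F.term j, hF j⟩ : PGS p n)

theorem evalT_toT (F : GSuperFun V p n) (hF : ∀ j, F.term j ∈ PGS p n) (z : Superspace V p n) :
    evalT z (toT F hF) = F.eval z := by
  rw [toT, map_sum]; rfl

theorem parPP_eq_sum (i : ZMod 2) (f : PGS p n) :
    ∑ I, (if i = 0 then (1 : ℂ) else (-1) ^ I.card) •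
      (⟨f.1.component I, compS_mem f.2 I⟩ : PGS p n) = parPP i f := by
  refine Subtype.ext (funext fun K => ?_)
  rw [AddSubmonoidClass.coe_finsetSum, Finset.sum_apply, Finset.sum_eq_single K]
  · change (if i = 0 then (1 : ℂ) else _) • (if K = K then f.1 K else 0) = _
    rw [if_pos rfl]
    rcases zmodTwo_cases i with rfl | rfl
    · rw [if_pos rfl, one_smul, parPP_zero]; rfl
    · rw [if_neg (by decide), parPP_one]; rfl
  · intro I _ h
    change (if i = 0 then (1 : ℂ) else _) • (if K = I then f.1 K else 0) = 0
    rw [if_neg h.symm, smul_zero]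
  · simp

/-- The star-product with coefficients is computed on representatives in `𝒜_ℂ ⊗ PGS`. -/
theorem star_eq_starT (hθ : θ ≠ 0) (F G : GSuperFun V p n) (hF : ∀ j, F.term j ∈ PGS p n)
    (hG : ∀ j, G.term j ∈ PGS p n) (z : Superspace V p n) :
    F.star θ α G z = starT hθ α z (toT F hF) (toT G hG) := by
  rw [toT, toT]
  simp only [map_sum, LinearMap.sum_apply]
  rw [Finset.sum_comm]
  refine Finset.sum_congr rfl fun j _ => Finset.sum_congr rfl fun k _ => ?_
  set f : PGS p n := ⟨F.term j, hF j⟩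
  set g : PGS p n := ⟨G.term k, hG k⟩
  have key : ∀ b : Grass V, ∑ I : Finset (Fin n), ofG (F.coeff j * (parityAut V)^[I.card] b)
      * starP hθ α z (⟨f.1.component I, compS_mem f.2 I⟩ : PGS p n) g
      = starT hθ α z (ofG (F.coeff j) ⊗ₜ f) (ofG b ⊗ₜ g) := by
    have hom : ∀ (i : ZMod 2) (b : Grass V), b ∈ part V i → ∑ I : Finset (Fin n),
        ofG (F.coeff j * (parityAut V)^[I.card] b)
        * starP hθ α z (⟨f.1.component I, compS_mem f.2 I⟩ : PGS p n) g
        = starT hθ α z (ofG (F.coeff j) ⊗ₜ f) (ofG b ⊗ₜ g) := by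
      intro i b hb
      rw [starT_hom hθ z _ hb, ← parPP_eq_sum, map_sum, LinearMap.sum_apply, Finset.mul_sum,
        Finset.mul_sum]
      refine Finset.sum_congr rfl fun I _ => ?_
      have h : ∀ k : ℕ, ofG ((parityAut V)^[k] b) = (if i = 0 then (1 : ℂ) else (-1) ^ k) • ofG b := by
        intro k
        induction k with
        | zero => simp
        | succ k ih =>
          rw [Function.iterate_succ_apply', ← parC_ofG, ih, map_smul, parC_ofG]
          rcases zmodTwo_cases i with rfl | rfl
          · rw [parityAut_even hb, if_pos rfl, if_pos rfl]
          · rw [parityAut_odd hb, if_neg (by decide), if_neg (by decide), map_neg, pow_succ,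
              mul_neg_one, neg_smul, smul_neg]
      rw [map_mul, h, map_smul, LinearMap.smul_apply]
      simp only [smul_mul_assoc, mul_smul_comm, mul_assoc]
    intro b
    obtain ⟨c, hc, d, hd, rfl⟩ := exists_even_add_odd b
    rw [map_add, TensorProduct.add_tmul, map_add, ← hom 0 c hc, ← hom 1 d hd,
      ← Finset.sum_add_distrib]
    refine Finset.sum_congr rfl fun I _ => ?_
    rw [← add_mul, ← map_add, ← mul_add, ← AlgHom.coe_pow, map_add]
  exact key (G.coeff k)

theorem exists_toT (x : TT V p n) :
    ∃ (F : GSuperFun V p n) (hF : ∀ j, F.term j ∈ PGS p n), toT F hF = x := by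
  induction x using TT.induction with
  | h i a f ha =>
    exact ⟨⟨1, fun _ => a, fun _ => f.1⟩, fun _ => f.2, by rw [toT]; exact Fin.sum_univ_one _⟩
  | hadd x y hx hy =>
    obtain ⟨F, hF, rfl⟩ := hx
    obtain ⟨G, hG, rfl⟩ := hy
    refine ⟨⟨F.size + G.size, Fin.append F.coeff G.coeff, Fin.append F.term G.term⟩,
      fun j => ?_, ?_⟩
    · refine Fin.addCases (fun j => ?_) (fun j => ?_) j
      · simpa using hF j
      · simpa using hG j
    · rw [toT, toT, toT]
      simp only [Fin.sum_univ_add, Fin.append_left, Fin.append_right]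

/-- The superfunction `g θ^J`. -/
def monoS (J : Finset (Fin n)) (g : Body p → ℂ) : SuperFun p n := fun I => if I = J then g else 0

theorem monoS_mem (J : Finset (Fin n)) {g : Body p → ℂ} (hg : PolyB g) :
    (monoS J g : SuperFun p n) ∈ PGS p n := by
  intro I
  rw [monoS]
  split_ifs
  · exact hg
  · exact PolyB.const 0

theorem polyB_of_hasCompactSupport {g : Body p → ℂ} (hg : ContDiff ℝ ∞ g)
    (hs : HasCompactSupport g) : PolyB g := ⟨0, isSym_of_hasCompactSupport hg hs _⟩

/-- The star-product is non-degenerate, already at the origin. -/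
theorem eq_zero_of_starT_zero (hθ : θ ≠ 0) (hα₀ : α ≠ 0) (hα₁ : α ≠ -1) {x : TT V p n}
    (h : ∀ (J : Finset (Fin n)) (g : Body p → ℂ) (hg : ContDiff ℝ ∞ g) (hs : HasCompactSupport g),
      starT hθ α (rl 0) x ((1 : GrassC V) ⊗ₜ[ℂ]
        (⟨monoS J g, monoS_mem J (polyB_of_hasCompactSupport hg hs)⟩ : PGS p n)) = 0) : x = 0 := by
  refine eq_zero_of_cont fun l => Subtype.ext (funext fun J => ?_)
  refine eq_zero_of_evenStar_zero hθ ((cont l x).2 J) fun g hg hs => ?_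
  set G : PGS p n := ⟨monoS J g, monoS_mem J (polyB_of_hasCompactSupport hg hs)⟩ with hG
  have key : ∀ x : TT V p n, l (starT hθ α (rl 0) x ((1 : GrassC V) ⊗ₜ[ℂ] G))
      = starProduct θ α (cont l x).1 G.1 ∅ 0 := by
    intro x
    induction x using TT.induction with
    | h i a f ha =>
      have := starT_hom (α := α) hθ (rl 0) (ofG a) (one_mem_even (V := V)) f G
      rw [map_one] at this
      rw [this, one_mul, parPP_zero, LinearMap.id_apply, starP_apply,
        eval_rl (contDiff_starProduct hθ α f.2 G.2), mul_smul_comm, mul_one, map_smul, cont_tmul,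
        Submodule.coe_smul, starProduct_smul_left hθ α _ f.2 G.2]
      exact mul_comm _ _
    | hadd x y hx hy =>
      rw [map_add, LinearMap.add_apply, map_add, hx, hy, map_add, Submodule.coe_add,
        starProduct_add_left hθ α (cont l x).2 (cont l y).2 G.2]; rfl
  have h0 := key x
  rw [h J g hg hs, map_zero, starProduct_apply] at h0
  have h1 := (mul_eq_zero.mp h0.symm).resolve_left (kappa_ne_zero hθ hα₀ hα₁)
  have h2 : ∀ I, ∑ K, oddKernel (oddConst θ α) I K ∅ * evenStar θ ((cont l x).1 I) (G.1 K) 0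
      = oddKernel (oddConst θ α) I J ∅ * evenStar θ ((cont l x).1 I) g 0 := by
    intro I
    rw [Finset.sum_eq_single J]
    · rw [hG]; simp only [monoS, if_true]
    · intro K _ hK
      change _ * evenStar θ _ (if K = J then g else fun _ => 0) 0 = 0
      rw [if_neg hK, evenStar_zero_right hθ, mul_zero]
    · simp
  rw [Finset.sum_congr rfl fun I _ => h2 I, Finset.sum_eq_single J] at h1
  · obtain ⟨r, hr, hk⟩ := oddKernel_empty_right (oddConst_ne_zero hθ hα₀ hα₁) J J
    rw [hk, if_pos rfl] at h1
    exact (mul_eq_zero.mp h1).resolve_left hr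
  · intro I _ hI
    obtain ⟨r, hr, hk⟩ := oddKernel_empty_right (oddConst_ne_zero hθ hα₀ hα₁) I J
    rw [hk, if_neg hI, zero_mul]
  · simp

end Representatives

/-! ### Composition of superfunctions with smooth maps -/

section Composition

variable {V : Type*} [AddCommGroup V] [Module ℝ V] {p n : ℕ}

/-- The projection of `𝒜` onto its component of degree `i`. -/
def prG (i : ZMod 2) : Grass V →ₗ[ℝ] Grass V :=
  (2⁻¹ : ℝ) • (LinearMap.id + (if i = 0 then (1 : ℝ) else -1) • (parityAut V).toLinearMap)

theorem prG_of_mem {i j : ZMod 2} {a : Grass V} (ha : a ∈ part V j) :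
    prG i a = if i = j then a else 0 := by
  change (2⁻¹ : ℝ) • (a + (if i = 0 then (1 : ℝ) else -1) • parityAut V a) = _
  have h1 : ¬ (1 : ZMod 2) = 0 := by decide
  have h2 : ¬ (0 : ZMod 2) = 1 := by decide
  rcases zmodTwo_cases i with rfl | rfl <;> rcases zmodTwo_cases j with rfl | rfl
  · rw [parityAut_even ha, if_pos rfl, if_pos rfl]; module
  · rw [parityAut_odd ha, if_pos rfl, if_neg h2]; module
  · rw [parityAut_even ha, if_neg h1, if_neg h1]; module
  · rw [parityAut_odd ha, if_neg h1, if_pos rfl]; module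

theorem prG_mem (i : ZMod 2) (a : Grass V) : prG i a ∈ part V i := by
  obtain ⟨b, hb, c, hc, rfl⟩ := exists_even_add_odd a
  rw [map_add, prG_of_mem hb, prG_of_mem hc]
  refine Submodule.add_mem _ ?_ ?_ <;> split_ifs with h
  exacts [h ▸ hb, Submodule.zero_mem _, h ▸ hc, Submodule.zero_mem _]

theorem prG_mul {i j : ZMod 2} (a : Grass V) {b : Grass V} (hb : b ∈ part V j) :
    prG i (a * b) = prG (i + j) a * b := by
  have key : ∀ k (c : Grass V), c ∈ part V k → prG i (c * b) = prG (i + j) c * b := by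
    intro k c hc
    rw [prG_of_mem (mul_mem_part V hc hb), prG_of_mem hc, ite_mul, zero_mul]
    have h : ∀ i j k : ZMod 2, i = k + j ↔ i + j = k := by decide
    exact if_congr (h i j k) rfl rfl
  obtain ⟨c, hc, d, hd, rfl⟩ := exists_even_add_odd a
  rw [add_mul, map_add, map_add, add_mul, key 0 c hc, key 1 d hd]

/-- The real part `𝒜_ℂ → 𝒜`. -/
def reC : GrassC V →ₗ[ℝ] Grass V :=
  (TensorProduct.lid ℝ (Grass V)).toLinearMap.comp (LinearMap.rTensor _ Complex.reLm)

theorem reC_smul_ofG (c : ℂ) (a : Grass V) : reC (c • ofG a) = c.re • a := by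
  rw [← tmul_eq_smul]; rfl

theorem reC_ofG (a : Grass V) : reC (ofG a) = a := by
  have := reC_smul_ofG 1 a
  rwa [one_smul, Complex.one_re, one_smul] at this

theorem reC_ofG_mul (a : Grass V) (x : GrassC V) : reC (ofG a * x) = a * reC x := by
  induction x using GrassC.induction with
  | h c b => rw [mul_smul_comm, ← map_mul, reC_smul_ofG, reC_smul_ofG, mul_smul_comm]
  | hadd x y hx hy => rw [mul_add, map_add, map_add, mul_add, hx, hy]

theorem reC_mul_ofG (x : GrassC V) (a : Grass V) : reC (x * ofG a) = reC x * a := by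
  induction x using GrassC.induction with
  | h c b => rw [smul_mul_assoc, ← map_mul, reC_smul_ofG, reC_smul_ofG, smul_mul_assoc]
  | hadd x y hx hy => rw [add_mul, map_add, map_add, add_mul, hx, hy]

/-- The Taylor extension of a real function. -/
def tay (h : Body p → ℝ) (z : Superspace V p n) : Grass V := reC (taylorExt (fun y => (h y : ℂ)) z)

theorem contDiff_ofReal {h : Body p → ℝ} (hh : ContDiff ℝ ∞ h) :
    ContDiff ℝ ∞ fun y => (h y : ℂ) := Complex.ofRealCLM.contDiff.comp hh

theorem pd_clm_comp {F G : Type*} [NormedAddCommGroup F] [NormedSpace ℝ F] [NormedAddCommGroup G]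
    [NormedSpace ℝ G] (L : F →L[ℝ] G) {f : Body p → F} (hf : ContDiff ℝ ∞ f) (a : Body p) :
    pd a (fun y => L (f y)) = fun y => L (pd a f y) := by
  ext y
  rw [pd, show (fun y => L (f y)) = ⇑L ∘ f from rfl, (L.hasFDerivAt.comp y (hf.differentiable (by simp) y).hasFDerivAt).fderiv]; rfl

theorem pd_ofReal {h : Body p → ℝ} (hh : ContDiff ℝ ∞ h) (a : Body p) :
    pd a (fun y => (h y : ℂ)) = fun y => ((pd a h y : ℝ) : ℂ) :=
  pd_clm_comp Complex.ofRealCLM hh a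

theorem pd_re {f : Body p → ℂ} (hf : ContDiff ℝ ∞ f) (a : Body p) :
    pd a (fun y => (f y).re) = fun y => (pd a f y).re :=
  pd_clm_comp Complex.reCLM hf a

theorem reC_taylorExt {f : Body p → ℂ} (hf : ContDiff ℝ ∞ f) (z : Superspace V p n) :
    reC (taylorExt f z) = tay (fun y => (f y).re) z := by
  have hr : ∀ {f : Body p → ℂ}, ContDiff ℝ ∞ f → ContDiff ℝ ∞ fun y => (f y).re :=
    fun hf => Complex.reCLM.contDiff.comp hf
  rw [tay]
  induction z using Superspace.induction generalizing f with
  | h0 y =>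
    rw [taylorExt_rl _ hf, taylorExt_rl _ (contDiff_ofReal (hr hf)), ← map_one ofG, reC_smul_ofG,
      reC_smul_ofG, Complex.ofReal_re]
  | h1 z μ ε hε ih =>
    rcases μ with j | j
    · rw [taylorExt_shift hf z j ε hε, taylorExt_shift (contDiff_ofReal (hr hf)) z j ε hε, map_add,
        map_add, reC_ofG_mul, reC_ofG_mul, ih hf, ih (contDiff_pd hf _),
        pd_ofReal (hr hf), pd_re hf]
    · rw [taylorExt_shift_inr, taylorExt_shift_inr, ih hf]

theorem ofG_tay {h : Body p → ℝ} (hh : ContDiff ℝ ∞ h) (z : Superspace V p n) :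
    ofG (tay h z) = taylorExt (fun y => (h y : ℂ)) z := by
  rw [tay]
  induction z using Superspace.induction generalizing h with
  | h0 y =>
    rw [taylorExt_rl _ (contDiff_ofReal hh), ← map_one ofG, reC_smul_ofG, Complex.ofReal_re,
      map_smul]
    exact (algebraMap_smul ℂ (h y) _).symm
  | h1 z μ ε hε ih =>
    rcases μ with j | j
    · rw [taylorExt_shift (contDiff_ofReal hh) z j ε hε, map_add, map_add, reC_ofG_mul, map_mul,
        pd_ofReal hh, ih hh]
      congr 2
      exact ih (contDiff_pd hh _)
    · rw [taylorExt_shift_inr, ih hh]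

theorem tay_mem {h : Body p → ℝ} (hh : ContDiff ℝ ∞ h) (z : Superspace V p n) :
    tay h z ∈ part V 0 := by
  have h1 : parityAut V (tay h z) = tay h z := ofG_injective (by
    rw [← parC_ofG, ofG_tay hh, parC_taylorExt (contDiff_ofReal hh)])
  have h2 : prG 0 (tay h z) = tay h z := by
    change (2⁻¹ : ℝ) • (_ + (if (0 : ZMod 2) = 0 then (1 : ℝ) else -1) • parityAut V _) = _
    rw [h1, if_pos rfl]; module
  rw [← h2]; exact prG_mem 0 _

theorem tay_shift {h : Body p → ℝ} (hh : ContDiff ℝ ∞ h) (z : Superspace V p n) (j : EvenIdx p)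
    (ε : part V (deg (Sum.inl j : Idx p n))) (hε : Sqz ε.1) :
    tay h (z + sg (Sum.inl j) ε) = tay h z + ε.1 * tay (pd (eb j) h) z := by
  rw [tay, taylorExt_shift (contDiff_ofReal hh) z j ε hε, map_add, reC_ofG_mul,
    pd_ofReal hh]; rfl

theorem tay_rl {h : Body p → ℝ} (hh : ContDiff ℝ ∞ h) (y : Body p) :
    tay h (rl y : Superspace V p n) = algebraMap ℝ _ (h y) := by
  rw [tay, taylorExt_rl _ (contDiff_ofReal hh), ← map_one ofG, reC_smul_ofG, Complex.ofReal_re,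
    Algebra.algebraMap_eq_smul_one]

theorem contDiff_comp_coord {u : Body p → Body p} (hu : ContDiff ℝ ∞ u) (i : EvenIdx p) :
    ContDiff ℝ ∞ fun y => u y i := (EuclideanSpace.proj i : Body p →L[ℝ] ℝ).contDiff.comp hu

/-- The extension of a smooth map of the body to the superspace, with odd coordinates `0`. -/
def extm (u : Body p → Body p) (hu : ContDiff ℝ ∞ u) (z : Superspace V p n) : Superspace V p n :=
  ⟨Sum.elim (fun i => tay (fun y => u y i) z) 0, by
    rintro (i | i)
    · exact tay_mem (contDiff_comp_coord hu i) z
    · exact Submodule.zero_mem _⟩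

theorem taylorExt_multishift {g : Body p → ℂ} (hg : ContDiff ℝ ∞ g) (w : Superspace V p n)
    {ε : Grass V} (hε : Sqz ε) (c : EvenIdx p → Grass V)
    (hc : ∀ i, ε * c i ∈ part V (deg (Sum.inl i : Idx p n))) (s : Finset (EvenIdx p)) :
    taylorExt g (w + ∑ i ∈ s, sg (Sum.inl i) ⟨ε * c i, hc i⟩)
      = taylorExt g w + ∑ i ∈ s, ofG (ε * c i) * taylorExt (pd (eb i) g) w := by
  classical
  induction s using Finset.induction_on generalizing g with
  | empty => simp
  | insert a s ha ih =>
    rw [Finset.sum_insert ha, Finset.sum_insert ha, add_comm (sg _ _), ← add_assoc,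
      taylorExt_shift hg _ a _ (hε.mul_right _), ih hg, ih (contDiff_pd hg _), mul_add,
      Finset.mul_sum, Finset.sum_eq_zero (f := fun i => _ * (ofG (ε * c i) * _)), add_zero]
    · abel
    · intro i _
      rw [map_mul, map_mul, mul_assoc (ofG ε) (ofG (c i)), ← mul_assoc _ (ofG ε), hε.ofG, zero_mul]

theorem taylorExt_sum {ι : Type*} (s : Finset ι) {f : ι → Body p → ℂ}
    (hf : ∀ i, ContDiff ℝ ∞ (f i)) (z : Superspace V p n) :
    taylorExt (fun y => ∑ i ∈ s, f i y) z = ∑ i ∈ s, taylorExt (f i) z := by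
  classical
  induction s using Finset.induction_on with
  | empty => simpa using taylorExt_const 0 z
  | insert a s ha ih =>
    simp only [Finset.sum_insert ha]
    rw [taylorExt_add (hf a) (ContDiff.sum fun i _ => hf i), ih]

theorem pd_comp_eq {u : Body p → Body p} (hu : ContDiff ℝ ∞ u) {g : Body p → ℂ}
    (hg : ContDiff ℝ ∞ g) (a : Body p) : pd a (fun y => g (u y))
      = fun y => ∑ i, ((pd a (fun y => u y i) y : ℝ) : ℂ) * pd (eb i) g (u y) := by
  ext y
  have h1 := ((hg.differentiable (by simp) (u y)).hasFDerivAt.comp y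
    (hu.differentiable (by simp) y).hasFDerivAt).fderiv
  have h2 : ∀ i, pd a (fun y => u y i) y = (fderiv ℝ u y a) i := fun i =>
    congrFun (pd_clm_comp (EuclideanSpace.proj i : Body p →L[ℝ] ℝ) hu a) y
  have h3 : fderiv ℝ u y a = ∑ i, (fderiv ℝ u y a) i • eb i := by
    conv_lhs => rw [← (EuclideanSpace.basisFun (EvenIdx p) ℝ).sum_repr (fderiv ℝ u y a)]
    simp only [EuclideanSpace.basisFun_repr, EuclideanSpace.basisFun_apply]
  rw [pd, show (fun y => g (u y)) = g ∘ u from rfl, h1, ContinuousLinearMap.comp_apply, h3,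
    map_sum]
  refine Finset.sum_congr rfl fun i _ => ?_
  rw [map_smul, h2, Complex.real_smul]; rfl

theorem extm_rl {u : Body p → Body p} (hu : ContDiff ℝ ∞ u) (y : Body p) :
    extm u hu (rl y : Superspace V p n) = rl (u y) := by
  refine Subtype.ext (funext fun μ => ?_)
  rcases μ with i | i
  · exact tay_rl (contDiff_comp_coord hu i) y
  · rfl

theorem extm_shift_inr {u : Body p → Body p} (hu : ContDiff ℝ ∞ u) (z : Superspace V p n)
    (j : Fin n) (ε : part V (deg (Sum.inr j : Idx p n))) :
    extm u hu (z + sg (Sum.inr j) ε) = extm u hu z := by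
  refine Subtype.ext (funext fun μ => ?_)
  rcases μ with i | i
  · change tay _ _ = tay _ _
    rw [tay, taylorExt_shift_inr]; rfl
  · rfl

theorem sum_sg_inl_apply (c : ∀ i, part V (deg (Sum.inl i : Idx p n))) (μ : Idx p n) :
    (∑ i, sg (Sum.inl i) (c i)).1 μ = Sum.elim (fun i => (c i).1) 0 μ := by
  rw [AddSubmonoidClass.coe_finsetSum, Finset.sum_apply]
  rcases μ with i | i
  · rw [Finset.sum_eq_single i]
    · rw [sg_apply, if_pos rfl]; rfl
    · intro b _ hb; rw [sg_apply, if_neg fun h => hb (Sum.inl_injective h).symm]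
    · intro h; exact absurd (Finset.mem_univ i) h
  · exact Finset.sum_eq_zero fun b _ => by rw [sg_apply, if_neg Sum.inr_ne_inl]

theorem extm_shift {u : Body p → Body p} (hu : ContDiff ℝ ∞ u) (z : Superspace V p n)
    (j : EvenIdx p) (ε : part V (deg (Sum.inl j : Idx p n))) (hε : Sqz ε.1)
    (hm : ∀ i, ε.1 * tay (pd (eb j) fun y => u y i) z ∈ part V (deg (Sum.inl i : Idx p n))) :
    extm u hu (z + sg (Sum.inl j) ε) = extm u hu z + ∑ i, sg (Sum.inl i)
        ⟨ε.1 * tay (pd (eb j) fun y => u y i) z, hm i⟩ := by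
  refine Subtype.ext (funext fun μ => ?_)
  rw [Submodule.coe_add, Pi.add_apply, sum_sg_inl_apply]
  rcases μ with i | i
  · exact tay_shift (contDiff_comp_coord hu i) z j ε hε
  · exact (add_zero _).symm

/-- The chain rule for Taylor extensions. -/
theorem taylorExt_extm {u : Body p → Body p} (hu : ContDiff ℝ ∞ u) {g : Body p → ℂ}
    (hg : ContDiff ℝ ∞ g) (z : Superspace V p n) :
    taylorExt g (extm u hu z) = taylorExt (fun y => g (u y)) z := by
  have hcomp : ∀ {g : Body p → ℂ}, ContDiff ℝ ∞ g → ContDiff ℝ ∞ fun y => g (u y) :=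
    fun hg => hg.comp hu
  induction z using Superspace.induction generalizing g with
  | h0 y => rw [extm_rl, taylorExt_rl _ hg, taylorExt_rl _ (hcomp hg)]
  | h1 z μ ε hε ih =>
    rcases μ with j | j
    · have hm : ∀ i, ε.1 * tay (pd (eb j) fun y => u y i) z ∈ part V (deg (Sum.inl i : Idx p n)) :=
        fun i => mul_mem_part V (i := 0) (j := 0) ε.2
          (tay_mem (contDiff_pd (contDiff_comp_coord hu i) _) z)
      have hd : ∀ i, ContDiff ℝ ∞ (pd (eb j) fun y => u y i) :=
        fun i => contDiff_pd (contDiff_comp_coord hu i) (eb j)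
      rw [extm_shift hu z j ε hε hm,
        taylorExt_multishift hg _ hε (fun i => tay (pd (eb j) fun y => u y i) z) hm,
        taylorExt_shift (hcomp hg) z j ε hε, pd_comp_eq hu hg, taylorExt_sum _ fun i => (contDiff_ofReal (hd i)).mul
          (hcomp (contDiff_pd hg (eb i))), ih hg, Finset.mul_sum]
      congr 1
      refine Finset.sum_congr rfl fun i _ => ?_
      rw [map_mul, mul_assoc, ih (contDiff_pd hg _), ofG_tay (hd i),
        taylorExt_mul (contDiff_ofReal (hd i)) (hcomp (contDiff_pd hg (eb i)))]
    · rw [extm_shift_inr, taylorExt_shift_inr, ih hg]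

theorem eval_extm {u : Body p → Body p} (hu : ContDiff ℝ ∞ u) {f : SuperFun p n} (hf : f.Smooth)
    (z : Superspace V p n) : f.eval (extm u hu z) = taylorExt (fun y => f ∅ (u y)) z := by
  have h : ∀ I, oddMonomial (extm u hu z) I = if I = ∅ then 1 else 0 := fun I =>
    oddMonomial_rl (V := V) (0 : Body p) I
  rw [eval_eq, Finset.sum_eq_single ∅]
  · rw [h, if_pos rfl, map_one, mul_one, taylorExt_extm hu (hf ∅)]
  · intro I _ hI; rw [h, if_neg hI, map_zero, mul_zero]
  · simp

/-- The functions on the superspace generated by the Grassmann numbers, the Taylor extensions and the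
odd coordinates. -/
def SA (V : Type*) [AddCommGroup V] [Module ℝ V] (p n : ℕ) :
    Subalgebra ℂ (Superspace V p n → GrassC V) :=
  Algebra.adjoin ℂ ((Set.range fun a : GrassC V => fun _ => a)
    ∪ {u | ∃ h : Body p → ℂ, ContDiff ℝ ∞ h ∧ u = taylorExt h}
    ∪ Set.range fun i : Fin n => fun z => ofG (z.1 (Sum.inr i)))

theorem const_mem_SA (a : GrassC V) : (fun _ => a) ∈ SA V p n :=
  Algebra.subset_adjoin (Or.inl (Or.inl ⟨a, rfl⟩))

theorem taylorExt_mem_SA {h : Body p → ℂ} (hh : ContDiff ℝ ∞ h) : taylorExt h ∈ SA V p n :=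
  Algebra.subset_adjoin (Or.inl (Or.inr ⟨h, hh, rfl⟩))

theorem oddMonomial_mem_SA (I : Finset (Fin n)) :
    (fun z : Superspace V p n => ofG (oddMonomial z I)) ∈ SA V p n := by
  change (fun z : Superspace V p n => ofG (mono _ I)) ∈ SA V p n
  induction I using Finset.induction_on_min with
  | empty => simp only [mono_empty, map_one]; exact const_mem_SA 1
  | insert a s ha ih =>
    simp only [mono_insert ha, map_mul]
    exact (SA V p n).mul_mem (Algebra.subset_adjoin (Or.inr ⟨a, rfl⟩)) ih

/-- The maps `N` that may be added to a map without affecting the smoothness of the pull-backs. -/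
def smoothIncr (V : Type*) [AddCommGroup V] [Module ℝ V] (p n : ℕ) :
    AddSubmonoid (Superspace V p n → Superspace V p n) where
  carrier := {N | ∀ ψ : Superspace V p n → Superspace V p n,
    (∀ f : SuperFun p n, f.Smooth → (fun z => f.eval (ψ z)) ∈ SA V p n) →
    ∀ f : SuperFun p n, f.Smooth → (fun z => f.eval (ψ z + N z)) ∈ SA V p n}
  zero_mem' ψ hψ f hf := by simpa using hψ f hf
  add_mem' {N N'} hN hN' ψ hψ f hf := by
    simpa only [add_assoc, Pi.add_apply] using hN' (fun z => ψ z + N z) (hN ψ hψ) f hf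

theorem smooth_dS {f : SuperFun p n} (hf : f.Smooth) (μ : Idx p n) : (dS μ f).Smooth := by
  rcases μ with j | i
  · exact fun K => contDiff_pd (hf K) _
  · intro K
    rw [dS_inr, dXi_apply]
    split_ifs
    · exact contDiff_const
    · exact contDiff_const.mul (hf _)

theorem sg_mem_smoothIncr (μ : Idx p n) (s : Superspace V p n → part V (deg μ))
    (hs : ∀ z, Sqz (s z).1) (hS : (fun z => ofG (s z).1) ∈ SA V p n) :
    (fun z => sg μ (s z)) ∈ smoothIncr V p n := by
  intro ψ hψ f hf
  simp only [eval_shift hf _ (hs _)]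
  exact (SA V p n).add_mem (hψ f hf) ((SA V p n).mul_mem hS (hψ _ (smooth_dS hf μ)))

end Composition

section SmoothMaps

variable {V : Type*} [AddCommGroup V] [Module ℝ V] {p n : ℕ}

theorem oddMonomial_mem (z : Superspace V p n) (I : Finset (Fin n)) :
    oddMonomial z I ∈ part V (I.card : ZMod 2) := by
  change mono _ I ∈ _
  induction I using Finset.induction_on_min with
  | empty => rw [mono_empty, Finset.card_empty, Nat.cast_zero]; exact one_mem_even
  | insert a s ha ih =>
    rw [mono_insert ha, Finset.card_insert_of_notMem fun h => lt_irrefl _ (ha a h), Nat.cast_add,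
      Nat.cast_one, add_comm]
    exact mul_mem_part V (i := 1) (z.2 (Sum.inr a)) ih

theorem sqz_oddMonomial (z : Superspace V p n) {I : Finset (Fin n)} (hI : I.Nonempty) :
    Sqz (oddMonomial z I) := by
  change Sqz (mono _ I)
  rw [← Finset.insert_erase (Finset.min'_mem I hI), mono_insert]
  · exact (sqz_of_inr ⟨_, z.2 (Sum.inr (I.min' hI))⟩).mul_right _
  · exact fun b hb => (Finset.min'_le I b (Finset.mem_of_mem_erase hb)).lt_of_ne
      (Finset.ne_of_mem_erase hb).symm

theorem tay_add {h h' : Body p → ℝ} (hh : ContDiff ℝ ∞ h) (hh' : ContDiff ℝ ∞ h')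
    (z : Superspace V p n) : tay (fun y => h y + h' y) z = tay h z + tay h' z := by
  rw [tay, tay, tay, ← map_add, ← taylorExt_add (contDiff_ofReal hh) (contDiff_ofReal hh')]
  simp only [Complex.ofReal_add]

theorem extm_add {u u' : Body p → Body p} (hu : ContDiff ℝ ∞ u) (hu' : ContDiff ℝ ∞ u')
    (z : Superspace V p n) :
    extm (fun y => u y + u' y) (hu.add hu') z = extm u hu z + extm u' hu' z := by
  refine Subtype.ext (funext fun μ => ?_)
  rcases μ with i | i
  · exact tay_add (contDiff_comp_coord hu i) (contDiff_comp_coord hu' i) z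
  · exact (add_zero _).symm

theorem tay_const (r : ℝ) (z : Superspace V p n) : tay (fun _ => r) z = algebraMap ℝ _ r := by
  rw [tay, taylorExt_const, ← map_one ofG, reC_smul_ofG, Complex.ofReal_re,
    Algebra.algebraMap_eq_smul_one]

theorem tay_const_mul (r : ℝ) {h : Body p → ℝ} (hh : ContDiff ℝ ∞ h) (z : Superspace V p n) :
    tay (fun y => r * h y) z = r • tay h z := by
  rw [tay, tay]
  simp only [Complex.ofReal_mul]
  rw [taylorExt_const_mul (contDiff_ofReal hh), ← ofG_tay hh, reC_smul_ofG, Complex.ofReal_re,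
    reC_ofG]

/-- The maps of the superspace of the form `extm u + N`, with `N` an increment as above.  These
turn out to be the maps with smooth components. -/
def smoothMaps (V : Type*) [AddCommGroup V] [Module ℝ V] (p n : ℕ) :
    AddSubmonoid (Superspace V p n → Superspace V p n) where
  carrier := {W | ∃ (u : Body p → Body p) (hu : ContDiff ℝ ∞ u), ∃ N ∈ smoothIncr V p n,
    ∀ z, W z = extm u hu z + N z}
  zero_mem' := ⟨fun _ => 0, contDiff_const, 0, AddSubmonoid.zero_mem _, fun z => by
    rw [Pi.zero_apply, add_zero]
    refine Subtype.ext (funext fun μ => ?_)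
    rcases μ with i | i
    · exact ((tay_const 0 z).trans (map_zero _)).symm
    · rfl⟩
  add_mem' := by
    rintro W W' ⟨u, hu, N, hN, h⟩ ⟨u', hu', N', hN', h'⟩
    refine ⟨_, hu.add hu', _, AddSubmonoid.add_mem _ hN hN', fun z => ?_⟩
    rw [Pi.add_apply, h, h', extm_add hu hu', Pi.add_apply]
    abel

theorem eval_mem_SA {W : Superspace V p n → Superspace V p n} (hW : W ∈ smoothMaps V p n)
    {f : SuperFun p n} (hf : f.Smooth) : (fun z => f.eval (W z)) ∈ SA V p n := by
  obtain ⟨u, hu, N, hN, h⟩ := hW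
  simp only [h]
  refine hN _ (fun f hf => ?_) f hf
  simp only [eval_extm hu hf]
  exact taylorExt_mem_SA ((hf ∅).comp hu)

theorem smoothIncr_le : smoothIncr V p n ≤ smoothMaps V p n := by
  intro N hN
  obtain ⟨u, hu, N', hN', h⟩ := (smoothMaps V p n).zero_mem
  exact ⟨u, hu, _, AddSubmonoid.add_mem _ hN' hN, fun z => by
    rw [Pi.add_apply, ← add_assoc, ← h z]; exact (zero_add _).symm⟩

/-- Only the term with `I = ∅` and the body of `b` contributes to the map of the bodies; everything
else is a sum of square-zero increments. -/
theorem term_mem_smoothMaps (μ : Idx p n) (I : Finset (Fin n)) {h : Body p → ℝ}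
    (hh : ContDiff ℝ ∞ h) {b : Grass V} (hb : b ∈ part V (deg μ + (I.card : ZMod 2)))
    (hm : ∀ z : Superspace V p n, b * (tay h z * oddMonomial z I) ∈ part V (deg μ)) :
    (fun z => sg μ ⟨b * (tay h z * oddMonomial z I), hm z⟩) ∈ smoothMaps V p n := by
  have hS : ∀ b : Grass V, (fun z : Superspace V p n => ofG (b * (tay h z * oddMonomial z I)))
      ∈ SA V p n := fun b => by
    simp only [map_mul, ofG_tay hh]
    exact (SA V p n).mul_mem (const_mem_SA _)
      ((SA V p n).mul_mem (taylorExt_mem_SA (contDiff_ofReal hh)) (oddMonomial_mem_SA I))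
  rcases I.eq_empty_or_nonempty with rfl | hI
  swap
  · exact smoothIncr_le (sg_mem_smoothIncr μ _
      (fun z => ((sqz_oddMonomial z hI).mul_left _).mul_left _) (hS b))
  rcases μ with i | i
  swap
  · exact smoothIncr_le (sg_mem_smoothIncr _ _ (fun z => sqz_odd (hm z)) (hS b))
  have hb0 : b ∈ part V 0 := hb
  have hm0 : ∀ c ∈ part V 0, ∀ z : Superspace V p n,
      c * (tay h z * oddMonomial z ∅) ∈ part V (deg (Sum.inl i : Idx p n)) := fun c hc z =>
    mul_mem_part V (i := 0) (j := 0) hc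
      (mul_mem_part V (i := 0) (j := 0) (tay_mem hh z) (oddMonomial_mem z ∅))
  let Q : Grass V → Prop := fun c => ∃ hc : c ∈ part V 0,
    (fun z => sg (Sum.inl i) ⟨c * (tay h z * oddMonomial z ∅), hm0 c hc z⟩) ∈ smoothMaps V p n
  have hadd : ∀ a b, Q a → Q b → Q (a + b) := by
    rintro a b ⟨ha, ha'⟩ ⟨hb, hb'⟩
    refine ⟨Submodule.add_mem _ ha hb, ?_⟩
    have := AddSubmonoid.add_mem _ ha' hb'
    convert this using 1
    funext z
    rw [Pi.add_apply, ← map_add]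
    exact congrArg _ (Subtype.ext (add_mul _ _ _))
  have h1 : Q (b - algebraMap ℝ _ (body V b)) := by
    refine soul_induction (Q := Q) ⟨Submodule.zero_mem _, ?_⟩ hadd ?_ hb0
    · convert (smoothMaps V p n).zero_mem using 1
      funext z
      exact (congrArg _ (Subtype.ext (zero_mul _))).trans (map_zero (sg _))
    · exact fun ε hε => ⟨hε.1, smoothIncr_le (sg_mem_smoothIncr _ _
        (fun z => hε.2.mul_right _) (hS ε))⟩
  have h2 : Q (algebraMap ℝ _ (body V b)) := by
    have hu : ContDiff ℝ ∞ fun y => (body V b * h y) • (eb i : Body p) :=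
      (contDiff_const.mul hh).smul contDiff_const
    refine ⟨algebraMap_mem_even _, _, hu, 0, AddSubmonoid.zero_mem _, fun z => ?_⟩
    rw [Pi.zero_apply, add_zero]
    refine Subtype.ext (funext fun μ => ?_)
    have he : oddMonomial z ∅ = 1 := mono_empty _
    rw [sg_apply]
    rcases μ with j | j
    · change _ = tay (fun y => (body V b * h y) * (eb i : Body p) j) z
      by_cases hj : j = i
      · subst hj
        have : (fun y => (body V b * h y) * (eb j : Body p) j) = fun y => body V b * h y := by
          simp [eb]
        rw [if_pos rfl, this, tay_const_mul _ hh, Algebra.smul_def]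
        change _ * (_ * _) = _
        rw [he, mul_one]
      · have : (fun y => (body V b * h y) * (eb i : Body p) j) = fun y => 0 := by
          simp [eb, hj]
        rw [if_neg fun h => hj (Sum.inl_injective h), this, tay_const, map_zero]
    · rw [if_neg Sum.inr_ne_inl]; rfl
  obtain ⟨_, h3⟩ := hadd _ _ h1 h2
  simpa only [sub_add_cancel] using h3

/-- Maps with smooth components pull superfunctions back to elements of `SA`. -/
theorem mem_smoothMaps {ψ : Superspace V p n → Superspace V p n}
    (hψ : ∀ μ, ∃ F : GSuperFun V p n, (∀ j, (F.term j).Smooth) ∧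
      ∀ z, ofG ((ψ z).1 μ) = F.eval z) : ψ ∈ smoothMaps V p n := by
  have hsum : ψ = ∑ μ, fun z => sg μ ⟨(ψ z).1 μ, (ψ z).2 μ⟩ := by
    funext z; rw [Finset.sum_apply, sum_sg]
  rw [hsum]
  refine AddSubmonoid.sum_mem _ fun μ _ => ?_
  obtain ⟨F, hF, h⟩ := hψ μ
  have hre : ∀ j I, ContDiff ℝ ∞ fun y => (F.term j I y).re :=
    fun j I => Complex.reCLM.contDiff.comp (hF j I)
  have hm : ∀ j I z, prG (deg μ + (I.card : ZMod 2)) (F.coeff j)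
      * (tay (fun y => (F.term j I y).re) z * oddMonomial z I) ∈ part V (deg μ) := by
    intro j I z
    have := mul_mem_part V (prG_mem (deg μ + (I.card : ZMod 2)) (F.coeff j))
      (mul_mem_part V (tay_mem (hre j I) z) (oddMonomial_mem z I))
    rwa [zero_add, zmodTwo_add_right] at this
  have key : (fun z => sg μ ⟨(ψ z).1 μ, (ψ z).2 μ⟩) = ∑ j, ∑ I, fun z => sg μ ⟨_, hm j I z⟩ := by
    funext z
    simp only [Finset.sum_apply, ← map_sum]
    refine congrArg _ (Subtype.ext ?_)
    have h1 : (ψ z).1 μ = prG (deg μ) (reC (F.eval z)) := by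
      rw [← h, reC_ofG, prG_of_mem ((ψ z).2 μ), if_pos rfl]
    rw [AddSubmonoidClass.coe_finsetSum]
    simp only [AddSubmonoidClass.coe_finsetSum]
    rw [h1, GSuperFun.eval, map_sum, map_sum]
    refine Finset.sum_congr rfl fun j _ => ?_
    rw [eval_eq, Finset.mul_sum, map_sum, map_sum]
    refine Finset.sum_congr rfl fun I _ => ?_
    have h2 : tay (fun y => (F.term j I y).re) z * oddMonomial z I ∈ part V (I.card : ZMod 2) := by
      have := mul_mem_part V (tay_mem (hre j I) z) (oddMonomial_mem z I)
      rwa [zero_add] at this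
    change prG _ (reC (ofG (F.coeff j) * _)) = _
    rw [reC_ofG_mul, reC_mul_ofG, reC_taylorExt (hF j I), prG_mul _ h2]
  rw [key]
  exact AddSubmonoid.sum_mem _ fun j _ => AddSubmonoid.sum_mem _ fun I _ =>
    term_mem_smoothMaps μ I (hre j I) (prG_mem _ _) (hm j I)

end SmoothMaps

/-! ### Pull-backs of compactly supported superfunctions -/

section CompactSupport

variable {V : Type*} [AddCommGroup V] [Module ℝ V] {p n : ℕ}

/-- The body map `𝒜_ℂ → ℂ`. -/
def bodyC : GrassC V →ₐ[ℂ] ℂ :=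
  Algebra.TensorProduct.lift (AlgHom.id ℂ ℂ) ((Algebra.ofId ℝ ℂ).comp (body V))
    fun _ _ => Commute.all _ _

theorem bodyC_ofG (a : Grass V) : bodyC (ofG a) = (body V a : ℂ) := by
  rw [bodyC, ofG_apply, Algebra.TensorProduct.lift_tmul, map_one, one_mul]; rfl

theorem bodyC_taylorExt {f : Body p → ℂ} (hf : ContDiff ℝ ∞ f) (z : Superspace V p n) :
    bodyC (taylorExt f z) = f (bodyPt z) := by
  induction z using Superspace.induction with
  | h0 y => rw [taylorExt_rl _ hf, map_smul, map_one, bodyPt_rl, smul_eq_mul, mul_one]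
  | h1 z μ ε hε ih =>
    rw [bodyPt_add_sg _ hε]
    rcases μ with j | j
    · rw [taylorExt_shift hf z j ε hε, map_add, map_mul, bodyC_ofG, body_sqz hε, ih,
        Complex.ofReal_zero, zero_mul, add_zero]
    · rw [taylorExt_shift_inr, ih]

theorem bodyC_eval {f : SuperFun p n} (hf : f.Smooth) (z : Superspace V p n) :
    bodyC (f.eval z) = f ∅ (bodyPt z) := by
  rw [eval_eq, map_sum, Finset.sum_eq_single ∅]
  · rw [show oddMonomial z ∅ = 1 from mono_empty _, map_one, mul_one, bodyC_taylorExt (hf ∅)]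
  · intro I _ hI
    rw [map_mul, bodyC_ofG, body_sqz (sqz_oddMonomial z (Finset.nonempty_of_ne_empty hI)),
      Complex.ofReal_zero, mul_zero]
  · simp

theorem taylorExt_congr {f g : Body p → ℂ} {z : Superspace V p n}
    (h : f =ᶠ[nhds (bodyPt z)] g) : taylorExt f z = taylorExt g z := by
  rw [taylorExt, taylorExt]
  refine finsum_congr fun k => Finset.sum_congr rfl fun i _ => ?_
  rw [(Filter.EventuallyEq.iteratedFDeriv ℝ h k).eq_of_nhds]

/-- The body of the image of a point under a map with smooth components is a continuous function
of the body of the point. -/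
theorem exists_body_map {φ : Superspace V p n → Superspace V p n}
    (hφ : ∀ μ, ∃ F : GSuperFun V p n, (∀ j, (F.term j).Smooth) ∧
      ∀ z, ofG ((φ z).1 μ) = F.eval z) :
    ∃ φ₀ : Body p → Body p, Continuous φ₀ ∧ ∀ z, bodyPt (φ z) = φ₀ (bodyPt z) := by
  choose F hF h using hφ
  have key : ∀ z i, ((bodyPt (φ z) i : ℝ) : ℂ) = ∑ j, (body V ((F (Sum.inl i)).coeff j) : ℂ)
      * (F (Sum.inl i)).term j ∅ (bodyPt z) := by
    intro z i
    rw [bodyPt_apply, ← bodyC_ofG, h, GSuperFun.eval, map_sum]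
    refine Finset.sum_congr rfl fun j _ => ?_
    rw [map_mul, bodyC_eval (hF _ j)]
    congr 1
    exact bodyC_ofG _
  refine ⟨fun y => WithLp.toLp 2 fun i => (∑ j, (body V ((F (Sum.inl i)).coeff j) : ℂ)
      * (F (Sum.inl i)).term j ∅ y).re, ?_, fun z => ?_⟩
  · refine (PiLp.continuous_toLp 2 _).comp (continuous_pi fun i => Complex.continuous_re.comp ?_)
    exact continuous_finsetSum _ fun j _ => continuous_const.mul (hF _ j ∅).continuous
  · ext i
    change _ = (∑ j, (body V ((F (Sum.inl i)).coeff j) : ℂ)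
      * (F (Sum.inl i)).term j ∅ (bodyPt z)).re
    rw [← key, Complex.ofReal_re]

/-- The elements of `𝒜_ℂ ⊗ PGS` with compactly supported coefficients. -/
def Tc (V : Type*) [AddCommGroup V] [Module ℝ V] (p n : ℕ) : Submodule (GrassC V) (TT V p n) :=
  Submodule.span (GrassC V)
    {x | ∃ f : PGS p n, (∀ I, HasCompactSupport (f.1 I)) ∧ x = (1 : GrassC V) ⊗ₜ[ℂ] f}

/-- Products with smooth superfunctions preserve compact supports. -/
theorem exists_mem_Tc_mul {u : Superspace V p n → GrassC V} (hu : u ∈ SA V p n)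
    {x : TT V p n} (hx : x ∈ Tc V p n) :
    ∃ x' ∈ Tc V p n, ∀ z, evalT z x' = u z * evalT z x := by
  -- for the generators of `SA` it suffices to treat the generators of `Tc`, up to signs
  have key : ∀ (i : ZMod 2) (u : Superspace V p n → GrassC V),
      (∀ z a, u z * a = parPow i a * u z) →
      (∀ f : PGS p n, (∀ I, HasCompactSupport (f.1 I)) → ∃ g : PGS p n,
        (∀ I, HasCompactSupport (g.1 I)) ∧ ∀ z, g.1.eval z = u z * f.1.eval z) →
      ∀ x ∈ Tc V p n, ∃ x' ∈ Tc V p n, ∀ z, evalT z x' = u z * evalT z x := by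
    intro i u hu hg x hx
    induction hx using Submodule.span_induction with
    | mem x hx =>
      obtain ⟨f, hf, rfl⟩ := hx
      obtain ⟨g, hg, h⟩ := hg f hf
      exact ⟨_, Submodule.subset_span ⟨g, hg, rfl⟩, fun z => by
        rw [evalT_tmul, evalT_tmul, one_mul, one_mul, h]⟩
    | zero => exact ⟨0, Submodule.zero_mem _, fun z => by rw [map_zero, mul_zero]⟩
    | add x y _ _ hx hy =>
      obtain ⟨x', hx', h⟩ := hx
      obtain ⟨y', hy', h'⟩ := hy
      exact ⟨_, Submodule.add_mem _ hx' hy', fun z => by rw [map_add, map_add, h, h', mul_add]⟩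
    | smul a x _ hx =>
      obtain ⟨x', hx', h⟩ := hx
      exact ⟨_, Submodule.smul_mem _ (parPow i a) hx', fun z => by
        rw [evalT_smul, evalT_smul, h, ← mul_assoc, ← mul_assoc, hu]⟩
  rw [SA] at hu
  induction hu using Algebra.adjoin_induction generalizing x with
  | mem u hu =>
    rcases hu with (⟨a, rfl⟩ | ⟨h, hh, rfl⟩) | ⟨i, rfl⟩
    · exact ⟨a • x, Submodule.smul_mem _ _ hx, fun z => evalT_smul z a x⟩
    · refine key 0 _ (fun z a => by rw [parPow_zero, ← mul_taylorExt hh]; rfl) (fun f hf => ?_) x hx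
      have hc : ∀ I, HasCompactSupport (bodyMul h f.1 I) := fun I => (hf I).mul_left
      have hs : ∀ I, ContDiff ℝ ∞ (bodyMul h f.1 I) := fun I => hh.mul (f.2 I).smooth
      refine ⟨⟨bodyMul h f.1, fun I => polyB_of_hasCompactSupport (hs I) (hc I)⟩, hc, fun z => ?_⟩
      rw [eval_eq, eval_eq, Finset.mul_sum]
      refine Finset.sum_congr rfl fun I _ => ?_
      rw [← mul_assoc, ← taylorExt_mul hh (f.2 I).smooth]; rfl
    · refine key 1 _ (fun z a => ofG_mul_eq (z.2 (Sum.inr i)) a) (fun f hf => ?_) x hx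
      refine ⟨zP (Sum.inr i) f, fun I => ?_,
        fun z => (coord_mul_eval (smooth_of_mem f.2) z (Sum.inr i)).symm⟩
      change HasCompactSupport (xiMul i f.1 I)
      rw [xiMul_apply]
      split_ifs
      · exact (hf _).comp_left (g := fun c => (-1 : ℂ) ^ lowCard i I • c) (smul_zero _)
      · exact HasCompactSupport.zero
  | algebraMap r =>
    exact ⟨algebraMap ℂ (GrassC V) r • x, Submodule.smul_mem _ _ hx, fun z => evalT_smul z _ x⟩
  | add u v _ _ hu hv =>
    obtain ⟨x', hx', h⟩ := hu hx
    obtain ⟨y', hy', h'⟩ := hv hx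
    exact ⟨_, Submodule.add_mem _ hx' hy', fun z => by
      rw [map_add, h, h', Pi.add_apply, add_mul]⟩
  | mul u v _ _ hu hv =>
    obtain ⟨y, hy, h⟩ := hv hx
    obtain ⟨y', hy', h'⟩ := hu hy
    exact ⟨y', hy', fun z => by rw [h', h, Pi.mul_apply, mul_assoc]⟩

/-- The pull-back of a compactly supported superfunction by a superdiffeomorphism is compactly
supported. -/
theorem exists_pullback_mem_Tc {φ : Equiv.Perm (Superspace V p n)} (hφ : IsSuperdiffeo φ)
    (J : Finset (Fin n)) {g : Body p → ℂ} (hg : ContDiff ℝ ∞ g) (hs : HasCompactSupport g) :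
    ∃ x ∈ Tc V p n, ∀ z, evalT z x = (monoS J g : SuperFun p n).eval (φ.symm z) := by
  obtain ⟨φ₀, hc, h₀⟩ := exists_body_map hφ.1
  obtain ⟨R, hR⟩ := (hs.isCompact.image hc).isBounded.subset_ball 0
  have hm : ∀ I, ContDiff ℝ ∞ (monoS J g I) := fun I => by
    rw [monoS]; split_ifs; exacts [hg, contDiff_const]
  let χ : ContDiffBump (0 : Body p) := ⟨max R 1, max R 1 + 1, by positivity, by simp⟩
  have hχ : ContDiff ℝ ∞ fun y => ((χ y : ℝ) : ℂ) := contDiff_ofReal χ.contDiff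
  have hχc : HasCompactSupport fun y => ((χ y : ℝ) : ℂ) :=
    χ.hasCompactSupport.comp_left (g := fun r : ℝ => (r : ℂ)) Complex.ofReal_zero
  have hmem : (1 : GrassC V) ⊗ₜ[ℂ] (⟨monoS ∅ fun y => ((χ y : ℝ) : ℂ),
      monoS_mem ∅ (polyB_of_hasCompactSupport hχ hχc)⟩ : PGS p n) ∈ Tc V p n :=
    Submodule.subset_span ⟨_, fun I => by
      change HasCompactSupport (monoS ∅ _ I)
      rw [monoS]; split_ifs; exacts [hχc, HasCompactSupport.zero], rfl⟩
  obtain ⟨x, hx, h⟩ := exists_mem_Tc_mul (eval_mem_SA (mem_smoothMaps hφ.2) hm) hmem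
  refine ⟨x, hx, fun z => ?_⟩
  have he : (monoS ∅ fun y => ((χ y : ℝ) : ℂ) : SuperFun p n).eval z
      = taylorExt (fun y => ((χ y : ℝ) : ℂ)) z := by
    rw [eval_eq, Finset.sum_eq_single ∅]
    · rw [show oddMonomial z ∅ = 1 from mono_empty _, map_one, mul_one, monoS, if_pos rfl]
    · intro I _ hI
      rw [monoS, if_neg hI, show (0 : Body p → ℂ) = fun _ => 0 from rfl, taylorExt_const, zero_smul,
        zero_mul]
    · simp
  rw [h, evalT_tmul, one_mul, he]
  by_cases hz : bodyPt z ∈ Metric.ball (0 : Body p) R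
  · have : (fun y => ((χ y : ℝ) : ℂ)) =ᶠ[nhds (bodyPt z)] fun _ => 1 := by
      filter_upwards [Metric.isOpen_ball.mem_nhds hz] with y hy
      rw [χ.one_of_mem_closedBall (Metric.ball_subset_closedBall
        (Metric.ball_subset_ball (le_max_left R 1) hy)), Complex.ofReal_one]
    rw [taylorExt_congr this, taylorExt_const, one_smul, mul_one]
  · have h1 : bodyPt (φ.symm z) ∉ tsupport g := fun h2 => hz (hR ⟨_, h2, by
      rw [← h₀, Equiv.apply_symm_apply]⟩)
    have h2 : (monoS J g : SuperFun p n).eval (φ.symm z) = 0 := by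
      refine (eval_eq _ _).trans (Finset.sum_eq_zero fun I _ => ?_)
      have h3 : monoS J g I =ᶠ[nhds (bodyPt (φ.symm z))] fun _ => 0 := by
        rw [monoS]
        split_ifs
        · exact notMem_tsupport_iff_eventuallyEq.mp h1
        · exact Filter.EventuallyEq.rfl
      rw [taylorExt_congr h3, taylorExt_const, zero_smul, zero_mul]
    rw [h2, zero_mul]

end CompactSupport

/-! ### Internal symmetries act affinely on the logarithms of plane waves -/

section Symmetries

variable {V : Type*} [AddCommGroup V] [Module ℝ V] {p n : ℕ} {θ α : ℝ}

theorem bounded_of_isSym {f : SuperFun p n} (h : ∀ I, IsSym 0 (f I)) : f.Bounded := fun I =>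
  ⟨(h I).1, fun k => by
    obtain ⟨C, hC⟩ := (h I).2 k
    exact ⟨C, fun x => by simpa using hC k le_rfl x⟩⟩

theorem mem_PGS_of_bounded {f : SuperFun p n} (h : f.Bounded) : f ∈ PGS p n := fun I =>
  polyB_iff.mpr ⟨(h I).1, 0, fun k => by simpa using (h I).2 k⟩

theorem mem_PGS_iff {f : SuperFun p n} : f ∈ PGS p n ↔ f.PolyGrowth :=
  forall_congr' fun _ => polyB_iff

/-- The elements of `𝒜_ℂ ⊗ PGS` with coefficients in `ℬ`. -/
def Tb (V : Type*) [AddCommGroup V] [Module ℝ V] (p n : ℕ) : Submodule (GrassC V) (TT V p n) :=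
  Submodule.span (GrassC V) {x | ∃ f : PGS p n, f.1.Bounded ∧ x = (1 : GrassC V) ⊗ₜ[ℂ] f}

theorem tmul_mem_Tb {f : PGS p n} (h : f.1.Bounded) : (1 : GrassC V) ⊗ₜ[ℂ] f ∈ Tb V p n :=
  Submodule.subset_span ⟨f, h, rfl⟩

theorem Tc_le_Tb : Tc V p n ≤ Tb V p n :=
  Submodule.span_mono fun _ ⟨f, hf, hx⟩ => ⟨f, fun I => ⟨(f.2 I).smooth, fun k =>
    (((f.2 I).smooth.continuous_iteratedFDeriv (m := k) (by exact_mod_cast le_top))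
      |>.bounded_above_of_compact_support ((hf I).iteratedFDeriv k))⟩, hx⟩

/-- `X` is the pull-back of `x` by `φ`. -/
def IsPull (φ : Superspace V p n → Superspace V p n) (x X : TT V p n) : Prop :=
  ∀ z, evalT z X = evalT (φ z) x

theorem IsPull.unique (hV : ¬ Module.Finite ℝ V) {φ : Superspace V p n → Superspace V p n}
    {x X X' : TT V p n} (h : IsPull φ x X) (h' : IsPull φ x X') : X = X' :=
  evalT_injective hV fun z => (h z).trans (h' z).symm

theorem IsPull.smul {φ : Superspace V p n → Superspace V p n} {x X : TT V p n}
    (h : IsPull φ x X) (a : GrassC V) : IsPull φ (a • x) (a • X) := fun z => by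
  rw [evalT_smul, evalT_smul, h]

theorem IsPull.add {φ : Superspace V p n → Superspace V p n} {x X y Y : TT V p n}
    (h : IsPull φ x X) (h' : IsPull φ y Y) : IsPull φ (x + y) (X + Y) := fun z => by
  rw [map_add, map_add, h, h']

theorem exists_isPull_tmul (hθ : θ ≠ 0) {φ : Equiv.Perm (Superspace V p n)}
    (hφ : IsInternalSymmetry θ α φ) {f g : PGS p n} (hf : f.1.Bounded) (hg : g.1.Bounded) :
    ∃ X Y : TT V p n, IsPull φ (1 ⊗ₜ f) X ∧ IsPull φ (1 ⊗ₜ g) Y ∧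
      ∀ z, starT hθ α z X Y = starT hθ α (φ z) (1 ⊗ₜ f) (1 ⊗ₜ g) := by
  obtain ⟨F, G, hF, hG, h1, h2, h3⟩ := hφ.2 f.1 g.1 hf hg
  refine ⟨toT F fun j => mem_PGS_iff.mpr (hF j), toT G fun j => mem_PGS_iff.mpr (hG j),
    fun z => ?_, fun z => ?_, fun z => ?_⟩
  · rw [evalT_toT, evalT_tmul, one_mul, h1]
  · rw [evalT_toT, evalT_tmul, one_mul, h2]
  · rw [← star_eq_starT, ← h3, ← map_one ofG, starT_hom hθ _ _ one_mem_even, parPP_zero,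
      map_one, one_mul, one_mul]
    rfl

theorem exists_isPull_left (hV : ¬ Module.Finite ℝ V) (hθ : θ ≠ 0)
    {φ : Equiv.Perm (Superspace V p n)} (hφ : IsInternalSymmetry θ α φ) {x : TT V p n}
    (hx : x ∈ Tb V p n) : ∃ X, IsPull φ x X ∧ ∀ g : PGS p n, g.1.Bounded →
      ∀ Y, IsPull φ (1 ⊗ₜ g) Y → ∀ z, starT hθ α z X Y = starT hθ α (φ z) x (1 ⊗ₜ g) := by
  induction hx using Submodule.span_induction with
  | mem x hx =>
    obtain ⟨f, hf, rfl⟩ := hx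
    obtain ⟨X, _, hX, _⟩ := exists_isPull_tmul hθ hφ hf hf
    refine ⟨X, hX, fun g hg Y hY z => ?_⟩
    obtain ⟨X', Y', hX', hY', h⟩ := exists_isPull_tmul hθ hφ hf hg
    rw [hX.unique hV hX', hY.unique hV hY', h]
  | zero => exact ⟨0, fun z => by rw [map_zero, map_zero], fun g _ Y _ z => by
      rw [map_zero, map_zero, LinearMap.zero_apply, LinearMap.zero_apply]⟩
  | add x y _ _ hx hy =>
    obtain ⟨X, hX, h⟩ := hx
    obtain ⟨X', hX', h'⟩ := hy
    exact ⟨_, hX.add hX', fun g hg Y hY z => by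
      rw [map_add, map_add, LinearMap.add_apply, LinearMap.add_apply, h g hg Y hY, h' g hg Y hY]⟩
  | smul a x _ hx =>
    obtain ⟨X, hX, h⟩ := hx
    exact ⟨_, hX.smul a, fun g hg Y hY z => by
      rw [starT_smul_left, starT_smul_left, h g hg Y hY]⟩

/-- The compatibility of a symmetry with star-products extends `𝒜_ℂ`-linearly in both arguments if
the left one is even. -/
theorem starT_isPull (hV : ¬ Module.Finite ℝ V) (hθ : θ ≠ 0)
    {φ : Equiv.Perm (Superspace V p n)} (hφ : IsInternalSymmetry θ α φ) {x y X Y : TT V p n}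
    (hx : x ∈ Tb V p n) (hxe : parT x = x) (hX : IsPull φ x X) (hy : y ∈ Tb V p n)
    (hY : IsPull φ y Y) (z : Superspace V p n) :
    starT hθ α z X Y = starT hθ α (φ z) x y := by
  have hXe : parT X = X := evalT_injective hV fun z => by
    rw [evalT_parT, hX, ← evalT_parT, hxe]
  suffices h : ∃ Y, IsPull φ y Y ∧ ∀ z, starT hθ α z X Y = starT hθ α (φ z) x y by
    obtain ⟨Y', hY', h⟩ := h
    rw [hY.unique hV hY', h]
  induction hy using Submodule.span_induction generalizing Y with
  | mem y hy =>
    obtain ⟨g, hg, rfl⟩ := hy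
    obtain ⟨X', hX', h⟩ := exists_isPull_left hV hθ hφ hx
    exact ⟨Y, hY, fun z => by rw [hX.unique hV hX', h g hg Y hY]⟩
  | zero => exact ⟨0, fun z => by rw [map_zero, map_zero], fun z => by rw [map_zero, map_zero]⟩
  | add y y' hy hy' h1 h2 =>
    obtain ⟨Z, hZ, _⟩ := exists_isPull_left hV hθ hφ hy
    obtain ⟨Z', hZ', _⟩ := exists_isPull_left hV hθ hφ hy'
    obtain ⟨W, hW, h⟩ := h1 hZ
    obtain ⟨W', hW', h'⟩ := h2 hZ'
    exact ⟨_, hW.add hW', fun z => by rw [map_add, map_add, h, h']⟩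
  | smul a y hy h1 =>
    obtain ⟨Z, hZ, _⟩ := exists_isPull_left hV hθ hφ hy
    obtain ⟨W, hW, h⟩ := h1 hZ
    exact ⟨_, hW.smul a, fun z => by
      rw [starT_smul_right_of_even hθ z a hXe, starT_smul_right_of_even hθ _ a hxe, h]⟩

/-- The covector of the plane wave that translates by `w`. -/
def cov (θ α : ℝ) (w : Superspace V p n) : Superspace V p n :=
  ⟨fun μ => (pc θ α μ)⁻¹ • w.1 (cj μ), fun μ =>
    Submodule.smul_mem _ _ (deg_cj μ ▸ w.2 (cj μ))⟩

theorem cov_apply (w : Superspace V p n) (μ : Idx p n) :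
    (cov θ α w).1 μ = (pc θ α μ)⁻¹ • w.1 (cj μ) := rfl

theorem pvec_cov (hθ : θ ≠ 0) (hα₀ : α ≠ 0) (hα₁ : α ≠ -1) (w : Superspace V p n) :
    pvec θ α (cov θ α w) = w := by
  refine Subtype.ext (funext fun ν => ?_)
  rw [pvec_apply, cov_apply, cj_cj, smul_smul, mul_inv_cancel₀ (pc_ne_zero hθ hα₀ hα₁ _), one_smul]

/-- The pull-back of a plane wave by a symmetry is a multiple of a plane wave. -/
theorem expG_dotp_symmetry (hV : ¬ Module.Finite ℝ V) (hθ : θ ≠ 0) (hα₀ : α ≠ 0) (hα₁ : α ≠ -1)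
    {φ : Equiv.Perm (Superspace V p n)} (hφ : IsInternalSymmetry θ α φ) {κ : Superspace V p n}
    {x : TT V p n} (hx : x ∈ Tb V p n) (hw : IsPlaneWave hθ α x (pvec θ α κ))
    (hev : ∀ z, evalT z x = expG (dotp κ z)) (z : Superspace V p n) :
    expG (dotp κ (φ z)) = expG (dotp κ (φ 0)) *
      expG (dotp (cov θ α (φ.symm (φ 0 + pvec θ α κ))) z) := by
  obtain ⟨X, hX, _⟩ := exists_isPull_left hV hθ hφ hx
  set κ' := cov θ α (φ.symm (φ 0 + pvec θ α κ)) with hκ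
  obtain ⟨E, hE, hEv⟩ := exists_planeWave hV hθ hα₀ hα₁ κ'
  have h0 : X - evalT 0 X • E = 0 := by
    refine eq_zero_of_starT_zero hθ hα₀ hα₁ fun J g hg hs => ?_
    obtain ⟨y, hy, h⟩ := exists_pullback_mem_Tc hφ.1 J hg hs
    have hY : IsPull φ y ((1 : GrassC V) ⊗ₜ[ℂ]
        (⟨monoS J g, monoS_mem J (polyB_of_hasCompactSupport hg hs)⟩ : PGS p n)) := fun z => by
      rw [h, Equiv.symm_apply_apply, evalT_tmul, one_mul]
    rw [map_sub, LinearMap.sub_apply, starT_smul_left, map_zero,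
      starT_isPull hV hθ hφ hx hw.even hX (Tc_le_Tb hy) hY, hw.star, hE.star, ← hX, hEv,
      dotp_zero_right, expG_zero, one_mul, zero_add, hκ, pvec_cov hθ hα₀ hα₁, h, evalT_tmul, one_mul,
      sub_self]
  rw [← hev, ← hX, ← hev, ← hX, ← hEv, ← evalT_smul, ← sub_eq_zero, ← map_sub, h0, map_zero]

theorem bodyPt_smul (r : ℝ) (z : Superspace V p n) : bodyPt (r • z) = r • bodyPt z := by
  ext i; exact map_smul (body V) r _

theorem body_dotp (κ z : Superspace V p n) :
    body V (dotp κ z) = ∑ i, body V (κ.1 (Sum.inl i)) * bodyPt z i := by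
  rw [dotp, map_sum, Fintype.sum_sum_type, Finset.sum_eq_zero (f := fun i : Fin n => _), add_zero]
  · exact Finset.sum_congr rfl fun i _ => map_mul _ _ _
  · exact fun i _ => by rw [map_mul, body_odd (κ.2 (Sum.inr i)), zero_mul]

/-- A continuous function with values in `2πℤ` that vanishes at `0` is zero. -/
theorem eq_zero_of_continuous_int {f : ℝ → ℝ} (hf : Continuous f) (h0 : f 0 = 0)
    (h : ∀ t, ∃ k : ℤ, f t = k * (2 * Real.pi)) (t : ℝ) : f t = 0 := by
  by_contra ht
  obtain ⟨k, hk⟩ := h t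
  have hpi := Real.pi_pos
  have hne : ∀ s, f s ≠ Real.pi ∧ f s ≠ -Real.pi := by
    intro s
    obtain ⟨l, hl⟩ := h s
    constructor
    · intro hs
      have : (2 * l : ℝ) = 1 := mul_right_cancel₀ hpi.ne' (by linarith)
      have : 2 * l = 1 := by exact_mod_cast this
      omega
    · intro hs
      have : (2 * l : ℝ) = -1 := mul_right_cancel₀ hpi.ne' (by linarith)
      have : 2 * l = -1 := by exact_mod_cast this
      omega
  have hk0 : k ≠ 0 := by rintro rfl; simp [hk] at ht
  rcases lt_or_gt_of_ne hk0 with hk1 | hk1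
  · have : (k : ℝ) ≤ -1 := by exact_mod_cast (by omega : k ≤ -1)
    obtain ⟨s, hs⟩ := mem_range_of_exists_le_of_exists_ge hf (c := -Real.pi) ⟨t, by nlinarith⟩
      ⟨0, by linarith⟩
    exact (hne s).2 hs
  · have : (1 : ℝ) ≤ k := by exact_mod_cast (by omega : 1 ≤ k)
    obtain ⟨s, hs⟩ := mem_range_of_exists_le_of_exists_ge hf (c := Real.pi) ⟨0, by linarith⟩
      ⟨t, by nlinarith⟩
    exact (hne s).1 hs

/-- The logarithm of `expG_dotp_symmetry`.  Multiples of `2π` are excluded by continuity along rays. -/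
theorem dotp_symmetry (hV : ¬ Module.Finite ℝ V) (hθ : θ ≠ 0) (hα₀ : α ≠ 0) (hα₁ : α ≠ -1)
    {φ : Equiv.Perm (Superspace V p n)} (hφ : IsInternalSymmetry θ α φ) {κ : Superspace V p n}
    {x : TT V p n} (hx : x ∈ Tb V p n) (hw : IsPlaneWave hθ α x (pvec θ α κ))
    (hev : ∀ z, evalT z x = expG (dotp κ z)) (z : Superspace V p n) :
    dotp κ (φ z - φ 0) = dotp (cov θ α (φ.symm (φ 0 + pvec θ α κ))) z := by
  set κ' := cov θ α (φ.symm (φ 0 + pvec θ α κ)) with hκ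
  let a : Superspace V p n → Grass V := fun z => dotp κ (φ z - φ 0) + dotp κ' (-z)
  have ha : ∀ z, a z ∈ part V 0 := fun z => Submodule.add_mem _ (dotp_mem _ _) (dotp_mem _ _)
  have hneg : ∀ κ z : Superspace V p n, expG (dotp κ z) * expG (dotp κ (-z)) = 1 := fun κ z => by
    rw [← expG_add (dotp_mem _ _) (dotp_mem _ _), ← dotp_add_right, add_neg_cancel, dotp_zero_right,
      expG_zero]
  have h1 : ∀ z, expG (a z) = 1 := by
    intro z
    rw [expG_add (dotp_mem _ _) (dotp_mem _ _), sub_eq_add_neg, dotp_add_right,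
      expG_add (dotp_mem _ _) (dotp_mem _ _),
      expG_dotp_symmetry hV hθ hα₀ hα₁ hφ hx hw hev z, ← hκ,
      comm_of_parC (parC_expG (dotp_mem κ (φ 0))), mul_assoc _ (expG (dotp κ (φ 0))), hneg, mul_one,
      hneg]
  obtain ⟨φ₀, hc, hφ₀⟩ := exists_body_map hφ.1.1
  have hb : ∀ t : ℝ, body V (a (t • z)) = ∑ i, body V (κ.1 (Sum.inl i)) *
      (φ₀ (t • bodyPt z) - φ₀ 0) i + ∑ i, body V (κ'.1 (Sum.inl i)) * (-(t • bodyPt z)) i := by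
    intro t
    have h2 : bodyPt (0 : Superspace V p n) = 0 := by simpa using bodyPt_smul 0 (0 : Superspace V p n)
    rw [map_add, body_dotp, body_dotp, sub_eq_add_neg, bodyPt_add, ← neg_one_smul ℝ (φ 0),
      ← neg_one_smul ℝ (t • z), bodyPt_smul, bodyPt_smul, bodyPt_smul, hφ₀, hφ₀, bodyPt_smul, h2,
      neg_one_smul, neg_one_smul, ← sub_eq_add_neg]
  have hcont : Continuous fun t : ℝ => body V (a (t • z)) := by
    simp only [hb]
    have : ∀ i, Continuous fun y : Body p => y i := fun i =>
      (EuclideanSpace.proj i : Body p →L[ℝ] ℝ).continuous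
    refine .add (continuous_finsetSum _ fun i _ => continuous_const.mul ((this i).comp ?_))
      (continuous_finsetSum _ fun i _ => continuous_const.mul ((this i).comp ?_))
    · exact (hc.comp (continuous_id.smul continuous_const)).sub continuous_const
    · exact (continuous_id.smul continuous_const).neg
  have h2 := eq_zero_of_continuous_int hcont (by simp [a, dotp_zero_right])
    (fun t => (eq_of_expG_eq_one (ha _) (h1 _)).2) 1
  have h3 : nil (a z) = 0 := (eq_of_expG_eq_one (ha _) (h1 _)).1
  simp only [one_smul] at h2
  rw [nil, h2, map_zero, sub_zero] at h3
  have h4 : dotp κ' z + dotp κ' (-z) = 0 := by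
    rw [← dotp_add_right, add_neg_cancel, dotp_zero_right]
  exact add_right_cancel (h3.trans h4.symm)

theorem dotp_symmetry_rl (hV : ¬ Module.Finite ℝ V) (hθ : θ ≠ 0) (hα₀ : α ≠ 0) (hα₁ : α ≠ -1)
    {φ : Equiv.Perm (Superspace V p n)} (hφ : IsInternalSymmetry θ α φ) (k : Body p)
    (z : Superspace V p n) : dotp (rl k) (φ z - φ 0)
      = dotp (cov θ α (φ.symm (φ 0 + pvec θ α (rl k)))) z :=
  dotp_symmetry hV hθ hα₀ hα₁ hφ (tmul_mem_Tb (bounded_of_isSym fun I => by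
    change IsSym 0 (if I = ∅ then chr k else 0)
    split_ifs
    exacts [isSym_chr k, IsSym.zero 0])) (isPlaneWave_chr hθ hα₀ hα₁ k) (evalT_chr k) z

theorem dotp_symmetry_sg (hV : ¬ Module.Finite ℝ V) (hθ : θ ≠ 0) (hα₀ : α ≠ 0) (hα₁ : α ≠ -1)
    {φ : Equiv.Perm (Superspace V p n)} (hφ : IsInternalSymmetry θ α φ) (l : Fin n)
    (η : part V (deg (Sum.inr l : Idx p n))) (z : Superspace V p n) :
    dotp (sg (Sum.inr l) η) (φ z - φ 0)
      = dotp (cov θ α (φ.symm (φ 0 + pvec θ α (sg (Sum.inr l) η)))) z := by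
  obtain ⟨h1, h2⟩ := (isPlaneWave_chr (n := n) hθ hα₀ hα₁ 0).step hV hθ hα₀ hα₁ (evalT_chr 0)
    (sqz_of_inr η)
  have hb : ∀ I, IsSym 0 ((bodyP n (chr (0 : Body p)) (polyB_chr 0)).1 I) := fun I => by
    change IsSym 0 (if I = ∅ then chr 0 else 0)
    split_ifs
    exacts [isSym_chr _, IsSym.zero 0]
  rw [map_zero, zero_add] at h1 h2
  refine dotp_symmetry hV hθ hα₀ hα₁ hφ (Submodule.add_mem _ (tmul_mem_Tb (bounded_of_isSym hb))
    (Submodule.smul_mem _ _ ?_)) h1 h2 z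
  rw [zT, TensorProduct.map_tmul, AlgHom.toLinearMap_apply, map_one]
  refine tmul_mem_Tb (bounded_of_isSym fun I => ?_)
  change IsSym 0 (xiMul l _ I)
  rw [xiMul_apply]
  split_ifs
  exacts [(hb _).const_mul _, IsSym.zero 0]

end Symmetries

/-! ### Internal symmetries are affine -/

section Linear

variable {V : Type*} [AddCommGroup V] [Module ℝ V] {p n : ℕ} {θ α : ℝ}

theorem eq_of_odd_mul (hV : ¬ Module.Finite ℝ V) {a b : Grass V}
    (h : ∀ η ∈ part V 1, η * a = η * b) : a = b := by
  obtain ⟨v, d, hd, hC⟩ := exists_fresh hV {ofG (a - b)}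
  have := eq_zero_of_fresh_mul hd (hC _ (Finset.mem_singleton_self _)) (by
    rw [← map_mul, mul_sub, h _ (ι_mem_odd v), sub_self, map_zero])
  exact sub_eq_zero.mp (ofG_injective (this.trans (map_zero _).symm))

theorem parityAut_parityAut (a : Grass V) : parityAut V (parityAut V a) = a :=
  CliffordAlgebra.involute_involute a

theorem mul_odd_eq {η : Grass V} (hη : η ∈ part V 1) (b : Grass V) :
    b * η = η * parityAut V b := by
  rw [odd_mul_eq hη, parityAut_parityAut]

theorem parityAut_mem {i : ZMod 2} {a : Grass V} (ha : a ∈ part V i) : parityAut V a ∈ part V i := by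
  rcases zmodTwo_cases i with rfl | rfl
  · rwa [parityAut_even ha]
  · rw [parityAut_odd ha]; exact Submodule.neg_mem _ ha

theorem eq_of_mul_odd (hV : ¬ Module.Finite ℝ V) {a b : Grass V}
    (h : ∀ η ∈ part V 1, a * η = b * η) : a = b := by
  have := eq_of_odd_mul hV (a := parityAut V a) (b := parityAut V b) fun η hη => by
    rw [← mul_odd_eq hη, ← mul_odd_eq hη, h η hη]
  rw [← parityAut_parityAut a, this, parityAut_parityAut]

/-- The unit vector of an even coordinate. -/
def unitE (V : Type*) [AddCommGroup V] [Module ℝ V] (n : ℕ) (j : EvenIdx p) : Superspace V p n :=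
  sg (Sum.inl j) ⟨1, one_mem_even⟩

theorem rl_smul_eb (r : ℝ) (j : EvenIdx p) : (rl (r • eb j) : Superspace V p n)
    = sg (Sum.inl j) ⟨algebraMap ℝ _ r, algebraMap_mem_even r⟩ := by
  refine Subtype.ext (funext fun ν => ?_)
  rw [sg_apply]
  rcases ν with i | i
  · rw [rl_inl]
    by_cases h : i = j
    · rw [if_pos (by rw [h]), h]; simp [eb]
    · rw [if_neg fun h' => h (Sum.inl_injective h')]; simp [eb, h]
  · rw [rl_inr, if_neg Sum.inr_ne_inl]

theorem rl_eb (j : EvenIdx p) : (rl (eb j) : Superspace V p n) = unitE V n j := by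
  rw [← one_smul ℝ (eb j), rl_smul_eb]
  exact congrArg (sg _) (Subtype.ext (map_one _))

theorem mulVec_sg (M : Matrix (Idx p n) (Idx p n) (Grass V)) (μ ν : Idx p n)
    (a : part V (deg μ)) : M.mulVec (sg μ a).1 ν = M ν μ * a.1 := by
  simp [Matrix.mulVec, dotProduct, sg_apply]

theorem matrix_ext (hV : ¬ Module.Finite ℝ V) {M M' : Matrix (Idx p n) (Idx p n) (Grass V)}
    (h0 : ∀ j, M.mulVec (unitE V n j).1 = M'.mulVec (unitE V n j).1)
    (h1 : ∀ l η, M.mulVec (sg (Sum.inr l) η).1 = M'.mulVec (sg (Sum.inr l) η).1) : M = M' := by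
  ext ν μ
  rcases μ with j | l
  · have := congrFun (h0 j) ν
    rwa [unitE, mulVec_sg, mulVec_sg, mul_one, mul_one] at this
  · refine eq_of_mul_odd hV fun η hη => ?_
    have := congrFun (h1 l ⟨η, hη⟩) ν
    rwa [mulVec_sg, mulVec_sg] at this

/-- A supermatrix, as a map of the superspace. -/
def smat {M : Matrix (Idx p n) (Idx p n) (Grass V)} (hM : IsSupermatrix M) :
    Superspace V p n →+ Superspace V p n where
  toFun z := ⟨M.mulVec z.1, fun μ => by
    change ∑ ν, M μ ν * z.1 ν ∈ part V (deg μ)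
    refine Submodule.sum_mem _ fun ν _ => ?_
    have h := mul_mem_part V (hM μ ν) (z.2 ν)
    rwa [zmodTwo_add_right] at h⟩
  map_zero' := Subtype.ext (Matrix.mulVec_zero M)
  map_add' z z' := Subtype.ext (Matrix.mulVec_add M z.1 z'.1)

theorem smat_coe {M : Matrix (Idx p n) (Idx p n) (Grass V)} (hM : IsSupermatrix M)
    (z : Superspace V p n) : (smat hM z).1 = M.mulVec z.1 := rfl

/-- A map with smooth components depends on an odd coordinate in an affine way. -/
theorem exists_odd_column {ψ : Superspace V p n → Superspace V p n}
    (hψ : ∀ μ, ∃ F : GSuperFun V p n, (∀ j, (F.term j).Smooth) ∧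
      ∀ z, ofG ((ψ z).1 μ) = F.eval z) (z : Superspace V p n) (l : Fin n) :
    ∃ b : Idx p n → Grass V, (∀ ν, b ν ∈ part V (deg ν + 1)) ∧
      ∀ (η : part V (deg (Sum.inr l : Idx p n))) ν,
        (ψ (z + sg (Sum.inr l) η)).1 ν = (ψ z).1 ν + b ν * η.1 := by
  choose F hF h using hψ
  refine ⟨fun ν => prG (deg ν + 1) (reC (∑ j, ofG ((F ν).coeff j)
    * parPow 1 ((dS (Sum.inr l) ((F ν).term j)).eval z))), fun ν => prG_mem _ _, fun η ν => ?_⟩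
  have h1 : ofG ((ψ (z + sg (Sum.inr l) η)).1 ν) = ofG ((ψ z).1 ν) + (∑ j, ofG ((F ν).coeff j)
      * parPow 1 ((dS (Sum.inr l) ((F ν).term j)).eval z)) * ofG η.1 := by
    rw [h, h, GSuperFun.eval, GSuperFun.eval, Finset.sum_mul, ← Finset.sum_add_distrib]
    refine Finset.sum_congr rfl fun j _ => ?_
    rw [eval_shift (hF ν j) z (sqz_of_inr η), mul_add, mul_assoc, ofG_mul_eq (i := 1) η.2]; rfl
  have h2 := congrArg (fun x => prG (deg ν) (reC x)) h1
  simp only [map_add, reC_ofG, reC_mul_ofG] at h2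
  rwa [prG_of_mem ((ψ _).2 ν), prG_of_mem ((ψ z).2 ν), if_pos rfl, if_pos rfl,
    prG_mul (j := 1) _ η.2] at h2

theorem cov_add (w w' : Superspace V p n) : cov θ α (w + w') = cov θ α w + cov θ α w' :=
  Subtype.ext (funext fun _ => smul_add _ _ _)

theorem cov_sg {μ : Idx p n} (ε : part V (deg μ)) :
    cov θ α (sg μ ε) = sg (cj μ) ⟨(pc θ α (cj μ))⁻¹ • ε.1, by
      rw [deg_cj]; exact Submodule.smul_mem _ _ ε.2⟩ := by
  refine Subtype.ext (funext fun ν => ?_)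
  rw [cov_apply, sg_apply, sg_apply]
  by_cases h : cj ν = μ
  · subst h
    rw [if_pos rfl, if_pos (cj_cj ν).symm]
    change _ = (pc θ α (cj (cj ν)))⁻¹ • ε.1
    rw [cj_cj]
  · rw [if_neg h, if_neg fun h' => h (by rw [h', cj_cj]), smul_zero]

theorem dotp_eq_mul {κ κ' : Superspace V p n} {a : Grass V} (h : ∀ ν, κ.1 ν = a * κ'.1 ν)
    (z : Superspace V p n) : dotp κ z = a * dotp κ' z := by
  rw [dotp, dotp, Finset.mul_sum]
  exact Finset.sum_congr rfl fun ν _ => by rw [h, mul_assoc]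

/-- If two supermatrices are adjoint to each other on the unit vectors of the even coordinates and
on the odd vectors, they are adjoint to each other. -/
theorem dotp_cov_smat {A B : Matrix (Idx p n) (Idx p n) (Grass V)} (hA : IsSupermatrix A)
    (hB : IsSupermatrix B)
    (h0 : ∀ j z, dotp (cov θ α (unitE V n j)) (smat hA z)
      = dotp (cov θ α (smat hB (unitE V n j))) z)
    (h1 : ∀ l η z, dotp (cov θ α (sg (Sum.inr l) η)) (smat hA z)
      = dotp (cov θ α (smat hB (sg (Sum.inr l) η))) z) (w z : Superspace V p n) :
    dotp (cov θ α w) (smat hA z) = dotp (cov θ α (smat hB w)) z := by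
  have key : ∀ μ (a : part V (deg μ)), dotp (cov θ α (sg μ a)) (smat hA z)
      = dotp (cov θ α (smat hB (sg μ a))) z := by
    rintro (j | l) a
    swap
    · exact h1 l a z
    rw [dotp_eq_mul (κ' := cov θ α (unitE V n j)) (a := a.1), h0, ← dotp_eq_mul (a := a.1)]
    · intro ν
      rw [cov_apply, cov_apply, mul_smul_comm, smat_coe, smat_coe, mulVec_sg, unitE, mulVec_sg,
        mul_one, even_mul_eq a.2]
    · intro ν
      rw [cov_apply, cov_apply, mul_smul_comm, unitE, sg_apply, sg_apply, mul_ite, mul_one, mul_zero]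
  have hw : w = ∑ μ, sg μ ⟨w.1 μ, w.2 μ⟩ := (sum_sg w).symm
  have hl : ∀ (s : Finset (Idx p n)),
      dotp (cov θ α (∑ μ ∈ s, sg μ ⟨w.1 μ, w.2 μ⟩)) (smat hA z)
        = dotp (cov θ α (smat hB (∑ μ ∈ s, sg μ ⟨w.1 μ, w.2 μ⟩))) z := by
    classical
    intro s
    induction s using Finset.induction_on with
    | empty =>
      have : cov θ α (0 : Superspace V p n) = 0 :=
        Subtype.ext (funext fun _ => smul_zero _)
      rw [Finset.sum_empty, map_zero, this, dotp, dotp]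
      exact (Finset.sum_eq_zero fun _ _ => zero_mul _).trans
        (Finset.sum_eq_zero fun _ _ => zero_mul _).symm
    | insert μ s hμ ih =>
      rw [Finset.sum_insert hμ, map_add, cov_add, cov_add, dotp_add_left, dotp_add_left, ih, key]
  rw [hw]
  exact hl _

/-- An internal symmetry is an affine map whose linear part leaves the form `dotp (cov w) z`
invariant. -/
theorem exists_affine_of_isInternalSymmetry (hV : ¬ Module.Finite ℝ V) (hθ : θ ≠ 0) (hα₀ : α ≠ 0)
    (hα₁ : α ≠ -1) {φ : Equiv.Perm (Superspace V p n)} (hφ : IsInternalSymmetry θ α φ) :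
    ∃ A : SuperGL V p n, (∀ w z : Superspace V p n,
      dotp (cov θ α (A • w)) (A • z) = dotp (cov θ α w) z) ∧ ∀ z, φ z = A • z + φ 0 := by
  have hpc := pc_ne_zero (p := p) (n := n) hθ hα₀ hα₁
  choose b hb hb' using exists_odd_column hφ.1.2 (φ 0)
  have hzero : φ.symm (φ 0) = 0 := φ.symm_apply_apply 0
  have hb0 : ∀ l η ν, (φ.symm (φ 0 + sg (Sum.inr l) η)).1 ν = b l ν * η.1 := fun l η ν => by
    rw [hb', hzero]; exact zero_add _
  -- the matrix of the inverse of the linear part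
  let B : Matrix (Idx p n) (Idx p n) (Grass V) := fun ν =>
    Sum.elim (fun j => (φ.symm (φ 0 + unitE V n j)).1 ν) fun l => b l ν
  have hB : IsSupermatrix B := by
    rintro ν (j | l)
    · exact (add_zero (deg ν)).symm ▸ (φ.symm (φ 0 + unitE V n j)).2 ν
    · exact hb l ν
  have hB0 : ∀ j, smat hB (unitE V n j) = φ.symm (φ 0 + unitE V n j) := fun j =>
    Subtype.ext (funext fun ν => by rw [smat_coe, unitE, mulVec_sg, mul_one]; rfl)
  have hB1 : ∀ l η, smat hB (sg (Sum.inr l) η) = φ.symm (φ 0 + sg (Sum.inr l) η) := fun l η =>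
    Subtype.ext (funext fun ν => by rw [smat_coe, mulVec_sg, hb0]; rfl)
  -- the matrix of the linear part
  let C : Fin n → Idx p n → Grass V := fun l ν =>
    ((pc θ α ν)⁻¹ * pc θ α (Sum.inr l : Idx p n)) • parityAut V (b l (cj ν))
  let A : Matrix (Idx p n) (Idx p n) (Grass V) := Sum.elim
    (fun j => (cov θ α (φ.symm (φ 0 + pvec θ α (rl (eb j))))).1) C
  have hA : IsSupermatrix A := by
    rintro (j | l) ν
    · exact (zero_add (deg ν)).symm ▸ (cov θ α (φ.symm (φ 0 + pvec θ α (rl (eb j))))).2 ν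
    · refine Submodule.smul_mem _ _ ?_
      have := parityAut_mem (hb l (cj ν))
      rw [deg_cj] at this
      rwa [add_comm] at this
  have hA' : ∀ z, smat hA z = φ z - φ 0 := by
    intro z
    refine Subtype.ext (funext fun μ => ?_)
    rcases μ with j | l
    · have := dotp_symmetry_rl hV hθ hα₀ hα₁ hφ (eb j) z
      have h1 : dotp (rl (eb j)) (φ z - φ 0) = (φ z - φ 0).1 (Sum.inl j) := by
        rw [rl_eb, unitE, dotp_sg_left, one_mul]
      rw [← h1, this]; rfl
    · refine eq_of_odd_mul hV fun η hη => ?_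
      have := dotp_symmetry_sg hV hθ hα₀ hα₁ hφ l ⟨η, hη⟩ z
      rw [dotp_sg_left] at this
      rw [this, dotp, smat_coe, Matrix.mulVec, dotProduct, Finset.mul_sum]
      refine Finset.sum_congr rfl fun ν _ => ?_
      rw [← mul_assoc, cov_apply, pvec_sg]
      congr 1
      have h1 := hb0 l ⟨pc θ α (Sum.inr l : Idx p n) • η, Submodule.smul_mem _ _ hη⟩ (cj ν)
      refine Eq.trans ?_ (congrArg (fun x => (pc θ α ν)⁻¹ • x) h1).symm
      change η * (_ • _) = _ • (_ * (_ • η))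
      rw [mul_smul_comm, mul_smul_comm, smul_smul, ← mul_odd_eq hη]
  have hA0 : ∀ w, smat hA (φ.symm (φ 0 + w)) = w := fun w => by
    rw [hA', Equiv.apply_symm_apply, add_sub_cancel_left]
  have hAB : A * B = 1 := by
    refine matrix_ext hV (fun j => ?_) fun l η => ?_
    · rw [← Matrix.mulVec_mulVec, Matrix.one_mulVec, ← smat_coe hB, hB0, ← smat_coe hA, hA0]
    · rw [← Matrix.mulVec_mulVec, Matrix.one_mulVec, ← smat_coe hB, hB1, ← smat_coe hA, hA0]
  have hBA' : ∀ z, smat hB (smat hA z) = z := by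
    intro z
    have h1 : smat hA (smat hB (smat hA z)) = smat hA z := Subtype.ext (by
      rw [smat_coe, smat_coe, Matrix.mulVec_mulVec, hAB, Matrix.one_mulVec])
    have h2 : φ (smat hB (smat hA z)) - φ 0 = φ z - φ 0 := by rw [← hA', ← hA', h1]
    exact φ.injective (sub_left_injective h2)
  have hBA : B * A = 1 := by
    refine matrix_ext hV (fun j => ?_) fun l η => ?_ <;>
    rw [← Matrix.mulVec_mulVec, Matrix.one_mulVec, ← smat_coe hA, ← smat_coe hB, hBA']
  have hadj := dotp_cov_smat (θ := θ) (α := α) hA hB (fun j z => by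
    have h1 : cov θ α (unitE V n j) = rl ((pc θ α (cj (Sum.inl j : Idx p n)))⁻¹ • eb j.swap) := by
      rw [unitE, cov_sg, rl_smul_eb]
      refine congrArg (sg _) (Subtype.ext ?_)
      exact (Algebra.algebraMap_eq_smul_one _).symm
    have := dotp_symmetry_rl hV hθ hα₀ hα₁ hφ ((pc θ α (cj (Sum.inl j : Idx p n)))⁻¹ • eb j.swap) z
    rw [← h1, pvec_cov hθ hα₀ hα₁] at this
    rw [hA', hB0, this]) (fun l η z => by
    have := dotp_symmetry_sg hV hθ hα₀ hα₁ hφ l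
      ⟨(pc θ α (cj (Sum.inr l : Idx p n)))⁻¹ • η.1, Submodule.smul_mem _ _ η.2⟩ z
    have h1 := cov_sg (θ := θ) (α := α) η
    have h2 : pvec θ α (cov θ α (sg (Sum.inr l) η)) = _ := pvec_cov hθ hα₀ hα₁ _
    rw [h1] at h2
    rw [hA', hB1, h1]
    exact this.trans (by rw [← h2]; rfl))
  refine ⟨⟨⟨A, B, hAB, hBA⟩, hA, hB⟩, fun w z => ?_, fun z => ?_⟩
  · change dotp (cov θ α (smat hA w)) (smat hA z) = _
    rw [hadj, hBA']
  · change φ z = smat hA z + φ 0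
    rw [hA', sub_add_cancel]

end Linear

/-! ### Functionals determined by their values on plane waves -/

section Functionals

variable {V : Type*} [AddCommGroup V] [Module ℝ V] {p n : ℕ} {θ α : ℝ}

/-- The functionals on superfunctions spanned by the `f ↦ (f_I ⋆ G)(Y) a`, with `G` of polynomial
growth and `a ∈ 𝒜_ℂ`.  In contrast to a general linear functional on functions of polynomial growth,
such a functional is determined by its values on the plane waves. -/
def starFun (V : Type*) [AddCommGroup V] [Module ℝ V] (n : ℕ) (θ : ℝ) (Y : Body p) :
    Submodule ℂ (PGS p n → GrassC V) :=
  Submodule.span ℂ {Λ | ∃ (I : Finset (Fin n)) (G : Body p → ℂ) (a : GrassC V), PolyB G ∧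
    Λ = fun f => evenStar θ (f.1 I) G Y • a}

theorem starFun_mem (I : Finset (Fin n)) {G : Body p → ℂ} (hG : PolyB G) (a : GrassC V)
    (Y : Body p) : (fun f : PGS p n => evenStar θ (f.1 I) G Y • a) ∈ starFun V n θ Y :=
  Submodule.subset_span ⟨I, G, a, hG, rfl⟩

theorem starFun_clm {Y : Body p} {Λ : PGS p n → GrassC V} (hΛ : Λ ∈ starFun V n θ Y)
    (T : GrassC V →ₗ[ℂ] GrassC V) : (fun f => T (Λ f)) ∈ starFun V n θ Y := by
  induction hΛ using Submodule.span_induction with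
  | mem Λ h =>
    obtain ⟨I, G, a, hG, rfl⟩ := h
    simp only [map_smul]
    exact starFun_mem I hG _ Y
  | zero => simp only [Pi.zero_apply, map_zero]; exact Submodule.zero_mem (starFun V n θ Y)
  | add Λ Λ' _ _ h h' => simp only [Pi.add_apply, map_add]; exact Submodule.add_mem _ h h'
  | smul c Λ _ h => simp only [Pi.smul_apply, map_smul]; exact Submodule.smul_mem _ c h

/-- The substitution of superfunctions whose coefficients are multiples of derivatives of those of
the given one. -/
theorem starFun_comp {Y : Body p} {Λ : PGS p n → GrassC V} (hΛ : Λ ∈ starFun V n θ Y)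
    (Q : PGS p n → PGS p n) (hQ : ∀ I G (a : GrassC V), PolyB G →
      (fun f => evenStar θ ((Q f).1 I) G Y • a) ∈ starFun V n θ Y) :
    (fun f => Λ (Q f)) ∈ starFun V n θ Y := by
  induction hΛ using Submodule.span_induction with
  | mem Λ h =>
    obtain ⟨I, G, a, hG, rfl⟩ := h
    exact hQ I G a hG
  | zero => exact Submodule.zero_mem (starFun V n θ Y)
  | add Λ Λ' _ _ h h' => exact Submodule.add_mem _ h h'
  | smul c Λ _ h => exact Submodule.smul_mem _ c h

theorem starFun_const_mul (hθ : θ ≠ 0) (c : ℂ) (I : Finset (Fin n)) {G : Body p → ℂ}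
    (hG : PolyB G) (a : GrassC V) (Y : Body p) :
    (fun f : PGS p n => evenStar θ (c • f.1 I) G Y • a) ∈ starFun V n θ Y := by
  have : (fun f : PGS p n => evenStar θ (c • f.1 I) G Y • a)
      = fun f => evenStar θ (f.1 I) G Y • (c • a) := by
    funext f
    rw [smul_smul, mul_comm, ← evenStar_const_mul_left hθ (f.2 I) hG]; rfl
  rw [this]
  exact starFun_mem I hG _ Y

theorem starFun_parPP (hθ : θ ≠ 0) {Y : Body p} {Λ : PGS p n → GrassC V}
    (hΛ : Λ ∈ starFun V n θ Y) (i : ZMod 2) : (fun f => Λ (parPP i f)) ∈ starFun V n θ Y := by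
  rcases zmodTwo_cases i with rfl | rfl
  · rwa [parPP_zero]
  · rw [parPP_one]
    exact starFun_comp hΛ _ fun I G a hG => starFun_const_mul hθ _ I hG a Y

theorem starFun_dP (hθ : θ ≠ 0) {Y : Body p} {Λ : PGS p n → GrassC V}
    (hΛ : Λ ∈ starFun V n θ Y) (μ : Idx p n) : (fun f => Λ (dP μ f)) ∈ starFun V n θ Y := by
  refine starFun_comp hΛ _ fun I G a hG => ?_
  rcases μ with j | i
  · have : (fun f : PGS p n => evenStar θ ((dP (Sum.inl j) f).1 I) G Y • a) = fun f =>
        evenStar θ (f.1 I) (fun x => (2 * Complex.I / θ)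
          * ((omR (eb j) Y + (-omR (eb j)) x) * G x)) Y • a := by
      funext f
      exact congrArg (· • a) (evenStar_pd_left hθ (f.2 I) hG (eb j) Y)
    rw [this]
    exact starFun_mem I (((PolyB.const _).add (PolyB.clm _)).mul hG |>.const_mul _) a Y
  · change (fun f : PGS p n => evenStar θ (dXi i f.1 I) G Y • a) ∈ _
    simp only [dXi_apply]
    split_ifs
    · convert Submodule.zero_mem (starFun V n θ Y) using 1
      funext f
      exact (congrArg (· • a) (evenStar_zero_left hθ G Y)).trans (zero_smul ℂ a)
    · exact starFun_const_mul hθ _ _ hG a Y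

theorem starFun_taylorExt (hθ : θ ≠ 0) (I : Finset (Fin n)) {G : Body p → ℂ} (hG : PolyB G)
    (w : Superspace V p n) :
    (fun f : PGS p n => taylorExt (evenStar θ (f.1 I) G) w) ∈ starFun V n θ (bodyPt w) := by
  have hs : ∀ (f : PGS p n) {G}, PolyB G → ContDiff ℝ ∞ (evenStar θ (f.1 I) G) :=
    fun f G hG => contDiff_evenStar hθ (f.2 I) hG
  induction w using Superspace.induction generalizing G with
  | h0 y =>
    have : (fun f : PGS p n => taylorExt (evenStar θ (f.1 I) G) (rl y : Superspace V p n))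
        = fun f => evenStar θ (f.1 I) G y • 1 := funext fun f => taylorExt_rl _ (hs f hG) y
    rw [this, bodyPt_rl]
    exact starFun_mem I hG 1 y
  | h1 z μ ε hε ih =>
    rw [bodyPt_add_sg _ hε]
    rcases μ with j | j
    · have : (fun f : PGS p n => taylorExt (evenStar θ (f.1 I) G) (z + sg (Sum.inl j) ε))
          = fun f => taylorExt (evenStar θ (f.1 I) G) z + (ofG ε.1
            * taylorExt (evenStar θ ((dP (Sum.inl j) f).1 I) G) z
            + ofG ε.1 * taylorExt (evenStar θ (f.1 I) (pd (eb j) G)) z) := by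
        funext f
        have h1 := taylorExt_add (hs (dP (Sum.inl j) f) hG) (hs f (hG.partialDeriv (eb j))) z
        rw [taylorExt_shift (hs f hG) z j ε hε, pd_evenStar hθ (f.2 I) hG, ← mul_add, ← h1]
        rfl
      rw [this]
      exact Submodule.add_mem _ (ih hG) (Submodule.add_mem _
        (starFun_clm (starFun_dP hθ (ih hG) (Sum.inl j)) (LinearMap.mulLeft ℂ (ofG ε.1)))
        (starFun_clm (ih (hG.partialDeriv _)) (LinearMap.mulLeft ℂ (ofG ε.1))))
    · simp only [taylorExt_shift_inr]
      exact ih hG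

theorem starFun_starP (hθ : θ ≠ 0) {Y : Body p} (Q : PGS p n → PGS p n) (g : PGS p n)
    (z : Superspace V p n) (h : ∀ I J, (fun f =>
      taylorExt (evenStar θ ((Q f).1 I) (g.1 J)) z) ∈ starFun V n θ Y) :
    (fun f => starP hθ α z (Q f) g) ∈ starFun V n θ Y := by
  let c : Finset (Fin n) → Finset (Fin n) → Finset (Fin n) → ℂ := fun I J K => kappa p n θ α *
    oddKernel (oddConst θ α) I J K
  have hs : ∀ f I J, ContDiff ℝ ∞ (evenStar θ ((Q f).1 I) (g.1 J)) :=
    fun f I J => contDiff_evenStar hθ ((Q f).2 I) (g.2 J)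
  have : (fun f => starP hθ α z (Q f) g) = ∑ K, ∑ I, ∑ J, fun f =>
      (c I J K • LinearMap.mulRight ℂ (ofG (oddMonomial z K)))
        (taylorExt (evenStar θ ((Q f).1 I) (g.1 J)) z) := by
    funext f
    simp only [Finset.sum_apply, LinearMap.smul_apply, LinearMap.mulRight_apply,
      ← smul_mul_assoc, ← Finset.sum_mul]
    rw [starP_apply, eval_eq]
    refine Finset.sum_congr rfl fun K _ => ?_
    congr 1
    have : starProduct θ α (Q f).1 g.1 K = fun y => ∑ I, ∑ J, c I J K
        * evenStar θ ((Q f).1 I) (g.1 J) y := by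
      funext y
      rw [starProduct_apply, Finset.mul_sum]
      refine Finset.sum_congr rfl fun I _ => ?_
      rw [Finset.mul_sum]
      exact Finset.sum_congr rfl fun J _ => (mul_assoc _ _ _).symm
    rw [this, taylorExt_sum _ fun I => ContDiff.sum fun J _ => contDiff_const.mul (hs f I J)]
    refine Finset.sum_congr rfl fun I _ => ?_
    rw [taylorExt_sum _ fun J => contDiff_const.mul (hs f I J)]
    exact Finset.sum_congr rfl fun J _ => taylorExt_const_mul (hs f I J) _ z
  rw [this]
  exact Submodule.sum_mem _ fun K _ => Submodule.sum_mem _ fun I _ => Submodule.sum_mem _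
    fun J _ => starFun_clm (h I J) _

/-- After contraction with a functional on `𝒜_ℂ`, `Λ` takes the form `f ↦ ∑ (f_I ⋆ G_I)(Y)`.  Its
value on a character is, up to a non-zero factor, a value of `G_I`, so all `G_I` vanish. -/
theorem starFun_eq_zero (hθ : θ ≠ 0) {Y : Body p} {Λ : PGS p n → GrassC V}
    (hΛ : Λ ∈ starFun V n θ Y)
    (h : ∀ I k, Λ ⟨monoS I (chr k), monoS_mem I (polyB_chr k)⟩ = 0) (f : PGS p n) : Λ f = 0 := by
  have key : ∀ l : GrassC V →ₗ[ℂ] ℂ, ∃ G : Finset (Fin n) → Body p → ℂ, (∀ I, PolyB (G I)) ∧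
      ∀ f, l (Λ f) = ∑ I, evenStar θ (f.1 I) (G I) Y := by
    intro l
    clear h
    induction hΛ using Submodule.span_induction with
    | mem Λ h =>
      obtain ⟨I, G, a, hG, rfl⟩ := h
      refine ⟨fun J => if J = I then fun y => l a * G y else fun _ => 0, fun J => ?_, fun f => ?_⟩
      · dsimp only; split_ifs
        exacts [hG.const_mul _, PolyB.const 0]
      · rw [Finset.sum_eq_single I]
        · dsimp only
          rw [if_pos rfl, evenStar_const_mul_right hθ (f.2 I) hG, map_smul, smul_eq_mul, mul_comm]
        · intro J _ hJ; dsimp only; rw [if_neg hJ]; exact evenStar_zero_right hθ _ _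
        · simp
    | zero =>
      exact ⟨fun _ _ => 0, fun _ => PolyB.const 0, fun f => by
        rw [Pi.zero_apply, map_zero]
        exact (Finset.sum_eq_zero fun I _ => evenStar_zero_right hθ _ _).symm⟩
    | add Λ Λ' _ _ h h' =>
      obtain ⟨G, hG, h⟩ := h
      obtain ⟨G', hG', h'⟩ := h'
      refine ⟨fun I y => G I y + G' I y, fun I => (hG I).add (hG' I), fun f => ?_⟩
      rw [Pi.add_apply, map_add, h, h', ← Finset.sum_add_distrib]
      exact Finset.sum_congr rfl fun I _ => (evenStar_add_right hθ (f.2 I) (hG I) (hG' I) Y).symm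
    | smul c Λ _ h =>
      obtain ⟨G, hG, h⟩ := h
      refine ⟨fun I y => c * G I y, fun I => (hG I).const_mul c, fun f => ?_⟩
      rw [Pi.smul_apply, map_smul, h, smul_eq_mul, Finset.mul_sum]
      exact Finset.sum_congr rfl fun I _ => (evenStar_const_mul_right hθ (f.2 I) (hG I) c Y).symm
  by_contra hne
  obtain ⟨l, hl⟩ : ∃ l : GrassC V →ₗ[ℂ] ℂ, l (Λ f) ≠ 0 := by
    by_contra hc
    push Not at hc
    exact hne ((Module.forall_dual_apply_eq_zero_iff ℂ _).mp hc)
  obtain ⟨G, hG, hl'⟩ := key l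
  have hG0 : ∀ I y, G I y = 0 := by
    intro I y
    have h1 := hl' ⟨monoS I (chr ((rotJ p).symm ((2 / θ) • (y - Y)))), monoS_mem I (polyB_chr _)⟩
    rw [h, map_zero, Finset.sum_eq_single I] at h1
    · dsimp only at h1
      rw [monoS, if_pos rfl, evenStar_chr_left hθ _ (hG I), LinearIsometryEquiv.apply_symm_apply,
        smul_smul, div_mul_div_cancel₀ two_ne_zero, div_self hθ, one_smul, add_sub_cancel] at h1
      have h2 : (Real.pi * θ : ℂ) ^ (2 * p) ≠ 0 := pow_ne_zero _
        (mul_ne_zero (by exact_mod_cast Real.pi_ne_zero) (by exact_mod_cast hθ))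
      exact ((mul_eq_zero.mp ((mul_eq_zero.mp h1.symm).resolve_left h2))).resolve_left
        (Complex.exp_ne_zero _)
    · intro J _ hJ
      dsimp only
      rw [monoS, if_neg hJ]
      exact evenStar_zero_left hθ _ _
    · simp
  refine hl ((hl' f).trans (Finset.sum_eq_zero fun I _ => ?_))
  rw [show G I = fun _ => 0 from funext (hG0 I)]
  exact evenStar_zero_right hθ _ _

end Functionals

/-! ### Pull-backs by affine maps -/

section Affine

variable {V : Type*} [AddCommGroup V] [Module ℝ V] {p n : ℕ} {θ α : ℝ}

/-- The maps `φ` by which superfunctions of polynomial growth may be pulled back, in such a way that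
the star-product of the pull-back of `f` with a fixed superfunction, at a point `z`, is determined by
the star-products of `f` at the point `Y z` of the body. -/
def IsGood (hθ : θ ≠ 0) (α : ℝ) (Y : Superspace V p n → Body p)
    (φ : Superspace V p n → Superspace V p n) : Prop :=
  ∃ P : PGS p n →ₗ[ℂ] TT V p n, (∀ z f, evalT z (P f) = f.1.eval (φ z)) ∧
    ∀ z F, (fun f => starT hθ α z (P f) F) ∈ starFun V n θ (Y z)

/-- The pull-back of the body part of a superfunction by an affine map of the body. -/
def affP (n : ℕ) (R : Body p →L[ℝ] Body p) (t : Body p) : PGS p n →ₗ[ℂ] PGS p n where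
  toFun f := bodyP n (fun y => f.1 ∅ (R y + t)) ((f.2 ∅).comp_affine R t)
  map_add' f g := Subtype.ext (funext fun I => by
    change (if I = ∅ then (_ : Body p → ℂ) else 0) = (if I = ∅ then _ else 0) + if I = ∅ then _ else 0
    split_ifs
    exacts [rfl, (add_zero _).symm])
  map_smul' c f := Subtype.ext (funext fun I => by
    change (if I = ∅ then (_ : Body p → ℂ) else 0) = c • (if I = ∅ then (_ : Body p → ℂ) else 0)
    split_ifs
    exacts [rfl, (smul_zero _).symm])

/-- The previous map, with values in `𝒜_ℂ ⊗ PGS`. -/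
def affT (V : Type*) [AddCommGroup V] [Module ℝ V] (n : ℕ) (R : Body p →L[ℝ] Body p)
    (t : Body p) : PGS p n →ₗ[ℂ] TT V p n :=
  (TensorProduct.mk ℂ (GrassC V) (PGS p n) 1).comp (affP n R t)

theorem affT_apply (R : Body p →L[ℝ] Body p) (t : Body p) (f : PGS p n) :
    affT V n R t f = (1 : GrassC V) ⊗ₜ[ℂ] affP n R t f := rfl

theorem starT_affT (hθ : θ ≠ 0) (R : Body p →L[ℝ] Body p) (t : Body p) (f g : PGS p n)
    (z : Superspace V p n) {i : ZMod 2} {b : Grass V} (hb : b ∈ part V i) :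
    starT hθ α z (affT V n R t f) (ofG b ⊗ₜ g) = ofG b * starP hθ α z (affP n R t f) g := by
  have h : parPP i (affP n R t f) = affP n R t f := parPP_bodyP ((f.2 ∅).comp_affine R t) i
  rw [affT_apply, starT_hom hθ z 1 hb, one_mul, h]

theorem contDiff_affine (R : Body p →L[ℝ] Body p) (t : Body p) : ContDiff ℝ ∞ fun y => R y + t :=
  R.contDiff.add contDiff_const

theorem bodyPt_extm {u : Body p → Body p} (hu : ContDiff ℝ ∞ u) (z : Superspace V p n) :
    bodyPt (extm u hu z) = u (bodyPt z) := by
  ext i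
  have h : ((bodyPt (extm u hu z) i : ℝ) : ℂ) = (u (bodyPt z) i : ℂ) := by
    rw [bodyPt_apply, ← bodyC_ofG]
    change bodyC (ofG (tay (fun y => u y i) z)) = _
    rw [ofG_tay (contDiff_comp_coord hu i), bodyC_taylorExt (contDiff_ofReal (contDiff_comp_coord hu i))]
  exact_mod_cast h

/-- For symplectic `R`, the even star-product commutes with the substitution. -/
theorem isGood_extm (hθ : θ ≠ 0) (R : Body p ≃L[ℝ] Body p)
    (hR : ∀ u v, omegaBody (R u) (R v) = omegaBody u v) (t : Body p) :
    IsGood (V := V) (n := n) hθ α (fun z => R (bodyPt z) + t)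
      (extm (fun y => R y + t) (contDiff_affine R.toContinuousLinearMap t)) := by
  have hu : ContDiff ℝ ∞ fun y => R y + t := contDiff_affine R.toContinuousLinearMap t
  refine ⟨affT V n R.toContinuousLinearMap t, fun z f => ?_, fun z F => ?_⟩
  · rw [eval_extm hu (smooth_of_mem f.2), affT_apply, evalT_tmul, one_mul]
    exact eval_ofBody _ z
  · induction F using TT.induction with
    | h i b g hb =>
      simp only [starT_affT hθ _ _ _ _ _ hb]
      refine starFun_clm (starFun_starP hθ _ g z fun I J => ?_) (LinearMap.mulLeft ℂ (ofG b))
      by_cases hI : I = ∅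
      · -- by symplectic covariance the star-product moves to the body point `R y + t`
        have h2 : ∀ f : PGS p n,
            taylorExt (evenStar θ ((affP n R.toContinuousLinearMap t f).1 I) (g.1 J)) z
            = taylorExt (evenStar θ (f.1 ∅) fun y => g.1 J (R.symm y + R.symm (-t)))
              (extm (fun y => R y + t) hu z) := by
          intro f
          have hG : PolyB fun y => g.1 J (R.symm y + R.symm (-t)) :=
            (g.2 J).comp_affine R.symm.toContinuousLinearMap (R.symm (-t))
          rw [taylorExt_extm hu (contDiff_evenStar hθ (f.2 ∅) hG)]
          congr 1
          funext y
          rw [← evenStar_comp hθ R (measurePreserving_of_symplectic R hR) hR t (f.2 ∅) hG]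
          have e1 : (affP n R.toContinuousLinearMap t f).1 I = fun y => f.1 ∅ (R y + t) := if_pos hI
          have e2 : (fun y => g.1 J (R.symm (R y + t) + R.symm (-t))) = g.1 J := by
            funext y
            rw [← map_add, add_neg_cancel_right, ContinuousLinearEquiv.symm_apply_apply]
          rw [e1]
          exact (congrArg (fun G => evenStar θ _ G y) e2).symm
        simp only [h2, ← bodyPt_extm hu]
        exact starFun_taylorExt hθ ∅
          ((g.2 J).comp_affine R.symm.toContinuousLinearMap (R.symm (-t))) _
      · have h2 : ∀ f : PGS p n,
            taylorExt (evenStar θ ((affP n R.toContinuousLinearMap t f).1 I) (g.1 J)) z = 0 := by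
          intro f
          have e1 : (affP n R.toContinuousLinearMap t f).1 I = fun _ => 0 := if_neg hI
          rw [e1, show evenStar θ (fun _ => 0) (g.1 J) = fun _ => 0 from
            funext fun y => evenStar_zero_left hθ _ y, taylorExt_const, zero_smul]
        simp only [h2]
        exact Submodule.zero_mem (starFun V n θ _)
    | hadd x y hx hy =>
      simp only [map_add]
      exact Submodule.add_mem _ hx hy

/-- The maps that may be added to good ones. -/
def goodIncr (V : Type*) [AddCommGroup V] [Module ℝ V] (p n : ℕ) (hθ : θ ≠ 0) (α : ℝ) :
    AddSubmonoid (Superspace V p n → Superspace V p n) where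
  carrier := {N | (∀ z, bodyPt (N z) = 0) ∧
    ∀ Y φ, IsGood hθ α Y φ → IsGood hθ α Y fun z => φ z + N z}
  zero_mem' := ⟨fun z => by simpa using bodyPt_smul 0 (0 : Superspace V p n),
    fun Y φ h => by
      rwa [show (fun z => φ z + (0 : Superspace V p n → Superspace V p n) z) = φ from
        funext fun z => add_zero _]⟩
  add_mem' {N N'} hN hN' := ⟨fun z => by rw [Pi.add_apply, bodyPt_add, hN.1, hN'.1, add_zero],
    fun Y φ h => by
      simpa only [add_assoc, Pi.add_apply] using hN'.2 Y _ (hN.2 Y φ h)⟩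

/-- A square-zero increment enters through the first-order Taylor polynomial only. -/
theorem sg_mem_goodIncr (hV : ¬ Module.Finite ℝ V) (hθ : θ ≠ 0) (μ : Idx p n)
    (s : Superspace V p n → part V (deg μ)) (hs : ∀ z, Sqz (s z).1) (M : TT V p n →ₗ[ℂ] TT V p n)
    (hM : ∀ z x, evalT z (M x) = ofG (s z).1 * evalT z x)
    (hM' : ∀ (z : Superspace V p n) Y (Q : PGS p n → TT V p n),
      (∀ i F, (fun f => starT hθ α z (parTP i (Q f)) F) ∈ starFun V n θ Y) →
      ∀ F, (fun f => starT hθ α z (M (Q f)) F) ∈ starFun V n θ Y) :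
    (fun z => sg μ (s z)) ∈ goodIncr V p n hθ α := by
  refine ⟨fun z => bodyPt_sg (body_sqz (hs z)), fun Y φ ⟨P, hP, hW⟩ => ?_⟩
  have hpar : ∀ i f, parTP i (P f) = P (parPP i f) := by
    intro i f
    rcases zmodTwo_cases i with rfl | rfl
    · rw [parTP_zero, parPP_zero]; rfl
    · refine evalT_injective hV fun z => ?_
      rw [parTP_one, parPP_one, evalT_parT, hP, hP, parC_eval (smooth_of_mem f.2)]; rfl
  refine ⟨P + M.comp (P.comp (dP μ)), fun z f => ?_, fun z F => ?_⟩
  · rw [LinearMap.add_apply, map_add, eval_shift (smooth_of_mem f.2) _ (hs z), LinearMap.comp_apply,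
      hM, hP, LinearMap.comp_apply, hP]
    rfl
  · simp only [LinearMap.add_apply, map_add, LinearMap.comp_apply]
    refine Submodule.add_mem _ (hW z F) (hM' z (Y z) (fun f => P (dP μ f)) (fun i F => ?_) F)
    simp only [hpar]
    exact starFun_dP hθ (starFun_parPP hθ (hW z F) i) μ

theorem const_mem_goodIncr (hV : ¬ Module.Finite ℝ V) (hθ : θ ≠ 0) (μ : Idx p n)
    (a : part V (deg μ)) (ha : Sqz a.1) : (fun _ => sg μ a) ∈ goodIncr V p n hθ α :=
  sg_mem_goodIncr hV hθ μ _ (fun _ => ha) (TensorProduct.map (LinearMap.mulLeft ℂ (ofG a.1)) .id)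
    (fun z x => evalT_smul z (ofG a.1) x) fun z Y Q hQ F => by
      have : (fun f => starT hθ α z (TensorProduct.map (LinearMap.mulLeft ℂ (ofG a.1)) .id (Q f)) F)
          = fun f => LinearMap.mulLeft ℂ (ofG a.1) (starT hθ α z (parTP 0 (Q f)) F) := by
        funext f
        rw [parTP_zero]
        exact starT_smul_left hθ z _ _ _
      rw [this]
      exact starFun_clm (hQ 0 F) _

theorem coord_mem_goodIncr (hV : ¬ Module.Finite ℝ V) (hθ : θ ≠ 0) (hα₀ : α ≠ 0) (hα₁ : α ≠ -1)
    (μ ν : Idx p n) (a : Grass V) (hm : ∀ z : Superspace V p n, a * z.1 ν ∈ part V (deg μ))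
    (ha : ∀ z : Superspace V p n, Sqz (a * z.1 ν)) :
    (fun z => sg μ ⟨a * z.1 ν, hm z⟩) ∈ goodIncr V p n hθ α :=
  sg_mem_goodIncr hV hθ μ _ ha
    ((TensorProduct.map (LinearMap.mulLeft ℂ (ofG a)) .id).comp (zT ν))
    (fun z x => by
      refine (evalT_smul z (ofG a) (zT ν x)).trans ?_
      rw [evalT_zT, ← mul_assoc, ← map_mul]) fun z Y Q hQ F => by
      have : (fun f => starT hθ α z
          (((TensorProduct.map (LinearMap.mulLeft ℂ (ofG a)) .id).comp (zT ν)) (Q f)) F)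
          = fun f => LinearMap.mulLeft ℂ (ofG a * ofG (z.1 ν)) (starT hθ α z (parTP 0 (Q f)) F)
            + ((-Complex.I * pc θ α ν) • LinearMap.mulLeft ℂ (ofG a))
              (starT hθ α z (parTP (deg ν) (Q f)) (dT (cj ν) F)) := by
        funext f
        rw [parTP_zero]
        refine (starT_smul_left hθ z (ofG a) (zT ν (Q f)) F).trans ?_
        rw [starT_zT hθ hα₀ hα₁, mul_add, ← mul_assoc, mul_smul_comm]; rfl
      rw [this]
      exact Submodule.add_mem _ (starFun_clm (hQ 0 F) _) (starFun_clm (hQ _ _) _)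

theorem extm_congr {u u' : Body p → Body p} (hu : ContDiff ℝ ∞ u) (hu' : ContDiff ℝ ∞ u')
    (h : ∀ y, u y = u' y) (z : Superspace V p n) : extm u hu z = extm u' hu' z := by
  obtain rfl : u = u' := funext h
  rfl

/-- The maps of the form `extm u + N`, with `u` an affine map of the body and `N` as above. -/
def affMaps (V : Type*) [AddCommGroup V] [Module ℝ V] (p n : ℕ) (hθ : θ ≠ 0) (α : ℝ) :
    AddSubmonoid (Superspace V p n → Superspace V p n) where
  carrier := {W | ∃ (R : Body p →L[ℝ] Body p) (t : Body p), ∃ N ∈ goodIncr V p n hθ α,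
    ∀ z, W z = extm (fun y => R y + t) (contDiff_affine R t) z + N z}
  zero_mem' := ⟨0, 0, 0, AddSubmonoid.zero_mem _, fun z => by
    rw [Pi.zero_apply, add_zero]
    refine Subtype.ext (funext fun μ => ?_)
    rcases μ with i | i
    · refine ((tay_const 0 z).trans (map_zero _)).symm.trans ?_
      exact congrArg (fun h => tay h z) (funext fun y => by simp)
    · rfl⟩
  add_mem' := by
    rintro W W' ⟨R, t, N, hN, h⟩ ⟨R', t', N', hN', h'⟩
    refine ⟨R + R', t + t', _, AddSubmonoid.add_mem _ hN hN', fun z => ?_⟩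
    rw [Pi.add_apply, h, h', Pi.add_apply, add_add_add_comm, ← extm_add]
    congr 1
    exact extm_congr _ _ (fun y => add_add_add_comm _ _ _ _) z

theorem goodIncr_le (hθ : θ ≠ 0) : goodIncr V p n hθ α ≤ affMaps V p n hθ α := by
  intro N hN
  obtain ⟨R, t, N', hN', h⟩ := (affMaps V p n hθ α).zero_mem
  exact ⟨R, t, _, AddSubmonoid.add_mem _ hN' hN, fun z => by
    rw [Pi.add_apply, ← add_assoc, ← h z]; exact (zero_add _).symm⟩

/-- An even coordinate multiplied by an even element, from the case of real elements and of elements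
that square to zero. -/
theorem even_mul_mem_affMaps (hθ : θ ≠ 0) (i : EvenIdx p) (m : Superspace V p n → Grass V)
    (h0 : ∀ a ∈ part V 0, ∀ z, a * m z ∈ part V (deg (Sum.inl i : Idx p n)))
    (h1 : ∀ a, (ha : a ∈ part V 0) → Sqz a →
      (fun z => sg (Sum.inl i) ⟨a * m z, h0 a ha z⟩) ∈ goodIncr V p n hθ α)
    (h2 : ∀ r : ℝ, (fun z => sg (Sum.inl i)
      ⟨algebraMap ℝ _ r * m z, h0 _ (algebraMap_mem_even r) z⟩) ∈ affMaps V p n hθ α)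
    {a : Grass V} (ha : a ∈ part V 0) :
    (fun z => sg (Sum.inl i) ⟨a * m z, h0 a ha z⟩) ∈ affMaps V p n hθ α := by
  let Q : Grass V → Prop := fun c => ∃ hc : c ∈ part V 0,
    (fun z => sg (Sum.inl i) ⟨c * m z, h0 c hc z⟩) ∈ affMaps V p n hθ α
  have hadd : ∀ a b, Q a → Q b → Q (a + b) := by
    rintro a b ⟨ha, ha'⟩ ⟨hb, hb'⟩
    refine ⟨Submodule.add_mem _ ha hb, ?_⟩
    have := AddSubmonoid.add_mem _ ha' hb'
    convert this using 1
    funext z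
    rw [Pi.add_apply, ← map_add]
    exact congrArg _ (Subtype.ext (add_mul _ _ _))
  have h3 : Q (a - algebraMap ℝ _ (body V a)) := by
    refine soul_induction (Q := Q) ⟨Submodule.zero_mem _, ?_⟩ hadd ?_ ha
    · convert (affMaps V p n hθ α).zero_mem using 1
      funext z
      exact (congrArg _ (Subtype.ext (zero_mul _))).trans (map_zero (sg _))
    · exact fun ε hε => ⟨hε.1, goodIncr_le hθ (h1 ε hε.1 hε.2)⟩
  obtain ⟨_, h4⟩ := hadd _ _ h3 ⟨algebraMap_mem_even _, h2 (body V a)⟩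
  simpa only [sub_add_cancel] using h4

/-- The body of `A μ ν` gives a linear map of the body; all else is square-zero increments. -/
theorem mulVec_mem_affMaps (hV : ¬ Module.Finite ℝ V) (hθ : θ ≠ 0) (hα₀ : α ≠ 0) (hα₁ : α ≠ -1)
    {A : Matrix (Idx p n) (Idx p n) (Grass V)} (hA : IsSupermatrix A) (μ ν : Idx p n)
    (hm : ∀ z : Superspace V p n, A μ ν * z.1 ν ∈ part V (deg μ)) :
    (fun z => sg μ ⟨A μ ν * z.1 ν, hm z⟩) ∈ affMaps V p n hθ α := by
  rcases μ with i | l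
  swap
  · exact goodIncr_le hθ (coord_mem_goodIncr hV hθ hα₀ hα₁ _ ν _ hm fun z => sqz_odd (hm z))
  rcases ν with j | l
  swap
  · exact goodIncr_le hθ (coord_mem_goodIncr hV hθ hα₀ hα₁ _ _ _ hm
      fun z => (sqz_odd (z.2 (Sum.inr l))).mul_left _)
  have h0 : ∀ a ∈ part V 0, ∀ z : Superspace V p n,
      a * z.1 (Sum.inl j) ∈ part V (deg (Sum.inl i : Idx p n)) := fun a ha z =>
    mul_mem_part V (i := 0) (j := 0) ha (z.2 (Sum.inl j))
  refine even_mul_mem_affMaps hθ i (fun z => z.1 (Sum.inl j)) h0 (fun a ha hs =>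
    coord_mem_goodIncr hV hθ hα₀ hα₁ _ _ _ (h0 a ha) fun z => hs.mul_right _) (fun r => ?_)
    (hA (Sum.inl i) (Sum.inl j))
  refine ⟨(EuclideanSpace.proj j : Body p →L[ℝ] ℝ).smulRight (r • eb i), 0, 0,
    AddSubmonoid.zero_mem _, fun z => ?_⟩
  rw [Pi.zero_apply, add_zero]
  refine Subtype.ext (funext fun μ => ?_)
  rw [sg_apply]
  have hj : ContDiff ℝ ∞ fun y : Body p => y j := (EuclideanSpace.proj j : Body p →L[ℝ] ℝ).contDiff
  have htay : tay (fun y => y j) z = z.1 (Sum.inl j) := ofG_injective (by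
    rw [ofG_tay hj, taylorExt_coord])
  rcases μ with k | k
  · change _ = tay (fun y => (y j • r • (eb i : Body p) + 0) k) z
    by_cases hk : k = i
    · subst hk
      have : (fun y : Body p => (y j • r • (eb k : Body p) + 0) k) = fun y => r * y j := by
        funext y; simp [eb, mul_comm]
      rw [if_pos rfl, this, tay_const_mul r hj, htay, Algebra.smul_def]
    · have : (fun y : Body p => (y j • r • (eb i : Body p) + 0) k) = fun y => 0 := by
        funext y; simp [eb, hk]
      rw [if_neg fun h => hk (Sum.inl_injective h), this, tay_const, map_zero]
  · rw [if_neg Sum.inr_ne_inl]; rfl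

theorem const_mem_affMaps (hV : ¬ Module.Finite ℝ V) (hθ : θ ≠ 0) (μ : Idx p n)
    (a : part V (deg μ)) : (fun _ => sg μ a) ∈ affMaps V p n hθ α := by
  rcases μ with i | l
  swap
  · exact goodIncr_le hθ (const_mem_goodIncr hV hθ _ a (sqz_of_inr a))
  have h0 : ∀ a ∈ part V 0, ∀ z : Superspace V p n,
      a * 1 ∈ part V (deg (Sum.inl i : Idx p n)) := fun a ha z => by rwa [mul_one]
  have := even_mul_mem_affMaps (α := α) hθ i (fun _ => 1) h0 (fun a ha hs =>
    const_mem_goodIncr hV hθ (Sum.inl i) ⟨a * 1, h0 a ha 0⟩ (hs.mul_right _)) (fun r => ?_) a.2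
  · simpa only [mul_one] using this
  · refine ⟨0, r • eb i, 0, AddSubmonoid.zero_mem _, fun z => ?_⟩
    rw [Pi.zero_apply, add_zero]
    have h1 := rl_smul_eb (V := V) (n := n) r i
    refine Subtype.ext (funext fun μ => ?_)
    have h2 := congrArg (fun w => w.1 μ) h1
    simp only [sg_apply] at h2 ⊢
    rw [mul_one, ← h2]
    rcases μ with k | k
    · refine (tay_const ((r • eb i : Body p) k) z).symm.trans ?_
      exact congrArg (fun h => tay h z) (funext fun y => by simp)
    · rfl

end Affine

/-! ### Affine orthosymplectic maps are internal symmetries -/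

section Covariance

variable {V : Type*} [AddCommGroup V] [Module ℝ V] {p n : ℕ} {θ α : ℝ}

theorem affine_mem_affMaps (hV : ¬ Module.Finite ℝ V) (hθ : θ ≠ 0) (hα₀ : α ≠ 0) (hα₁ : α ≠ -1)
    (A : SuperGL V p n) (τ : Superspace V p n) :
    (fun z => A • z + τ) ∈ affMaps V p n hθ α := by
  have hm : ∀ μ ν (z : Superspace V p n), A.1.val μ ν * z.1 ν ∈ part V (deg μ) := fun μ ν z => by
    have h := mul_mem_part V (A.2.1 μ ν) (z.2 ν)
    rwa [zmodTwo_add_right] at h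
  have key : (fun z => A • z + τ) = ∑ μ, ((∑ ν, fun z => sg μ ⟨_, hm μ ν z⟩)
      + fun _ => sg μ ⟨τ.1 μ, τ.2 μ⟩) := by
    funext z
    simp only [Finset.sum_apply, Pi.add_apply, Finset.sum_add_distrib, sum_sg, ← map_sum]
    congr 1
    rw [← sum_sg (A • z)]
    refine Finset.sum_congr rfl fun μ _ => congrArg _ (Subtype.ext ?_)
    rw [AddSubmonoidClass.coe_finsetSum]; rfl
  rw [key]
  exact AddSubmonoid.sum_mem _ fun μ _ => AddSubmonoid.add_mem _
    (AddSubmonoid.sum_mem _ fun ν _ => mulVec_mem_affMaps hV hθ hα₀ hα₁ A.2.1 μ ν (hm μ ν))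
    (const_mem_affMaps hV hθ μ _)

theorem body_dotp_cov (w z : Superspace V p n) :
    body V (dotp (cov θ α w) z) = -(2 / θ) * omegaBody (bodyPt w) (bodyPt z) := by
  rw [body_dotp, Fintype.sum_sum_type, omegaBody, Finset.mul_sum, ← Finset.sum_add_distrib]
  refine Finset.sum_congr rfl fun i _ => ?_
  rw [cov_apply, cov_apply, map_smul, map_smul]
  change (θ / 2)⁻¹ * bodyPt w (Sum.inr i) * _ + (-(θ / 2))⁻¹ * bodyPt w (Sum.inl i) * _ = _
  rw [inv_neg, inv_div]
  ring

/-- An affine map whose linear part leaves the form `dotp (cov w) z` invariant is good. -/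
theorem isGood_affine (hV : ¬ Module.Finite ℝ V) (hθ : θ ≠ 0) (hα₀ : α ≠ 0) (hα₁ : α ≠ -1)
    {A : SuperGL V p n} (hA : ∀ w z : Superspace V p n,
      dotp (cov θ α (A • w)) (A • z) = dotp (cov θ α w) z) (τ : Superspace V p n) :
    IsGood hθ α (fun z => bodyPt (A • z + τ)) fun z => A • z + τ := by
  obtain ⟨R, t, N, hN, h⟩ := affine_mem_affMaps hV hθ hα₀ hα₁ A τ
  have hb : ∀ z, bodyPt (A • z + τ) = R (bodyPt z) + t := fun z => by
    rw [show A • z + τ = _ from h z, bodyPt_add, hN.1, add_zero, bodyPt_extm (contDiff_affine R t)]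
  have h0 : bodyPt (0 : Superspace V p n) = 0 := by
    simpa using bodyPt_smul 0 (0 : Superspace V p n)
  have ht : bodyPt τ = t := by
    have := hb 0
    rwa [smul_zero, zero_add, h0, map_zero, zero_add] at this
  have hR : ∀ y : Body p, R y = bodyPt (A • (rl y : Superspace V p n)) := fun y => by
    have := hb (rl y)
    rw [bodyPt_add, ht, bodyPt_rl] at this
    exact (add_right_cancel this).symm
  have hω : ∀ u v, omegaBody (R u) (R v) = omegaBody u v := by
    intro u v
    have h1 := congrArg (body V) (hA (rl u) (rl v))
    rw [body_dotp_cov, body_dotp_cov, ← hR, ← hR, bodyPt_rl, bodyPt_rl] at h1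
    exact mul_left_cancel₀ (neg_ne_zero.mpr (div_ne_zero two_ne_zero hθ)) h1
  have hinj : Function.Injective (R : Body p →ₗ[ℝ] Body p) := by
    rw [← LinearMap.ker_eq_bot, LinearMap.ker_eq_bot']
    intro u hu
    have h1 : ∀ v, omegaBody u v = 0 := fun v => by
      rw [← hω, show R u = 0 from hu]; simp [omegaBody]
    ext (i | i)
    · simpa [omegaBody, eb] using h1 (eb (Sum.inr i))
    · simpa [omegaBody, eb] using h1 (eb (Sum.inl i))
  let R' : Body p ≃L[ℝ] Body p :=
    (LinearEquiv.ofInjectiveEndo (R : Body p →ₗ[ℝ] Body p) hinj).toContinuousLinearEquiv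
  have h1 := hN.2 _ _ (isGood_extm (V := V) (n := n) (α := α) hθ R' hω t)
  have h2 : (fun z => A • z + τ) = fun z =>
      extm (fun y => R' y + t) (contDiff_affine R'.toContinuousLinearMap t) z + N z :=
    funext h
  rw [h2]
  exact (funext hb : (fun z => bodyPt (A • z + τ)) = _) ▸ h1

/-- The monomial of a list of odd coordinates, as an operator. -/
def zL : List (Fin n) → TT V p n →ₗ[ℂ] TT V p n
  | [] => LinearMap.id
  | l :: L => (zT (Sum.inr l)).comp (zL L)

theorem zL_append (L : List (Fin n)) (l : Fin n) (x : TT V p n) :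
    zL (L ++ [l]) x = zL L (zT (Sum.inr l) x) := by
  induction L with
  | nil => rfl
  | cons a L ih => exact congrArg (zT (Sum.inr a)) ih

theorem zT_inr_smul (l : Fin n) (a : GrassC V) (x : TT V p n) :
    zT (Sum.inr l) (a • x) = parC a • zT (Sum.inr l) x := by
  induction x using TT.induction with
  | h i b f hb =>
    rw [TensorProduct.smul_tmul', smul_eq_mul, zT, TensorProduct.map_tmul, TensorProduct.map_tmul,
      TensorProduct.smul_tmul', AlgHom.toLinearMap_apply, map_mul]
    change (parPow 1 a * _) ⊗ₜ[ℂ] _ = _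
    rw [parPow_one]; rfl
  | hadd x y hx hy => rw [smul_add, map_add, map_add, hx, hy, smul_add]

theorem neg_smul_TT (a : GrassC V) (x : TT V p n) : (-a) • x = -(a • x) := by
  refine eq_neg_of_add_eq_zero_left ?_
  have h := add_smul (-a) a x
  rw [← h, neg_add_cancel]
  exact zero_smul (GrassC V) x

theorem zL_smul_odd (L : List (Fin n)) {a : GrassC V} (ha : parC a = -a) (x : TT V p n) :
    zL L (a • x) = a • zL L x ∨ zL L (a • x) = -(a • zL L x) := by
  induction L with
  | nil => exact Or.inl rfl
  | cons l L ih =>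
    rw [zL, LinearMap.comp_apply, LinearMap.comp_apply]
    rcases ih with h | h
    · right; rw [h, zT_inr_smul, ha, neg_smul_TT]
    · left; rw [h, map_neg, zT_inr_smul, ha, neg_smul_TT, neg_neg]

theorem exists_zL_eq_monoS {g : Body p → ℂ} (hg : PolyB g) (I : Finset (Fin n)) :
    ∃ L : List (Fin n), zL L ((1 : GrassC V) ⊗ₜ[ℂ] bodyP n g hg)
      = (1 : GrassC V) ⊗ₜ[ℂ] (⟨monoS I g, monoS_mem I hg⟩ : PGS p n) := by
  induction I using Finset.induction_on_min with
  | empty => exact ⟨[], rfl⟩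
  | insert a s ha ih =>
    obtain ⟨L, hL⟩ := ih
    refine ⟨a :: L, ?_⟩
    have has : a ∉ s := fun h => lt_irrefl _ (ha a h)
    rw [zL, LinearMap.comp_apply, hL, zT, TensorProduct.map_tmul, AlgHom.toLinearMap_apply, map_one]
    congr 1
    refine Subtype.ext (funext fun K => ?_)
    change xiMul a (monoS s g) K = monoS (insert a s) g K
    rw [xiMul_apply, monoS, monoS]
    by_cases hK : K = insert a s
    · subst hK
      have h0 : lowCard a (insert a s) = 0 := by
        rw [lowCard, Finset.card_eq_zero, Finset.filter_eq_empty_iff]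
        intro b hb
        rcases Finset.mem_insert.mp hb with rfl | hb
        · exact lt_irrefl _
        · exact (ha b hb).not_gt
      rw [if_pos (Finset.mem_insert_self _ _), if_pos rfl, Finset.erase_insert has, if_pos rfl, h0,
        pow_zero, one_smul]
    · rw [if_neg hK]
      split_ifs with h1 h2
      · exact absurd (by rw [← h2, Finset.insert_erase h1]) hK
      · exact smul_zero _
      · rfl

/-- An `𝒜_ℂ`-linear map that vanishes on the plane waves vanishes on the functions
`exp(i k · x) ξ^I`: the monomials in the odd coordinates are extracted one by one, with a new odd
parameter each time. -/
theorem eq_zero_of_planeWave (hV : ¬ Module.Finite ℝ V) (hθ : θ ≠ 0) (hα₀ : α ≠ 0) (hα₁ : α ≠ -1)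
    {D : TT V p n →ₗ[ℂ] GrassC V} (hs : ∀ a x, D (a • x) = a * D x)
    (hD : ∀ E κ, IsPlaneWave hθ α E (pvec θ α κ) → (∀ z, evalT z E = expG (dotp κ z)) → D E = 0)
    (I : Finset (Fin n)) (k : Body p) :
    D ((1 : GrassC V) ⊗ₜ[ℂ] (⟨monoS I (chr k), monoS_mem I (polyB_chr k)⟩ : PGS p n)) = 0 := by
  have key : ∀ (L : List (Fin n)) E κ, IsPlaneWave hθ α E (pvec θ α κ) →
      (∀ z, evalT z E = expG (dotp κ z)) → D (zL L E) = 0 := by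
    intro L
    induction L using List.reverseRecOn with
    | nil => exact hD
    | append_singleton L l ih =>
      intro E κ h1 h2
      rw [zL_append]
      obtain ⟨v, d, hd, hC⟩ := exists_fresh hV {D (zL L (zT (Sum.inr l) E))}
      refine eq_zero_of_fresh_mul hd (hC _ (Finset.mem_singleton_self _)) ?_
      obtain ⟨h3, h4⟩ := h1.step hV hθ hα₀ hα₁ h2
        (sqz_of_inr (⟨_, ι_mem_odd v⟩ : part V (deg (Sum.inr l : Idx p n))))
      have h5 := ih _ _ h3 h4
      rw [map_add, map_add, ih E κ h1 h2, zero_add] at h5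
      have hodd : parC (Complex.I • ofG (ExteriorAlgebra.ι ℝ v))
          = -(Complex.I • ofG (ExteriorAlgebra.ι ℝ v)) := by
        rw [map_smul, parC_ofG, parityAut_odd (ι_mem_odd v), map_neg, smul_neg]
      have h6 : (Complex.I • ofG (ExteriorAlgebra.ι ℝ v)) * D (zL L (zT (Sum.inr l) E)) = 0 := by
        rcases zL_smul_odd L hodd (zT (Sum.inr l) E) with h | h <;> rw [h] at h5
        · rwa [hs] at h5
        · rwa [map_neg, neg_eq_zero, hs] at h5
      rw [smul_mul_assoc] at h6
      exact (smul_eq_zero.mp h6).resolve_left Complex.I_ne_zero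
  obtain ⟨L, hL⟩ := exists_zL_eq_monoS (V := V) (polyB_chr k) I
  rw [← hL]
  exact key L _ _ (isPlaneWave_chr hθ hα₀ hα₁ k) (evalT_chr k)

theorem cov_pvec (hθ : θ ≠ 0) (hα₀ : α ≠ 0) (hα₁ : α ≠ -1) (κ : Superspace V p n) :
    cov θ α (pvec θ α κ) = κ := by
  refine Subtype.ext (funext fun ν => ?_)
  rw [cov_apply, pvec_apply, cj_cj, smul_smul, inv_mul_cancel₀ (pc_ne_zero hθ hα₀ hα₁ _), one_smul]

/-- The covariance of the star-product under affine orthosymplectic maps.  Both sides agree if `f` is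
replaced with a plane wave, and for fixed `g` and `z` both are functionals of `f` determined by their
values on plane waves. -/
theorem exists_pullback_star (hV : ¬ Module.Finite ℝ V) (hθ : θ ≠ 0) (hα₀ : α ≠ 0) (hα₁ : α ≠ -1)
    {A : SuperGL V p n} (hA : ∀ w z : Superspace V p n,
      dotp (cov θ α (A • w)) (A • z) = dotp (cov θ α w) z) (τ : Superspace V p n) :
    ∃ P : PGS p n → TT V p n, (∀ z f, evalT z (P f) = f.1.eval (A • z + τ)) ∧
      ∀ z f g, starP hθ α (A • z + τ) f g = starT hθ α z (P f) (P g) := by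
  obtain ⟨P, hP, hW⟩ := isGood_affine hV hθ hα₀ hα₁ hA τ
  have hP' : ∀ z f, evalT z (P f) = f.1.eval (A • z + τ) := hP
  clear hP
  refine ⟨P, hP', fun z f g => ?_⟩
  let PT : TT V p n →ₗ[ℂ] TT V p n :=
    TensorProduct.lift ((Algebra.lsmul ℂ ℂ (TT V p n)).toLinearMap.compl₂ P)
  have hPT : ∀ a f, PT (a ⊗ₜ f) = a • P f := fun a f => rfl
  have hPTs : ∀ (a : GrassC V) x, PT (a • x) = a • PT x := by
    intro a x
    induction x using TT.induction with
    | h i b f hb => exact mul_smul a (ofG b) (P f)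
    | hadd x y hx hy => rw [smul_add, map_add, hx, hy, map_add, smul_add]
  have hPTe : ∀ z x, evalT z (PT x) = evalT (A • z + τ) x := by
    intro z x
    induction x using TT.induction with
    | h i b f hb => rw [hPT, evalT_smul, hP', evalT_tmul]
    | hadd x y hx hy => rw [map_add, map_add, map_add, hx, hy]
  let D : TT V p n →ₗ[ℂ] GrassC V := (starT hθ α (A • z + τ)).flip (1 ⊗ₜ g)
    - ((starT hθ α z).flip (P g)).comp PT
  have hDx : ∀ x, D x = starT hθ α (A • z + τ) x (1 ⊗ₜ g) - starT hθ α z (PT x) (P g) :=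
    fun x => rfl
  have hDf : ∀ f, D (1 ⊗ₜ f) = starP hθ α (A • z + τ) f g - starT hθ α z (P f) (P g) := by
    intro f
    rw [hDx, hPT, one_smul, ← map_one ofG, starT_hom hθ _ _ one_mem_even, parPP_zero, map_one,
      one_mul, one_mul]
    rfl
  have hfun : (fun f => D (1 ⊗ₜ f)) ∈ starFun V n θ (bodyPt (A • z + τ)) := by
    simp only [hDf]
    exact Submodule.sub_mem _ (starFun_starP hθ (fun f => f) g _ fun I J =>
      starFun_taylorExt hθ I (g.2 J) _) (hW z (P g))
  have h0 := starFun_eq_zero hθ hfun (fun I k => eq_zero_of_planeWave hV hθ hα₀ hα₁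
    (fun a x => by rw [hDx, hDx, hPTs, starT_smul_left, starT_smul_left, mul_sub])
    (fun E κ hE hev => by
      obtain ⟨E', hE', hev'⟩ := exists_planeWave hV hθ hα₀ hα₁ (cov θ α (A⁻¹ • pvec θ α κ))
      have hκ : ∀ z, dotp κ (A • z) = dotp (cov θ α (A⁻¹ • pvec θ α κ)) z := fun z => by
        rw [← hA, smul_inv_smul, cov_pvec hθ hα₀ hα₁]
      have hPE : PT E = expG (dotp κ τ) • E' := evalT_injective hV fun z => by
        rw [hPTe, hev, evalT_smul, hev', dotp_add_right, hκ, expG_add (dotp_mem _ _) (dotp_mem _ _)]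
        exact comm_of_parC (parC_expG (dotp_mem _ _)) _
      have h1 : evalT (A • z + τ) E = expG (dotp κ τ) * evalT z E' := by
        rw [← hPTe, hPE, evalT_smul]
      rw [hDx, hE.star, hPE, starT_smul_left, hE'.star, h1, pvec_cov hθ hα₀ hα₁, hP', smul_add,
        smul_inv_smul, evalT_tmul, one_mul, add_right_comm, mul_assoc, sub_self]) I k) f
  exact sub_eq_zero.mp ((hDf f).symm.trans h0)

/-- The components of an affine map are superfunctions with coefficients in `𝒜`. -/
theorem exists_eval_affine (A : SuperGL V p n) (τ : Superspace V p n) (μ : Idx p n) :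
    ∃ F : GSuperFun V p n, (∀ j, (F.term j).Smooth) ∧
      ∀ z, ofG ((A • z + τ).1 μ) = F.eval z := by
  let e : TT V p n := 1 ⊗ₜ bodyP n (fun _ => 1) (PolyB.const 1)
  have he : ∀ z, evalT z e = 1 := fun z => by
    rw [evalT_tmul, one_mul, bodyP, eval_ofBody, taylorExt_const, one_smul]
  obtain ⟨F, hF, h⟩ := exists_toT (∑ ν, ofG (A.1.val μ ν) • zT ν e + ofG (τ.1 μ) • e)
  refine ⟨F, fun j => smooth_of_mem (hF j), fun z => ?_⟩
  rw [← evalT_toT F hF, h, map_add, evalT_smul, he, mul_one, map_sum]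
  simp only [evalT_smul, evalT_zT, he, mul_one, ← map_mul, ← map_sum, ← map_add]
  rfl

theorem isInternalSymmetry_affine (hV : ¬ Module.Finite ℝ V) (hθ : θ ≠ 0) (hα₀ : α ≠ 0)
    (hα₁ : α ≠ -1) {A : SuperGL V p n} (hA : ∀ w z : Superspace V p n,
      dotp (cov θ α (A • w)) (A • z) = dotp (cov θ α w) z) (τ : Superspace V p n)
    {φ : Equiv.Perm (Superspace V p n)} (hφ : ∀ z, φ z = A • z + τ) :
    IsInternalSymmetry θ α φ := by
  have hsymm : ∀ z, φ.symm z = A⁻¹ • z + -(A⁻¹ • τ) := fun z => by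
    rw [Equiv.symm_apply_eq, hφ, smul_add, smul_inv_smul, smul_neg, smul_inv_smul,
      neg_add_cancel_right]
  refine ⟨⟨fun μ => ?_, fun μ => ?_⟩, fun f₁ f₂ h₁ h₂ => ?_⟩
  · simp only [hφ]; exact exists_eval_affine A τ μ
  · simp only [hsymm]; exact exists_eval_affine A⁻¹ _ μ
  · obtain ⟨P, hP, hs⟩ := exists_pullback_star hV hθ hα₀ hα₁ hA τ
    obtain ⟨F₁, hF₁, e₁⟩ := exists_toT (P ⟨f₁, mem_PGS_of_bounded h₁⟩)
    obtain ⟨F₂, hF₂, e₂⟩ := exists_toT (P ⟨f₂, mem_PGS_of_bounded h₂⟩)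
    refine ⟨F₁, F₂, fun j => mem_PGS_iff.mp (hF₁ j), fun j => mem_PGS_iff.mp (hF₂ j),
      fun z => ?_, fun z => ?_, fun z => ?_⟩
    · rw [hφ, ← evalT_toT F₁ hF₁, e₁, hP]
    · rw [hφ, ← evalT_toT F₂ hF₂, e₂, hP]
    · rw [hφ, star_eq_starT hθ F₁ F₂ hF₁ hF₂, e₁, e₂, ← hs]; rfl

end Covariance

/-! ### The group of internal symmetries -/

section Isomorphism

variable {V : Type*} [AddCommGroup V] [Module ℝ V] {p n : ℕ} {θ α : ℝ}

theorem isSupermatrix_diagonal (d : Idx p n → ℝ) :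
    IsSupermatrix (Matrix.diagonal fun μ => algebraMap ℝ (Grass V) (d μ)) := by
  intro μ ν
  by_cases h : μ = ν
  · subst h
    rw [Matrix.diagonal_apply_eq, zmodTwo_add_self]
    exact algebraMap_mem_even _
  · rw [Matrix.diagonal_apply_ne _ h]
    exact Submodule.zero_mem _

/-- The diagonal supermatrix with the given non-zero real entries. -/
def diagGL (V : Type*) [AddCommGroup V] [Module ℝ V] (d : Idx p n → ℝ) (hd : ∀ μ, d μ ≠ 0) :
    SuperGL V p n :=
  ⟨⟨Matrix.diagonal fun μ => algebraMap ℝ (Grass V) (d μ),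
    Matrix.diagonal fun μ => algebraMap ℝ (Grass V) (d μ)⁻¹,
    by simp only [Matrix.diagonal_mul_diagonal, ← map_mul, mul_inv_cancel₀ (hd _), map_one,
        Matrix.diagonal_one],
    by simp only [Matrix.diagonal_mul_diagonal, ← map_mul, inv_mul_cancel₀ (hd _), map_one,
        Matrix.diagonal_one]⟩,
    isSupermatrix_diagonal d, isSupermatrix_diagonal fun μ => (d μ)⁻¹⟩

theorem diagGL_smul_apply (d : Idx p n → ℝ) (hd : ∀ μ, d μ ≠ 0) (z : Superspace V p n)
    (μ : Idx p n) : (diagGL V d hd • z).1 μ = d μ • z.1 μ := by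
  rw [Algebra.smul_def]
  exact Matrix.mulVec_diagonal (fun μ => algebraMap ℝ (Grass V) (d μ)) z.1 μ

/-- The scaling of the coordinates that turns the form of the star-product into a multiple of the
standard symplectic form: the factor `2√|α|/(1+α)` produces the `2` in the odd block of that form,
and the sign `|α|/α` of `α` makes the even and the odd block multiples by the same constant. -/
def scaling (p n : ℕ) (α : ℝ) : Idx p n → ℝ :=
  Sum.elim (Sum.elim (fun _ => 1) fun _ => |α| / α) fun _ => 2 * √|α| / (1 + α)

theorem scaling_ne_zero (hα₀ : α ≠ 0) (hα₁ : α ≠ -1) (μ : Idx p n) : scaling p n α μ ≠ 0 := by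
  have h1 : 1 + α ≠ 0 := fun h => hα₁ (by linarith)
  rcases μ with (i | i) | i
  · exact one_ne_zero
  · exact div_ne_zero (abs_ne_zero.mpr hα₀) hα₀
  · exact div_ne_zero (mul_ne_zero two_ne_zero
      (Real.sqrt_ne_zero'.mpr (abs_pos.mpr hα₀))) h1

theorem symplForm_eq (z z' : Superspace V p n) : symplForm z z'
    = ∑ i, (z.1 (Sum.inl (Sum.inl i)) * z'.1 (Sum.inl (Sum.inr i))
        - z.1 (Sum.inl (Sum.inr i)) * z'.1 (Sum.inl (Sum.inl i)))
      + ∑ l, (2 : ℝ) • (z.1 (Sum.inr l) * z'.1 (Sum.inr l)) := by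
  simp [symplForm, omega, Fintype.sum_sum_type, Matrix.one_apply, Matrix.smul_apply, ite_smul,
    Finset.sum_add_distrib, sub_eq_neg_add]

theorem dotp_cov_scaling (hα₀ : α ≠ 0) (hα₁ : α ≠ -1) (z z' : Superspace V p n) :
    dotp (cov θ α (diagGL V (scaling p n α) (scaling_ne_zero hα₀ hα₁) • z))
        (diagGL V (scaling p n α) (scaling_ne_zero hα₀ hα₁) • z')
      = (-(2 * (|α| / α) / θ)) • symplForm z z' := by
  have h1 : 1 + α ≠ 0 := fun h => hα₁ (by linarith)
  rw [symplForm_eq, dotp, Fintype.sum_sum_type, Fintype.sum_sum_type, ← Finset.sum_add_distrib,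
    smul_add, Finset.smul_sum, Finset.smul_sum]
  simp only [cov_apply, diagGL_smul_apply, smul_smul, smul_mul_smul_comm]
  congr 1
  · refine Finset.sum_congr rfl fun i _ => ?_
    change ((θ / 2)⁻¹ * (|α| / α) * 1) • (z.1 (Sum.inl (Sum.inr i)) * _)
      + ((-(θ / 2))⁻¹ * 1 * (|α| / α)) • (z.1 (Sum.inl (Sum.inl i)) * _) = _
    rw [smul_sub, inv_neg, inv_div, sub_eq_neg_add, ← neg_smul]
    congr 2 <;> ring
  · refine Finset.sum_congr rfl fun l _ => ?_
    change ((-(θ * α / (1 + α) ^ 2))⁻¹ * (2 * √|α| / (1 + α)) * (2 * √|α| / (1 + α))) •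
      (z.1 (Sum.inr l) * _) = _
    congr 1
    have h2 : √|α| * √|α| = |α| := Real.mul_self_sqrt (abs_nonneg α)
    rw [inv_neg, inv_div, mul_assoc, div_mul_div_comm, mul_mul_mul_comm, h2]
    by_cases hθ : θ = 0
    · simp [hθ]
    · field_simp

theorem mem_OSp_iff (hθ : θ ≠ 0) (hα₀ : α ≠ 0) (hα₁ : α ≠ -1) {A A' D : SuperGL V p n}
    (hD : D = diagGL V (scaling p n α) (scaling_ne_zero hα₀ hα₁)) (h : A' = D * A * D⁻¹) :
    (∀ w z : Superspace V p n, dotp (cov θ α (A' • w)) (A' • z) = dotp (cov θ α w) z)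
      ↔ A ∈ OSp V p n := by
  have key : ∀ w z : Superspace V p n, dotp (cov θ α (D • w)) (D • z)
      = (-(2 * (|α| / α) / θ)) • symplForm w z := hD ▸ dotp_cov_scaling hα₀ hα₁
  have hc : -(2 * (|α| / α) / θ) ≠ 0 := neg_ne_zero.mpr (div_ne_zero (mul_ne_zero two_ne_zero
    (div_ne_zero (abs_ne_zero.mpr hα₀) hα₀)) hθ)
  have hA : ∀ z : Superspace V p n, A' • D • z = D • A • z := fun z => by
    rw [smul_smul, smul_smul, h, inv_mul_cancel_right]
  constructor
  · intro hs w z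
    refine smul_right_injective (Grass V) hc ?_
    change _ • _ = _ • _
    rw [← key, ← key, ← hA, ← hA, hs]
  · intro hs w z
    rw [← smul_inv_smul D w, ← smul_inv_smul D z, hA, hA, key, key, hs]

theorem superGL_ext (hV : ¬ Module.Finite ℝ V) {A B : SuperGL V p n}
    (h : ∀ z : Superspace V p n, A • z = B • z) : A = B :=
  Subtype.ext (Units.ext (matrix_ext hV (fun _ => congrArg Subtype.val (h _))
    fun _ _ => congrArg Subtype.val (h _)))

theorem affineAct_mul (g h : InhomOSp V p n) (z : Superspace V p n) :
    affineAct (g * h) z = affineAct g (affineAct h z) := by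
  change (g.right * h.right) • z + (Multiplicative.toAdd g.left + g.right • Multiplicative.toAdd h.left) =
    g.right • (h.right • z + Multiplicative.toAdd h.left) + Multiplicative.toAdd g.left
  rw [smul_add, mul_smul, add_assoc, add_comm (Multiplicative.toAdd g.left)]

/-- The action of `OSP(n, m/2) ⋉ ℝ^{m|n}` on `ℝ^{m|n}`, in the coordinates `D⁻¹ z`. -/
def affineHom (D : SuperGL V p n) : InhomOSp V p n →* Equiv.Perm (Superspace V p n) :=
  MonoidHom.toHomPerm
    { toFun := fun g z => D • affineAct g (D⁻¹ • z)
      map_one' := by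
        funext z
        change D • ((1 : OSp V p n) • D⁻¹ • z + 0) = z
        rw [one_smul, add_zero, smul_inv_smul]
      map_mul' := fun g h => by
        funext z
        change _ = D • affineAct g (D⁻¹ • D • affineAct h (D⁻¹ • z))
        rw [inv_smul_smul, affineAct_mul] }

theorem affineHom_apply (D : SuperGL V p n) (g : InhomOSp V p n) (z : Superspace V p n) :
    affineHom D g z = D • affineAct g (D⁻¹ • z) := rfl

theorem affineHom_apply' (D : SuperGL V p n) (g : InhomOSp V p n) (z : Superspace V p n) :
    affineHom D g z = (D * g.right.1 * D⁻¹) • z + D • Multiplicative.toAdd g.left := by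
  rw [mul_smul, mul_smul]
  exact smul_add D (g.right.1 • D⁻¹ • z) _

theorem affineHom_injective (hV : ¬ Module.Finite ℝ V) (D : SuperGL V p n) :
    Function.Injective (affineHom D) := by
  intro g h hgh
  have h1 : ∀ z, affineAct g z = affineAct h z := fun z => by
    have := DFunLike.congr_fun hgh (D • z)
    rw [affineHom_apply, affineHom_apply, inv_smul_smul] at this
    exact smul_left_cancel D this
  have h2 : Multiplicative.toAdd g.left = Multiplicative.toAdd h.left := by
    have := h1 0
    rwa [affineAct, affineAct, smul_zero, smul_zero, zero_add, zero_add] at this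
  refine SemidirectProduct.ext h2 (Subtype.ext (superGL_ext hV fun z => ?_))
  have := h1 z
  rw [affineAct, affineAct, h2] at this
  exact add_right_cancel this

/-- The internal symmetries are the affine orthosymplectic maps. -/
theorem mem_range_affineHom (hV : ¬ Module.Finite ℝ V) (hθ : θ ≠ 0) (hα₀ : α ≠ 0) (hα₁ : α ≠ -1)
    {D : SuperGL V p n} (hD : D = diagGL V (scaling p n α) (scaling_ne_zero hα₀ hα₁))
    (φ : Equiv.Perm (Superspace V p n)) :
    φ ∈ (affineHom D).range ↔ IsInternalSymmetry θ α φ := by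
  constructor
  · rintro ⟨g, rfl⟩
    exact isInternalSymmetry_affine hV hθ hα₀ hα₁ ((mem_OSp_iff hθ hα₀ hα₁ hD rfl).mpr g.right.2) _
      (affineHom_apply' D g)
  · intro hφ
    obtain ⟨A, hA, h⟩ := exists_affine_of_isInternalSymmetry hV hθ hα₀ hα₁ hφ
    refine ⟨⟨Multiplicative.ofAdd (D⁻¹ • φ 0), ⟨D⁻¹ * A * D,
      (mem_OSp_iff hθ hα₀ hα₁ hD ?_).mp hA⟩⟩, Equiv.ext fun z => ?_⟩
    · group
    · rw [affineHom_apply', h z, toAdd_ofAdd, smul_inv_smul]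
      congr 2
      group

end Isomorphism

end SuperMoyal

end

theorem proposition4 {V : Type*} [AddCommGroup V] [Module ℝ V] (hV : ¬ Module.Finite ℝ V)
    (p n : ℕ) (θ α : ℝ) (hθ : θ ≠ 0) (hα₀ : α ≠ 0) (hα₁ : α ≠ -1) :
    ∃ (Aut : Subgroup (Equiv.Perm (SuperMoyal.Superspace V p n)))
      (e : SuperMoyal.InhomOSp V p n ≃* Aut),
      (∀ φ, φ ∈ Aut ↔ SuperMoyal.IsInternalSymmetry θ α φ) ∧
      ∃ D : SuperMoyal.SuperGL V p n,
        (∀ μ ν, ∃ r : ℝ, D.1.val μ ν = algebraMap ℝ (SuperMoyal.Grass V) r) ∧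
        ∀ g z, (e g).1 (D • z) = D • SuperMoyal.affineAct g z := by
  obtain ⟨D, hD⟩ : ∃ D, D = SuperMoyal.diagGL V (SuperMoyal.scaling p n α)
    (SuperMoyal.scaling_ne_zero hα₀ hα₁) := ⟨_, rfl⟩
  refine ⟨_, MonoidHom.ofInjective (SuperMoyal.affineHom_injective hV D),
    SuperMoyal.mem_range_affineHom hV hθ hα₀ hα₁ hD, D, fun μ ν => ?_, fun g z => ?_⟩
  · by_cases h : μ = ν
    · exact ⟨_, by rw [h, hD]; exact Matrix.diagonal_apply_eq _ _⟩
    · exact ⟨0, by rw [hD, map_zero]; exact Matrix.diagonal_apply_ne _ h⟩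
  · change SuperMoyal.affineHom D g (D • z) = _
    rw [SuperMoyal.affineHom_apply, inv_smul_smul]
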